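/- Let $X$ be a compact, metrisable, totally disconnected space, and let $\varphi,\sigma$ be homeomorphisms of $X$ with $\sigma^2=\mathrm{id}$ and $\sigma\varphi\sigma=\varphi^{-1}$. Assume that the points of $X$ which are not periodic for $\varphi$ are dense in $X$, and that $\sigma$ preserves no $\varphi$-orbit. *Suspensions.* Let $Y=(X\times\mathbb R)/\mathbb Z$ be the suspension of $\varphi$, where $n\in\mathbb Z$ acts by $n\cdot(x,t)=(\varphi^n(x),t-n)$, let $\pi_Y\colon X\times\mathbb R\to Y$ be the projection, and let $\Phi$ be the suspension flow, $\Phi^t(\pi_Y(x,s))=\pi_Y(x,s+t)$. Let $Z=(X\times\mathbb R)/D_\infty$ be the dihedral suspension, where the elements of the infinite dihedral group $D_\infty$ act by $(x,t)\mapsto(\varphi^n(x),t-n)$ and $(x,t)\mapsto(\varphi^n\sigma(x),-t-n)$, $n\in\mathbb Z$. Let $\pi_Z\colon X\times\mathbb R\to Z$ be the projection and $p\colon Y\to Z$ the map with $p\circ\pi_Y=\pi_Z$. If $C\subset X$ is clopen, $I\subset\mathbb R$ is an open interval and $\pi_Z$ is injective on $C\times I$, the set $Z_{C,I}=\pi_Z(C\times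 I)$ is called a chart. *Maps of type $\mathfrak D$.* A homeomorphism $f\colon I\to J$ between open intervals is of type $\mathfrak D$ if there is a finite set $B\subset I\cap\mathbb Z[\tfrac12]$ such that 1. every $x\in I\setminus B$ has an open neighbourhood $U\subset I$ on which $f$ is dyadic piecewise linear, i.e. outside a finite subset of $U\cap\mathbb Z[\tfrac12]$ it is locally of the form $y\mapsto 2^n y+b$ with $n\in\mathbb Z$, $b\in\mathbb Z[\tfrac12]$; 2. for every $x_0\in B$ one has $f\circ h_{x_0}=h_{f(x_0)}\circ f$ near $x_0$, where $h_{a}(x)=2(x-a)+a$. *The group.* Let $G=\mathscr T(\varphi,\sigma)$ be the group of all homeomorphisms $g$ of $Z$ such that for every $z\in Z$ there are charts $Z_{C,I}\ni z$ and $Z_{C,J}\ni g(z)$ and a homeomorphism $f\colon I\to J$ of type $\mathfrak D$ with $g(Z_{C,I})=Z_{C,J}$ and $g(\pi_Z(x,t))=\pi_Z(x,f(t))$ for all $(x,t)\in C\times I$. For each $g\in G$ there is a unique continuous function $\tau_g\colon Y\to\mathbb R$ such that $p(\Phi^{\tau_g(y)}(y))=g(p(y))$ for all $y\in Y$. For $y\in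 Y$, let $\rho_y$ be the action of $G$ on $\mathbb R$ by orientation-preserving homeomorphisms given by $$\rho_y(g)(t)=t+\tau_g(\Phi^t(y)).$$ **Theorem.** Let $\rho$ be an action of $G$ on $\mathbb R$ by orientation-preserving homeomorphisms that is irreducible (it has no global fixed point) and minimal (every orbit is dense). Then there exists $y\in Y$ such that $\rho$ and $\rho_y$ are pointed conjugate: there is an orientation-preserving homeomorphism $h\colon\mathbb R\to\mathbb R$ with $h(0)=0$ and $h\circ\rho(g)=\rho_y(g)\circ h$ for all $g\in G$. (The group $G$ is not assumed to be finitely generated.) -/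

import Mathlib

namespace SolenoidalThompson

open Set Filter Topology

section TypeD

/-- The ring `ℤ[1/2]` of dyadic rationals, inside `ℝ`. -/
def dyadic : Subring ℝ := Subring.closure {(2 : ℝ)⁻¹}

/-- Near `x`, the map `f` is `y ↦ 2 ^ n * y + b` with `n ∈ ℤ` and `b ∈ ℤ[1/2]`. -/
def LocallyDyadicAffineAt (f : ℝ → ℝ) (x : ℝ) : Prop :=
  ∃ n : ℤ, ∃ b ∈ dyadic, ∀ᶠ y in 𝓝 x, f y = (2 : ℝ) ^ n * y + b

/-- `f` is dyadic piecewise linear on `U`: outside a finite set of dyadic points of `U`, it is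
locally (equivalently, on each connected component of the complement) dyadic affine. -/
def IsDyadicPLOn (f : ℝ → ℝ) (U : Set ℝ) : Prop :=
  ∃ S : Finset ℝ, (∀ s ∈ S, s ∈ U ∧ s ∈ dyadic) ∧
    ∀ x ∈ U, x ∉ S → LocallyDyadicAffineAt f x

/-- The doubling map `x ↦ 2 (x - x₀) + x₀` with centre `x₀`. -/
def doubling (x₀ x : ℝ) : ℝ := 2 * (x - x₀) + x₀

/-- A homeomorphism between open subsets of `ℝ` is of type `𝔇` if, outside a finite set `B` of
dyadic points of its domain, it is locally dyadic piecewise linear, while near every point `x₀`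
of `B` it intertwines the doubling map at `x₀` with the doubling map at `f x₀`. -/
def IsTypeD (f : OpenPartialHomeomorph ℝ ℝ) : Prop :=
  ∃ B : Finset ℝ, (∀ x ∈ B, x ∈ f.source ∧ x ∈ dyadic) ∧
    (∀ x ∈ f.source, x ∉ B → ∃ U : Set ℝ, IsOpen U ∧ x ∈ U ∧ U ⊆ f.source ∧ IsDyadicPLOn f U) ∧
    ∀ x₀ ∈ B, ∀ᶠ x in 𝓝 x₀, f (doubling x₀ x) = doubling (f x₀) (f x)

/-! Maps of type `𝔇` are stable under composition, inversion, restriction, and conjugation by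
the isometries `t ↦ ± t - n` of `ℝ`. -/

theorem half_mem : (2 : ℝ)⁻¹ ∈ dyadic := Subring.subset_closure rfl

theorem two_mem : (2 : ℝ) ∈ dyadic := ofNat_mem dyadic 2

theorem zpow_mem (n : ℤ) : (2 : ℝ) ^ n ∈ dyadic := by
  rcases n with n | n
  · simpa using pow_mem two_mem n
  · have := pow_mem half_mem (n + 1)
    simpa [zpow_negSucc] using this

theorem LocallyDyadicAffineAt.mem_iff {f : ℝ → ℝ} {x : ℝ} (h : LocallyDyadicAffineAt f x) :
    f x ∈ dyadic ↔ x ∈ dyadic := by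
  obtain ⟨n, b, hb, h⟩ := h
  have hx := h.self_of_nhds
  constructor
  · intro hf
    have : x = (2 : ℝ) ^ (-n) * (f x - b) := by
      rw [hx, zpow_neg]; field_simp; ring
    rw [this]
    exact mul_mem (zpow_mem _) (sub_mem hf hb)
  · intro hd
    rw [hx]
    exact add_mem (mul_mem (zpow_mem _) hd) hb

theorem LocallyDyadicAffineAt.comp {f g : ℝ → ℝ} {x : ℝ} (hg : LocallyDyadicAffineAt g (f x))
    (hf : LocallyDyadicAffineAt f x) (hc : ContinuousAt f x) :
    LocallyDyadicAffineAt (fun y => g (f y)) x := by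
  obtain ⟨n, b, hb, h⟩ := hf
  obtain ⟨m, c, hc', h'⟩ := hg
  refine ⟨m + n, 2 ^ m * b + c, add_mem (mul_mem (zpow_mem _) hb) hc', ?_⟩
  filter_upwards [h, hc.eventually h'] with y hy hy'
  rw [hy', hy, zpow_add₀ (by norm_num)]; ring

theorem LocallyDyadicAffineAt.congr {f g : ℝ → ℝ} {x : ℝ} (hf : LocallyDyadicAffineAt f x)
    (h : ∀ᶠ y in 𝓝 x, g y = f y) : LocallyDyadicAffineAt g x := by
  obtain ⟨n, b, hb, h1⟩ := hf
  exact ⟨n, b, hb, by filter_upwards [h, h1] with y h2 h3; rw [h2, h3]⟩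

/-- Dyadic piecewise linearity near a point. -/
def PLAt (f : ℝ → ℝ) (x : ℝ) : Prop :=
  (∀ᶠ y in 𝓝[≠] x, LocallyDyadicAffineAt f y) ∧ (LocallyDyadicAffineAt f x ∨ x ∈ dyadic)

theorem IsDyadicPLOn.plAt {f : ℝ → ℝ} {U : Set ℝ} (h : IsDyadicPLOn f U) (hU : IsOpen U) {x : ℝ}
    (hx : x ∈ U) : PLAt f x := by
  obtain ⟨S, hS, h⟩ := h
  constructor
  · have h1 : ∀ᶠ y in 𝓝[≠] x, y ∈ U := nhdsWithin_le_nhds (hU.mem_nhds hx)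
    have h2 : ∀ᶠ y in 𝓝[≠] x, y ∉ S := by
      have : ((S : Set ℝ) \ {x})ᶜ ∈ 𝓝 x :=
        ((S.finite_toSet.subset sdiff_subset).isClosed.isOpen_compl).mem_nhds (by simp)
      filter_upwards [nhdsWithin_le_nhds this, self_mem_nhdsWithin] with y hy hne hyS
      exact hy ⟨hyS, hne⟩
    filter_upwards [h1, h2] with y hy hy' using h y hy hy'
  · by_cases hxS : x ∈ S
    · exact Or.inr (hS x hxS).2
    · exact Or.inl (h x hx hxS)

theorem PLAt.exists_isDyadicPLOn {f : ℝ → ℝ} {x : ℝ} (h : PLAt f x) {V : Set ℝ} (hV : V ∈ 𝓝 x) :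
    ∃ U : Set ℝ, IsOpen U ∧ x ∈ U ∧ U ⊆ V ∧ IsDyadicPLOn f U := by
  have h1 := eventually_nhdsWithin_iff.1 h.1
  obtain ⟨U, hU, hUo, hxU⟩ := mem_nhds_iff.1 (inter_mem h1 hV)
  refine ⟨U, hUo, hxU, fun y hy => (hU hy).2, ?_⟩
  by_cases hx : LocallyDyadicAffineAt f x
  · refine ⟨∅, by simp, fun y hy _ => ?_⟩
    by_cases hyx : y = x
    · rwa [hyx]
    · exact (hU hy).1 hyx
  · refine ⟨{x}, by simpa using ⟨hxU, h.2.resolve_left hx⟩, fun y hy hyx => ?_⟩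
    exact (hU hy).1 (by simpa using hyx)

theorem isTypeD_iff (f : OpenPartialHomeomorph ℝ ℝ) : IsTypeD f ↔
    ∃ B : Finset ℝ, (∀ x ∈ B, x ∈ f.source → x ∈ dyadic) ∧
      (∀ x ∈ f.source, x ∉ B → PLAt f x) ∧
      ∀ x ∈ f.source, x ∈ B → ∀ᶠ y in 𝓝 x, f (doubling x y) = doubling (f x) (f y) := by
  classical
  constructor
  · rintro ⟨B, h1, h2, h3⟩
    refine ⟨B, fun x hx _ => (h1 x hx).2, fun x hx hxB => ?_, fun x _ hx => h3 x hx⟩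
    obtain ⟨U, hU, hxU, -, h⟩ := h2 x hx hxB
    exact h.plAt hU hxU
  · rintro ⟨B, h1, h2, h3⟩
    refine ⟨B.filter (· ∈ f.source), fun x hx => ?_, fun x hx hxB => ?_, fun x hx => ?_⟩
    · rw [Finset.mem_filter] at hx
      exact ⟨hx.2, h1 x hx.1 hx.2⟩
    · exact (h2 x hx (fun h => hxB (Finset.mem_filter.2 ⟨h, hx⟩))).exists_isDyadicPLOn
        (f.open_source.mem_nhds hx)
    · rw [Finset.mem_filter] at hx
      exact h3 x hx.2 hx.1

theorem affine_of_locally {f : ℝ → ℝ} {a b : ℝ} (hab : a < b)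
    (h : ∀ y ∈ Ioo a b, LocallyDyadicAffineAt f y) :
    ∃ n : ℤ, ∃ c ∈ dyadic, ∀ y ∈ Ioo a b, f y = (2 : ℝ) ^ n * y + c := by
  have key : ∀ y ∈ Ioo a b, ∃ n : ℤ, ∃ c ∈ dyadic, f y = 2 ^ n * y + c ∧
      (∀ᶠ z in 𝓝 y, deriv f z = (2 : ℝ) ^ n) ∧
      (∀ᶠ z in 𝓝 y, f z - z * deriv f z = c) := by
    intro y hy
    obtain ⟨n, c, hc, h1⟩ := h y hy
    have hd : ∀ᶠ z in 𝓝 y, deriv f z = (2 : ℝ) ^ n := by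
      filter_upwards [h1.eventually_nhds] with z hz
      have : f =ᶠ[𝓝 z] fun w => (2 : ℝ) ^ n * w + c := hz
      rw [this.deriv_eq]
      simp
    refine ⟨n, c, hc, h1.self_of_nhds, hd, ?_⟩
    filter_upwards [h1, hd] with z h2 h3
    rw [h2, h3]; ring
  have d1 : ∀ y ∈ Ioo a b, HasDerivAt (deriv f) 0 y := by
    intro y hy
    obtain ⟨n, c, hc, -, h2, -⟩ := key y hy
    exact (hasDerivAt_const y ((2 : ℝ) ^ n)).congr_of_eventuallyEq h2
  have d2 : ∀ y ∈ Ioo a b, HasDerivAt (fun z => f z - z * deriv f z) 0 y := by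
    intro y hy
    obtain ⟨n, c, hc, -, -, h2⟩ := key y hy
    exact (hasDerivAt_const y c).congr_of_eventuallyEq h2
  have hm : (a + b) / 2 ∈ Ioo a b := ⟨by linarith, by linarith⟩
  obtain ⟨n, c, hc, -, h2, h3⟩ := key _ hm
  refine ⟨n, c, hc, fun y hy => ?_⟩
  have e1 := isOpen_Ioo.is_const_of_deriv_eq_zero isPreconnected_Ioo
    (fun z hz => (d1 z hz).differentiableAt.differentiableWithinAt)
    (fun z hz => (d1 z hz).deriv) hy hm
  have e2 := isOpen_Ioo.is_const_of_deriv_eq_zero isPreconnected_Ioo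
    (fun z hz => (d2 z hz).differentiableAt.differentiableWithinAt)
    (fun z hz => (d2 z hz).deriv) hy hm
  have e3 := h2.self_of_nhds
  have e4 := h3.self_of_nhds
  beta_reduce at e1 e2 e3 e4
  rw [e4, e1, e3] at e2
  linarith

/-- One-sided affine forms of a map that is dyadic piecewise linear near `x`. -/
theorem PLAt.sides {f : ℝ → ℝ} {x : ℝ} (h : PLAt f x) (hc : ContinuousAt f x) :
    ∃ ε > 0, (∃ n : ℤ, ∃ c ∈ dyadic, ∀ y ∈ Ico x (x + ε), f y = (2 : ℝ) ^ n * y + c) ∧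
      (∃ n : ℤ, ∃ c ∈ dyadic, ∀ y ∈ Ioc (x - ε) x, f y = (2 : ℝ) ^ n * y + c) := by
  have h1 := eventually_nhdsWithin_iff.1 h.1
  obtain ⟨ε, hε, h2⟩ := Metric.eventually_nhds_iff.1 h1
  refine ⟨ε, hε, ?_, ?_⟩
  · obtain ⟨n, c, hc', h3⟩ := affine_of_locally (f := f) (a := x) (b := x + ε) (by linarith)
      (fun y hy => h2 (by rw [Real.dist_eq, abs_lt]; constructor <;> linarith [hy.1, hy.2])
        hy.1.ne')
    have hx : f x = (2 : ℝ) ^ n * x + c := by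
      have t1 : Tendsto f (𝓝[>] x) (𝓝 (f x)) := hc.mono_left nhdsWithin_le_nhds
      have t2 : Tendsto (fun y => (2 : ℝ) ^ n * y + c) (𝓝[>] x) (𝓝 ((2 : ℝ) ^ n * x + c)) :=
        (Continuous.tendsto (by fun_prop) x).mono_left nhdsWithin_le_nhds
      refine tendsto_nhds_unique (t1.congr' ?_) t2
      filter_upwards [Ioo_mem_nhdsGT (show x < x + ε by linarith)] with y hy using h3 y hy
    refine ⟨n, c, hc', fun y hy => ?_⟩
    rcases hy.1.eq_or_lt with h4 | h4
    · rw [← h4, hx]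
    · exact h3 y ⟨h4, hy.2⟩
  · obtain ⟨n, c, hc', h3⟩ := affine_of_locally (f := f) (a := x - ε) (b := x) (by linarith)
      (fun y hy => h2 (by rw [Real.dist_eq, abs_lt]; constructor <;> linarith [hy.1, hy.2])
        hy.2.ne)
    have hx : f x = (2 : ℝ) ^ n * x + c := by
      have t1 : Tendsto f (𝓝[<] x) (𝓝 (f x)) := hc.mono_left nhdsWithin_le_nhds
      have t2 : Tendsto (fun y => (2 : ℝ) ^ n * y + c) (𝓝[<] x) (𝓝 ((2 : ℝ) ^ n * x + c)) :=
        (Continuous.tendsto (by fun_prop) x).mono_left nhdsWithin_le_nhds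
      refine tendsto_nhds_unique (t1.congr' ?_) t2
      filter_upwards [Ioo_mem_nhdsLT (show x - ε < x by linarith)] with y hy using h3 y hy
    refine ⟨n, c, hc', fun y hy => ?_⟩
    rcases hy.2.eq_or_lt with h4 | h4
    · rw [h4, hx]
    · exact h3 y ⟨hy.1, h4⟩

theorem PLAt.commutes {f : ℝ → ℝ} {x : ℝ} (h : PLAt f x) (hc : ContinuousAt f x) :
    ∀ᶠ y in 𝓝 x, f (doubling x y) = doubling (f x) (f y) := by
  obtain ⟨ε, hε, ⟨n, c, -, h1⟩, ⟨m, d, -, h2⟩⟩ := h.sides hc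
  filter_upwards [Ioo_mem_nhds (show x - ε / 2 < x by linarith) (show x < x + ε / 2 by linarith)]
    with y hy
  have hy1 := hy.1
  have hy2 := hy.2
  unfold doubling
  rcases le_total x y with h3 | h3
  · rw [h1 y ⟨h3, by linarith⟩, h1 x ⟨le_rfl, by linarith⟩, h1 _ ⟨by linarith, by linarith⟩]
    ring
  · rw [h2 y ⟨by linarith, h3⟩, h2 x ⟨by linarith, le_rfl⟩, h2 _ ⟨by linarith, by linarith⟩]
    ring

theorem PLAt.mem_iff {f : ℝ → ℝ} {x : ℝ} (h : PLAt f x) (hc : ContinuousAt f x) :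
    x ∈ dyadic → f x ∈ dyadic := by
  intro hx
  obtain ⟨ε, hε, ⟨n, c, h0, h1⟩, -⟩ := h.sides hc
  rw [h1 x ⟨le_rfl, by linarith⟩]
  exact add_mem (mul_mem (zpow_mem _) hx) h0

theorem tendsto_nhdsNE (f : OpenPartialHomeomorph ℝ ℝ) {x : ℝ} (hx : x ∈ f.source) :
    Tendsto f (𝓝[≠] x) (𝓝[≠] (f x)) := by
  refine tendsto_nhdsWithin_iff.2 ⟨(f.continuousAt hx).mono_left nhdsWithin_le_nhds, ?_⟩
  filter_upwards [nhdsWithin_le_nhds (f.open_source.mem_nhds hx), self_mem_nhdsWithin] with y hy hne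
  exact fun h => hne (f.injOn hy hx h)

theorem eventually_mem_source (f : OpenPartialHomeomorph ℝ ℝ) {x : ℝ} (hx : x ∈ f.source) :
    ∀ᶠ y in 𝓝[≠] x, y ∈ f.source :=
  nhdsWithin_le_nhds (f.open_source.mem_nhds hx)

theorem IsTypeD.comp {f g : OpenPartialHomeomorph ℝ ℝ} (hf : IsTypeD f) (hg : IsTypeD g) :
    IsTypeD (f.trans g) := by
  classical
  rw [isTypeD_iff] at *
  obtain ⟨B, hB, hf1, hf2⟩ := hf
  obtain ⟨B', hB', hg1, hg2⟩ := hg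
  have hcomm : ∀ x ∈ f.source, ∀ᶠ y in 𝓝 x, f (doubling x y) = doubling (f x) (f y) := by
    intro x hx
    by_cases h : x ∈ B
    · exact hf2 x hx h
    · exact (hf1 x hx h).commutes (f.continuousAt hx)
  have hcomm' : ∀ x ∈ g.source, ∀ᶠ y in 𝓝 x, g (doubling x y) = doubling (g x) (g y) := by
    intro x hx
    by_cases h : x ∈ B'
    · exact hg2 x hx h
    · exact (hg1 x hx h).commutes (g.continuousAt hx)
  have himg : ∀ x ∈ f.source,
      (x ∈ (B'.filter (· ∈ f.target)).image f.symm ↔ f x ∈ B') := by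
    intro x hx
    constructor
    · intro h
      obtain ⟨w, hw, rfl⟩ := Finset.mem_image.1 h
      rw [Finset.mem_filter] at hw
      rw [f.right_inv hw.2]
      exact hw.1
    · intro h
      exact Finset.mem_image.2 ⟨f x, Finset.mem_filter.2 ⟨h, f.map_source hx⟩, f.left_inv hx⟩
  refine ⟨B ∪ (B'.filter (· ∈ f.target)).image f.symm, ?_, ?_, ?_⟩
  · intro x hx hxs
    rw [OpenPartialHomeomorph.trans_source] at hxs
    by_cases hxB : x ∈ B
    · exact hB x hxB hxs.1
    have hfx : f x ∈ B' := (himg x hxs.1).1 ((Finset.mem_union.1 hx).resolve_left hxB)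
    rcases (hf1 x hxs.1 hxB).2 with h2 | h2
    · exact h2.mem_iff.1 (hB' _ hfx hxs.2)
    · exact h2
  · intro x hxs hx
    rw [OpenPartialHomeomorph.trans_source] at hxs
    rw [Finset.mem_union, not_or, himg x hxs.1] at hx
    have p := hf1 x hxs.1 hx.1
    have q := hg1 _ hxs.2 hx.2
    refine ⟨?_, ?_⟩
    · filter_upwards [p.1, (tendsto_nhdsNE f hxs.1).eventually q.1, eventually_mem_source f hxs.1]
        with y h1 h2 h3
      exact h2.comp h1 (f.continuousAt h3)
    · rcases p.2 with h1 | h1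
      · rcases q.2 with h2 | h2
        · exact Or.inl (h2.comp h1 (f.continuousAt hxs.1))
        · exact Or.inr (h1.mem_iff.1 h2)
      · exact Or.inr h1
  · intro x hxs _
    rw [OpenPartialHomeomorph.trans_source] at hxs
    have c := f.continuousAt hxs.1
    filter_upwards [hcomm x hxs.1, c.eventually (hcomm' _ hxs.2)] with y h1 h2
    simp only [OpenPartialHomeomorph.coe_trans, Function.comp_apply]
    rw [h1, h2]

theorem LocallyDyadicAffineAt.symm {f : OpenPartialHomeomorph ℝ ℝ} {x : ℝ}
    (h : LocallyDyadicAffineAt f x) (hx : x ∈ f.source) : LocallyDyadicAffineAt f.symm (f x) := by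
  obtain ⟨n, b, hb, h⟩ := h
  refine ⟨-n, -(2 ^ (-n) * b), neg_mem (mul_mem (zpow_mem _) hb), ?_⟩
  have c : Tendsto f.symm (𝓝 (f x)) (𝓝 x) := by
    have := f.continuousAt_symm (f.map_source hx)
    rwa [ContinuousAt, f.left_inv hx] at this
  filter_upwards [c.eventually h, f.open_target.mem_nhds (f.map_source hx)] with w h1 h2
  rw [f.right_inv h2] at h1
  have h3 : (2 : ℝ) ^ (-n) * 2 ^ n = 1 := by rw [← zpow_add₀ (by norm_num)]; simp
  linear_combination (-(2 : ℝ) ^ (-n)) * h1 - f.symm w * h3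

theorem IsTypeD.symm {f : OpenPartialHomeomorph ℝ ℝ} (hf : IsTypeD f) : IsTypeD f.symm := by
  classical
  rw [isTypeD_iff] at *
  obtain ⟨B, hB, h1, h2⟩ := hf
  have hmem : ∀ x ∈ f.source, x ∈ dyadic → f x ∈ dyadic := by
    intro x hx hd
    by_cases hxB : x ∈ B
    swap
    · exact (h1 x hx hxB).mem_iff (f.continuousAt hx) hd
    have e1 := h2 x hx hxB
    have e2 : ∀ᶠ y in 𝓝[≠] x, y ∈ f.source ∧ y ∉ B := by
      have : ((B : Set ℝ) \ {x})ᶜ ∈ 𝓝 x :=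
        ((B.finite_toSet.subset sdiff_subset).isClosed.isOpen_compl).mem_nhds (by simp)
      filter_upwards [nhdsWithin_le_nhds this, self_mem_nhdsWithin, eventually_mem_source f hx]
        with y hy hne hys
      exact ⟨hys, fun hyS => hy ⟨hyS, hne⟩⟩
    have e3 : ∀ᶠ y in 𝓝 x, y ≠ x → (y ∈ f.source ∧ y ∉ B) := eventually_nhdsWithin_iff.1 e2
    obtain ⟨ε, hε, e4⟩ := Metric.eventually_nhds_iff.1 (e1.and e3)
    obtain ⟨k, hk⟩ := exists_pow_lt_of_lt_one (show 0 < ε / 2 by linarith)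
      (show (2 : ℝ)⁻¹ < 1 by norm_num)
    have hkp : (0 : ℝ) < (2 : ℝ)⁻¹ ^ k := by positivity
    have hyd : x + (2 : ℝ)⁻¹ ^ k ∈ dyadic := add_mem hd (pow_mem half_mem k)
    have a1 := e4 (y := x + (2 : ℝ)⁻¹ ^ k)
      (by rw [Real.dist_eq, abs_lt]; constructor <;> linarith)
    have a2 := e4 (y := doubling x (x + (2 : ℝ)⁻¹ ^ k))
      (by unfold doubling; rw [Real.dist_eq, abs_lt]; constructor <;> linarith)
    have b1 := a1.2 (by linarith)
    have b2 := a2.2 (by unfold doubling; linarith)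
    have c1 := (h1 _ b1.1 b1.2).mem_iff (f.continuousAt b1.1) hyd
    have c2 := (h1 _ b2.1 b2.2).mem_iff (f.continuousAt b2.1)
      (add_mem (mul_mem two_mem (sub_mem hyd hd)) hd)
    rw [a1.1] at c2
    have : f x = 2 * f (x + (2 : ℝ)⁻¹ ^ k) - doubling (f x) (f (x + (2 : ℝ)⁻¹ ^ k)) := by
      unfold doubling; ring
    rw [this]
    exact sub_mem (mul_mem two_mem c1) c2
  refine ⟨(B.filter (· ∈ f.source)).image f, ?_, ?_, ?_⟩
  · intro w hw _
    obtain ⟨x, hx, rfl⟩ := Finset.mem_image.1 hw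
    rw [Finset.mem_filter] at hx
    exact hmem x hx.2 (hB x hx.1 hx.2)
  · intro w hw hwB
    obtain ⟨x, hx, rfl⟩ : ∃ x ∈ f.source, f x = w := ⟨f.symm w, f.map_target hw, f.right_inv hw⟩
    have hxB : x ∉ B := fun h => hwB (Finset.mem_image.2 ⟨x, Finset.mem_filter.2 ⟨h, hx⟩, rfl⟩)
    have p := h1 x hx hxB
    refine ⟨?_, ?_⟩
    · have t : Tendsto f.symm (𝓝[≠] (f x)) (𝓝[≠] x) := by
        have := tendsto_nhdsNE f.symm hw
        rwa [f.left_inv hx] at this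
      filter_upwards [t.eventually p.1, t.eventually (eventually_mem_source f hx),
        eventually_mem_source f.symm hw] with y h3 h4 h5
      have := h3.symm h4
      rwa [f.right_inv h5] at this
    · rcases p.2 with h3 | h3
      · exact Or.inl (h3.symm hx)
      · exact Or.inr (hmem x hx h3)
  · intro w hw hwB
    obtain ⟨x, hx, rfl⟩ := Finset.mem_image.1 hwB
    rw [Finset.mem_filter] at hx
    have c : Tendsto f.symm (𝓝 (f x)) (𝓝 x) := by
      have := f.continuousAt_symm hw
      rwa [ContinuousAt, f.left_inv hx.2] at this
    have hd : ∀ᶠ y in 𝓝 x, doubling x y ∈ f.source := by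
      have : Tendsto (doubling x) (𝓝 x) (𝓝 x) := by
        have : Continuous (doubling x) := by unfold doubling; fun_prop
        simpa [doubling] using this.tendsto x
      exact this.eventually (f.open_source.mem_nhds hx.2)
    filter_upwards [c.eventually (h2 x hx.2 hx.1), c.eventually hd, f.open_target.mem_nhds hw]
      with y h3 h4 h5
    rw [f.right_inv h5] at h3
    rw [← h3, f.left_inv h4, f.left_inv hx.2]

theorem IsTypeD.restr {f : OpenPartialHomeomorph ℝ ℝ} (hf : IsTypeD f) {U : Set ℝ}
    (hU : IsOpen U) : IsTypeD (f.restrOpen U hU) := by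
  rw [isTypeD_iff] at *
  obtain ⟨B, hB, h1, h2⟩ := hf
  exact ⟨B, fun x hx hs => hB x hx hs.1, fun x hs hx => h1 x hs.1 hx, fun x hs hx => h2 x hs.1 hx⟩

/-- The isometry `t ↦ ε * t - n` of `ℝ`, for a sign `ε`. -/
def isometryHomeo (ε : ℤˣ) (n : ℤ) : ℝ ≃ₜ ℝ where
  toFun t := (ε : ℤ) * t - n
  invFun t := (ε : ℤ) * (t + n)
  left_inv t := by
    rcases Int.units_eq_one_or ε with rfl | rfl <;> simp
  right_inv t := by
    rcases Int.units_eq_one_or ε with rfl | rfl <;> simp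
  continuous_toFun := by fun_prop
  continuous_invFun := by fun_prop

/-- Conjugation of `f` by an isometry `t ↦ ε * t - n`. -/
def conjIsometry (f : OpenPartialHomeomorph ℝ ℝ) (ε : ℤˣ) (n : ℤ) : OpenPartialHomeomorph ℝ ℝ :=
  ((isometryHomeo ε n).toOpenPartialHomeomorph.trans f).trans
    (isometryHomeo ε n).symm.toOpenPartialHomeomorph

theorem conjIsometry_apply (f : OpenPartialHomeomorph ℝ ℝ) (ε : ℤˣ) (n : ℤ) (t : ℝ) :
    conjIsometry f ε n t = (ε : ℤ) * (f ((ε : ℤ) * t - n) + n) := rfl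

theorem conjIsometry_source (f : OpenPartialHomeomorph ℝ ℝ) (ε : ℤˣ) (n : ℤ) :
    (conjIsometry f ε n).source = isometryHomeo ε n ⁻¹' f.source := by
  simp [conjIsometry]

theorem conjIsometry_target (f : OpenPartialHomeomorph ℝ ℝ) (ε : ℤˣ) (n : ℤ) :
    (conjIsometry f ε n).target = isometryHomeo ε n ⁻¹' f.target := by
  simp [conjIsometry]

theorem IsTypeD.conj {f : OpenPartialHomeomorph ℝ ℝ} (hf : IsTypeD f) (ε : ℤˣ) (n : ℤ) :
    IsTypeD (conjIsometry f ε n) := by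
  classical
  rw [isTypeD_iff] at *
  obtain ⟨B, hB, h1, h2⟩ := hf
  set e := isometryHomeo ε n with he
  have hε : ((ε : ℤ) : ℝ) * (ε : ℤ) = 1 := by
    rcases Int.units_eq_one_or ε with rfl | rfl <;> simp
  have eapp : ∀ t, e t = (ε : ℤ) * t - n := fun t => rfl
  have hn : ∀ k : ℤ, (k : ℝ) ∈ dyadic := fun k => intCast_mem dyadic k
  have hd : ∀ t, e t ∈ dyadic → t ∈ dyadic := by
    intro t ht
    have : t = (ε : ℤ) * (e t + n) := by rw [eapp]; linear_combination (-t) * hε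
    rw [this]
    exact mul_mem (hn _) (add_mem ht (hn _))
  have hA : ∀ t, LocallyDyadicAffineAt f (e t) →
      LocallyDyadicAffineAt (conjIsometry f ε n) t := by
    rintro t ⟨m, b, hb, h⟩
    refine ⟨m, (ε : ℤ) * (b + n - 2 ^ m * n),
      mul_mem (hn _) (sub_mem (add_mem hb (hn _)) (mul_mem (zpow_mem _) (hn _))), ?_⟩
    filter_upwards [(e.continuous.tendsto t).eventually h] with y hy
    rw [conjIsometry_apply, ← eapp, hy, eapp]
    linear_combination (2 ^ m * y) * hε
  have ht : ∀ t, Tendsto e (𝓝[≠] t) (𝓝[≠] (e t)) := fun t =>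
    tendsto_nhdsNE e.toOpenPartialHomeomorph (mem_univ t)
  refine ⟨B.image e.symm, ?_, ?_, ?_⟩
  · intro x hx hs
    obtain ⟨w, hw, rfl⟩ := Finset.mem_image.1 hx
    rw [conjIsometry_source, mem_preimage, ← he, e.apply_symm_apply] at hs
    exact hd _ (by rw [e.apply_symm_apply]; exact hB w hw hs)
  · intro x hs hx
    rw [conjIsometry_source, mem_preimage, ← he] at hs
    have hxB : e x ∉ B := fun h => hx (Finset.mem_image.2 ⟨e x, h, e.symm_apply_apply x⟩)
    have p := h1 _ hs hxB
    exact ⟨((ht x).eventually p.1).mono fun y hy => hA y hy, p.2.imp (hA x) (hd x)⟩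
  · intro x hs hx
    rw [conjIsometry_source, mem_preimage, ← he] at hs
    obtain ⟨w, hw, rfl⟩ := Finset.mem_image.1 hx
    have p := h2 _ hs (by rwa [e.apply_symm_apply])
    filter_upwards [(e.continuous.tendsto _).eventually p] with y hy
    have hy' : e (doubling (e.symm w) y) = doubling (e (e.symm w)) (e y) := by
      simp only [eapp, doubling]; ring
    rw [conjIsometry_apply, ← eapp, hy', hy, conjIsometry_apply, conjIsometry_apply, ← eapp,
      ← eapp]
    simp only [doubling]
    ring

theorem isTypeD_refl : IsTypeD (OpenPartialHomeomorph.refl ℝ) := by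
  rw [isTypeD_iff]
  refine ⟨∅, by simp, fun x _ _ => ?_, by simp⟩
  have : ∀ y : ℝ, LocallyDyadicAffineAt (OpenPartialHomeomorph.refl ℝ) y := fun y =>
    ⟨0, 0, zero_mem _, by simp⟩
  exact ⟨Eventually.of_forall this, Or.inl (this x)⟩

end TypeD

/-- A homeomorphism `φ` of a space `X` together with a reversing involution `σ`, such that `φ` is
topologically free (its non-periodic points are dense) and `σ` preserves no `φ`-orbit. -/
structure ReversibleSystem (X : Type*) [TopologicalSpace X] where
  φ : X ≃ₜ X
  σ : X ≃ₜ X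
  σ_σ : ∀ x, σ (σ x) = x
  σ_φ_σ : ∀ x, σ (φ (σ x)) = φ.symm x
  topologicallyFree : Dense {x : X | ∀ n : ℤ, n ≠ 0 → (φ ^ n) x ≠ x}
  σ_not_mem_orbit : ∀ (x : X) (n : ℤ), (φ ^ n) x ≠ σ x

namespace ReversibleSystem

variable {X : Type*} [TopologicalSpace X] (S : ReversibleSystem X)

theorem zpow_zpow (m n : ℤ) (x : X) : (S.φ ^ m) ((S.φ ^ n) x) = (S.φ ^ (m + n)) x := by
  rw [zpow_add]; rfl

theorem σ_zpow (n : ℤ) (x : X) : S.σ ((S.φ ^ n) x) = (S.φ ^ (-n)) (S.σ x) := by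
  have h1 : S.σ * S.σ = 1 := Homeomorph.ext S.σ_σ
  have h2 : S.σ⁻¹ = S.σ := inv_eq_of_mul_eq_one_left h1
  have h3 : S.σ * S.φ * S.σ⁻¹ = S.φ⁻¹ := by
    rw [h2]; exact Homeomorph.ext S.σ_φ_σ
  have h4 : S.σ * S.φ ^ n * S.σ⁻¹ = S.φ ^ (-n) := by
    rw [← conj_zpow, h3, inv_zpow, zpow_neg]
  rw [← h4, h2]
  simp [Homeomorph.mul_apply, S.σ_σ]

/-- The orbit relation of the action `n • (x, t) = (φ ^ n x, t - n)` of `ℤ` on `X × ℝ`. -/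
def suspensionSetoid : Setoid (X × ℝ) where
  r a b := ∃ n : ℤ, b = ((S.φ ^ n) a.1, a.2 - n)
  iseqv :=
    { refl := fun a => ⟨0, by simp⟩
      symm := by
        rintro a b ⟨n, rfl⟩
        exact ⟨-n, by simp⟩
      trans := by
        rintro a b c ⟨n, rfl⟩ ⟨m, rfl⟩
        exact ⟨m + n, by simp only [S.zpow_zpow, Prod.mk.injEq, true_and]; push_cast; ring⟩ }

/-- The orbit relation on `X × ℝ` of the action of the infinite dihedral group, whose elements act
by `(x, t) ↦ (φ ^ n x, t - n)` and by `(x, t) ↦ (φ ^ n (σ x), - t - n)`, for `n ∈ ℤ`. -/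
def dihedralSetoid : Setoid (X × ℝ) where
  r a b := ∃ n : ℤ, b = ((S.φ ^ n) a.1, a.2 - n) ∨ b = ((S.φ ^ n) (S.σ a.1), -a.2 - n)
  iseqv :=
    { refl := fun a => ⟨0, Or.inl (by simp)⟩
      symm := by
        rintro a b ⟨n, rfl | rfl⟩
        · exact ⟨-n, Or.inl (by simp)⟩
        · exact ⟨n, Or.inr (by simp [S.σ_zpow, S.σ_σ])⟩
      trans := by
        rintro a b c ⟨n, rfl | rfl⟩ ⟨m, rfl | rfl⟩
        · exact ⟨m + n, Or.inl (by
            simp only [S.zpow_zpow, Prod.mk.injEq, true_and]; push_cast; ring)⟩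
        · exact ⟨m - n, Or.inr (by
            simp only [S.zpow_zpow, S.σ_zpow, Prod.mk.injEq, ← sub_eq_add_neg, true_and]
            push_cast; ring)⟩
        · exact ⟨m + n, Or.inr (by
            simp only [S.zpow_zpow, Prod.mk.injEq, true_and]; push_cast; ring)⟩
        · exact ⟨m - n, Or.inl (by
            simp only [S.zpow_zpow, S.σ_zpow, S.σ_σ, Prod.mk.injEq, ← sub_eq_add_neg, true_and]
            push_cast; ring)⟩ }

/-- The suspension `Y` of `φ`, with the quotient topology. -/
def Suspension : Type _ := Quotient S.suspensionSetoid

/-- The dihedral suspension `Z` of `(φ, σ)`, with the quotient topology. -/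
def DihedralSuspension : Type _ := Quotient S.dihedralSetoid

instance : TopologicalSpace S.Suspension :=
  inferInstanceAs (TopologicalSpace (Quotient S.suspensionSetoid))

instance : TopologicalSpace S.DihedralSuspension :=
  inferInstanceAs (TopologicalSpace (Quotient S.dihedralSetoid))

/-- The projection `π_Y : X × ℝ → Y`. -/
def projY (a : X × ℝ) : S.Suspension := Quotient.mk S.suspensionSetoid a

/-- The projection `π_Z : X × ℝ → Z`. -/
def projZ (a : X × ℝ) : S.DihedralSuspension := Quotient.mk S.dihedralSetoid a

theorem projY_eq_iff {a b : X × ℝ} :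
    S.projY a = S.projY b ↔ ∃ n : ℤ, b = ((S.φ ^ n) a.1, a.2 - n) := Quotient.eq

theorem projZ_eq_iff {a b : X × ℝ} : S.projZ a = S.projZ b ↔
    ∃ n : ℤ, b = ((S.φ ^ n) a.1, a.2 - n) ∨ b = ((S.φ ^ n) (S.σ a.1), -a.2 - n) := Quotient.eq

theorem projY_surjective : Function.Surjective S.projY := Quotient.mk_surjective

theorem projZ_surjective : Function.Surjective S.projZ := Quotient.mk_surjective

theorem continuous_projY : Continuous S.projY := continuous_quotient_mk'

theorem continuous_projZ : Continuous S.projZ := continuous_quotient_mk'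

/-- The suspension flow `Φ` on `Y`, `Φ ^ t (π_Y (x, s)) = π_Y (x, s + t)`. -/
def flow (t : ℝ) : S.Suspension → S.Suspension :=
  Quotient.map' (s₁ := S.suspensionSetoid) (s₂ := S.suspensionSetoid)
    (fun a => (a.1, a.2 + t)) (by
      rintro a b ⟨n, rfl⟩
      exact ⟨n, by simp only [Prod.mk.injEq, true_and]; ring⟩)

/-- The two-to-one quotient map `p : Y → Z`, with `p ∘ π_Y = π_Z`. -/
def toDihedral : S.Suspension → S.DihedralSuspension :=
  Quotient.map' (s₁ := S.suspensionSetoid) (s₂ := S.dihedralSetoid) id (by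
    rintro a b ⟨n, rfl⟩
    exact ⟨n, Or.inl rfl⟩)

theorem flow_projY (t : ℝ) (a : X × ℝ) : S.flow t (S.projY a) = S.projY (a.1, a.2 + t) := rfl

theorem toDihedral_projY (a : X × ℝ) : S.toDihedral (S.projY a) = S.projZ a := rfl

/-- `π_Z` restricts to a chart `C × I → Z_{C, I}`: `C ⊆ X` is clopen, `I ⊆ ℝ` is an open interval,
and `π_Z` is injective on `C × I`. -/
def IsChart (C : Set X) (I : Set ℝ) : Prop :=
  IsClopen C ∧ IsOpen I ∧ I.OrdConnected ∧ InjOn S.projZ (C ×ˢ I)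

/-- `g` maps the chart `Z_{C, I}` onto the chart `Z_{C, J}` by `π_Z (x, t) ↦ π_Z (x, f t)`, where
`f : I → J` is a homeomorphism of type `𝔇`. -/
def IsTypeDOnChart (g : S.DihedralSuspension ≃ₜ S.DihedralSuspension) (C : Set X)
    (f : OpenPartialHomeomorph ℝ ℝ) : Prop :=
  S.IsChart C f.source ∧ S.IsChart C f.target ∧ IsTypeD f ∧
    g '' (S.projZ '' (C ×ˢ f.source)) = S.projZ '' (C ×ˢ f.target) ∧
    ∀ x ∈ C, ∀ t ∈ f.source, g (S.projZ (x, t)) = S.projZ (x, f t)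

theorem isOpenMap_projY : IsOpenMap S.projY := by
  intro U hU
  have : S.projY ⁻¹' (S.projY '' U) =
      ⋃ n : ℤ, (fun a : X × ℝ => ((S.φ ^ n) a.1, a.2 - (n : ℝ))) ⁻¹' U := by
    ext a
    simp only [mem_preimage, mem_image, mem_iUnion]
    constructor
    · rintro ⟨b, hb, h⟩
      obtain ⟨n, rfl⟩ := S.projY_eq_iff.1 h.symm
      exact ⟨n, hb⟩
    · rintro ⟨n, h⟩
      exact ⟨_, h, (S.projY_eq_iff.2 ⟨n, rfl⟩).symm⟩
  change IsOpen (S.projY ⁻¹' (S.projY '' U))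
  rw [this]
  exact isOpen_iUnion fun n => hU.preimage
    (((S.φ ^ n).continuous.comp continuous_fst).prodMk (by fun_prop))

theorem isOpenQuotientMap_projY : IsOpenQuotientMap S.projY :=
  ⟨S.projY_surjective, S.continuous_projY, S.isOpenMap_projY⟩

theorem continuous_flow : Continuous fun q : ℝ × S.Suspension => S.flow q.1 q.2 := by
  have h := (IsOpenQuotientMap.id (X := ℝ)).prodMap S.isOpenQuotientMap_projY
  rw [← h.continuous_comp_iff]
  have : (fun q : ℝ × S.Suspension => S.flow q.1 q.2) ∘ Prod.map id S.projY =
      fun r : ℝ × X × ℝ => S.projY (r.2.1, r.2.2 + r.1) := rfl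
  rw [this]
  exact S.continuous_projY.comp (by fun_prop)

theorem flow_zero (y : S.Suspension) : S.flow 0 y = y := by
  obtain ⟨a, rfl⟩ := S.projY_surjective y
  simp [flow_projY]

theorem flow_flow (s t : ℝ) (y : S.Suspension) : S.flow s (S.flow t y) = S.flow (t + s) y := by
  obtain ⟨a, rfl⟩ := S.projY_surjective y
  simp [flow_projY, add_assoc]

/-- The action on `X` of the dihedral group element that acts on `ℝ` as `t ↦ ε * t - n`. -/
def actX (ε : ℤˣ) (n : ℤ) : X ≃ₜ X := S.φ ^ n * (if ε = 1 then 1 else S.σ)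

theorem projZ_act (ε : ℤˣ) (n : ℤ) (x : X) (t : ℝ) :
    S.projZ (S.actX ε n x, isometryHomeo ε n t) = S.projZ (x, t) := by
  refine (S.projZ_eq_iff.2 ⟨n, ?_⟩).symm
  rcases Int.units_eq_one_or ε with rfl | rfl
  · left; simp [actX, isometryHomeo]
  · right; simp [actX, isometryHomeo, Homeomorph.mul_apply]

theorem exists_act {a b : X × ℝ} (h : S.projZ a = S.projZ b) :
    ∃ (ε : ℤˣ) (n : ℤ), S.actX ε n a.1 = b.1 ∧ isometryHomeo ε n a.2 = b.2 := by
  obtain ⟨n, rfl | rfl⟩ := S.projZ_eq_iff.1 h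
  · exact ⟨1, n, by simp [actX], by simp [isometryHomeo]⟩
  · exact ⟨-1, n, by simp [actX, Homeomorph.mul_apply], by simp [isometryHomeo]⟩

variable {S}

theorem IsChart.act {C : Set X} {I : Set ℝ} (h : S.IsChart C I) (ε : ℤˣ) (n : ℤ) :
    S.IsChart (S.actX ε n ⁻¹' C) (isometryHomeo ε n ⁻¹' I) := by
  refine ⟨h.1.preimage (S.actX ε n).continuous, h.2.1.preimage (isometryHomeo ε n).continuous,
    ?_, ?_⟩
  · refine IsPreconnected.ordConnected ?_
    rw [(isometryHomeo ε n).isPreconnected_preimage]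
    exact h.2.2.1.isPreconnected
  · rintro ⟨x, t⟩ hx ⟨x', t'⟩ hx' he
    rw [← S.projZ_act ε n, ← S.projZ_act ε n x'] at he
    have := h.2.2.2 (x₁ := (S.actX ε n x, isometryHomeo ε n t))
      (x₂ := (S.actX ε n x', isometryHomeo ε n t')) ⟨hx.1, hx.2⟩ ⟨hx'.1, hx'.2⟩ he
    rw [Prod.mk.injEq] at this
    rw [(S.actX ε n).injective this.1, (isometryHomeo ε n).injective this.2]

theorem IsChart.mono {C C' : Set X} {I I' : Set ℝ} (h : S.IsChart C I) (hC : IsClopen C')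
    (hI : IsOpen I') (hI' : I'.OrdConnected) (hCC : C' ⊆ C) (hII : I' ⊆ I) : S.IsChart C' I' :=
  ⟨hC, hI, hI', h.2.2.2.mono (prod_mono hCC hII)⟩

theorem image_of_forall {g : S.DihedralSuspension ≃ₜ S.DihedralSuspension} {C : Set X}
    {f : OpenPartialHomeomorph ℝ ℝ}
    (h : ∀ x ∈ C, ∀ t ∈ f.source, g (S.projZ (x, t)) = S.projZ (x, f t)) :
    g '' (S.projZ '' (C ×ˢ f.source)) = S.projZ '' (C ×ˢ f.target) := by
  ext z
  constructor
  · rintro ⟨_, ⟨⟨x, t⟩, hx, rfl⟩, rfl⟩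
    exact ⟨(x, f t), ⟨hx.1, f.map_source hx.2⟩, (h x hx.1 t hx.2).symm⟩
  · rintro ⟨⟨x, t⟩, hx, rfl⟩
    refine ⟨_, ⟨(x, f.symm t), ⟨hx.1, f.map_target hx.2⟩, rfl⟩, ?_⟩
    rw [h x hx.1 _ (f.map_target hx.2), f.right_inv hx.2]

/-- A chart on which `g` is of type `𝔇` can be moved so as to contain a given representative. -/
theorem IsTypeDOnChart.move {g : S.DihedralSuspension ≃ₜ S.DihedralSuspension} {C : Set X}
    {f : OpenPartialHomeomorph ℝ ℝ} (h : S.IsTypeDOnChart g C f) {a : X × ℝ}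
    (ha : S.projZ a ∈ S.projZ '' (C ×ˢ f.source)) :
    ∃ C' f', S.IsTypeDOnChart g C' f' ∧ a.1 ∈ C' ∧ a.2 ∈ f'.source := by
  obtain ⟨b, hb, hab⟩ := ha
  obtain ⟨ε, n, h1, h2⟩ := S.exists_act hab.symm
  have key : ∀ x ∈ S.actX ε n ⁻¹' C, ∀ t ∈ (conjIsometry f ε n).source,
      g (S.projZ (x, t)) = S.projZ (x, conjIsometry f ε n t) := by
    intro x hx t ht
    rw [conjIsometry_source] at ht
    rw [← S.projZ_act ε n x t, h.2.2.2.2 _ hx _ ht, ← S.projZ_act ε n x]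
    congr 2
    exact ((isometryHomeo ε n).apply_symm_apply _).symm
  refine ⟨S.actX ε n ⁻¹' C, conjIsometry f ε n, ⟨?_, ?_, h.2.2.1.conj ε n, image_of_forall key,
    key⟩, ?_, ?_⟩
  · rw [conjIsometry_source]; exact h.1.act ε n
  · rw [conjIsometry_target]; exact h.2.1.act ε n
  · rw [mem_preimage, h1]; exact hb.1
  · rw [conjIsometry_source, mem_preimage, h2]; exact hb.2

variable (S)

/-- The defining condition of `𝒯(φ, σ)`: around every point `z`, the homeomorphism `g` maps a chart
`Z_{C, I}` containing `z` to a chart `Z_{C, J}` containing `g z` through a map of type `𝔇`. -/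
def IsLocallyTypeD (g : S.DihedralSuspension ≃ₜ S.DihedralSuspension) : Prop :=
  ∀ z, ∃ C f, S.IsTypeDOnChart g C f ∧ z ∈ S.projZ '' (C ×ˢ f.source) ∧
    g z ∈ S.projZ '' (C ×ˢ f.target)

theorem exists_chart [CompactSpace X] [TopologicalSpace.MetrizableSpace X]
    [TotallyDisconnectedSpace X] (a : X × ℝ) :
    ∃ C I, S.IsChart C I ∧ a.1 ∈ C ∧ a.2 ∈ I := by
  obtain ⟨x, t⟩ := a
  set n : ℤ := round (-2 * t) with hn
  have hx : (S.φ ^ n) (S.σ x) ≠ x := by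
    intro h
    apply S.σ_not_mem_orbit x (-n)
    conv_lhs => rw [← h]
    rw [S.zpow_zpow]; simp
  obtain ⟨C, hC, hxC, hCsub⟩ := compact_exists_isClopen_in_isOpen
    (isOpen_compl_singleton (x := (S.φ ^ n) (S.σ x))) (show x ∈ _ from fun h => hx h.symm)
  set ψ : X ≃ₜ X := S.φ ^ n * S.σ with hψ
  refine ⟨C ∩ ψ ⁻¹' Cᶜ, Ioo (t - 1 / 8) (t + 1 / 8), ⟨hC.inter (hC.compl.preimage ψ.continuous),
    isOpen_Ioo, ordConnected_Ioo, ?_⟩, ⟨hxC, fun h => ?_⟩, by constructor <;> simp⟩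
  · rintro ⟨u, s⟩ hu ⟨v, r⟩ hv h
    obtain ⟨hu1, hu2⟩ := hu
    obtain ⟨hv1, hv2⟩ := hv
    simp only [mem_Ioo] at hu2 hv2
    obtain ⟨m, h | h⟩ := S.projZ_eq_iff.1 h
    · rw [Prod.mk.injEq] at h
      have hm : m = 0 := by
        have h1 : (-1 : ℝ) < m := by linarith [h.2]
        have h2 : (m : ℝ) < 1 := by linarith [h.2]
        have h1' : -1 < m := by exact_mod_cast h1
        have h2' : m < 1 := by exact_mod_cast h2
        omega
      subst hm
      simp only [zpow_zero, Int.cast_zero, sub_zero] at h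
      rw [h.1, h.2]; rfl
    · rw [Prod.mk.injEq] at h
      have hm : m = n := by
        have h0 := abs_le.1 (abs_sub_round (-2 * t))
        rw [← hn] at h0
        have h1 : (-1 : ℝ) < m - n := by linarith [h.2, h0.1, h0.2]
        have h2 : (m - n : ℝ) < 1 := by linarith [h.2, h0.1, h0.2]
        have h1' : -1 < m - n := by exact_mod_cast h1
        have h2' : m - n < 1 := by exact_mod_cast h2
        omega
      subst hm
      exact absurd (show ψ u ∈ C by rw [hψ, Homeomorph.mul_apply, ← h.1]; exact hv1.1) hu1.2
  · exact hCsub h rfl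

variable {S}

/-- Elements of `𝒯(φ, σ)` lift to `Y` along the orbits of the flow: `τ` is the translation cocycle
of `g` if it is continuous and the lift `y ↦ Φ ^ (τ y) y` covers `g`. -/
structure IsTranslationCocycle (g : S.DihedralSuspension ≃ₜ S.DihedralSuspension)
    (τ : S.Suspension → ℝ) : Prop where
  continuous : Continuous τ
  toDihedral_flow : ∀ y, S.toDihedral (S.flow (τ y) y) = g (S.toDihedral y)

theorem eqOn_of_cocycles {g : S.DihedralSuspension ≃ₜ S.DihedralSuspension}
    {τ τ' : S.Suspension → ℝ} {U : Set S.Suspension} (hU : IsOpen U)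
    (hτ : ContinuousOn τ U) (hτ' : ContinuousOn τ' U)
    (h : ∀ y ∈ U, S.toDihedral (S.flow (τ y) y) = g (S.toDihedral y))
    (h' : ∀ y ∈ U, S.toDihedral (S.flow (τ' y) y) = g (S.toDihedral y)) : EqOn τ τ' U := by
  by_contra hne
  have hW : IsOpen (U ∩ (fun y => τ y - τ' y) ⁻¹' {0}ᶜ) :=
    (hτ.sub hτ').isOpen_inter_preimage hU isOpen_compl_singleton
  have hWn : (U ∩ (fun y => τ y - τ' y) ⁻¹' {0}ᶜ).Nonempty := by
    simp only [EqOn, not_forall] at hne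
    obtain ⟨y, hy, h1⟩ := hne
    exact ⟨y, hy, fun h2 => h1 (sub_eq_zero.1 h2)⟩
  have hd : Dense (S.projY '' (Prod.fst ⁻¹' {x : X | ∀ n : ℤ, n ≠ 0 → (S.φ ^ n) x ≠ x})) :=
    S.projY_surjective.denseRange.dense_image S.continuous_projY
      (S.topologicallyFree.preimage isOpenMap_fst)
  obtain ⟨_, hy, ⟨⟨x, t⟩, hx, rfl⟩⟩ := hd.inter_open_nonempty _ hW hWn
  have e := (h _ hy.1).trans (h' _ hy.1).symm
  rw [flow_projY, flow_projY, toDihedral_projY, toDihedral_projY, projZ_eq_iff] at e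
  obtain ⟨n, e | e⟩ := e
  · rw [Prod.mk.injEq] at e
    have hn : n = 0 := by
      by_contra hn
      exact hx n hn e.1.symm
    have e2 := e.2
    rw [hn] at e2
    apply hy.2
    simp only [mem_singleton_iff]
    push_cast at e2
    linarith
  · rw [Prod.mk.injEq] at e
    apply S.σ_not_mem_orbit x (-n)
    have e1 : x = (S.φ ^ n) (S.σ x) := e.1
    conv_lhs => rw [e1]
    rw [S.zpow_zpow]; simp

theorem IsTranslationCocycle.unique {g : S.DihedralSuspension ≃ₜ S.DihedralSuspension}
    {τ τ' : S.Suspension → ℝ} (h : IsTranslationCocycle g τ) (h' : IsTranslationCocycle g τ') :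
    τ = τ' :=
  funext fun y => eqOn_of_cocycles isOpen_univ h.continuous.continuousOn h'.continuous.continuousOn
    (fun y _ => h.toDihedral_flow y) (fun y _ => h'.toDihedral_flow y) (mem_univ y)

theorem exists_local_cocycle {g : S.DihedralSuspension ≃ₜ S.DihedralSuspension}
    (hg : S.IsLocallyTypeD g) (y : S.Suspension) :
    ∃ (U : Set S.Suspension) (τ : S.Suspension → ℝ), IsOpen U ∧ y ∈ U ∧ ContinuousOn τ U ∧
      ∀ y ∈ U, S.toDihedral (S.flow (τ y) y) = g (S.toDihedral y) := by
  obtain ⟨a, rfl⟩ := S.projY_surjective y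
  obtain ⟨D, e, k, hD, -⟩ := hg (S.projZ a)
  obtain ⟨C, f, k, hx, ht⟩ := k.move hD
  have hinj : InjOn S.projY (C ×ˢ f.source) := fun b hb c hc h =>
    k.1.2.2.2 hb hc (congrArg S.toDihedral h)
  have hopen : IsOpen (C ×ˢ f.source) := k.1.1.isOpen.prod f.open_source
  have hex : ∀ y, ∃ b : X × ℝ, y ∈ S.projY '' (C ×ˢ f.source) →
      b ∈ C ×ˢ f.source ∧ S.projY b = y := by
    intro y
    by_cases h : y ∈ S.projY '' (C ×ˢ f.source)
    · obtain ⟨b, hb⟩ := h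
      exact ⟨b, fun _ => hb⟩
    · exact ⟨a, fun h' => absurd h' h⟩
  choose s hs using hex
  have hsb : ∀ b ∈ C ×ˢ f.source, s (S.projY b) = b := fun b hb =>
    have := hs (S.projY b) ⟨b, hb, rfl⟩
    hinj this.1 hb this.2
  refine ⟨S.projY '' (C ×ˢ f.source), fun y => f (s y).2 - (s y).2, S.isOpenMap_projY _ hopen,
    ⟨a, ⟨hx, ht⟩, rfl⟩, ?_, ?_⟩
  · rintro _ ⟨b, hb, rfl⟩
    apply ContinuousAt.continuousWithinAt
    rw [← S.isOpenQuotientMap_projY.continuousAt_comp_iff]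
    have hc : ContinuousAt (fun b : X × ℝ => f b.2 - b.2) b :=
      ((f.continuousAt hb.2).comp continuous_snd.continuousAt).sub continuous_snd.continuousAt
    refine hc.congr ?_
    filter_upwards [hopen.mem_nhds hb] with c hc
    simp only [Function.comp_apply]
    rw [hsb c hc]
  · rintro _ ⟨b, hb, rfl⟩
    beta_reduce
    rw [hsb b hb, flow_projY, toDihedral_projY, toDihedral_projY, k.2.2.2.2 b.1 hb.1 b.2 hb.2]
    simp

theorem exists_isTranslationCocycle {g : S.DihedralSuspension ≃ₜ S.DihedralSuspension}
    (hg : S.IsLocallyTypeD g) : ∃ τ, IsTranslationCocycle g τ := by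
  choose U τ hU hy hτ h using exists_local_cocycle hg
  refine ⟨fun y => τ y y, ?_, fun y => h y y (hy y)⟩
  rw [continuous_iff_continuousAt]
  intro y
  refine ((hτ y).continuousAt ((hU y).mem_nhds (hy y))).congr ?_
  filter_upwards [(hU y).mem_nhds (hy y)] with w hw
  exact eqOn_of_cocycles ((hU y).inter (hU w)) ((hτ y).mono inter_subset_left)
    ((hτ w).mono inter_subset_right) (fun v hv => h y v hv.1) (fun v hv => h w v hv.2) ⟨hw, hy w⟩

variable (S)

variable [CompactSpace X] [TopologicalSpace.MetrizableSpace X] [TotallyDisconnectedSpace X]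

/-- The group `𝒯(φ, σ)` of homeomorphisms of the dihedral suspension. -/
def thompsonGroup : Subgroup (S.DihedralSuspension ≃ₜ S.DihedralSuspension) where
  carrier := {g | S.IsLocallyTypeD g}
  one_mem' := by
    intro z
    obtain ⟨a, rfl⟩ := S.projZ_surjective z
    obtain ⟨C, I, hc, h1, h2⟩ := S.exists_chart a
    have key : ∀ x ∈ C, ∀ t ∈ ((OpenPartialHomeomorph.refl ℝ).restrOpen I hc.2.1).source,
      (1 : S.DihedralSuspension ≃ₜ S.DihedralSuspension) (S.projZ (x, t)) = S.projZ
        (x, (OpenPartialHomeomorph.refl ℝ).restrOpen I hc.2.1 t) := fun x _ t _ => rfl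
    have hs : ((OpenPartialHomeomorph.refl ℝ).restrOpen I hc.2.1).source = I := by simp
    have ht : ((OpenPartialHomeomorph.refl ℝ).restrOpen I hc.2.1).target = I := by simp
    exact ⟨C, (OpenPartialHomeomorph.refl ℝ).restrOpen I hc.2.1,
      ⟨by rwa [hs], by rwa [ht], isTypeD_refl.restr _, image_of_forall key, key⟩,
      ⟨a, ⟨h1, by rwa [hs]⟩, rfl⟩, ⟨a, ⟨h1, by rwa [ht]⟩, rfl⟩⟩
  mul_mem' := by
    intro g₂ g₁ h₂ h₁ z
    obtain ⟨C₁, f₁, k₁, ⟨⟨x, t⟩, ⟨hx₁, ht₁⟩, rfl⟩, -⟩ := h₁ z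
    have hg : g₁ (S.projZ (x, t)) = S.projZ (x, f₁ t) := k₁.2.2.2.2 x hx₁ t ht₁
    obtain ⟨D, e, k, hD, -⟩ := h₂ (S.projZ (x, f₁ t))
    obtain ⟨C₂, f₂, k₂, hx₂, ht₂⟩ := k.move hD
    have hts : t ∈ (f₁.trans f₂).source := by
      rw [OpenPartialHomeomorph.trans_source]; exact ⟨ht₁, ht₂⟩
    obtain ⟨ε, hε, hball⟩ := Metric.isOpen_iff.1 (f₁.trans f₂).open_source t hts
    rw [Real.ball_eq_Ioo] at hball
    set f := (f₁.trans f₂).restrOpen (Ioo (t - ε) (t + ε)) isOpen_Ioo with hf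
    have hs : f.source = Ioo (t - ε) (t + ε) := inter_eq_right.2 hball
    have hss : f.source ⊆ f₁.source := fun s h => by
      have := h.1; rw [OpenPartialHomeomorph.trans_source] at this; exact this.1
    have hst : ∀ s ∈ f.source, f₁ s ∈ f₂.source := fun s h => by
      have := h.1; rw [OpenPartialHomeomorph.trans_source] at this; exact this.2
    have htt : f.target ⊆ f₂.target := by
      rw [← f.image_source_eq_target]
      rintro _ ⟨s, h, rfl⟩
      exact f₂.map_source (hst s h)
    have htc : f.target.OrdConnected := by
      rw [← f.image_source_eq_target]
      refine IsPreconnected.ordConnected (IsPreconnected.image ?_ _ f.continuousOn)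
      rw [hs]; exact isPreconnected_Ioo
    have hC : IsClopen (C₁ ∩ C₂) := k₁.1.1.inter k₂.1.1
    have key : ∀ u ∈ C₁ ∩ C₂, ∀ s ∈ f.source,
        (g₂ * g₁) (S.projZ (u, s)) = S.projZ (u, f s) := by
      intro u hu s hsf
      rw [Homeomorph.mul_apply, k₁.2.2.2.2 u hu.1 s (hss hsf),
        k₂.2.2.2.2 u hu.2 _ (hst s hsf)]
      rfl
    have htf : t ∈ f.source := by rw [hs]; constructor <;> linarith
    refine ⟨C₁ ∩ C₂, f, ⟨?_, ?_, (k₁.2.2.1.comp k₂.2.2.1).restr _, image_of_forall key, key⟩,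
      ⟨(x, t), ⟨⟨hx₁, hx₂⟩, htf⟩, rfl⟩,
      ⟨(x, f t), ⟨⟨hx₁, hx₂⟩, f.map_source htf⟩, (key x ⟨hx₁, hx₂⟩ t htf).symm⟩⟩
    · exact k₁.1.mono hC f.open_source (hs ▸ ordConnected_Ioo) inter_subset_left hss
    · exact k₂.2.1.mono hC f.open_target htc inter_subset_right htt
  inv_mem' := by
    intro g hg z
    obtain ⟨C, f, k, -, hz⟩ := hg (g⁻¹ z)
    have e : ∀ z, g (g⁻¹ z) = z := fun z => g.apply_symm_apply z
    have e' : ∀ z, g⁻¹ (g z) = z := fun z => g.symm_apply_apply z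
    rw [e] at hz
    have key : ∀ x ∈ C, ∀ t ∈ f.symm.source, g⁻¹ (S.projZ (x, t)) = S.projZ (x, f.symm t) := by
      intro x hx t ht
      have := k.2.2.2.2 x hx _ (f.map_target ht)
      rw [f.right_inv ht] at this
      rw [← this, e']
    refine ⟨C, f.symm, ⟨k.2.1, k.1, k.2.2.1.symm, image_of_forall key, key⟩, hz, ?_⟩
    obtain ⟨⟨x, t⟩, h, rfl⟩ := hz
    exact ⟨(x, f.symm t), ⟨h.1, f.map_target h.2⟩, (key x h.1 t h.2).symm⟩

variable {S}

/-- The translation cocycle `τ_g : Y → ℝ` of `g ∈ 𝒯(φ, σ)`. -/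
noncomputable def translationCocycle (g : S.thompsonGroup) : S.Suspension → ℝ :=
  (exists_isTranslationCocycle g.2).choose

theorem translationCocycle_spec (g : S.thompsonGroup) :
    IsTranslationCocycle (g : S.DihedralSuspension ≃ₜ S.DihedralSuspension)
      (translationCocycle g) :=
  (exists_isTranslationCocycle g.2).choose_spec

theorem translationCocycle_one (y : S.Suspension) :
    translationCocycle (1 : S.thompsonGroup) y = 0 := by
  have h : IsTranslationCocycle (1 : S.DihedralSuspension ≃ₜ S.DihedralSuspension)
      (fun _ => (0 : ℝ)) := ⟨continuous_const, fun y => by rw [S.flow_zero]; rfl⟩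
  exact congrFun ((translationCocycle_spec (1 : S.thompsonGroup)).unique h) y

theorem translationCocycle_mul (g₁ g₂ : S.thompsonGroup) (y : S.Suspension) :
    translationCocycle (g₁ * g₂) y = translationCocycle g₂ y +
      translationCocycle g₁ (S.flow (translationCocycle g₂ y) y) := by
  have h₁ := translationCocycle_spec g₁
  have h₂ := translationCocycle_spec g₂
  have h : IsTranslationCocycle ((g₁ * g₂ : S.thompsonGroup) :
      S.DihedralSuspension ≃ₜ S.DihedralSuspension)
      (fun y => translationCocycle g₂ y +
        translationCocycle g₁ (S.flow (translationCocycle g₂ y) y)) := by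
    refine ⟨h₂.continuous.add (h₁.continuous.comp
      (S.continuous_flow.comp (h₂.continuous.prodMk continuous_id))), fun y => ?_⟩
    rw [← S.flow_flow, h₁.toDihedral_flow, h₂.toDihedral_flow]
    rfl
  exact congrFun ((translationCocycle_spec (g₁ * g₂)).unique h) y

/-- The map `ρ_y(g) : t ↦ t + τ_g (Φ ^ t y)` of the real line. -/
noncomputable def orbitMap (y : S.Suspension) (g : S.thompsonGroup) (t : ℝ) : ℝ :=
  t + translationCocycle g (S.flow t y)

theorem orbitMap_one (y : S.Suspension) (t : ℝ) : orbitMap y 1 t = t := by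
  simp [orbitMap, translationCocycle_one]

theorem orbitMap_mul (y : S.Suspension) (g₁ g₂ : S.thompsonGroup) (t : ℝ) :
    orbitMap y (g₁ * g₂) t = orbitMap y g₁ (orbitMap y g₂ t) := by
  simp only [orbitMap, translationCocycle_mul, S.flow_flow, add_assoc]

theorem compactSpace_suspension : CompactSpace S.Suspension := by
  have h : S.projY '' (univ ×ˢ Icc (0 : ℝ) 1) = univ := by
    refine eq_univ_of_forall fun y => ?_
    obtain ⟨⟨x, t⟩, rfl⟩ := S.projY_surjective y
    refine ⟨((S.φ ^ ⌊t⌋) x, t - ⌊t⌋), ⟨mem_univ _, ?_⟩, (S.projY_eq_iff (a := (x, t)).2 ⟨⌊t⌋, rfl⟩).symm⟩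
    constructor
    · simp
    · have := (Int.lt_floor_add_one t).le
      simp only
      linarith
  rw [← isCompact_univ_iff, ← h]
  exact (isCompact_univ.prod isCompact_Icc).image S.continuous_projY

theorem strictMono_orbitMap (y : S.Suspension) (g : S.thompsonGroup) :
    StrictMono (orbitMap y g) := by
  have hτ := (translationCocycle_spec g).continuous
  have hc : Continuous (orbitMap y g) :=
    continuous_id.add (hτ.comp (S.continuous_flow.comp (continuous_id.prodMk continuous_const)))
  have hi : Function.Injective (orbitMap y g) := fun s t h => by
    have := congrArg (orbitMap y g⁻¹) h
    rwa [← orbitMap_mul, ← orbitMap_mul, inv_mul_cancel, orbitMap_one, orbitMap_one] at this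
  refine (hc.strictMono_of_inj hi).resolve_right fun h => ?_
  have := compactSpace_suspension (S := S)
  obtain ⟨M, hM⟩ := (isCompact_range hτ).isBounded.exists_norm_le
  have h1 : ∀ t, |translationCocycle g (S.flow t y)| ≤ M := fun t => hM _ ⟨_, rfl⟩
  have h2 : 0 ≤ M := (abs_nonneg _).trans (h1 0)
  have h3 := h (show (0 : ℝ) < 2 * M + 1 by linarith)
  simp only [orbitMap] at h3
  have h4 := abs_le.1 (h1 0)
  have h5 := abs_le.1 (h1 (2 * M + 1))
  linarith [h4.1, h4.2, h5.1, h5.2]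

/-- The action `ρ_y` of `𝒯(φ, σ)` on the real line, `ρ_y(g)(t) = t + τ_g (Φ ^ t y)`, by
orientation-preserving homeomorphisms (that is, order automorphisms of `ℝ`). -/
noncomputable def orbitAction (y : S.Suspension) : S.thompsonGroup →* (ℝ ≃o ℝ) where
  toFun g := StrictMono.orderIsoOfRightInverse (orbitMap y g) (strictMono_orbitMap y g)
    (orbitMap y g⁻¹) fun t => by rw [← orbitMap_mul, mul_inv_cancel, orbitMap_one]
  map_one' := by
    ext t
    exact orbitMap_one y t
  map_mul' g₁ g₂ := by
    ext t
    exact orbitMap_mul y g₁ g₂ t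

theorem orbitAction_apply (y : S.Suspension) (g : S.thompsonGroup) (t : ℝ) :
    orbitAction y g t = t + translationCocycle g (S.flow t y) := rfl

end ReversibleSystem

/-- An action on the line by orientation-preserving homeomorphisms is irreducible if it has no
global fixed point. -/
def IsIrreducible {G : Type*} [Group G] (ρ : G →* (ℝ ≃o ℝ)) : Prop :=
  ∀ t, ∃ g, ρ g t ≠ t

/-- An action on the line is minimal if all its orbits are dense. -/
def IsMinimal {G : Type*} [Group G] (ρ : G →* (ℝ ≃o ℝ)) : Prop :=
  ∀ t, Dense (range fun g => ρ g t)

/-- Two actions on the line are pointed conjugate if they are conjugate by an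
orientation-preserving homeomorphism fixing `0`. -/
def PointedConjugate {G : Type*} [Group G] (ρ₁ ρ₂ : G →* (ℝ ≃o ℝ)) : Prop :=
  ∃ h : ℝ ≃o ℝ, h 0 = 0 ∧ ∀ g t, h (ρ₁ g t) = ρ₂ g (h t)

end SolenoidalThompson

namespace SolenoidalThompson

open Set Filter Topology

/-! ### Dyadic affine maps and local calculus -/

/-! To a point `z` of `Z` belongs the subgroup `locSub {z}ᶜ` generated by the elements supported in
boxes that miss `z`. The heart of the proof is that for some `z` this subgroup fixes some point `t`
of the line (`exists_fixed_pair`).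

Granting this, the pairs `(z, t)` form a closed invariant set. By minimality and compactness of `Z`
every `t` has a partner `z`. It is unique, since the subgroups of two distinct points generate the
whole group (`locSub_univ`, `locSub_union_le`) and a second partner would make `t` a global fixed
point. This gives a continuous equivariant map from the line to `Z` (`exists_equivariant_map`). As
`X × ℝ → Z` is a covering and `X` is totally disconnected, the map lifts to an equivariant `h` into
one leaf (`exists_leafSemiconj`). An interior maximum of `h` above both end values is impossible:
some element pushes it up while fixing points of lower level on both sides. Minimality excludes
plateaus. So `h` is a homeomorphism, and if it is decreasing, `-h` parametrizes the leaf of `σ x`.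

The fixed pair rests on roots. An increasing homeomorphism fixes a point as soon as a positive power
does, so stabilizers of points and of convex sets are root-closed. Type `𝔇` provides enough roots:
in logarithmic coordinates at a point, doubling is the unit translation, and the lifts of Thompson's
group `T` are generated by the roots of that translation (`perSub_le_closure`). Hence a root-closed
subgroup containing the compactly supported piecewise linear maps contains those of type `𝔇`
(`Dc_le_of_PLc_le`). For locally constant families of maps of the unit interval, the two constants
`genA` and `genB` thereby control all families supported in a core interval (`core_fixed`).

There is also a quantitative form. Piecewise linear core families are double commutators `⁅⁅f, a⁻¹
a'⁆, h⁆` with `a ^ 2 = a' ^ 2`. If `κ` commutes with the action and moves points up, two square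
roots of one element differ by at most `κ`, so every such family is bounded by `κ ^ 4`
(`core_bound`). Letting `κ` run through ever higher roots of one element bounds words of every
length by that element. So in a finite family of boxes, those commuting with a suitably maximal one
have cores with a common fixed point (`exists_common_fixed`). Compactness of `Z`, together with the
bound `exists_orbit_bound`, then yields the pair. -/

theorem PLAt.congr {f g : ℝ → ℝ} {x : ℝ} (hf : PLAt f x) (h : ∀ᶠ y in 𝓝 x, g y = f y) :
    PLAt g x := by
  refine ⟨?_, hf.2.imp (fun h1 => h1.congr h) id⟩
  filter_upwards [hf.1, nhdsWithin_le_nhds h.eventually_nhds] with y h1 h2 using h1.congr h2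

theorem tendsto_nhdsNE_of_injective {f : ℝ → ℝ} (hc : Continuous f) (hi : Function.Injective f)
    (x : ℝ) : Tendsto f (𝓝[≠] x) (𝓝[≠] (f x)) := by
  refine tendsto_nhdsWithin_iff.2 ⟨hc.continuousAt.mono_left nhdsWithin_le_nhds, ?_⟩
  filter_upwards [self_mem_nhdsWithin] with y hne
  exact fun h => hne (hi h)

theorem PLAt.comp {f g : ℝ → ℝ} {x : ℝ} (hg : PLAt g (f x)) (hf : PLAt f x) (hc : Continuous f)
    (hi : Function.Injective f) : PLAt (fun y => g (f y)) x := by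
  refine ⟨?_, ?_⟩
  · filter_upwards [hf.1, (tendsto_nhdsNE_of_injective hc hi x).eventually hg.1] with y h1 h2
    exact h2.comp h1 hc.continuousAt
  · rcases hf.2 with h1 | h1
    · rcases hg.2 with h2 | h2
      · exact Or.inl (h2.comp h1 hc.continuousAt)
      · exact Or.inr (h1.mem_iff.1 h2)
    · exact Or.inr h1

theorem LocallyDyadicAffineAt.plAt {f : ℝ → ℝ} {x : ℝ} (h : LocallyDyadicAffineAt f x) :
    PLAt f x := by
  refine ⟨?_, Or.inl h⟩
  obtain ⟨n, b, hb, h⟩ := h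
  filter_upwards [nhdsWithin_le_nhds h.eventually_nhds] with y hy using ⟨n, b, hb, hy⟩

theorem locallyDyadicAffineAt_of_eq {f : ℝ → ℝ} {n : ℤ} {b : ℝ} (hb : b ∈ dyadic)
    (h : ∀ y, f y = 2 ^ n * y + b) (x : ℝ) : LocallyDyadicAffineAt f x :=
  ⟨n, b, hb, Eventually.of_forall h⟩

theorem plAt_id (x : ℝ) : PLAt (fun y => y) x :=
  (locallyDyadicAffineAt_of_eq (n := 0) (zero_mem dyadic) (by simp) x).plAt

/-- A map agreeing on either side of a dyadic point with piecewise linear maps is piecewise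
linear. -/
theorem PLAt.of_sides {f g k : ℝ → ℝ} {x : ℝ} (hx : x ∈ dyadic) (hg : PLAt g x) (hk : PLAt k x)
    (h1 : ∀ᶠ y in 𝓝[<] x, f y = g y) (h2 : ∀ᶠ y in 𝓝[>] x, f y = k y) : PLAt f x := by
  refine ⟨?_, Or.inr hx⟩
  rw [← Iio_union_Ioi, nhdsWithin_union, eventually_sup]
  have key : ∀ s : Set ℝ, IsOpen s → s ⊆ {x}ᶜ → ∀ u : ℝ → ℝ, PLAt u x →
      (∀ᶠ y in 𝓝[s] x, f y = u y) → ∀ᶠ y in 𝓝[s] x, LocallyDyadicAffineAt f y := by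
    intro s hs hsx u hu h
    filter_upwards [nhdsWithin_mono x hsx hu.1, eventually_nhdsWithin_iff.1 h |>.eventually_nhds
      |> fun t => nhdsWithin_le_nhds t, self_mem_nhdsWithin] with y h3 h4 h5
    exact h3.congr (by filter_upwards [h4, hs.mem_nhds h5] with z h6 h7 using h6 h7)
  exact ⟨key _ isOpen_Iio (fun y hy => ne_of_lt hy) g hg h1,
    key _ isOpen_Ioi (fun y hy => ne_of_gt hy) k hk h2⟩

/-- Type `𝔇` near a point. -/
def DAt (f : ℝ → ℝ) (x : ℝ) : Prop :=
  ∃ e : OpenPartialHomeomorph ℝ ℝ, x ∈ e.source ∧ IsTypeD e ∧ ∀ y ∈ e.source, f y = e y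

theorem DAt.eventually {f : ℝ → ℝ} {x : ℝ} (h : DAt f x) : ∀ᶠ y in 𝓝 x, DAt f y := by
  obtain ⟨e, hx, he, h⟩ := h
  filter_upwards [e.open_source.mem_nhds hx] with y hy using ⟨e, hy, he, h⟩

theorem DAt.congr {f g : ℝ → ℝ} {x : ℝ} (hf : DAt f x) (h : ∀ᶠ y in 𝓝 x, g y = f y) :
    DAt g x := by
  obtain ⟨e, hx, he, h1⟩ := hf
  obtain ⟨U, hU, hUo, hxU⟩ := mem_nhds_iff.1 h
  refine ⟨e.restrOpen U hUo, ⟨hx, hxU⟩, he.restr hUo, fun y hy => ?_⟩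
  exact (hU hy.2).trans (h1 y hy.1)

theorem DAt.continuousAt {f : ℝ → ℝ} {x : ℝ} (hf : DAt f x) : ContinuousAt f x := by
  obtain ⟨e, hx, he, h1⟩ := hf
  refine (e.continuousAt hx).congr ?_
  filter_upwards [e.open_source.mem_nhds hx] with y hy using (h1 y hy).symm

theorem DAt.comp {f g : ℝ → ℝ} {x : ℝ} (hg : DAt g (f x)) (hf : DAt f x) :
    DAt (fun y => g (f y)) x := by
  obtain ⟨e, hx, he, h1⟩ := hf
  obtain ⟨e', hx', he', h1'⟩ := hg
  rw [h1 x hx] at hx'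
  refine ⟨e.trans e', by simp [hx, hx'], he.comp he', fun y hy => ?_⟩
  rw [OpenPartialHomeomorph.trans_source] at hy
  change g (f y) = e' (e y)
  rw [h1 y hy.1, h1' _ hy.2]

/-- The exceptional set is finite, so it misses a punctured neighbourhood. Piecewise linear maps,
being affine on each side of a point, commute with doublings automatically, so the doubling relation
holds whether or not the point is exceptional. -/
theorem DAt.plAt_or {f : ℝ → ℝ} {x : ℝ} (hf : DAt f x) : (∀ᶠ y in 𝓝[≠] x, PLAt f y) ∧
    (PLAt f x ∨ x ∈ dyadic) ∧ ∀ᶠ y in 𝓝 x, f (doubling x y) = doubling (f x) (f y) := by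
  obtain ⟨e, hx, he, h1⟩ := hf
  obtain ⟨B, hB, h2, h3⟩ := (isTypeD_iff e).1 he
  have hs : ∀ y ∈ e.source, ∀ᶠ z in 𝓝 y, f z = e z := fun y hy => by
    filter_upwards [e.open_source.mem_nhds hy] with z hz using h1 z hz
  have hd : Tendsto (doubling x) (𝓝 x) (𝓝 x) := by
    have : Continuous (doubling x) := by unfold doubling; fun_prop
    simpa [doubling] using this.tendsto x
  refine ⟨?_, ?_, ?_⟩
  · have : ((B : Set ℝ) \ {x})ᶜ ∈ 𝓝 x :=
      ((B.finite_toSet.subset sdiff_subset).isClosed.isOpen_compl).mem_nhds (by simp)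
    filter_upwards [nhdsWithin_le_nhds this, self_mem_nhdsWithin, eventually_mem_source e hx]
      with y h4 h5 h6
    exact (h2 y h6 fun h => h4 ⟨h, h5⟩).congr (hs y h6)
  · by_cases hxB : x ∈ B
    · exact Or.inr (hB x hxB hx)
    · exact Or.inl ((h2 x hx hxB).congr (hs x hx))
  · have : ∀ᶠ y in 𝓝 x, e (doubling x y) = doubling (e x) (e y) := by
      by_cases hxB : x ∈ B
      · exact h3 x hx hxB
      · exact (h2 x hx hxB).commutes (e.continuousAt hx)
    filter_upwards [this, hs x hx, hd.eventually (hs x hx)] with y h4 h5 h6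
    rw [h6, h5, h1 x hx, h4]

theorem exists_Ioo_of_eventually {p : ℝ → Prop} {x : ℝ} (h : ∀ᶠ y in 𝓝 x, p y) :
    ∃ ε > 0, ∀ y, |y - x| < ε → p y := by
  obtain ⟨ε, hε, h⟩ := Metric.eventually_nhds_iff.1 h
  exact ⟨ε, hε, fun y hy => h (by rwa [Real.dist_eq])⟩

/-- The converse of `DAt.plAt_or` for global homeomorphisms: after restriction to a small
neighbourhood, `x` is the only possible exceptional point. -/
theorem DAt.intro (f : ℝ ≃o ℝ) {x : ℝ} (h1 : ∀ᶠ y in 𝓝[≠] x, PLAt f y)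
    (h2 : PLAt f x ∨ (x ∈ dyadic ∧ ∀ᶠ y in 𝓝 x, f (doubling x y) = doubling (f x) (f y))) :
    DAt f x := by
  classical
  obtain ⟨U, hU, hUo, hxU⟩ := mem_nhds_iff.1 (eventually_nhdsWithin_iff.1 h1)
  refine ⟨f.toHomeomorph.toOpenPartialHomeomorph.restrOpen U hUo, by simpa using hxU, ?_,
    fun y hy => rfl⟩
  rw [isTypeD_iff]
  by_cases h : PLAt f x
  · refine ⟨∅, by simp, fun y hy _ => ?_, by simp⟩
    by_cases hyx : y = x
    · rw [hyx]; exact h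
    · exact hU hy.2 hyx
  · have h3 := h2.resolve_left h
    refine ⟨{x}, ?_, fun y hy hyx => hU hy.2 (by simpa using hyx), ?_⟩
    · intro y hy _
      rw [Finset.mem_singleton] at hy
      rw [hy]; exact h3.1
    · intro y _ hy
      rw [Finset.mem_singleton] at hy
      subst hy
      exact h3.2

theorem DAt.of_forall_plAt (f : ℝ ≃o ℝ) (h : ∀ x, PLAt f x) (x : ℝ) : DAt f x :=
  DAt.intro f (Eventually.of_forall h) (Or.inl (h x))

theorem DAt.symm (f : ℝ ≃o ℝ) {x : ℝ} (h : DAt f x) : DAt f.symm (f x) := by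
  obtain ⟨e, hx, he, h1⟩ := h
  refine ⟨e.symm, by rw [h1 x hx]; exact e.map_source hx, he.symm, fun y hy => ?_⟩
  rw [f.symm_apply_eq, h1 _ (e.map_target hy), e.right_inv hy]

theorem PLAt.symm (f : ℝ ≃o ℝ) {x : ℝ} (h : PLAt f x) : PLAt f.symm (f x) := by
  set e := f.toHomeomorph.toOpenPartialHomeomorph with he
  have t : Tendsto f.symm (𝓝[≠] (f x)) (𝓝[≠] x) := by
    have := tendsto_nhdsNE_of_injective f.symm.continuous f.symm.injective (f x)
    rwa [f.symm_apply_apply] at this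
  refine ⟨?_, ?_⟩
  · filter_upwards [t.eventually h.1] with y hy
    have := LocallyDyadicAffineAt.symm (f := e) hy (by simp [he])
    have e1 : e (f.symm y) = y := f.apply_symm_apply y
    rw [e1] at this
    exact this
  · rcases h.2 with h3 | h3
    · exact Or.inl (LocallyDyadicAffineAt.symm (f := e) h3 (by simp [he]))
    · exact Or.inr (h.mem_iff f.continuous.continuousAt h3)

/-- For a dyadic `y` close to `x`, both `y` and its double about `x` have dyadic images, since `f`
is piecewise linear there. The doubling relation expresses `f x` as `2 * f y` minus the image of the
double. -/
theorem DAt.mem_dyadic {f : ℝ → ℝ} {x : ℝ} (h : DAt f x) (hx : x ∈ dyadic) : f x ∈ dyadic := by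
  obtain ⟨h1, -, h3⟩ := h.plAt_or
  have hc : ∀ᶠ y in 𝓝[≠] x, ContinuousAt f y := by
    filter_upwards [nhdsWithin_le_nhds h.eventually] with y hy using hy.continuousAt
  obtain ⟨ε, hε, h4⟩ := exists_Ioo_of_eventually
    ((eventually_nhdsWithin_iff.1 (h1.and hc)).and h3)
  obtain ⟨k, hk⟩ := exists_pow_lt_of_lt_one (show 0 < ε / 2 by linarith)
    (show (2 : ℝ)⁻¹ < 1 by norm_num)
  have hkp : (0 : ℝ) < (2 : ℝ)⁻¹ ^ k := by positivity
  have hyd : x + (2 : ℝ)⁻¹ ^ k ∈ dyadic := add_mem hx (pow_mem half_mem k)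
  have a1 := h4 (x + (2 : ℝ)⁻¹ ^ k) (by rw [abs_lt]; constructor <;> linarith)
  have a2 := h4 (doubling x (x + (2 : ℝ)⁻¹ ^ k))
      (by unfold doubling; rw [abs_lt]; constructor <;> linarith)
  have b1 := a1.1 (by simp)
  have b2 := a2.1 (by unfold doubling; simp)
  have c1 := b1.1.mem_iff b1.2 hyd
  have c2 := b2.1.mem_iff b2.2 (add_mem (mul_mem two_mem (sub_mem hyd hx)) hx)
  rw [a1.2] at c2
  have : f x = 2 * f (x + (2 : ℝ)⁻¹ ^ k) - doubling (f x) (f (x + (2 : ℝ)⁻¹ ^ k)) := by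
    unfold doubling; ring
  rw [this]
  exact sub_mem (mul_mem two_mem c1) c2

/-! ### Groups of homeomorphisms of the line -/

/-- Homeomorphisms of the line that fix every point off `s`. -/
def fixOff (s : Set ℝ) : Subgroup (ℝ ≃o ℝ) where
  carrier := {f | ∀ x ∉ s, f x = x}
  mul_mem' {f g} hf hg x hx := by
    rw [RelIso.mul_apply, hg x hx, hf x hx]
  one_mem' x _ := rfl
  inv_mem' {f} hf x hx := by
    have := congrArg f.symm (hf x hx)
    rw [f.symm_apply_apply] at this
    exact this.symm

theorem fixOff_mono {s t : Set ℝ} (h : s ⊆ t) : fixOff s ≤ fixOff t :=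
  fun _ hf x hx => hf x fun h' => hx (h h')

theorem fixOff_apply_mem {s : Set ℝ} {f : ℝ ≃o ℝ} (hf : f ∈ fixOff s) {x : ℝ} (hx : x ∈ s) :
    f x ∈ s := by
  by_contra h
  have := hf _ h
  rw [f.injective this] at h
  exact h hx

theorem conj_mem_fixOff {s : Set ℝ} {f : ℝ ≃o ℝ} (hf : f ∈ fixOff s) (g : ℝ ≃o ℝ) :
    g * f * g⁻¹ ∈ fixOff (g '' s) := by
  intro x hx
  have : g⁻¹ x ∉ s := fun h => hx ⟨_, h, g.apply_symm_apply x⟩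
  simp only [RelIso.mul_apply]
  rw [hf _ this]
  exact g.apply_symm_apply x

theorem image_Ioo_orderIso (g : ℝ ≃o ℝ) (a b : ℝ) : g '' Ioo a b = Ioo (g a) (g b) :=
  g.image_Ioo a b

theorem fixOff_commute {s t : Set ℝ} (h : Disjoint s t) {f g : ℝ ≃o ℝ} (hf : f ∈ fixOff s)
    (hg : g ∈ fixOff t) : Commute f g := by
  ext x
  simp only [RelIso.mul_apply]
  by_cases hx : x ∈ s
  · have h1 : x ∉ t := fun h' => h.le_bot ⟨hx, h'⟩
    have h2 : f x ∉ t := fun h' => h.le_bot ⟨fixOff_apply_mem hf hx, h'⟩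
    rw [hg x h1, hg _ h2]
  · have h2 : g x ∉ s := by
      by_cases hx' : x ∈ t
      · exact fun h' => h.le_bot ⟨h', fixOff_apply_mem hg hx'⟩
      · rwa [hg x hx']
    rw [hf x hx, hf _ h2]

/-- Dyadic piecewise linear homeomorphisms of the line. -/
def plSub : Subgroup (ℝ ≃o ℝ) where
  carrier := {f | ∀ x, PLAt f x}
  mul_mem' {f g} hf hg x := by
    change PLAt (fun y => f (g y)) x
    exact PLAt.comp (hf (g x)) (hg x) g.continuous g.injective
  one_mem' x := plAt_id x
  inv_mem' {f} hf x := by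
    have := (hf (f.symm x)).symm
    rwa [f.apply_symm_apply] at this

/-- Homeomorphisms of the line that are everywhere of type `𝔇`. -/
def dSub : Subgroup (ℝ ≃o ℝ) where
  carrier := {f | ∀ x, DAt f x}
  mul_mem' {f g} hf hg x := by
    change DAt (fun y => f (g y)) x
    exact DAt.comp (hf (g x)) (hg x)
  one_mem' x := DAt.of_forall_plAt 1 plAt_id x
  inv_mem' {f} hf x := by
    have := (hf (f.symm x)).symm
    rwa [f.apply_symm_apply] at this

theorem plSub_le_dSub : plSub ≤ dSub := fun f hf => DAt.of_forall_plAt f hf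

theorem dSub_apply_mem {f : ℝ ≃o ℝ} (hf : f ∈ dSub) {x : ℝ} : f x ∈ dyadic ↔ x ∈ dyadic := by
  refine ⟨fun h => ?_, (hf x).mem_dyadic⟩
  have := (inv_mem hf (f x)).mem_dyadic h
  rwa [show f⁻¹ (f x) = x from f.symm_apply_apply x] at this

theorem plSub_apply_mem {f : ℝ ≃o ℝ} (hf : f ∈ plSub) {x : ℝ} : f x ∈ dyadic ↔ x ∈ dyadic :=
  dSub_apply_mem (plSub_le_dSub hf)

/-- Homeomorphisms of the line of type `𝔇` supported in `(a, b)`. -/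
def Dd (a b : ℝ) : Subgroup (ℝ ≃o ℝ) := dSub ⊓ fixOff (Ioo a b)

/-- Homeomorphisms with support inside a compact subset of `(u, v)`. -/
def cptSub (u v : ℝ) : Subgroup (ℝ ≃o ℝ) where
  carrier := {f | ∃ α > u, ∃ β < v, f ∈ fixOff (Ioo α β)}
  mul_mem' := by
    rintro f g ⟨α, hα, β, hβ, hf⟩ ⟨α', hα', β', hβ', hg⟩
    exact ⟨min α α', lt_min hα hα', max β β', max_lt hβ hβ',
      mul_mem (fixOff_mono (Ioo_subset_Ioo (min_le_left _ _) (le_max_left _ _)) hf)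
      (fixOff_mono (Ioo_subset_Ioo (min_le_right _ _) (le_max_right _ _)) hg)⟩
  one_mem' := ⟨u + 1, by simp, v - 1, by simp, one_mem _⟩
  inv_mem' := by
    rintro f ⟨α, hα, β, hβ, hf⟩
    exact ⟨α, hα, β, hβ, inv_mem hf⟩

theorem cptSub_le_fixOff (u v : ℝ) : cptSub u v ≤ fixOff (Ioo u v) := by
  rintro f ⟨α, hα, β, hβ, hf⟩
  exact fixOff_mono (Ioo_subset_Ioo hα.le hβ.le) hf

theorem fixOff_le_cptSub {a b u v : ℝ} (h1 : u < a) (h2 : b < v) :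
    fixOff (Ioo a b) ≤ cptSub u v := fun _ hf => ⟨a, h1, b, h2, hf⟩

/-- Compact support in the open interval, as for `Dc`. By contrast, elements of `Dd` may act
nontrivially arbitrarily close to the end points. -/
def PLc (u v : ℝ) : Subgroup (ℝ ≃o ℝ) := plSub ⊓ cptSub u v

def Dc (u v : ℝ) : Subgroup (ℝ ≃o ℝ) := dSub ⊓ cptSub u v

theorem PLc_le_Dc (u v : ℝ) : PLc u v ≤ Dc u v := inf_le_inf_right _ plSub_le_dSub

theorem Dc_le_Dd (u v : ℝ) : Dc u v ≤ Dd u v := inf_le_inf_left _ (cptSub_le_fixOff u v)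

theorem Dd_mono {a b c d : ℝ} (h1 : c ≤ a) (h2 : b ≤ d) : Dd a b ≤ Dd c d :=
  inf_le_inf_left _ (fixOff_mono (Ioo_subset_Ioo h1 h2))

theorem Dd_le_Dc {a b u v : ℝ} (h1 : u < a) (h2 : b < v) : Dd a b ≤ Dc u v :=
  inf_le_inf_left _ (fixOff_le_cptSub h1 h2)

/-! ### Affine maps and gluing -/

/-- The affine map `t ↦ 2 ^ n * t + b`. -/
noncomputable def affIso (n : ℤ) (b : ℝ) : ℝ ≃o ℝ where
  toFun t := 2 ^ n * t + b
  invFun t := 2 ^ (-n) * (t - b)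
  left_inv t := by
    have : (2 : ℝ) ^ n ≠ 0 := by positivity
    rw [zpow_neg]; field_simp; ring
  right_inv t := by
    have : (2 : ℝ) ^ n ≠ 0 := by positivity
    rw [zpow_neg]; field_simp; ring
  map_rel_iff' {s t} := by
    have : (0 : ℝ) < 2 ^ n := by positivity
    simp [this]

@[simp] theorem affIso_apply (n : ℤ) (b t : ℝ) : affIso n b t = 2 ^ n * t + b := rfl

theorem affIso_inv_apply (n : ℤ) (b t : ℝ) : (affIso n b)⁻¹ t = 2 ^ (-n) * (t - b) := rfl

theorem affIso_mem {n : ℤ} {b : ℝ} (hb : b ∈ dyadic) : affIso n b ∈ plSub :=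
  fun x => (locallyDyadicAffineAt_of_eq hb (affIso_apply n b) x).plAt

/-- The map equal to `f` on the left of `m` and to `g` on the right. -/
noncomputable def glue (f g : ℝ ≃o ℝ) (m : ℝ) (h : f m = g m) : ℝ ≃o ℝ where
  toFun t := if t ≤ m then f t else g t
  invFun t := if t ≤ f m then f.symm t else g.symm t
  left_inv t := by
    by_cases ht : t ≤ m
    · simp [ht]
    · have : ¬ g t ≤ f m := by rw [h]; simpa using ht
      simp [ht, this]
  right_inv t := by
    by_cases ht : t ≤ f m
    · have : f.symm t ≤ m := by rwa [f.symm_apply_le]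
      simp [ht, this]
    · have : ¬ g.symm t ≤ m := by rw [g.symm_apply_le, ← h]; exact ht
      simp [ht, this]
  map_rel_iff' {s t} := by
    simp only [Equiv.coe_fn_mk]
    by_cases hs : s ≤ m <;> by_cases ht : t ≤ m
    · simp [hs, ht]
    · simp only [hs, ht, if_true, if_false]
      push Not at ht
      refine ⟨fun _ => hs.trans ht.le, fun _ => ?_⟩
      calc f s ≤ f m := f.monotone hs
        _ = g m := h
        _ ≤ g t := g.monotone ht.le
    · simp only [hs, ht, if_true, if_false]
      push Not at hs
      constructor
      · intro h1
        have h2 : g m < g s := g.strictMono hs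
        have h3 : f t ≤ f m := f.monotone ht
        rw [← h] at h2
        exact absurd (h1.trans h3) (not_le.2 h2)
      · intro h1
        exact absurd (h1.trans ht) (not_le.2 hs)
    · simp [hs, ht]

theorem glue_of_le {f g : ℝ ≃o ℝ} {m : ℝ} (h : f m = g m) {t : ℝ} (ht : t ≤ m) :
    glue f g m h t = f t := if_pos ht

theorem glue_of_ge {f g : ℝ ≃o ℝ} {m : ℝ} (h : f m = g m) {t : ℝ} (ht : m ≤ t) :
    glue f g m h t = g t := by
  rcases ht.eq_or_lt with rfl | ht
  · rw [glue_of_le h le_rfl, h]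
  · exact if_neg (not_le.2 ht)

theorem glue_plAt {f g : ℝ ≃o ℝ} {m : ℝ} (h : f m = g m) (hm : m ∈ dyadic) {x : ℝ}
    (h1 : x ≤ m → PLAt f x) (h2 : m ≤ x → PLAt g x) : PLAt (glue f g m h) x := by
  rcases lt_trichotomy x m with hx | rfl | hx
  · exact (h1 hx.le).congr (by
      filter_upwards [Iio_mem_nhds hx] with y hy using glue_of_le h (le_of_lt hy))
  · refine PLAt.of_sides hm (h1 le_rfl) (h2 le_rfl) ?_ ?_
    · filter_upwards [self_mem_nhdsWithin] with y hy using glue_of_le h (le_of_lt hy)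
    · filter_upwards [self_mem_nhdsWithin] with y hy using glue_of_ge h (le_of_lt hy)
  · exact (h2 hx.le).congr (by
      filter_upwards [Ioi_mem_nhds hx] with y hy using glue_of_ge h (le_of_lt hy))

theorem glue_mem_plSub {f g : ℝ ≃o ℝ} {m : ℝ} (h : f m = g m) (hm : m ∈ dyadic)
    (hf : f ∈ plSub) (hg : g ∈ plSub) : glue f g m h ∈ plSub :=
  fun x => glue_plAt h hm (fun _ => hf x) fun _ => hg x

/-- The doubling about `m` preserves each side of `m`, so the two doubling relations glue to one at
`m`. -/
theorem glue_dAt {f g : ℝ ≃o ℝ} {m : ℝ} (h : f m = g m) (hm : m ∈ dyadic) {x : ℝ}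
    (h1 : x ≤ m → DAt f x) (h2 : m ≤ x → DAt g x) : DAt (glue f g m h) x := by
  rcases lt_trichotomy x m with hx | rfl | hx
  · exact (h1 hx.le).congr (by
      filter_upwards [Iio_mem_nhds hx] with y hy using glue_of_le h (le_of_lt hy))
  · obtain ⟨a1, -, a3⟩ := (h1 le_rfl).plAt_or
    obtain ⟨b1, -, b3⟩ := (h2 le_rfl).plAt_or
    refine DAt.intro _ ?_ (Or.inr ⟨hm, ?_⟩)
    · filter_upwards [a1, b1, self_mem_nhdsWithin] with y h5 h6 h7
      rcases lt_or_gt_of_ne h7 with h8 | h8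
      · exact glue_plAt h hm (fun _ => h5) fun h9 => absurd h8 (not_lt.2 h9)
      · exact glue_plAt h hm (fun h9 => absurd h8 (not_lt.2 h9)) fun _ => h6
    · filter_upwards [a3, b3] with y h5 h6
      rw [glue_of_le h le_rfl]
      rcases le_total y x with hy | hy
      · rw [glue_of_le h hy, glue_of_le h (by unfold doubling; linarith), h5]
      · rw [glue_of_ge h hy, glue_of_ge h (by unfold doubling; linarith), h6, h]
  · exact (h2 hx.le).congr (by
      filter_upwards [Ioi_mem_nhds hx] with y hy using glue_of_ge h (le_of_lt hy))

theorem glue_mem_dSub {f g : ℝ ≃o ℝ} {m : ℝ} (h : f m = g m) (hm : m ∈ dyadic)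
    (hf : f ∈ dSub) (hg : g ∈ dSub) : glue f g m h ∈ dSub :=
  fun x => glue_dAt h hm (fun _ => hf x) fun _ => hg x

theorem exists_zpow_near {r : ℝ} (hr : 0 < r) : ∃ k : ℤ, (2 : ℝ) ^ k ≤ r ∧ r < 2 ^ (k + 1) :=
  exists_mem_Ico_zpow hr (by norm_num)

/-- Dyadic intervals are identified by dyadic piecewise linear maps. -/
theorem exists_pl_interval {a b c d : ℝ} (hab : a < b) (hcd : c < d) (ha : a ∈ dyadic)
    (hb : b ∈ dyadic) (hc : c ∈ dyadic) (hd : d ∈ dyadic) : ∃ f ∈ plSub, f a = c ∧ f b = d := by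
  obtain ⟨k, h1, h2⟩ := exists_zpow_near (r := (d - c) / (b - a))
    (div_pos (by linarith) (by linarith))
  have hba : 0 < b - a := by linarith
  rw [le_div_iff₀ hba] at h1
  rw [div_lt_iff₀ hba] at h2
  have hk : (0 : ℝ) < 2 ^ k := by positivity
  have hkn : (2 : ℝ) ^ k * 2 ^ (-k) = 1 := by rw [← zpow_add₀ (by norm_num)]; simp
  have hk1 : (2 : ℝ) ^ (k + 1) = 2 * 2 ^ k := by rw [zpow_add₀ (by norm_num)]; simp; ring
  -- The break point: slope `2 ^ k` on `[a, m]` and `2 ^ (k + 1)` on `[m, b]` give total length `d -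
  -- c` exactly for this `m`. The bounds on `k` place it in `[a, b]`.
  set m : ℝ := 2 * b - a - (d - c) * 2 ^ (-k) with hm
  have hmd : m ∈ dyadic := sub_mem (sub_mem (mul_mem two_mem hb) ha)
    (mul_mem (sub_mem hd hc) (zpow_mem _))
  have hkm : 2 ^ k * m = 2 ^ k * (2 * b - a) - (d - c) := by
    rw [hm]; linear_combination (-(d - c)) * hkn
  have ham : a ≤ m := by
    have : 2 ^ k * a ≤ 2 ^ k * m := by rw [hkm]; rw [hk1] at h2; nlinarith
    exact le_of_mul_le_mul_left this hk
  have hmb : m ≤ b := by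
    have : 2 ^ k * m ≤ 2 ^ k * b := by rw [hkm]; nlinarith
    exact le_of_mul_le_mul_left this hk
  have hgl : affIso k (c - 2 ^ k * a) m = affIso (k + 1) (c - 2 ^ k * a - 2 ^ k * m) m := by
    simp only [affIso_apply, hk1]; ring
  have e1 := sub_mem hc (mul_mem (zpow_mem k) ha)
  refine ⟨glue _ _ m hgl, glue_mem_plSub hgl hmd (affIso_mem e1)
    (affIso_mem (sub_mem e1 (mul_mem (zpow_mem k) hmd))), ?_, ?_⟩
  · rw [glue_of_le hgl ham]; simp
  · rw [glue_of_ge hgl hmb]; simp only [affIso_apply, hk1]; rw [hkm]; ring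

/-- A piecewise linear map can be extended from a compact interval to one with compact support. -/
theorem exists_extend {f : ℝ ≃o ℝ} {a b x y : ℝ} (hf : f ∈ dSub) (ha : a ∈ dyadic)
    (hb : b ∈ dyadic) (hx : x ∈ dyadic) (hy : y ∈ dyadic) (hax : a < x) (hxy : x ≤ y) (hyb : y < b)
    (hafx : a < f x) (hfyb : f y < b) : ∃ g ∈ Dd a b, (∀ t ∈ Icc x y, g t = f t) ∧
      (∀ t, (t ∈ Icc x y → PLAt f t) → PLAt g t) := by
  have hfx := (dSub_apply_mem hf).2 hx
  have hfy := (dSub_apply_mem hf).2 hy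
  -- `p` carries `[a, x]` onto `[a, f x]` and `q` carries `[y, b]` onto `[f y, b]`; outside `[a, b]`
  -- the identity is glued on.
  obtain ⟨p, hp, hp1, hp2⟩ := exists_pl_interval hax hafx ha hx ha hfx
  obtain ⟨q, hq, hq1, hq2⟩ := exists_pl_interval hyb hfyb hy hb hfy hb
  have g1 : p x = f x := hp2
  have g2 : glue p f x g1 y = q y := by rw [glue_of_ge g1 hxy, hq1]
  set u := glue _ _ y g2 with hu
  have u1 : ∀ t, t ≤ x → u t = p t := fun t ht => by
    rw [hu, glue_of_le g2 (ht.trans hxy), glue_of_le g1 ht]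
  have u2 : ∀ t, y ≤ t → u t = q t := fun t ht => by rw [hu, glue_of_ge g2 ht]
  have u3 : ∀ t ∈ Icc x y, u t = f t := fun t ht => by
    rw [hu, glue_of_le g2 ht.2, glue_of_ge g1 ht.1]
  have ud : u ∈ dSub := glue_mem_dSub g2 hy (glue_mem_dSub g1 hx (plSub_le_dSub hp) hf)
    (plSub_le_dSub hq)
  have g3 : (1 : ℝ ≃o ℝ) a = u a := by rw [u1 a hax.le, hp1]; rfl
  have g4 : glue 1 u a g3 b = (1 : ℝ ≃o ℝ) b := by
    rw [glue_of_ge g3 (by linarith), u2 b hyb.le, hq2]; rfl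
  refine ⟨glue _ _ b g4, ⟨?_, ?_⟩, ?_, ?_⟩
  · exact glue_mem_dSub g4 hb (glue_mem_dSub g3 ha (one_mem _) ud) (one_mem _)
  · intro t ht
    rcases le_or_gt b t with h | h
    · rw [glue_of_ge g4 h]; rfl
    · have : t ≤ a := by by_contra h'; exact ht ⟨not_le.1 h', h⟩
      rw [glue_of_le g4 h.le, glue_of_le g3 this]; rfl
  · intro t ht
    rw [glue_of_le g4 (by linarith [ht.2]), glue_of_ge g3 (by linarith [ht.1]), u3 t ht]
  · intro t h
    refine glue_plAt g4 hb (fun _ => glue_plAt g3 ha (fun _ => plAt_id t) fun _ => ?_)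
      fun _ => plAt_id t
    exact glue_plAt g2 hy (fun h1 => glue_plAt g1 hx (fun _ => hp t) fun h2 => h ⟨h2, h1⟩)
      fun _ => hq t

/-- Transitivity on ordered dyadic pairs. -/
theorem exists_pl_map_pair {a b x y x' y' : ℝ} (ha : a ∈ dyadic)
    (hb : b ∈ dyadic) (hx : x ∈ dyadic) (hy : y ∈ dyadic) (hx' : x' ∈ dyadic) (hy' : y' ∈ dyadic)
    (hax : a < x) (hxy : x < y) (hyb : y < b) (hax' : a < x') (hxy' : x' < y') (hyb' : y' < b) :
    ∃ g ∈ plSub, g ∈ fixOff (Ioo a b) ∧ g x = x' ∧ g y = y' := by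
  obtain ⟨f, hf, hf1, hf2⟩ := exists_pl_interval hxy hxy' hx hy hx' hy'
  obtain ⟨g, hg, hg1, hg2⟩ := exists_extend (plSub_le_dSub hf) ha hb hx hy hax hxy.le hyb
    (by rwa [hf1]) (by rwa [hf2])
  exact ⟨g, fun t => hg2 t fun _ => hf t, hg.2, by rw [hg1 x ⟨le_rfl, hxy.le⟩, hf1],
    by rw [hg1 y ⟨hxy.le, le_rfl⟩, hf2]⟩

theorem exists_pl_map {a b x x' : ℝ} (ha : a ∈ dyadic)
    (hb : b ∈ dyadic) (hx : x ∈ dyadic) (hx' : x' ∈ dyadic)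
    (hax : a < x) (hxb : x < b) (hax' : a < x') (hxb' : x' < b) :
    ∃ g ∈ plSub, g ∈ fixOff (Ioo a b) ∧ g x = x' := by
  -- A translation is prescribed on the degenerate interval `[x, x]` and then extended.
  obtain ⟨g, hg, hg1, hg2⟩ := exists_extend (f := affIso 0 (x' - x))
    (plSub_le_dSub (affIso_mem (sub_mem hx' hx))) ha hb hx hx hax le_rfl hxb (by simpa using hax')
    (by simpa using hxb')
  exact ⟨g, fun t => hg2 t fun _ => affIso_mem (sub_mem hx' hx) t, hg.2,
    by rw [hg1 x ⟨le_rfl, le_rfl⟩]; simp⟩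

theorem exists_dyadic_between {a b : ℝ} (h : a < b) : ∃ x ∈ dyadic, a < x ∧ x < b := by
  obtain ⟨k, hk⟩ := exists_pow_lt_of_lt_one (show 0 < (b - a) by linarith)
    (show (2 : ℝ)⁻¹ < 1 by norm_num)
  have hkp : (0 : ℝ) < (2 : ℝ)⁻¹ ^ k := by positivity
  refine ⟨(2 : ℝ)⁻¹ ^ k * (⌊a / (2 : ℝ)⁻¹ ^ k⌋ + 1), mul_mem (pow_mem half_mem k)
    (add_mem (intCast_mem _ _) (one_mem _)), ?_, ?_⟩
  · have := Int.lt_floor_add_one (a / (2 : ℝ)⁻¹ ^ k)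
    rw [div_lt_iff₀ hkp] at this
    linarith
  · have := Int.floor_le (a / (2 : ℝ)⁻¹ ^ k)
    rw [le_div_iff₀ hkp] at this
    linarith

end SolenoidalThompson
namespace SolenoidalThompson

open Set Filter Topology

/-! ### Periodic extension -/

theorem perExt_aux {p : ℝ} (hp : 0 < p) (t : ℝ) : 0 ≤ t - p * ⌊t / p⌋ ∧ t - p * ⌊t / p⌋ < p := by
  have h1 := Int.floor_le (t / p)
  have h2 := Int.lt_floor_add_one (t / p)
  rw [le_div_iff₀ hp] at h1
  rw [div_lt_iff₀ hp] at h2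
  constructor <;> linarith

/-- The extension of `f` on `[0, p]` that commutes with translation by `p` and `p'`. -/
noncomputable def perExt (f : ℝ ≃o ℝ) {p p' : ℝ} (hp : 0 < p) (h : f p = f 0 + p') : ℝ ≃o ℝ :=
  have hp' : 0 < p' := by have := f.strictMono hp; linarith
  StrictMono.orderIsoOfSurjective (fun t => f (t - p * ⌊t / p⌋) + p' * ⌊t / p⌋)
    (by
      intro s t hst
      have h1 : ⌊s / p⌋ ≤ ⌊t / p⌋ := Int.floor_mono (by gcongr)
      obtain ⟨a1, a2⟩ := perExt_aux hp s
      obtain ⟨b1, b2⟩ := perExt_aux hp t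
      rcases h1.eq_or_lt with h2 | h2
      · simp only [h2]
        have := f.strictMono (show s - p * ⌊t / p⌋ < t - p * ⌊t / p⌋ by linarith)
        linarith
      · have h3 : ((⌊s / p⌋ : ℤ) : ℝ) + 1 ≤ ⌊t / p⌋ := by exact_mod_cast h2
        have h4 := f.strictMono a2
        have h5 := f.monotone b1
        have h6 : p' * (⌊s / p⌋ + 1) ≤ p' * ⌊t / p⌋ := by gcongr
        beta_reduce
        linarith)
    (by
      intro y
      set j := ⌊(y - f 0) / p'⌋ with hj
      obtain ⟨a1, a2⟩ := perExt_aux hp' (y - f 0)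
      rw [← hj] at a1 a2
      set s := f.symm (y - p' * j) with hs
      have s1 : 0 ≤ s := by rw [hs, OrderIso.le_symm_apply]; linarith
      have s2 : s < p := by rw [hs, OrderIso.symm_apply_lt, h]; linarith
      have hfl : ⌊(s + p * j) / p⌋ = j := by
        rw [Int.floor_eq_iff, le_div_iff₀ hp, div_lt_iff₀ hp]
        constructor <;> nlinarith
      refine ⟨s + p * j, ?_⟩
      change f (s + p * j - p * ⌊(s + p * j) / p⌋) + p' * ⌊(s + p * j) / p⌋ = y
      rw [hfl, add_sub_cancel_right, hs, OrderIso.apply_symm_apply]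
      ring)

theorem perExt_apply (f : ℝ ≃o ℝ) {p p' : ℝ} (hp : 0 < p) (h : f p = f 0 + p') (t : ℝ) :
    perExt f hp h t = f (t - p * ⌊t / p⌋) + p' * ⌊t / p⌋ := rfl

/-- The formulas of adjacent closed cells agree at the common end point because `f p = f 0 + p'`.
This gives one-sided descriptions at the multiples of `p`. -/
theorem perExt_of_mem (f : ℝ ≃o ℝ) {p p' : ℝ} (hp : 0 < p) (h : f p = f 0 + p') {t : ℝ} (j : ℤ)
    (ht : t ∈ Icc (p * j) (p * (j + 1))) : perExt f hp h t = f (t - p * j) + p' * j := by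
  rcases ht.2.eq_or_lt with h1 | h1
  · have hfl : ⌊t / p⌋ = j + 1 := by
      rw [h1, mul_comm, mul_div_assoc, div_self hp.ne', mul_one]
      exact_mod_cast Int.floor_intCast (R := ℝ) (j + 1)
    rw [perExt_apply, hfl, h1]
    push_cast
    rw [show p * ((j : ℝ) + 1) - p * (j + 1) = 0 by ring, show p * ((j : ℝ) + 1) - p * j = p by ring,
      h]
    ring
  · have hfl : ⌊t / p⌋ = j := by
      rw [Int.floor_eq_iff, le_div_iff₀ hp, div_lt_iff₀ hp]
      constructor <;> linarith [ht.1]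
    rw [perExt_apply, hfl]

theorem perExt_add (f : ℝ ≃o ℝ) {p p' : ℝ} (hp : 0 < p) (h : f p = f 0 + p') (t : ℝ) :
    perExt f hp h (t + p) = perExt f hp h t + p' := by
  have : ⌊(t + p) / p⌋ = ⌊t / p⌋ + 1 := by
    rw [add_div, div_self hp.ne', Int.floor_add_one]
  rw [perExt_apply, perExt_apply, this]
  push_cast
  rw [show t + p - p * ((⌊t / p⌋ : ℝ) + 1) = t - p * ⌊t / p⌋ by ring]
  ring

theorem plAt_translate {f : ℝ → ℝ} {x b c : ℝ} (hb : b ∈ dyadic) (hc : c ∈ dyadic)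
    (h : PLAt f (x + b)) : PLAt (fun y => f (y + b) + c) x := by
  have h1 : PLAt (fun y => f (y + b)) x := by
    refine PLAt.comp (f := fun y => y + b) h ?_ (by fun_prop) (add_left_injective b)
    exact (locallyDyadicAffineAt_of_eq (n := 0) hb (by simp) x).plAt
  refine ⟨?_, h1.2.imp ?_ id⟩
  · filter_upwards [h1.1] with y hy
    obtain ⟨n, d, hd, h2⟩ := hy
    exact ⟨n, d + c, add_mem hd hc, by filter_upwards [h2] with z hz; rw [hz]; ring⟩
  · rintro ⟨n, d, hd, h2⟩
    exact ⟨n, d + c, add_mem hd hc, by filter_upwards [h2] with z hz; rw [hz]; ring⟩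

theorem perExt_mem_plSub (f : ℝ ≃o ℝ) {p p' : ℝ} (hp : 0 < p) (h : f p = f 0 + p')
    (hpd : p ∈ dyadic) (hpd' : p' ∈ dyadic) (hf : ∀ t ∈ Icc 0 p, PLAt f t) :
    perExt f hp h ∈ plSub := by
  intro t
  have hz : ∀ j : ℤ, (j : ℝ) ∈ dyadic := fun j => intCast_mem _ _
  have tr : ∀ j : ℤ, t - p * j ∈ Icc 0 p → PLAt (fun y => f (y - p * j) + p' * j) t :=
    fun j hj => by
      simp only [sub_eq_add_neg]
      exact plAt_translate (neg_mem (mul_mem hpd (hz j))) (mul_mem hpd' (hz j))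
        (hf _ (by simpa only [sub_eq_add_neg] using hj))
  set j := ⌊t / p⌋ with hj
  obtain ⟨a1, a2⟩ := perExt_aux hp t
  rw [← hj] at a1 a2
  rcases a1.eq_or_lt with h0 | h0
  · have ht : t = p * j := by linarith
    refine PLAt.of_sides (by rw [ht]; exact mul_mem hpd (hz j))
      (tr (j - 1) (by push_cast; constructor <;> linarith)) (tr j ⟨a1, a2.le⟩) ?_ ?_
    · filter_upwards [Ioo_mem_nhdsLT (show t - p < t by linarith)] with y hy
      exact perExt_of_mem f hp h (j - 1) (by
        push_cast; constructor <;> linarith [hy.1, hy.2])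
    · filter_upwards [Ioo_mem_nhdsGT (show t < t + p by linarith)] with y hy
      exact perExt_of_mem f hp h j (by constructor <;> linarith [hy.1, hy.2])
  · refine (tr j ⟨a1, a2.le⟩).congr ?_
    filter_upwards [Ioo_mem_nhds (show p * j < t by linarith) (show t < p * (j + 1) by linarith)]
      with y hy
    exact perExt_of_mem f hp h j (Ioo_subset_Icc_self hy)

/-! ### Torsion generation modulo the centre -/

/-- The translation by one. -/
noncomputable def trans1 : ℝ ≃o ℝ := affIso 0 1

@[simp] theorem trans1_apply (t : ℝ) : trans1 t = t + 1 := by simp [trans1]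

theorem trans1_zpow (j : ℤ) (t : ℝ) : (trans1 ^ j) t = t + j := by
  have h : ∀ n : ℕ, ∀ t, (trans1 ^ n) t = t + n := by
    intro n
    induction n with
    | zero => intro t; simp
    | succ n ih =>
      intro t
      rw [pow_succ, RelIso.mul_apply, ih, trans1_apply]
      push_cast; ring
  rcases j with j | j
  · simpa using h j t
  · rw [zpow_negSucc]
    apply (trans1 ^ (j + 1)).injective
    rw [← RelIso.mul_apply, mul_inv_cancel, h]
    push_cast
    simp only [RelIso.one_apply]
    ring

/-- Piecewise linear homeomorphisms commuting with the translation by one. -/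
def perSub : Subgroup (ℝ ≃o ℝ) where
  carrier := {f | f ∈ plSub ∧ ∀ t, f (t + 1) = f t + 1}
  mul_mem' {f g} hf hg := ⟨mul_mem hf.1 hg.1, fun t => by
    simp only [RelIso.mul_apply]; rw [hg.2, hf.2]⟩
  one_mem' := ⟨one_mem _, fun _ => rfl⟩
  inv_mem' {f} hf := ⟨inv_mem hf.1, fun t => by
    apply f.injective
    rw [hf.2, ← RelIso.mul_apply, ← RelIso.mul_apply, mul_inv_cancel]
    rfl⟩

theorem trans1_mem_perSub : trans1 ∈ perSub :=
  ⟨affIso_mem (one_mem _), fun t => by simp⟩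

/-- Roots of the translation by one. -/
def rootSet : Set (ℝ ≃o ℝ) := {c | c ∈ perSub ∧ ∃ n : ℕ, 0 < n ∧ c ^ n = trans1}

/-- The conclusion holds for all large `M`, so that finitely many dyadic numbers can be placed on
one common grid. -/
theorem dyadic_scale {b : ℝ} (hb : b ∈ dyadic) :
    ∃ N : ℤ, ∀ M ≥ N, ∃ i : ℤ, b * (2 : ℝ) ^ M = i := by
  have pow : ∀ M : ℤ, 0 ≤ M → ∃ i : ℤ, (2 : ℝ) ^ M = i := by
    intro M hM
    lift M to ℕ using hM
    exact ⟨2 ^ M, by simp⟩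
  induction hb using Subring.closure_induction with
  | mem x hx =>
    rw [mem_singleton_iff] at hx
    refine ⟨1, fun M hM => ?_⟩
    obtain ⟨i, hi⟩ := pow (M - 1) (by linarith)
    refine ⟨i, ?_⟩
    rw [← hi, hx, zpow_sub₀ (by norm_num)]
    simp; ring
  | zero => exact ⟨0, fun M _ => ⟨0, by simp⟩⟩
  | one => exact ⟨0, fun M hM => by simpa using pow M hM⟩
  | add x y _ _ hx hy =>
    obtain ⟨N, hN⟩ := hx
    obtain ⟨N', hN'⟩ := hy
    refine ⟨max N N', fun M hM => ?_⟩
    obtain ⟨i, hi⟩ := hN M (le_trans (le_max_left _ _) hM)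
    obtain ⟨j, hj⟩ := hN' M (le_trans (le_max_right _ _) hM)
    exact ⟨i + j, by push_cast; rw [add_mul, hi, hj]⟩
  | neg x _ hx =>
    obtain ⟨N, hN⟩ := hx
    refine ⟨N, fun M hM => ?_⟩
    obtain ⟨i, hi⟩ := hN M hM
    exact ⟨-i, by push_cast; rw [← hi]; ring⟩
  | mul x y _ _ hx hy =>
    obtain ⟨N, hN⟩ := hx
    obtain ⟨N', hN'⟩ := hy
    refine ⟨N + N', fun M hM => ?_⟩
    obtain ⟨i, hi⟩ := hN N le_rfl
    obtain ⟨j, hj⟩ := hN' (M - N) (by linarith)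
    refine ⟨i * j, ?_⟩
    push_cast
    rw [← hi, ← hj, zpow_sub₀ (by norm_num)]
    field_simp

/-- `L` maps integer cells onto standard dyadic intervals, with `n` cells per period. -/
structure IsCellMap (n : ℕ) (L : ℝ ≃o ℝ) : Prop where
  pl : L ∈ plSub
  per : ∀ t, L (t + n) = L t + 1
  cell : ∀ k : ℤ, ∃ m i : ℤ, ∀ t ∈ Icc (k : ℝ) (k + 1), L t = 2 ^ m * (i + (t - k))

theorem IsCellMap.shift {n : ℕ} {L : ℝ ≃o ℝ} (h : IsCellMap n L) (j : ℤ) :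
    IsCellMap n (L * trans1 ^ j) where
  pl := mul_mem h.pl (Subgroup.zpow_mem _ trans1_mem_perSub.1 j)
  per t := by
    simp only [RelIso.mul_apply, trans1_zpow]
    rw [← h.per]; congr 1; ring
  cell k := by
    obtain ⟨m, i, h1⟩ := h.cell (k + j)
    refine ⟨m, i, fun t ht => ?_⟩
    simp only [RelIso.mul_apply, trans1_zpow]
    rw [h1 _ (by push_cast; constructor <;> linarith [ht.1, ht.2])]
    push_cast; ring

/-- `L` conjugates the translation by `n` to the translation by one, so `L * trans1 * L⁻¹` is an
`n`-th root of `trans1`. Being a root, it commutes with `trans1` and so lies in `perSub`. -/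
theorem IsCellMap.conj_mem {n : ℕ} (hn : 0 < n) {L : ℝ ≃o ℝ} (h : IsCellMap n L) (j : ℤ) :
    L * trans1 ^ j * L⁻¹ ∈ Subgroup.closure rootSet := by
  have h0 : ∀ t, (L * trans1 ^ n * L⁻¹) t = t + 1 := by
    intro t
    have : (trans1 ^ n) (L⁻¹ t) = L⁻¹ t + n := by simpa using trans1_zpow n (L⁻¹ t)
    simp only [RelIso.mul_apply]
    rw [this, h.per, ← RelIso.mul_apply, mul_inv_cancel]
    rfl
  have h1 : (L * trans1 * L⁻¹) ^ n = trans1 := by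
    rw [conj_pow]
    ext t
    rw [h0, trans1_apply]
  have h2 : L * trans1 * L⁻¹ ∈ rootSet := by
    refine ⟨⟨mul_mem (mul_mem h.pl trans1_mem_perSub.1) (inv_mem h.pl), fun t => ?_⟩, n, hn, h1⟩
    have h3 : Commute trans1 (L * trans1 * L⁻¹) := by
      nth_rewrite 1 [← h1]; exact (Commute.refl _).pow_left n
    have := DFunLike.congr_fun h3.eq t
    simp only [RelIso.mul_apply (r := (· ≤ ·)) trans1, RelIso.mul_apply _ trans1,
      trans1_apply] at this
    exact this.symm
  have : L * trans1 ^ j * L⁻¹ = (L * trans1 * L⁻¹) ^ j := (conj_zpow).symm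
  rw [this]
  exact Subgroup.zpow_mem _ (Subgroup.subset_closure h2) j

/-- Take a shortest cell and its neighbour across the end point that is an odd multiple of its
length. The neighbour is at least as long and its end points are multiples of its own length, which
forces equal lengths. The two cells are then the halves of a standard dyadic interval. -/
theorem IsCellMap.exists_sibling {n : ℕ} (hn : 0 < n) {L : ℝ ≃o ℝ} (h : IsCellMap n L) :
    ∃ k m i : ℤ, ∀ t ∈ Icc (k : ℝ) (k + 2), L t = 2 ^ m * (2 * i + (t - k)) := by
  let d : ℤ → ℝ := fun k => L (k + 1) - L k
  have hd : Function.Periodic d (n : ℤ) := by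
    intro k
    change L _ - L _ = L _ - L _
    have e1 := h.per k
    have e2 := h.per (k + 1)
    push_cast
    rw [e1, show (k : ℝ) + n + 1 = k + 1 + n by ring, e2]
    ring
  obtain ⟨k, hk⟩ : ∃ k, ∀ k', d k ≤ d k' := by
    obtain ⟨k, -, hk⟩ := Finset.exists_min_image (Finset.Ico (0 : ℤ) n) d ⟨0, by simpa using hn⟩
    refine ⟨k, fun k' => ?_⟩
    have e : d (k' % n) = d k' := by
      have : k' % n = k' - (k' / n) • (n : ℤ) := by
        rw [smul_eq_mul, mul_comm, Int.emod_def]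
      rw [this]; exact hd.sub_zsmul_eq _
    rw [← e]
    exact hk _ (by
      rw [Finset.mem_Ico]
      exact ⟨Int.emod_nonneg _ (by omega), Int.emod_lt_of_pos _ (by omega)⟩)
  have size : ∀ (k m i : ℤ), (∀ t ∈ Icc (k : ℝ) (k + 1), L t = 2 ^ m * (i + (t - k))) →
      d k = 2 ^ m := by
    intro k m i h1
    change L _ - L _ = _
    rw [h1 k (by simp), h1 (k + 1) (by simp)]; ring
  have pow : ∀ M : ℤ, 0 ≤ M → ∃ i : ℕ, (2 : ℝ) ^ M = 2 ^ i := by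
    intro M hM
    lift M to ℕ using hM
    exact ⟨M, by simp⟩
  obtain ⟨m, i, h1⟩ := h.cell k
  have two_ne : (2 : ℝ) ≠ 0 := by norm_num
  have hm0 : (2 : ℝ) ^ m ≠ 0 := by positivity
  have odd_eq : ∀ (m' j i' : ℤ), (2 : ℝ) ^ m ≤ 2 ^ m' → Odd j →
      (2 : ℝ) ^ m * j = 2 ^ m' * i' → m' = m ∧ i' = j := by
    intro m' j i' hle hj he
    have hmm : m ≤ m' := (zpow_le_zpow_iff_right₀ (by norm_num : (1 : ℝ) < 2)).1 hle
    obtain ⟨q, hq⟩ : ∃ q : ℕ, m' = m + q := ⟨(m' - m).toNat, by omega⟩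
    have : (j : ℝ) = 2 ^ q * i' := by
      rw [hq, zpow_add₀ two_ne, mul_assoc] at he
      simpa using mul_left_cancel₀ hm0 he
    have hz : j = 2 ^ q * i' := by exact_mod_cast this
    rcases Nat.eq_zero_or_pos q with rfl | hq0
    · exact ⟨by simpa using hq, by simpa using hz.symm⟩
    · exfalso
      obtain ⟨r, rfl⟩ : ∃ r, q = r + 1 := ⟨q - 1, by omega⟩
      rw [pow_succ] at hz
      rw [hz] at hj
      have : Even (2 ^ r * 2 * i') := by
        refine Even.mul_right ?_ _
        exact Even.mul_left even_two _
      exact (Int.not_even_iff_odd.2 hj) this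
  rcases Int.even_or_odd i with hi | hi
  · obtain ⟨m', i', h2⟩ := h.cell (k + 1)
    have hle : (2 : ℝ) ^ m ≤ 2 ^ m' := by
      rw [← size _ _ _ h1, ← size _ _ _ h2]; exact hk _
    have e1 := h1 (k + 1) (by simp)
    have e2 := h2 (k + 1) (by push_cast; simp)
    push_cast at e2
    obtain ⟨rfl, rfl⟩ := odd_eq m' (i + 1) i' hle hi.add_one (by
      push_cast; rw [e1] at e2; linear_combination e2)
    obtain ⟨r, rfl⟩ := hi
    refine ⟨k, m', r, fun t ht => ?_⟩
    rcases le_total t (k + 1) with h3 | h3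
    · rw [h1 t ⟨ht.1, h3⟩]; push_cast; ring
    · rw [h2 t (by push_cast; exact ⟨h3, by linarith [ht.2]⟩)]; push_cast; ring
  · obtain ⟨m', i', h2⟩ := h.cell (k - 1)
    have hle : (2 : ℝ) ^ m ≤ 2 ^ m' := by
      rw [← size _ _ _ h1, ← size _ _ _ h2]; exact hk _
    have e1 := h1 k (by simp)
    have e2 := h2 k (by push_cast; simp)
    push_cast at e2
    obtain ⟨rfl, e⟩ := odd_eq m' i (i' + 1) hle hi (by
      push_cast; rw [e1] at e2; linear_combination e2)
    obtain ⟨r, rfl⟩ := hi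
    obtain rfl : i' = r + r := by omega
    refine ⟨k - 1, m', r, fun t ht => ?_⟩
    push_cast at ht ⊢
    rcases le_total t k with h3 | h3
    · rw [h2 t (by push_cast; exact ⟨ht.1, by linarith⟩)]; push_cast; ring
    · rw [h1 t ⟨h3, by linarith [ht.2]⟩]; push_cast; ring

/-- Merging two sibling cells. -/
theorem exists_merge (p : ℕ) (hp : 0 < p) : ∃ M ∈ plSub, (∀ t, M (t + p) = M t + (p + 1)) ∧
    (∀ t ∈ Icc (0 : ℝ) (p - 1), M t = t) ∧ ∀ t ∈ Icc ((p : ℝ) - 1) p, M t = 2 * t - (p - 1) := by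
  have hz : ((p : ℝ) - 1) ∈ dyadic := sub_mem (natCast_mem _ _) (one_mem _)
  have h1 : (1 : ℝ) ≤ p := by exact_mod_cast hp
  have hg : (1 : ℝ ≃o ℝ) ((p : ℝ) - 1) = affIso 1 (-((p : ℝ) - 1)) ((p : ℝ) - 1) := by
    simp only [affIso_apply, zpow_one]
    change (p : ℝ) - 1 = _
    ring
  set f := glue _ _ _ hg with hf
  have f1 : ∀ t ≤ (p : ℝ) - 1, f t = t := fun t ht => by rw [hf, glue_of_le hg ht]; rfl
  have f2 : ∀ t, (p : ℝ) - 1 ≤ t → f t = 2 * t - (p - 1) := fun t ht => by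
    rw [hf, glue_of_ge hg ht]; simp [sub_eq_add_neg]
  have hp' : (0 : ℝ) < p := by linarith
  have hper : f p = f 0 + (p + 1) := by
    rw [f1 0 (by linarith), f2 p (by linarith)]; ring
  refine ⟨perExt f hp' hper, perExt_mem_plSub f hp' hper (natCast_mem _ _)
    (add_mem (natCast_mem _ _) (one_mem _)) fun t _ => ?_, perExt_add f hp' hper, ?_, ?_⟩
  · exact glue_mem_plSub hg hz (one_mem _) (affIso_mem (neg_mem hz)) t
  · intro t ht
    rw [perExt_of_mem f hp' hper 0 (by simp; constructor <;> linarith [ht.1, ht.2])]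
    simp only [Int.cast_zero, mul_zero, sub_zero, add_zero]
    exact f1 t ht.2
  · intro t ht
    rw [perExt_of_mem f hp' hper 0 (by simp; constructor <;> linarith [ht.1, ht.2])]
    simp only [Int.cast_zero, mul_zero, sub_zero, add_zero]
    exact f2 t ht.1

/-- With one cell per period every cell has length one, so all slopes are one and the end points are
integers. -/
theorem isCellMap_one {L : ℝ ≃o ℝ} (h : IsCellMap 1 L) : ∃ j : ℤ, L = trans1 ^ j := by
  have hp : ∀ t, L (t + 1) = L t + 1 := by simpa using h.per
  have hk : ∀ k : ℤ, L k = L 0 + k := by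
    intro k
    induction k using Int.induction_on with
    | zero => simp
    | succ k ih => push_cast at ih ⊢; rw [hp, ih]; ring
    | pred k ih =>
      have := hp (-(k : ℝ) - 1)
      push_cast at ih ⊢
      rw [sub_add_cancel] at this
      linarith
  have one : ∀ k m i : ℤ, (∀ t ∈ Icc (k : ℝ) (k + 1), L t = 2 ^ m * (i + (t - k))) →
      (2 : ℝ) ^ m = 1 := by
    intro k m i h1
    have e1 := h1 k (by simp)
    have e2 := h1 (k + 1) (by simp)
    rw [hp, e1] at e2
    linear_combination -e2
  obtain ⟨m, i, h0⟩ := h.cell 0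
  have hm := one _ _ _ h0
  have hL0 : L 0 = i := by
    have := h0 0 (by simp)
    rw [hm] at this; simpa using this
  refine ⟨i, ?_⟩
  ext t
  obtain ⟨m', i', h1⟩ := h.cell ⌊t⌋
  have hm' := one _ _ _ h1
  have e1 := h1 t ⟨Int.floor_le t, (Int.lt_floor_add_one t).le⟩
  have e2 := h1 ⌊t⌋ (by simp)
  rw [hm'] at e1 e2
  rw [hk, hL0] at e2
  rw [trans1_zpow, e1]
  linear_combination -e2

/-- A power of `trans1` rotates the sibling cells to the positions `p - 1` and `p`. As `M` stretches
`[p - 1, p]` over both, precomposition with `M` turns them into one cell of double length. -/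
theorem IsCellMap.exists_reduce {p : ℕ} (hp : 0 < p) {L M : ℝ ≃o ℝ} (h : IsCellMap (p + 1) L)
    (hM : M ∈ plSub) (M1 : ∀ t, M (t + p) = M t + (p + 1))
    (M2 : ∀ t ∈ Icc (0 : ℝ) (p - 1), M t = t)
    (M3 : ∀ t ∈ Icc ((p : ℝ) - 1) p, M t = 2 * t - (p - 1)) :
    ∃ j : ℤ, IsCellMap p (L * trans1 ^ j * M) := by
  obtain ⟨k, m, i, h1⟩ := h.exists_sibling (by omega)
  refine ⟨k - (p - 1), ?_⟩
  set L1 := L * trans1 ^ (k - (p - 1)) with hL1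
  have c1 := h.shift (k - (p - 1))
  rw [← hL1] at c1
  have hper : ∀ t, (L1 * M) (t + p) = (L1 * M) t + 1 := fun t => by
    simp only [RelIso.mul_apply]
    rw [M1]; simpa using c1.per (M t)
  have hp1 : (1 : ℝ) ≤ p := by exact_mod_cast hp
  have base : ∀ k' : ℤ, 0 ≤ k' → k' < p → ∃ m i : ℤ, ∀ t ∈ Icc (k' : ℝ) (k' + 1),
      (L1 * M) t = 2 ^ m * (i + (t - k')) := by
    intro k' hk0 hkp
    have hk0' : (0 : ℝ) ≤ k' := by exact_mod_cast hk0
    rcases lt_or_ge k' (p - 1) with h2 | h2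
    · have h2' : (k' : ℝ) + 1 ≤ p - 1 := by exact_mod_cast h2
      obtain ⟨m', i', h3⟩ := c1.cell k'
      refine ⟨m', i', fun t ht => ?_⟩
      rw [RelIso.mul_apply, M2 t ⟨by linarith [ht.1], by linarith [ht.2]⟩, h3 t ht]
    · have h2' : k' = p - 1 := by omega
      have h3 : (k' : ℝ) = p - 1 := by rw [h2']; push_cast; ring
      refine ⟨m + 1, i, fun t ht => ?_⟩
      rw [h3] at ht ⊢
      have h4 : (p : ℝ) - 1 ≤ t ∧ t ≤ p := ⟨ht.1, by linarith [ht.2]⟩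
      rw [RelIso.mul_apply, M3 t h4, hL1, RelIso.mul_apply, trans1_zpow]
      push_cast
      rw [h1 _ (by constructor <;> linarith [h4.1, h4.2]), zpow_add₀ (by norm_num)]
      simp; ring
  refine ⟨mul_mem c1.pl hM, hper, fun k' => ?_⟩
  -- move to a cell of the fundamental period
  have zper : ∀ (j : ℤ) (t : ℝ), (L1 * M) (t + p * j) = (L1 * M) t + j := by
    intro j
    induction j using Int.induction_on with
    | zero => intro t; simp
    | succ j ih =>
      intro t
      push_cast at ih ⊢
      rw [mul_add, mul_one, ← add_assoc, hper, ih]; ring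
    | pred j ih =>
      intro t
      have := hper (t + p * (-(j : ℝ) - 1))
      push_cast at ih ⊢
      rw [show t + p * (-(j : ℝ) - 1) + p = t + p * (-j) by ring, ih] at this
      linarith
  obtain ⟨m', i', h3⟩ := base (k' % p) (Int.emod_nonneg _ (by omega)) (Int.emod_lt_of_pos _ (by omega))
  have hk : (k' : ℝ) = ((k' % p : ℤ) : ℝ) + p * ((k' / p : ℤ) : ℝ) := by
    have := Int.emod_add_mul_ediv k' p
    exact_mod_cast this.symm
  -- A cell is no longer than the period, so an integer translation moves it by a whole number of
  -- its lengths and keeps it standard.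
  have hm : m' ≤ 0 := by
    have e1 := h3 _ (left_mem_Icc.2 (by linarith))
    have e2 := h3 _ (right_mem_Icc.2 (by linarith))
    have e3 := (L1 * M).monotone
      (show ((k' % p : ℤ) : ℝ) + 1 ≤ ((k' % p : ℤ) : ℝ) + p by linarith)
    rw [hper, e1, e2] at e3
    have : (2 : ℝ) ^ m' ≤ 2 ^ (0 : ℤ) := by rw [zpow_zero]; linarith
    exact (zpow_le_zpow_iff_right₀ (by norm_num : (1 : ℝ) < 2)).1 this
  obtain ⟨q, hq⟩ : ∃ q : ℕ, m' = -q := ⟨(-m').toNat, by omega⟩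
  have hq1 : (2 : ℝ) ^ m' * 2 ^ q = 1 := by
    rw [hq, ← zpow_natCast, ← zpow_add₀ (by norm_num)]; simp
  refine ⟨m', i' + 2 ^ q * (k' / p), fun t ht => ?_⟩
  have e := h3 (t - p * ((k' / p : ℤ) : ℝ)) (by constructor <;> linarith [ht.1, ht.2])
  have e2 := zper (k' / p) (t - p * ((k' / p : ℤ) : ℝ))
  rw [sub_add_cancel, e] at e2
  rw [e2]
  push_cast at hk ⊢
  linear_combination (-((k' / p : ℤ) : ℝ)) * hq1 + 2 ^ m' * hk

/-- Induction on the number of cells: merging siblings brings both maps down to `p` cells, and the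
rotations used become conjugates of powers of `trans1`, covered by `conj_mem`. -/
theorem IsCellMap.mul_inv_mem {n : ℕ} (hn : 0 < n) : ∀ {L L' : ℝ ≃o ℝ}, IsCellMap n L →
    IsCellMap n L' → L' * L⁻¹ ∈ Subgroup.closure rootSet := by
  induction n, hn using Nat.le_induction with
  | base =>
    intro L L' h h'
    have ht : trans1 ∈ Subgroup.closure rootSet :=
      Subgroup.subset_closure ⟨trans1_mem_perSub, 1, one_pos, pow_one _⟩
    obtain ⟨j, rfl⟩ := isCellMap_one h
    obtain ⟨j', rfl⟩ := isCellMap_one h'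
    exact mul_mem (Subgroup.zpow_mem _ ht _) (inv_mem (Subgroup.zpow_mem _ ht _))
  | succ p hp ih =>
    intro L L' h h'
    obtain ⟨M, hM, M1, M2, M3⟩ := exists_merge p hp
    obtain ⟨j, hj⟩ := h.exists_reduce hp hM M1 M2 M3
    obtain ⟨j', hj'⟩ := h'.exists_reduce hp hM M1 M2 M3
    have e : L' * L⁻¹ = (L' * trans1 ^ (-j') * L'⁻¹) *
        ((L' * trans1 ^ j' * M) * (L * trans1 ^ j * M)⁻¹) * (L * trans1 ^ j * L⁻¹) := by
      group
    rw [e]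
    exact mul_mem (mul_mem (h'.conj_mem (by omega) _) (ih hj hj')) (h.conj_mem (by omega) _)

/-- Locally the map is affine on either side of a dyadic point. A fine grid contains that point, so
no cell straddles the break, and the dyadic constants become multiples of the cell length.
Compactness of `[0, 1]` makes the scale uniform. -/
theorem exists_fine_cells {g : ℝ ≃o ℝ} (hg : g ∈ plSub) : ∃ M₀ : ℤ, ∀ M ≥ M₀, ∀ k : ℤ,
    k * (2 : ℝ) ^ (-M) ∈ Icc (0 : ℝ) 1 →
    ∃ m i : ℤ, ∀ t ∈ Icc (k : ℝ) (k + 1), g (t * 2 ^ (-M)) = 2 ^ m * (i + (t - k)) := by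
  have two_ne : (2 : ℝ) ≠ 0 := by norm_num
  have small : ∀ ε > (0 : ℝ), ∃ N : ℤ, ∀ M ≥ N, (2 : ℝ) ^ (-M) < ε := by
    intro ε hε
    obtain ⟨k, hk⟩ := exists_pow_lt_of_lt_one hε (show (2 : ℝ)⁻¹ < 1 by norm_num)
    refine ⟨k, fun M hM => lt_of_le_of_lt ?_ hk⟩
    rw [inv_pow, ← zpow_natCast, ← zpow_neg]
    exact zpow_le_zpow_right₀ (by norm_num) (by omega)
  -- affine pieces are good on fine cells
  have good : ∀ (n : ℤ) (c : ℝ), c ∈ dyadic → ∃ N : ℤ, ∀ M ≥ N, ∀ k : ℤ,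
      ∃ m i : ℤ, ∀ t : ℝ, (2 : ℝ) ^ n * (t * 2 ^ (-M)) + c = 2 ^ m * (i + (t - k)) := by
    intro n c hc
    obtain ⟨N, hN⟩ := dyadic_scale hc
    refine ⟨N + n, fun M hM k => ?_⟩
    obtain ⟨i, hi⟩ := hN (M - n) (by linarith)
    refine ⟨n - M, i + k, fun t => ?_⟩
    push_cast
    have e : (2 : ℝ) ^ (n - M) * 2 ^ (M - n) = 1 := by rw [← zpow_add₀ two_ne]; simp
    have e2 : (2 : ℝ) ^ (n - M) = 2 ^ n * 2 ^ (-M) := by rw [sub_eq_add_neg, zpow_add₀ two_ne]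
    rw [← hi]
    linear_combination (-c) * e - t * e2
  refine isCompact_Icc.induction_on (p := fun s => ∃ M₀ : ℤ, ∀ M ≥ M₀, ∀ k : ℤ,
    k * (2 : ℝ) ^ (-M) ∈ s →
    ∃ m i : ℤ, ∀ t ∈ Icc (k : ℝ) (k + 1), g (t * 2 ^ (-M)) = 2 ^ m * (i + (t - k)))
    ⟨0, by simp⟩ ?_ ?_ ?_
  · rintro s t hst ⟨M₀, h⟩
    exact ⟨M₀, fun M hM k hk => h M hM k (hst hk)⟩
  · rintro s t ⟨M₀, h⟩ ⟨M₁, h'⟩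
    refine ⟨max M₀ M₁, fun M hM k hk => ?_⟩
    rcases hk with hk | hk
    · exact h M (le_trans (le_max_left _ _) hM) k hk
    · exact h' M (le_trans (le_max_right _ _) hM) k hk
  · intro x _
    have hx := hg x
    rcases hx.2 with ⟨n, c, hc, h1⟩ | hxd
    · obtain ⟨ε, hε, h2⟩ := exists_Ioo_of_eventually h1
      obtain ⟨N1, hN1⟩ := small (ε / 2) (by linarith)
      obtain ⟨N2, hN2⟩ := good n c hc
      refine ⟨Ioo (x - ε / 2) (x + ε / 2),
        nhdsWithin_le_nhds (Ioo_mem_nhds (by linarith) (by linarith)), max N1 N2, fun M hM k hk => ?_⟩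
      have s1 := hN1 M (le_trans (le_max_left _ _) hM)
      have s0 : (0 : ℝ) < 2 ^ (-M) := by positivity
      obtain ⟨m, i, h3⟩ := hN2 M (le_trans (le_max_right _ _) hM) k
      refine ⟨m, i, fun t ht => ?_⟩
      rw [← h3]
      apply h2
      rw [abs_lt]
      constructor <;> nlinarith [ht.1, ht.2, hk.1, hk.2]
    · obtain ⟨ε, hε, ⟨n, c, hc, h1⟩, ⟨n', c', hc', h1'⟩⟩ := hx.sides g.continuous.continuousAt
      obtain ⟨N1, hN1⟩ := small (ε / 2) (by linarith)
      obtain ⟨N2, hN2⟩ := good n c hc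
      obtain ⟨N3, hN3⟩ := good n' c' hc'
      obtain ⟨N4, hN4⟩ := dyadic_scale hxd
      refine ⟨Ioo (x - ε / 2) (x + ε / 2), nhdsWithin_le_nhds (Ioo_mem_nhds (by linarith)
        (by linarith)), max (max N1 N2) (max N3 N4), fun M hM k hk => ?_⟩
      have s1 := hN1 M (le_trans ((le_max_left _ _).trans (le_max_left _ _)) hM)
      have s0 : (0 : ℝ) < 2 ^ (-M) := by positivity
      obtain ⟨q, hq⟩ := hN4 M (le_trans ((le_max_right _ _).trans (le_max_right _ _)) hM)
      have hxq : x = q * 2 ^ (-M) := by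
        rw [← hq, mul_assoc, ← zpow_add₀ two_ne]; simp
      rcases le_or_gt q k with hqk | hqk
      · have hqk' : (q : ℝ) ≤ k := by exact_mod_cast hqk
        obtain ⟨m, i, h3⟩ := hN2 M (le_trans ((le_max_right _ _).trans (le_max_left _ _)) hM) k
        refine ⟨m, i, fun t ht => ?_⟩
        rw [← h3]
        apply h1
        constructor
        · rw [hxq]
          have := ht.1
          gcongr
          linarith
        · nlinarith [ht.1, ht.2, hk.1, hk.2]
      · have hqk' : (k : ℝ) + 1 ≤ q := by exact_mod_cast hqk
        obtain ⟨m, i, h3⟩ := hN3 M (le_trans ((le_max_left _ _).trans (le_max_right _ _)) hM) k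
        refine ⟨m, i, fun t ht => ?_⟩
        rw [← h3]
        apply h1'
        constructor
        · nlinarith [ht.1, ht.2, hk.1, hk.2]
        · rw [hxq]
          have := ht.2
          gcongr
          linarith

/-- The lifts of Thompson's group `T` are generated by the roots of the translation by one. -/
theorem perSub_le_closure : perSub ≤ Subgroup.closure rootSet := by
  rintro g ⟨hg, hper⟩
  have two_ne : (2 : ℝ) ≠ 0 := by norm_num
  obtain ⟨M₀, h⟩ := exists_fine_cells hg
  obtain ⟨M, hM⟩ : ∃ M : ℕ, M₀ ≤ M := ⟨M₀.toNat, Int.self_le_toNat _⟩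
  have hMM : (2 : ℝ) ^ (-(M : ℤ)) * 2 ^ M = 1 := by
    rw [← zpow_natCast, ← zpow_add₀ two_ne]; simp
  have s0 : (0 : ℝ) < 2 ^ (-(M : ℤ)) := by positivity
  -- `U` cuts the period into `2 ^ M` equal cells and `g * U` has equally many, so `g = (g * U) *
  -- U⁻¹` is a quotient of two cell maps.
  set U := affIso (-(M : ℤ)) 0 with hU
  have hUa : ∀ t, U t = t * 2 ^ (-(M : ℤ)) := fun t => by rw [hU]; simp [mul_comm]
  have hUp : ∀ t, U (t + (2 ^ M : ℕ)) = U t + 1 := fun t => by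
    rw [hUa, hUa]; push_cast; linear_combination hMM
  have cU : IsCellMap (2 ^ M) U := by
    refine ⟨affIso_mem (zero_mem _), hUp, fun k => ⟨-(M : ℤ), k, fun t _ => ?_⟩⟩
    rw [hUa]; ring
  have hgz : ∀ (j : ℤ) (t : ℝ), g (t + j) = g t + j := by
    intro j
    induction j using Int.induction_on with
    | zero => intro t; simp
    | succ j ih => intro t; push_cast at ih ⊢; rw [← add_assoc, hper, ih]; ring
    | pred j ih =>
      intro t
      have := hper (t + (-(j : ℝ) - 1))
      push_cast at ih ⊢
      rw [show t + (-(j : ℝ) - 1) + 1 = t + -j by ring, ih] at this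
      linarith
  have cg : IsCellMap (2 ^ M) (g * U) := by
    refine ⟨mul_mem hg (affIso_mem (zero_mem _)), fun t => ?_, fun k => ?_⟩
    · simp only [RelIso.mul_apply]; rw [hUp, hper]
    · set p : ℤ := 2 ^ M with hp
      have hp0 : 0 < p := by positivity
      have hpr : (p : ℝ) = 2 ^ M := by rw [hp]; push_cast; rfl
      have hk : (k : ℝ) = ((k % p : ℤ) : ℝ) + p * ((k / p : ℤ) : ℝ) := by
        have := Int.emod_add_mul_ediv k p
        exact_mod_cast this.symm
      have r0 : (0 : ℝ) ≤ ((k % p : ℤ) : ℝ) := by exact_mod_cast Int.emod_nonneg k hp0.ne'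
      have r1 : ((k % p : ℤ) : ℝ) + 1 ≤ p := by exact_mod_cast Int.emod_lt_of_pos k hp0
      have hm0 : ((k % p : ℤ) : ℝ) * 2 ^ (-(M : ℤ)) ∈ Icc (0 : ℝ) 1 := by
        constructor
        · positivity
        · rw [hpr] at r1; nlinarith
      obtain ⟨m, i, h1⟩ := h M hM _ hm0
      have hm : m ≤ 0 := by
        have e1 := h1 _ (left_mem_Icc.2 (by linarith))
        have e2 := h1 _ (right_mem_Icc.2 (by linarith))
        have e3 := g.monotone (show (((k % p : ℤ) : ℝ) + 1) * 2 ^ (-(M : ℤ)) ≤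
          ((k % p : ℤ) : ℝ) * 2 ^ (-(M : ℤ)) + 1 by
            rw [hpr] at r1; nlinarith)
        rw [hper, e1, e2] at e3
        have : (2 : ℝ) ^ m ≤ 2 ^ (0 : ℤ) := by rw [zpow_zero]; linarith
        exact (zpow_le_zpow_iff_right₀ (by norm_num : (1 : ℝ) < 2)).1 this
      obtain ⟨q, hq⟩ : ∃ q : ℕ, m = -q := ⟨(-m).toNat, by omega⟩
      have hq1 : (2 : ℝ) ^ m * 2 ^ q = 1 := by
        rw [hq, ← zpow_natCast, ← zpow_add₀ (by norm_num)]; simp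
      refine ⟨m, i + 2 ^ q * (k / p), fun t ht => ?_⟩
      have e := h1 (t - p * ((k / p : ℤ) : ℝ)) (by constructor <;> linarith [ht.1, ht.2])
      have e2 := hgz (k / p) ((t - p * ((k / p : ℤ) : ℝ)) * 2 ^ (-(M : ℤ)))
      rw [e] at e2
      have e3 : (t - p * ((k / p : ℤ) : ℝ)) * 2 ^ (-(M : ℤ)) + ((k / p : ℤ) : ℝ) = U t := by
        rw [hUa, hpr]; linear_combination (-((k / p : ℤ) : ℝ)) * hMM
      rw [e3] at e2
      rw [RelIso.mul_apply, e2]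
      push_cast
      linear_combination (-((k / p : ℤ) : ℝ)) * hq1 + 2 ^ m * hk
  have := cU.mul_inv_mem (by positivity) cg
  rwa [mul_inv_cancel_right] at this

end SolenoidalThompson
namespace SolenoidalThompson

open Set Filter Topology

/-! ### Conjugation into an interval -/

section ExtendConj

variable {s : Set ℝ} (ψ : ℝ ≃o s)

open Classical in
/-- The inverse of `ψ`, extended by zero. -/
noncomputable def isoInv (y : ℝ) : ℝ := if h : y ∈ s then ψ.symm ⟨y, h⟩ else 0

theorem isoInv_apply (t : ℝ) : isoInv ψ (ψ t) = t := by
  simp [isoInv]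

theorem apply_isoInv {y : ℝ} (hy : y ∈ s) : (ψ (isoInv ψ y) : ℝ) = y := by
  simp [isoInv, hy]

theorem iso_strictMono : StrictMono fun t => (ψ t : ℝ) := fun _ _ h => ψ.strictMono h

theorem isoInv_lt {x y : ℝ} (hx : x ∈ s) (hy : y ∈ s) : isoInv ψ x < isoInv ψ y ↔ x < y := by
  rw [← (iso_strictMono ψ).lt_iff_lt]
  simp only [apply_isoInv ψ hx, apply_isoInv ψ hy]

theorem continuousAt_isoInv (hs : IsOpen s) {y : ℝ} (hy : y ∈ s) :
    ContinuousAt (isoInv ψ) y := by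
  refine continuousAt_of_monotoneOn_of_image_mem_nhds (s := s) ?_ (hs.mem_nhds hy) ?_
  · intro a ha b hb hab
    rcases hab.eq_or_lt with rfl | h
    · exact le_rfl
    · exact ((isoInv_lt ψ ha hb).2 h).le
  · have : isoInv ψ '' s = univ := eq_univ_of_forall fun t => ⟨ψ t, (ψ t).2, isoInv_apply ψ t⟩
    rw [this]; exact univ_mem

theorem LocallyDyadicAffineAt.of_leftInverse {f k : ℝ → ℝ} (h : ∀ y, k (f y) = y) {x : ℝ}
    (hf : LocallyDyadicAffineAt f x) : LocallyDyadicAffineAt k (f x) := by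
  obtain ⟨n, b, hb, h1⟩ := hf
  have e : (2 : ℝ) ^ n * 2 ^ (-n) = 1 := by rw [← zpow_add₀ (by norm_num)]; simp
  refine ⟨-n, -(2 ^ (-n) * b), neg_mem (mul_mem (zpow_mem _) hb), ?_⟩
  have hc : Tendsto (fun w : ℝ => 2 ^ (-n) * (w - b)) (𝓝 (f x)) (𝓝 x) := by
    have : Continuous fun w : ℝ => (2 : ℝ) ^ (-n) * (w - b) := by fun_prop
    have h2 := this.tendsto (f x)
    rw [h1.self_of_nhds] at h2 ⊢
    have e2 : (2 : ℝ) ^ (-n) * (2 ^ n * x + b - b) = x := by linear_combination x * e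
    rwa [e2] at h2
  filter_upwards [hc.eventually h1] with w hw
  have := h (2 ^ (-n) * (w - b))
  rw [hw, show (2 : ℝ) ^ n * (2 ^ (-n) * (w - b)) + b = w by linear_combination (w - b) * e] at this
  rw [this]; ring

theorem plAt_isoInv (hs : IsOpen s) (hψ : ∀ t, PLAt (fun t => (ψ t : ℝ)) t) (t : ℝ) :
    PLAt (isoInv ψ) (ψ t) := by
  have hc := continuousAt_isoInv ψ hs (ψ t).2
  rw [ContinuousAt, isoInv_apply] at hc
  have t1 : Tendsto (isoInv ψ) (𝓝[≠] (ψ t : ℝ)) (𝓝[≠] t) := by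
    refine tendsto_nhdsWithin_iff.2 ⟨hc.mono_left nhdsWithin_le_nhds, ?_⟩
    filter_upwards [self_mem_nhdsWithin, nhdsWithin_le_nhds (hs.mem_nhds (ψ t).2)] with y hne hy h
    rw [mem_singleton_iff] at h
    exact hne (by rw [mem_singleton_iff, ← h, apply_isoInv ψ hy])
  have hcψ : Continuous fun t => (ψ t : ℝ) := by
    rw [continuous_iff_continuousAt]
    intro t
    refine continuousAt_of_monotoneOn_of_image_mem_nhds (s := univ)
      ((iso_strictMono ψ).monotone.monotoneOn _) univ_mem ?_
    have : (fun t => (ψ t : ℝ)) '' univ = s := by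
      ext y
      exact ⟨by rintro ⟨z, -, rfl⟩; exact (ψ z).2, fun h => ⟨_, trivial, apply_isoInv ψ h⟩⟩
    rw [this]; exact hs.mem_nhds (ψ t).2
  have h := hψ t
  refine ⟨?_, h.2.imp (fun h1 => LocallyDyadicAffineAt.of_leftInverse (isoInv_apply ψ) h1)
    fun h1 => h.mem_iff hcψ.continuousAt h1⟩
  filter_upwards [t1.eventually h.1, nhdsWithin_le_nhds (hs.mem_nhds (ψ t).2)] with y h1 hy
  have := LocallyDyadicAffineAt.of_leftInverse (isoInv_apply ψ) h1
  rwa [apply_isoInv ψ hy] at this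

open Classical in
/-- The homeomorphism equal to `ψ g ψ⁻¹` on `s` and to the identity off `s`. -/
noncomputable def extendFun (g : ℝ ≃o ℝ) (y : ℝ) : ℝ := if y ∈ s then ψ (g (isoInv ψ y)) else y

theorem extendFun_of_mem (g : ℝ ≃o ℝ) {y : ℝ} (hy : y ∈ s) :
    extendFun ψ g y = ψ (g (isoInv ψ y)) := if_pos hy

theorem extendFun_of_notMem (g : ℝ ≃o ℝ) {y : ℝ} (hy : y ∉ s) : extendFun ψ g y = y := if_neg hy

theorem extendFun_mul (g h : ℝ ≃o ℝ) (y : ℝ) :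
    extendFun ψ (g * h) y = extendFun ψ g (extendFun ψ h y) := by
  by_cases hy : y ∈ s
  · rw [extendFun_of_mem ψ h hy, extendFun_of_mem ψ _ hy, extendFun_of_mem ψ g (ψ _).2,
      isoInv_apply]
    rfl
  · simp only [extendFun_of_notMem ψ _ hy]

theorem extendFun_one (y : ℝ) : extendFun ψ 1 y = y := by
  by_cases hy : y ∈ s
  · rw [extendFun_of_mem ψ _ hy]; exact apply_isoInv ψ hy
  · exact extendFun_of_notMem ψ _ hy

/-- The homeomorphism `ψ⁻¹ f ψ` for `f` preserving `s`. -/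
noncomputable def restrictConj (f : ℝ ≃o ℝ) (hf : ∀ y, f y ∈ s ↔ y ∈ s) : ℝ ≃o ℝ where
  toFun t := ψ.symm ⟨f (ψ t), (hf _).2 (ψ t).2⟩
  invFun t := ψ.symm ⟨f.symm (ψ t), by rw [← hf]; simp⟩
  left_inv t := by simp
  right_inv t := by simp
  map_rel_iff' {a b} := by simp

theorem restrictConj_apply (f : ℝ ≃o ℝ) (hf : ∀ y, f y ∈ s ↔ y ∈ s) (t : ℝ) :
    (ψ (restrictConj ψ f hf t) : ℝ) = f (ψ t) := by simp [restrictConj]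

variable [hs : s.OrdConnected]

theorem extendFun_monotone (g : ℝ ≃o ℝ) : Monotone (extendFun ψ g) := by
  intro a b hab
  have key : ∀ y ∈ s, extendFun ψ g y ∈ s := fun y hy => by
    rw [extendFun_of_mem ψ _ hy]; exact (ψ _).2
  by_cases ha : a ∈ s <;> by_cases hb : b ∈ s
  · rcases hab.eq_or_lt with rfl | h
    · exact le_rfl
    · rw [extendFun_of_mem ψ _ ha, extendFun_of_mem ψ _ hb]
      exact (iso_strictMono ψ (g.strictMono ((isoInv_lt ψ ha hb).2 h))).le
  · rw [extendFun_of_notMem ψ _ hb]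
    by_contra h
    exact hb (hs.out ha (key a ha) ⟨hab, (not_le.1 h).le⟩)
  · rw [extendFun_of_notMem ψ _ ha]
    by_contra h
    exact ha (hs.out (key b hb) hb ⟨(not_le.1 h).le, hab⟩)
  · rwa [extendFun_of_notMem ψ _ ha, extendFun_of_notMem ψ _ hb]

/-- Conjugation by `ψ`, extended by the identity, as a homomorphism. -/
noncomputable def extendConj : (ℝ ≃o ℝ) →* (ℝ ≃o ℝ) where
  toFun g := Equiv.toOrderIso
    { toFun := extendFun ψ g
      invFun := extendFun ψ g⁻¹
      left_inv := fun y => by rw [← extendFun_mul, inv_mul_cancel, extendFun_one]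
      right_inv := fun y => by rw [← extendFun_mul, mul_inv_cancel, extendFun_one] }
    (extendFun_monotone ψ g) (extendFun_monotone ψ g⁻¹)
  map_one' := by ext y; exact extendFun_one ψ y
  map_mul' g h := by ext y; exact extendFun_mul ψ g h y

theorem extendConj_apply (g : ℝ ≃o ℝ) (t : ℝ) : extendConj ψ g (ψ t) = ψ (g t) := by
  change extendFun ψ g (ψ t) = _
  rw [extendFun_of_mem ψ _ (ψ t).2, isoInv_apply]

theorem extendConj_mem_fixOff (g : ℝ ≃o ℝ) : extendConj ψ g ∈ fixOff s :=
  fun _ hy => extendFun_of_notMem ψ g hy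

theorem extendConj_plAt (hso : IsOpen s) (hψ : ∀ t, PLAt (fun t => (ψ t : ℝ)) t) {g : ℝ ≃o ℝ}
    (hg : g ∈ plSub) {y : ℝ} (hy : y ∈ s) : PLAt (extendConj ψ g) y := by
  obtain ⟨t, rfl⟩ : ∃ t, (ψ t : ℝ) = y := ⟨_, apply_isoInv ψ hy⟩
  have hcψ : ∀ t, ContinuousAt (fun t => (ψ t : ℝ)) t := by
    intro t
    refine continuousAt_of_monotoneOn_of_image_mem_nhds (s := univ)
      ((iso_strictMono ψ).monotone.monotoneOn _) univ_mem ?_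
    have : (fun t => (ψ t : ℝ)) '' univ = s := by
      ext y
      exact ⟨by rintro ⟨z, -, rfl⟩; exact (ψ z).2, fun h => ⟨_, trivial, apply_isoInv ψ h⟩⟩
    rw [this]; exact hso.mem_nhds (ψ t).2
  have h1 : PLAt (fun t => (ψ (g t) : ℝ)) t :=
    PLAt.comp (f := g) (g := fun t => (ψ t : ℝ)) (hψ _) (hg t) g.continuous g.injective
  have h2 := plAt_isoInv ψ hso hψ t
  have hci : ∀ y ∈ s, ContinuousAt (isoInv ψ) y := fun y hy => continuousAt_isoInv ψ hso hy
  have h1' : PLAt (fun t => (ψ (g t) : ℝ)) (isoInv ψ (ψ t)) := by rwa [isoInv_apply]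
  have h3 : PLAt (fun y => (ψ (g (isoInv ψ y)) : ℝ)) (ψ t) := by
    refine ⟨?_, ?_⟩
    · have hc := hci _ (ψ t).2
      have t1 : Tendsto (isoInv ψ) (𝓝[≠] (ψ t : ℝ)) (𝓝[≠] (isoInv ψ (ψ t))) := by
        refine tendsto_nhdsWithin_iff.2 ⟨hc.mono_left nhdsWithin_le_nhds, ?_⟩
        filter_upwards [self_mem_nhdsWithin, nhdsWithin_le_nhds (hso.mem_nhds (ψ t).2)]
          with y hne hy h
        rw [isoInv_apply, mem_singleton_iff] at h
        exact hne (by rw [mem_singleton_iff, ← h, apply_isoInv ψ hy])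
      filter_upwards [h2.1, t1.eventually h1'.1, nhdsWithin_le_nhds (hso.mem_nhds (ψ t).2)]
        with y a1 a2 hy
      exact LocallyDyadicAffineAt.comp (f := isoInv ψ) a2 a1 (hci y hy)
    · rcases h2.2 with a1 | a1
      · rcases h1'.2 with a2 | a2
        · exact Or.inl (LocallyDyadicAffineAt.comp (f := isoInv ψ) a2 a1 (hci _ (ψ t).2))
        · exact Or.inr (a1.mem_iff.1 a2)
      · exact Or.inr a1
  refine h3.congr ?_
  filter_upwards [hso.mem_nhds (ψ t).2] with y hy using extendFun_of_mem ψ g hy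

end ExtendConj

/-! ### The dyadic logarithm -/

/-- The piecewise linear interpolation of `2 ^ n` at integers. -/
noncomputable def pexp (t : ℝ) : ℝ := 2 ^ ⌊t⌋ * (1 + Int.fract t)

theorem pexp_of_mem {t : ℝ} (j : ℤ) (h : t ∈ Icc (j : ℝ) (j + 1)) :
    pexp t = 2 ^ j * (1 + (t - j)) := by
  rcases h.2.eq_or_lt with rfl | h1
  · have e : ⌊(j : ℝ) + 1⌋ = j + 1 := by simp
    rw [pexp, Int.fract, e, zpow_add₀ (by norm_num)]
    push_cast
    rw [zpow_one]; ring
  · have e : ⌊t⌋ = j := Int.floor_eq_iff.2 ⟨h.1, h1⟩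
    rw [pexp, Int.fract, e]

theorem pexp_pos (t : ℝ) : 0 < pexp t := by
  have := Int.fract_nonneg t
  unfold pexp; positivity

/-- The purpose of `pexp`: the unit translation becomes the doubling, so homeomorphisms commuting
with the former yield germs commuting with the latter. -/
theorem pexp_add_one (t : ℝ) : pexp (t + 1) = 2 * pexp t := by
  rw [pexp, pexp, Int.floor_add_one, Int.fract_add_one, zpow_add₀ (by norm_num)]
  simp; ring

theorem pexp_strictMono : StrictMono pexp := by
  intro s t hst
  have h1 := Int.floor_mono hst.le
  rcases h1.eq_or_lt with h2 | h2
  · rw [pexp, pexp, Int.fract, Int.fract, h2]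
    have : (0 : ℝ) < 2 ^ ⌊t⌋ := by positivity
    gcongr
  · have h3 : (2 : ℝ) ^ (⌊s⌋ + 1) ≤ 2 ^ ⌊t⌋ := zpow_le_zpow_right₀ (by norm_num) (by omega)
    rw [zpow_add₀ (by norm_num), zpow_one] at h3
    have h4 := Int.fract_lt_one s
    have h5 := Int.fract_nonneg t
    have h6 : (0 : ℝ) < 2 ^ ⌊s⌋ := by positivity
    have h7 : (0 : ℝ) < 2 ^ ⌊t⌋ := by positivity
    rw [pexp, pexp]
    nlinarith

theorem range_pexp : range pexp = Ioi 0 := by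
  ext y
  refine ⟨by rintro ⟨t, rfl⟩; exact pexp_pos t, fun hy => ?_⟩
  obtain ⟨k, h1, h2⟩ := exists_zpow_near (show 0 < y from hy)
  have hk : (0 : ℝ) < 2 ^ k := by positivity
  have e : (2 : ℝ) ^ k * 2 ^ (-k) = 1 := by rw [← zpow_add₀ (by norm_num)]; simp
  rw [zpow_add₀ (by norm_num), zpow_one] at h2
  have e1 : 2 ^ k * (y * 2 ^ (-k)) = y := by linear_combination y * e
  have b1 : 1 ≤ y * 2 ^ (-k) := by
    refine le_of_mul_le_mul_left ?_ hk; rw [e1]; linarith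
  have b2 : y * 2 ^ (-k) < 2 := by
    refine lt_of_mul_lt_mul_left ?_ hk.le; rw [e1]; linarith
  refine ⟨k + (y * 2 ^ (-k) - 1), ?_⟩
  rw [pexp_of_mem k (by constructor <;> linarith)]
  linear_combination y * e

theorem plAt_pexp (t : ℝ) : PLAt pexp t := by
  have aff : ∀ j : ℤ, PLAt (fun s : ℝ => 2 ^ j * (1 + (s - j))) t := fun j =>
    (locallyDyadicAffineAt_of_eq (n := j) (b := 2 ^ j * (1 - j))
      (mul_mem (zpow_mem _) (sub_mem (one_mem _) (intCast_mem _ _)))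
      (fun y => by ring) t).plAt
  have h1 := Int.floor_le t
  have h2 := Int.lt_floor_add_one t
  rcases h1.eq_or_lt with h3 | h3
  · refine PLAt.of_sides (by rw [← h3]; exact intCast_mem _ _) (aff (⌊t⌋ - 1)) (aff ⌊t⌋) ?_ ?_
    · filter_upwards [Ioo_mem_nhdsLT (show t - 1 < t by linarith)] with y hy
      exact pexp_of_mem _ (by push_cast; constructor <;> linarith [hy.1, hy.2])
    · filter_upwards [Ioo_mem_nhdsGT (show t < t + 1 by linarith)] with y hy
      exact pexp_of_mem _ (by constructor <;> linarith [hy.1, hy.2])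
  · refine (aff ⌊t⌋).congr ?_
    filter_upwards [Ioo_mem_nhds h3 h2] with y hy
    exact pexp_of_mem _ (Ioo_subset_Icc_self hy)

/-- `pexp` as an order isomorphism onto the positive half-line. -/
noncomputable def pexpIso : ℝ ≃o Ioi (0 : ℝ) :=
  (pexp_strictMono.orderIso).trans (OrderIso.setCongr _ _ range_pexp)

@[simp] theorem pexpIso_apply (t : ℝ) : (pexpIso t : ℝ) = pexp t := rfl

/-! ### Reflection -/

theorem LocallyDyadicAffineAt.reflect {f : ℝ → ℝ} {x : ℝ} (h : LocallyDyadicAffineAt f (-x)) :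
    LocallyDyadicAffineAt (fun y => -f (-y)) x := by
  obtain ⟨n, b, hb, h⟩ := h
  refine ⟨n, -b, neg_mem hb, ?_⟩
  filter_upwards [(continuous_neg.tendsto x).eventually h] with y hy
  rw [hy]; ring

theorem PLAt.reflect {f : ℝ → ℝ} {x : ℝ} (h : PLAt f (-x)) : PLAt (fun y => -f (-y)) x := by
  refine ⟨?_, h.2.imp (fun h1 => h1.reflect) fun h1 => by simpa using neg_mem h1⟩
  filter_upwards [(tendsto_nhdsNE_of_injective continuous_neg neg_injective x).eventually h.1]
    with y hy using hy.reflect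

/-- Conjugation by `t ↦ -t`. -/
def reflectHom : (ℝ ≃o ℝ) →* (ℝ ≃o ℝ) where
  toFun f :=
    { toFun := fun t => -f (-t)
      invFun := fun t => -f.symm (-t)
      left_inv := fun t => by simp
      right_inv := fun t => by simp
      map_rel_iff' := fun {a b} => by simp }
  map_one' := by ext; simp
  map_mul' f g := by ext; simp

@[simp] theorem reflectHom_apply (f : ℝ ≃o ℝ) (t : ℝ) : reflectHom f t = -f (-t) := rfl

theorem reflectHom_mem_plSub {f : ℝ ≃o ℝ} (hf : f ∈ plSub) : reflectHom f ∈ plSub :=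
  fun _ => PLAt.reflect (hf _)

theorem reflectHom_mem_dSub {f : ℝ ≃o ℝ} (hf : f ∈ dSub) : reflectHom f ∈ dSub := by
  intro x
  obtain ⟨h1, h2, h3⟩ := (hf (-x)).plAt_or
  refine DAt.intro _ ?_ (h2.imp PLAt.reflect fun h => ⟨by simpa using neg_mem h, ?_⟩)
  · filter_upwards [(tendsto_nhdsNE_of_injective continuous_neg neg_injective x).eventually h1]
      with y hy using hy.reflect
  · filter_upwards [(continuous_neg.tendsto x).eventually h3] with y hy
    simp only [reflectHom_apply]
    have e : -doubling x y = doubling (-x) (-y) := by unfold doubling; ring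
    rw [e, hy]
    unfold doubling; ring

theorem reflectHom_mem_fixOff {f : ℝ ≃o ℝ} {a b : ℝ} (hf : f ∈ fixOff (Ioo a b)) :
    reflectHom f ∈ fixOff (Ioo (-b) (-a)) := by
  intro x hx
  rw [reflectHom_apply, hf (-x) fun h => hx ⟨by linarith [h.2], by linarith [h.1]⟩, neg_neg]

theorem reflectHom_mem_cptSub {f : ℝ ≃o ℝ} {u v : ℝ} (hf : f ∈ cptSub u v) :
    reflectHom f ∈ cptSub (-v) (-u) := by
  obtain ⟨α, hα, β, hβ, h⟩ := hf
  exact ⟨-β, by linarith, -α, by linarith, reflectHom_mem_fixOff h⟩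

end SolenoidalThompson
namespace SolenoidalThompson

open Set Filter Topology

/-! ### Germs at a fixed point -/

theorem tendsto_nhdsGT_of_fixed {f : ℝ ≃o ℝ} {x : ℝ} (hx : f x = x) :
    Tendsto f (𝓝[>] x) (𝓝[>] x) := by
  refine tendsto_nhdsWithin_iff.2 ⟨?_, ?_⟩
  · have := f.continuous.tendsto x
    rw [hx] at this
    exact this.mono_left nhdsWithin_le_nhds
  · filter_upwards [self_mem_nhdsWithin] with y hy
    have := f.strictMono hy
    rwa [hx] at this

/-- Pairs of homeomorphisms fixing `x` with the same germ on the right of `x`. -/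
def germPairs (x : ℝ) : Subgroup ((ℝ ≃o ℝ) × (ℝ ≃o ℝ)) where
  carrier := {p | p.1 x = x ∧ p.2 x = x ∧ ∀ᶠ y in 𝓝[>] x, p.1 y = p.2 y}
  mul_mem' := by
    rintro ⟨a, b⟩ ⟨c, d⟩ ⟨h1, h2, h3⟩ ⟨h1', h2', h3'⟩
    refine ⟨?_, ?_, ?_⟩
    · exact (congrArg a h1').trans h1
    · exact (congrArg b h2').trans h2
    · filter_upwards [h3', (tendsto_nhdsGT_of_fixed h2').eventually h3] with y e1 e2
      exact (congrArg a e1).trans e2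
  one_mem' := ⟨rfl, rfl, Eventually.of_forall fun _ => rfl⟩
  inv_mem' := by
    rintro ⟨a, b⟩ ⟨h1, h2, h3⟩
    have i1 : a⁻¹ x = x := by
      apply a.injective
      rw [← RelIso.mul_apply, mul_inv_cancel]; exact h1.symm
    have i2 : b⁻¹ x = x := by
      apply b.injective
      rw [← RelIso.mul_apply, mul_inv_cancel]; exact h2.symm
    refine ⟨i1, i2, ?_⟩
    filter_upwards [(tendsto_nhdsGT_of_fixed i2).eventually h3] with y e1
    change a⁻¹ y = b⁻¹ y
    apply a.injective
    have e2 : a (b⁻¹ y) = b (b⁻¹ y) := e1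
    have e3 : a (a⁻¹ y) = y := a.apply_symm_apply y
    rw [e2, e3]
    exact (b.apply_symm_apply y).symm

/-- Homeomorphisms that fix `x` and all points near `x` on its left, and are piecewise linear off
`x`. -/
def rightSub (u v x : ℝ) : Subgroup (ℝ ≃o ℝ) where
  carrier := {e | e ∈ Dc u v ∧ e x = x ∧ (∀ t ≠ x, PLAt e t) ∧ ∃ y < x, ∀ t ∈ Icc y x, e t = t}
  mul_mem' := by
    rintro a b ⟨h1, h2, h3, y, hy, h4⟩ ⟨h1', h2', h3', y', hy', h4'⟩
    refine ⟨mul_mem h1 h1', (congrArg a h2').trans h2, fun t ht => ?_, max y y', max_lt hy hy',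
      fun t ht => ?_⟩
    · refine PLAt.comp (f := b) (h3 _ fun h => ht ?_) (h3' t ht) b.continuous b.injective
      exact b.injective (h.trans h2'.symm)
    · rw [RelIso.mul_apply, h4' t ⟨(le_max_right _ _).trans ht.1, ht.2⟩,
        h4 t ⟨(le_max_left _ _).trans ht.1, ht.2⟩]
  one_mem' := ⟨one_mem _, rfl, fun t _ => plAt_id t, x - 1, by linarith, fun _ _ => rfl⟩
  inv_mem' := by
    rintro a ⟨h1, h2, h3, y, hy, h4⟩
    have inv : ∀ t, a t = t → a⁻¹ t = t := fun t ht => by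
      apply a.injective
      rw [← RelIso.mul_apply, mul_inv_cancel]; exact ht.symm
    refine ⟨inv_mem h1, inv x h2, fun t ht => ?_, y, hy, fun t ht => inv t (h4 t ht)⟩
    have e : a (a⁻¹ t) = t := a.apply_symm_apply t
    have := (h3 (a⁻¹ t) fun h => ht (by rw [← e, h, h2])).symm
    rwa [e] at this

/-- The homeomorphism of `(x, ∞)` corresponding to `c` under the dyadic logarithm. -/
noncomputable def germMap (x : ℝ) : (ℝ ≃o ℝ) →* (ℝ ≃o ℝ) :=
  (MulAut.conj (affIso 0 x)).toMonoidHom.comp (extendConj pexpIso)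

theorem germMap_apply (x : ℝ) (c : ℝ ≃o ℝ) (y : ℝ) :
    germMap x c y = x + extendConj pexpIso c (y - x) := by
  have : (affIso 0 x)⁻¹ y = y - x := by rw [affIso_inv_apply]; simp
  change affIso 0 x (extendConj pexpIso c ((affIso 0 x)⁻¹ y)) = _
  rw [this, affIso_apply]; simp [add_comm]

theorem germMap_of_le (x : ℝ) (c : ℝ ≃o ℝ) {y : ℝ} (hy : y ≤ x) : germMap x c y = y := by
  rw [germMap_apply, extendConj_mem_fixOff pexpIso c _ (by simpa using hy)]; ring

/-- The right-hand side is the doubling about `x`. Hence every root of `trans1` gives a germ with a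
piecewise linear power. -/
theorem germMap_trans1 (x : ℝ) {y : ℝ} (hy : x < y) : germMap x trans1 y = affIso 1 (-x) y := by
  obtain ⟨t, ht⟩ : ∃ t, (pexpIso t : ℝ) = y - x := ⟨_, apply_isoInv pexpIso (by simpa using hy)⟩
  rw [germMap_apply, ← ht, extendConj_apply, trans1_apply, pexpIso_apply, pexp_add_one]
  rw [pexpIso_apply] at ht
  rw [ht]; simp; ring

theorem plAt_pexpIso (t : ℝ) : PLAt (fun t => (pexpIso t : ℝ)) t := plAt_pexp t

theorem germMap_plAt {x : ℝ} (hx : x ∈ dyadic) {c : ℝ ≃o ℝ} (hc : c ∈ plSub) {y : ℝ}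
    (hy : y ≠ x) : PLAt (germMap x c) y := by
  rcases lt_or_gt_of_ne hy with h | h
  · refine (plAt_id y).congr ?_
    filter_upwards [Iio_mem_nhds h] with z hz using germMap_of_le x c (le_of_lt hz)
  · have h1 : PLAt (extendConj pexpIso c) (y + -x) :=
      extendConj_plAt pexpIso isOpen_Ioi plAt_pexpIso hc (by simpa using h)
    refine (plAt_translate (neg_mem hx) hx h1).congr (Eventually.of_forall fun z => ?_)
    rw [germMap_apply, sub_eq_add_neg]; ring

/-- Commuting with the unit translation becomes commuting with the doubling about `x`, which is the
type `𝔇` condition at the only exceptional point. -/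
theorem germMap_mem_dSub {x : ℝ} (hx : x ∈ dyadic) {c : ℝ ≃o ℝ} (hc : c ∈ perSub) :
    germMap x c ∈ dSub := by
  intro y
  by_cases hy : y = x
  · subst hy
    refine DAt.intro _ ?_ (Or.inr ⟨hx, Eventually.of_forall fun z => ?_⟩)
    · filter_upwards [self_mem_nhdsWithin] with z hz using germMap_plAt hx hc.1 hz
    · rw [germMap_of_le y c le_rfl]
      rcases le_or_gt z y with hz | hz
      · rw [germMap_of_le y c hz, germMap_of_le y c (by unfold doubling; linarith)]
      · obtain ⟨t, ht⟩ : ∃ t, (pexpIso t : ℝ) = z - y :=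
          ⟨_, apply_isoInv pexpIso (by simpa using hz)⟩
        have ht2 : (pexpIso (t + 1) : ℝ) = doubling y z - y := by
          rw [pexpIso_apply, pexp_add_one, ← pexpIso_apply, ht]; unfold doubling; ring
        rw [germMap_apply, germMap_apply, ← ht, ← ht2, extendConj_apply, extendConj_apply, hc.2,
          pexpIso_apply, pexp_add_one, pexpIso_apply]
        unfold doubling; ring
  · exact DAt.intro _ (by
      have : {x}ᶜ ∈ 𝓝 y := isOpen_compl_singleton.mem_nhds hy
      filter_upwards [nhdsWithin_le_nhds this] with z hz using germMap_plAt hx hc.1 hz)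
      (Or.inl (germMap_plAt hx hc.1 hy))

section Root

variable {u v x : ℝ} {P : Subgroup (ℝ ≃o ℝ)}

/-- If `c ^ n = trans1`, let `e` be a compactly supported map with the germ of `germMap x c`. Its
power `e ^ n` is a doubling just to the right of `x`, hence piecewise linear and in `P`, and
root-closedness gives `e ∈ P`. Products and inverses pass through, since `rightSub` and `germPairs`
are subgroups. -/
theorem exists_right_of_perSub (hux : u < x) (hxv : x < v) (hx : x ∈ dyadic)
    (hroot : ∀ g ∈ Dc u v, ∀ n : ℕ, 0 < n → g ^ n ∈ P → g ∈ P) (hPL : PLc u v ≤ P)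
    {c : ℝ ≃o ℝ} (hc : c ∈ perSub) : ∃ e ∈ P, e ∈ rightSub u v x ∧ (e, germMap x c) ∈ germPairs x := by
  replace hc := perSub_le_closure hc
  induction hc using Subgroup.closure_induction with
  | mem c hc =>
    obtain ⟨hc, n, hn, hcn⟩ := hc
    set F := germMap x c with hF
    have hFx : F x = x := germMap_of_le x c le_rfl
    obtain ⟨a, had, ha1, ha2⟩ := exists_dyadic_between hux
    obtain ⟨x', hxd', hx1, hx2⟩ := exists_dyadic_between ha2
    obtain ⟨b, hbd, hb1, hb2⟩ := exists_dyadic_between hxv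
    have hFb : x < F.symm b := by rw [OrderIso.lt_symm_apply, hFx]; exact hb1
    obtain ⟨y, hyd, hy1, hy2⟩ := exists_dyadic_between (lt_min hb1 hFb)
    have hyb := hy2.trans_le (min_le_left _ _)
    have hFy : F y < b := by
      rw [← OrderIso.lt_symm_apply]; exact hy2.trans_le (min_le_right _ _)
    have hFx' : F x' = x' := germMap_of_le x c hx2.le
    obtain ⟨e, he, he1, he2⟩ := exists_extend (germMap_mem_dSub hx hc) had hbd hxd' hyd hx1
      (by linarith) hyb (by rw [← hF, hFx']; exact hx1) (by rw [← hF]; exact hFy)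
    rw [← hF] at he1 he2
    have hex : e x = x := by rw [he1 x ⟨hx2.le, hy1.le⟩, hFx]
    have hR : e ∈ rightSub u v x := by
      refine ⟨Dd_le_Dc ha1 hb2 he, hex, fun t ht => he2 t fun _ => germMap_plAt hx hc.1 ht, x', hx2,
        fun t ht => ?_⟩
      rw [he1 t ⟨ht.1, ht.2.trans hy1.le⟩, germMap_of_le x c ht.2]
    have hG : (e, F) ∈ germPairs x := by
      refine ⟨hex, hFx, ?_⟩
      filter_upwards [Ioo_mem_nhdsGT hy1] with t ht
      exact he1 t ⟨by linarith [ht.1], ht.2.le⟩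
    refine ⟨e, hroot e hR.1 n hn (hPL ?_), hR, hG⟩
    have hRn := pow_mem hR n
    obtain ⟨h1, h2, h3, z, hz, h4⟩ := hRn
    refine ⟨fun t => ?_, h1.2⟩
    by_cases ht : t = x
    · subst ht
      obtain ⟨-, -, h5⟩ := pow_mem hG n
      refine PLAt.of_sides (g := fun y => y) (k := affIso 1 (-t)) hx (plAt_id t)
        (affIso_mem (neg_mem hx) t) ?_ ?_
      · filter_upwards [Ioo_mem_nhdsLT hz] with y hy using h4 y (Ioo_subset_Icc_self hy)
      · filter_upwards [h5, self_mem_nhdsWithin] with y hy hy'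
        have : (e ^ n) y = (F ^ n) y := hy
        rw [this, hF, ← map_pow, hcn, germMap_trans1 t hy']
    · exact h3 t ht
  | one => exact ⟨1, one_mem _, one_mem _, by rw [map_one]; exact one_mem (germPairs x)⟩
  | mul a b _ _ ha hb =>
    obtain ⟨e, h1, h2, h3⟩ := ha
    obtain ⟨e', h1', h2', h3'⟩ := hb
    exact ⟨e * e', mul_mem h1 h1', mul_mem h2 h2', by rw [map_mul]; exact mul_mem h3 h3'⟩
  | inv a _ ha =>
    obtain ⟨e, h1, h2, h3⟩ := ha
    exact ⟨e⁻¹, inv_mem h1, inv_mem h2, by rw [map_inv]; exact inv_mem h3⟩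

theorem continuous_pexp : Continuous pexp := by
  rw [continuous_iff_continuousAt]
  intro t
  refine continuousAt_of_monotoneOn_of_image_mem_nhds (s := univ)
    (pexp_strictMono.monotone.monotoneOn _) univ_mem ?_
  rw [image_univ, range_pexp]
  exact isOpen_Ioi.mem_nhds (pexp_pos t)

theorem pexp_lt_of_pos {ε : ℝ} (hε : 0 < ε) : ∃ N : ℕ, pexp (1 - N) < ε := by
  obtain ⟨k, hk⟩ := exists_pow_lt_of_lt_one hε (show (2 : ℝ)⁻¹ < 1 by norm_num)
  refine ⟨k + 1, ?_⟩
  have := pexp_of_mem (t := 1 - ((k + 1 : ℕ) : ℝ)) (-k) (by push_cast; constructor <;> linarith)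
  rw [this]
  push_cast
  rw [zpow_neg, zpow_natCast, ← inv_pow]
  have e : (2 : ℝ)⁻¹ ^ k * (1 + (1 - ((k : ℝ) + 1) - -k)) = 2⁻¹ ^ k := by ring
  rw [e]; exact hk

/-- The right germ of an element of type `𝔇` at a fixed point comes from a periodic map. -/
theorem exists_perSub_germ (hx : x ∈ dyadic) {d : ℝ ≃o ℝ} (hd : d ∈ dSub) (hdx : d x = x) :
    ∃ c ∈ perSub, (d, germMap x c) ∈ germPairs x := by
  set δ : ℝ ≃o ℝ := (affIso 0 x)⁻¹ * d * affIso 0 x with hδ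
  have δa : ∀ y, δ y = d (x + y) - x := fun y => by
    change (affIso 0 x)⁻¹ (d (affIso 0 x y)) = _
    rw [affIso_inv_apply]; simp [add_comm]
  have δ0 : δ 0 = 0 := by rw [δa, add_zero, hdx, sub_self]
  have δd : δ ∈ dSub := mul_mem (mul_mem (inv_mem (plSub_le_dSub (affIso_mem hx))) hd)
    (plSub_le_dSub (affIso_mem hx))
  have δs : ∀ y, δ y ∈ Ioi (0 : ℝ) ↔ y ∈ Ioi (0 : ℝ) := fun y => by
    simp only [mem_Ioi]
    nth_rewrite 1 [← δ0]
    exact δ.lt_iff_lt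
  obtain ⟨p1, -, p3⟩ := (δd 0).plAt_or
  obtain ⟨ε, hε, hev⟩ := exists_Ioo_of_eventually ((eventually_nhdsWithin_iff.1 p1).and p3)
  have h2 : ∀ y, 0 < y → y < ε → PLAt δ y ∧ δ (2 * y) = 2 * δ y := fun y hy hyε => by
    obtain ⟨a, b⟩ := hev y (by rw [abs_lt]; constructor <;> linarith)
    refine ⟨a (by simpa using hy.ne'), ?_⟩
    simpa [doubling, δ0] using b
  obtain ⟨N, hN⟩ := pexp_lt_of_pos hε
  -- `δ` is `d` recentred at `0`, and `γ` is `δ` in logarithmic coordinates. The local doubling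
  -- relation makes `γ` commute with the unit translation only on the half-line `t ≤ 1 - N`.
  set γ := restrictConj pexpIso δ δs with hγ
  have γa : ∀ t, pexp (γ t) = δ (pexp t) := restrictConj_apply pexpIso δ δs
  have γ1 : ∀ t ≤ 1 - (N : ℝ), γ (t + 1) = γ t + 1 := fun t ht => by
    apply pexp_strictMono.injective
    rw [γa, pexp_add_one, (h2 _ (pexp_pos t) ((pexp_strictMono.monotone ht).trans_lt hN)).2,
      pexp_add_one, γa]
  have γn : ∀ n : ℕ, ∀ t ≤ 1 - (N : ℝ), γ (t - n) = γ t - n := by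
    intro n
    induction n with
    | zero => simp
    | succ n ih =>
      intro t ht
      have hn : (0 : ℝ) ≤ n := by positivity
      have := γ1 (t - (n + 1)) (by linarith)
      rw [show t - ((n : ℝ) + 1) + 1 = t - n by ring, ih t ht] at this
      push_cast
      linarith
  have γpl : ∀ t ≤ 1 - (N : ℝ), PLAt γ t := fun t ht => by
    have a1 := (h2 _ (pexp_pos t) ((pexp_strictMono.monotone ht).trans_lt hN)).1
    have a2 : PLAt (fun s => δ (pexp s)) t :=
      PLAt.comp a1 (plAt_pexp t) continuous_pexp pexp_strictMono.injective
    have a3 : PLAt (isoInv pexpIso) (δ (pexp t)) := by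
      rw [← γa]; exact plAt_isoInv pexpIso isOpen_Ioi plAt_pexpIso (γ t)
    have a4 := PLAt.comp (f := fun s => δ (pexp s)) a3 a2 (δ.continuous.comp continuous_pexp)
      (δ.injective.comp pexp_strictMono.injective)
    refine a4.congr (Eventually.of_forall fun s => ?_)
    rw [← γa]
    exact (isoInv_apply pexpIso (γ s)).symm
  -- Conjugation by the translation by `N` moves the period `[-N, 1 - N]` of `γ` to `[0, 1]`, where
  -- it is extended periodically.
  set f0 : ℝ ≃o ℝ := affIso 0 N * γ * affIso 0 (-N) with hf0
  have f0a : ∀ t, f0 t = γ (t - N) + N := fun t => by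
    change affIso 0 N (γ (affIso 0 (-N) t)) = _
    simp [sub_eq_add_neg]
  have hN' : (N : ℝ) ∈ dyadic := natCast_mem _ _
  have f01 : f0 1 = f0 0 + 1 := by
    rw [f0a, f0a]
    have := γ1 (0 - N) (by linarith)
    rw [show (0 : ℝ) - N + 1 = 1 - N by ring] at this
    rw [this]; ring
  refine ⟨perExt f0 one_pos f01, ⟨perExt_mem_plSub f0 one_pos f01 (one_mem _) (one_mem _)
    fun t ht => ?_, perExt_add f0 one_pos f01⟩, hdx, germMap_of_le x _ le_rfl, ?_⟩
  · have := plAt_translate (f := γ) (x := t) (neg_mem hN') hN' (γpl _ (by linarith [ht.2]))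
    refine this.congr (Eventually.of_forall fun s => ?_)
    rw [f0a, sub_eq_add_neg]
  · have hp := pexp_pos (1 - N)
    filter_upwards [Ioo_mem_nhdsGT (show x < x + pexp (1 - N) by linarith)] with y hy
    obtain ⟨t, ht⟩ : ∃ t, (pexpIso t : ℝ) = y - x :=
      ⟨_, apply_isoInv pexpIso (by simpa using hy.1)⟩
    have htN : t < 1 - N := by
      rw [← pexp_strictMono.lt_iff_lt, ← pexpIso_apply, ht]; linarith [hy.2]
    have hg : perExt f0 one_pos f01 t = γ t := by
      rw [perExt_apply, f0a]
      simp only [div_one, one_mul]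
      have h3 := Int.floor_le t
      have h4 := Int.lt_floor_add_one t
      have h5 : ⌊t⌋ + (N : ℤ) ≤ 0 := by
        have : (⌊t⌋ : ℝ) + N < 1 := by linarith
        have : ⌊t⌋ + (N : ℤ) < 1 := by exact_mod_cast this
        omega
      obtain ⟨n, hn⟩ : ∃ n : ℕ, ⌊t⌋ + (N : ℤ) = -n := ⟨(-(⌊t⌋ + (N : ℤ))).toNat, by omega⟩
      have hn' : (⌊t⌋ : ℝ) = -n - N := by
        have : ((⌊t⌋ + (N : ℤ) : ℤ) : ℝ) = ((-n : ℤ) : ℝ) := by rw [hn]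
        push_cast at this; linarith
      have := γn n (t - ⌊t⌋ - N) (by linarith)
      rw [hn'] at this ⊢
      rw [show t - (-(n : ℝ) - N) - N - n = t by ring] at this
      rw [this]; ring
    change d y = germMap x _ y
    rw [germMap_apply, ← ht, extendConj_apply, hg, pexpIso_apply, γa, δa, ← pexpIso_apply, ht]
    ring_nf

theorem exists_right (hux : u < x) (hxv : x < v) (hx : x ∈ dyadic)
    (hroot : ∀ g ∈ Dc u v, ∀ n : ℕ, 0 < n → g ^ n ∈ P → g ∈ P) (hPL : PLc u v ≤ P)
    {d : ℝ ≃o ℝ} (hd : d ∈ dSub) (hdx : d x = x) :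
    ∃ e ∈ P, e ∈ rightSub u v x ∧ ∀ᶠ y in 𝓝[>] x, e y = d y := by
  obtain ⟨c, hc, h1⟩ := exists_perSub_germ hx hd hdx
  obtain ⟨e, he, h2, h3⟩ := exists_right_of_perSub hux hxv hx hroot hPL hc
  refine ⟨e, he, h2, ?_⟩
  filter_upwards [h1.2.2, h3.2.2] with y h4 h5
  exact h5.trans h4.symm

/-- The right germ comes from `exists_right` and the left germ from the same lemma after reflection.
Near `x` each factor is the identity on the other side, so the product has both germs. -/
theorem exists_germ (hux : u < x) (hxv : x < v) (hx : x ∈ dyadic)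
    (hroot : ∀ g ∈ Dc u v, ∀ n : ℕ, 0 < n → g ^ n ∈ P → g ∈ P) (hPL : PLc u v ≤ P)
    {d : ℝ ≃o ℝ} (hd : d ∈ dSub) (hdx : d x = x) :
    ∃ e ∈ P, e ∈ Dc u v ∧ e x = x ∧ (∀ t ≠ x, PLAt e t) ∧ ∀ᶠ y in 𝓝 x, e y = d y := by
  obtain ⟨e, he, ⟨h1, h2, h3, z, hz, h4⟩, h5⟩ := exists_right hux hxv hx hroot hPL hd hdx
  have hrP : ∀ g ∈ Dc (-v) (-u), reflectHom g ∈ Dc u v := fun g hg => by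
    have := reflectHom_mem_cptSub hg.2
    rw [neg_neg, neg_neg] at this
    exact ⟨reflectHom_mem_dSub hg.1, this⟩
  obtain ⟨e', he', ⟨h1', h2', h3', z', hz', h4'⟩, h5'⟩ :=
    exists_right (P := P.comap reflectHom) (u := -v) (v := -u) (x := -x) (by linarith)
    (by linarith) (neg_mem hx) (fun g hg n hn hgn => hroot _ (hrP g hg) n hn (by
      rw [← map_pow]; exact hgn)) (fun g hg => hPL ⟨reflectHom_mem_plSub hg.1,
        (hrP g (PLc_le_Dc _ _ hg)).2⟩)
    (d := reflectHom d) (reflectHom_mem_dSub hd) (by simp [hdx])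
  have rx : reflectHom e' x = x := by simp [h2']
  refine ⟨e * reflectHom e', mul_mem he he', mul_mem h1 (hrP _ h1'), ?_, fun t ht => ?_, ?_⟩
  · rw [RelIso.mul_apply, rx, h2]
  · refine PLAt.comp (f := reflectHom e') (h3 _ fun h => ht ?_) ?_ (OrderIso.continuous _)
      (OrderIso.injective _)
    · exact (reflectHom e').injective (h.trans rx.symm)
    · exact PLAt.reflect (h3' (-t) fun h => ht (neg_injective h))
  · have hd2 : ∀ᶠ y in 𝓝 x, y < x → reflectHom e' y = d y := by
      rw [eventually_nhdsWithin_iff] at h5'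
      filter_upwards [(continuous_neg.tendsto x).eventually h5'] with y hy hyx
      have := hy (show -x < -y by linarith)
      rw [reflectHom_apply, this]; simp
    have hd1 := eventually_nhdsWithin_iff.1 h5
    have cd : Tendsto d (𝓝 x) (𝓝 x) := by
      have := d.continuous.tendsto x
      rwa [hdx] at this
    filter_upwards [hd1, hd2, cd.eventually (Ioi_mem_nhds hz),
      Iio_mem_nhds (show x < -z' by linarith)] with y a1 a2 a3 a4
    rw [RelIso.mul_apply]
    rcases lt_trichotomy y x with hy | rfl | hy
    · rw [a2 hy]
      have := d.strictMono hy
      rw [hdx] at this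
      exact h4 _ ⟨le_of_lt a3, this.le⟩
    · rw [rx, h2, hdx]
    · have : reflectHom e' y = y := by
        rw [mem_Iio] at a4
        rw [reflectHom_apply, h4' (-y) ⟨by linarith, by linarith⟩, neg_neg]
      rw [this, a1 hy]

/-- A subgroup closed under roots that contains the piecewise linear maps with compact support in
an interval contains all maps of type `𝔇` with compact support in it. -/
theorem Dc_le_of_PLc_le
    (hroot : ∀ g ∈ Dc u v, ∀ n : ℕ, 0 < n → g ^ n ∈ P → g ∈ P) (hPL : PLc u v ≤ P) :
    Dc u v ≤ P := by
  classical
  have main : ∀ n : ℕ, ∀ d ∈ Dc u v, ∀ B : Finset ℝ, B.card ≤ n → (∀ t ∉ B, PLAt d t) → d ∈ P := by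
    intro n
    induction n with
    | zero =>
      intro d hd B hB h
      have : B = ∅ := Finset.card_eq_zero.1 (by omega)
      subst this
      exact hPL ⟨fun t => h t (by simp), hd.2⟩
    | succ n ih =>
      intro d hd B hB h
      by_cases hall : ∀ t, PLAt d t
      · exact hPL ⟨hall, hd.2⟩
      push Not at hall
      obtain ⟨x, hxn⟩ := hall
      have hxB : x ∈ B := by by_contra h'; exact hxn (h x h')
      have hxd : x ∈ dyadic := (hd.1 x).plAt_or.2.1.resolve_left hxn
      have hxuv : x ∈ Ioo u v := by
        obtain ⟨α, hα, β, hβ, hf⟩ := hd.2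
        by_contra hx
        apply hxn
        have hx' : x ∈ (Icc α β)ᶜ := fun h' => hx ⟨by linarith [h'.1], by linarith [h'.2]⟩
        refine (plAt_id x).congr ?_
        filter_upwards [isClosed_Icc.isOpen_compl.mem_nhds hx'] with y hy
        exact hf y fun h' => hy (Ioo_subset_Icc_self h')
      have hdx : d x ∈ Ioo u v := fixOff_apply_mem (cptSub_le_fixOff _ _ hd.2) hxuv
      have hdxd := (dSub_apply_mem hd.1).2 hxd
      obtain ⟨a, had, ha1, ha2⟩ := exists_dyadic_between (lt_min hxuv.1 hdx.1)
      obtain ⟨b, hbd, hb1, hb2⟩ := exists_dyadic_between (max_lt hxuv.2 hdx.2)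
      rw [lt_min_iff] at ha2
      rw [max_lt_iff] at hb1
      -- A piecewise linear `p` returns `d x` to `x`, and some `e` in `P` copies the germ of `p * d`
      -- there. Then `p * d * e⁻¹` is the identity near `x` and has one exceptional point fewer.
      obtain ⟨p, hp, hp1, hp2⟩ := exists_pl_map had hbd hdxd hxd ha2.2 hb1.2 ha2.1 hb1.1
      have hpc : p ∈ PLc u v := ⟨hp, fixOff_le_cptSub ha1 hb2 hp1⟩
      have hd1 : p * d ∈ Dc u v := mul_mem (PLc_le_Dc _ _ hpc) hd
      obtain ⟨e, he, e1, e2, e3, e4⟩ := exists_germ hxuv.1 hxuv.2 hxd hroot hPL hd1.1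
        (by rw [RelIso.mul_apply, hp2])
      have hmem : p * d * e⁻¹ ∈ P := by
        refine ih _ (mul_mem hd1 (inv_mem e1)) ((B.erase x).image e) ?_ fun t ht => ?_
        · refine Finset.card_image_le.trans ?_
          rw [Finset.card_erase_of_mem hxB]; omega
        · obtain ⟨s, rfl⟩ := e.surjective t
          by_cases hs : s = x
          · subst hs
            rw [e2]
            refine (plAt_id s).congr ?_
            have c : Tendsto (e⁻¹ : ℝ ≃o ℝ) (𝓝 s) (𝓝 s) := by
              have := (e⁻¹ : ℝ ≃o ℝ).continuous.tendsto s
              rwa [show e⁻¹ s = s from e.injective (by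
                rw [← RelIso.mul_apply, mul_inv_cancel]; exact e2.symm)] at this
            filter_upwards [c.eventually e4] with y hy
            rw [RelIso.mul_apply, ← hy]
            exact e.apply_symm_apply y
          · have hsB : s ∉ B := fun h' => ht (Finset.mem_image_of_mem e
              (Finset.mem_erase.2 ⟨hs, h'⟩))
            have hes : e⁻¹ (e s) = s := e.symm_apply_apply s
            refine PLAt.comp (f := (e⁻¹ : ℝ ≃o ℝ)) (g := (p * d : ℝ ≃o ℝ)) ?_ (e3 s hs).symm
              (OrderIso.continuous _) (OrderIso.injective _)
            rw [hes]
            exact PLAt.comp (f := d) (hp _) (h s hsB) d.continuous d.injective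
      have h1 : d = p⁻¹ * (p * d * e⁻¹ * e) := by group
      rw [h1]
      exact mul_mem (inv_mem (hPL hpc)) (mul_mem hmem he)
  intro d hd
  obtain ⟨α, hα, β, hβ, hf⟩ := hd.2
  -- Exceptional points are isolated, so a compact interval contains finitely many.
  obtain ⟨B, hB⟩ : ∃ B : Finset ℝ, ∀ t ∈ Icc α β, t ∉ B → PLAt d t := by
    refine isCompact_Icc.induction_on (p := fun s => ∃ B : Finset ℝ, ∀ t ∈ s, t ∉ B → PLAt d t)
      ⟨∅, by simp⟩ ?_ ?_ ?_
    · rintro s t hst ⟨B, h⟩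
      exact ⟨B, fun x hx => h x (hst hx)⟩
    · rintro s t ⟨B, h⟩ ⟨B', h'⟩
      refine ⟨B ∪ B', fun x hx hxB => ?_⟩
      rw [Finset.mem_union, not_or] at hxB
      exact hx.elim (fun h1 => h x h1 hxB.1) fun h1 => h' x h1 hxB.2
    · intro x _
      exact ⟨_, nhdsWithin_le_nhds (eventually_nhdsWithin_iff.1 (hd.1 x).plAt_or.1), {x},
        fun t ht htx => ht (by simpa using htx)⟩
  refine main _ d hd B le_rfl fun t ht => ?_
  by_cases h : t ∈ Icc α β
  · exact hB t h ht
  · refine (plAt_id t).congr ?_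
    filter_upwards [isClosed_Icc.isOpen_compl.mem_nhds h] with y hy
    exact hf y fun h' => hy (Ioo_subset_Icc_self h')

end Root

end SolenoidalThompson
namespace SolenoidalThompson

open Set Filter Topology

/-! ### A piecewise linear identification of the line with the unit interval -/

/-- A piecewise linear map from the line onto `(0, 1)`. -/
noncomputable def squash (t : ℝ) : ℝ := if t ≤ 0 then pexp t / 2 else 1 - pexp (-t) / 2

theorem pexp_zero : pexp 0 = 1 := by simp [pexp]

theorem squash_of_nonpos {t : ℝ} (ht : t ≤ 0) : squash t = pexp t / 2 := if_pos ht

theorem squash_of_nonneg {t : ℝ} (ht : 0 ≤ t) : squash t = 1 - pexp (-t) / 2 := by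
  rcases ht.eq_or_lt with rfl | h
  · rw [squash_of_nonpos le_rfl, neg_zero, pexp_zero]; norm_num
  · exact if_neg (not_le.2 h)

/-- The source of the explicit constants below: `squash` takes `-1/2, 0, 1/2, 1` to `3/8, 1/2, 5/8,
3/4`. -/
theorem squash_of_mem {t : ℝ} (ht : t ∈ Icc (-1 : ℝ) 1) : squash t = (t + 2) / 4 := by
  rcases le_total t 0 with h | h
  · rw [squash_of_nonpos h, pexp_of_mem (-1) (by push_cast; constructor <;> linarith [ht.1])]
    push_cast; rw [zpow_neg, zpow_one]; ring
  · rw [squash_of_nonneg h, pexp_of_mem (-1) (by push_cast; constructor <;> linarith [ht.2])]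
    push_cast; rw [zpow_neg, zpow_one]; ring

theorem pexp_le_one {t : ℝ} (ht : t ≤ 0) : pexp t ≤ 1 := by
  rw [← pexp_zero]; exact pexp_strictMono.monotone ht

theorem squash_strictMono : StrictMono squash := by
  intro s t h
  rcases le_or_gt t 0 with ht | ht
  · rw [squash_of_nonpos ht, squash_of_nonpos (h.le.trans ht)]
    have := pexp_strictMono h
    linarith
  · rw [squash_of_nonneg ht.le]
    have h1 : pexp (-t) < 1 := by rw [← pexp_zero]; exact pexp_strictMono (by linarith)
    rcases le_or_gt s 0 with hs | hs
    · rw [squash_of_nonpos hs]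
      have := pexp_le_one hs
      linarith
    · rw [squash_of_nonneg hs.le]
      have := pexp_strictMono (show -t < -s by linarith)
      linarith

theorem range_squash : range squash = Ioo 0 1 := by
  ext y
  constructor
  · rintro ⟨t, rfl⟩
    rcases le_total t 0 with h | h
    · rw [squash_of_nonpos h]
      constructor <;> linarith [pexp_pos t, pexp_le_one h]
    · rw [squash_of_nonneg h]
      constructor <;> linarith [pexp_pos (-t), pexp_le_one (neg_nonpos.2 h)]
  · rintro ⟨h0, h1⟩
    have sur : ∀ z : ℝ, 0 < z → ∃ t, pexp t = z := fun z hz => by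
      have : z ∈ range pexp := by rw [range_pexp]; exact hz
      exact this
    rcases le_total y (1 / 2) with h | h
    · obtain ⟨t, ht⟩ := sur (2 * y) (by linarith)
      have ht0 : t ≤ 0 := by
        rw [← pexp_strictMono.le_iff_le, ht, pexp_zero]; linarith
      exact ⟨t, by rw [squash_of_nonpos ht0, ht]; ring⟩
    · obtain ⟨t, ht⟩ := sur (2 * (1 - y)) (by linarith)
      have ht0 : t ≤ 0 := by
        rw [← pexp_strictMono.le_iff_le, ht, pexp_zero]; linarith
      exact ⟨-t, by rw [squash_of_nonneg (by linarith), neg_neg, ht]; ring⟩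

theorem plAt_squash (t : ℝ) : PLAt squash t := by
  have half : PLAt (fun s => pexp s / 2) t := by
    have := PLAt.comp (f := pexp) (affIso_mem (n := -1) (zero_mem dyadic) (pexp t)) (plAt_pexp t)
      continuous_pexp pexp_strictMono.injective
    refine this.congr (Eventually.of_forall fun s => ?_)
    rw [affIso_apply, zpow_neg, zpow_one]; ring
  rcases lt_trichotomy t 0 with h | rfl | h
  · refine half.congr ?_
    filter_upwards [Iio_mem_nhds h] with s hs using squash_of_nonpos (le_of_lt hs)
  · refine (affIso_mem (n := -2) (b := 2⁻¹) half_mem 0).congr ?_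
    filter_upwards [Ioo_mem_nhds (show (-1 : ℝ) < 0 by norm_num) (show (0 : ℝ) < 1 by norm_num)]
      with s hs
    rw [squash_of_mem (Ioo_subset_Icc_self hs), affIso_apply, zpow_neg]; norm_num; ring
  · have h1 : PLAt (fun s => pexp s / 2) (-t) := by
      have := PLAt.comp (f := pexp) (affIso_mem (n := -1) (zero_mem dyadic) (pexp (-t)))
        (plAt_pexp (-t)) continuous_pexp pexp_strictMono.injective
      refine this.congr (Eventually.of_forall fun s => ?_)
      rw [affIso_apply, zpow_neg, zpow_one]; ring
    have h2 := plAt_translate (f := fun y => -(pexp (-y) / 2)) (x := t) (b := 0) (zero_mem _)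
      (one_mem dyadic) (by rw [add_zero]; exact h1.reflect)
    refine h2.congr ?_
    filter_upwards [Ioi_mem_nhds h] with s hs
    rw [squash_of_nonneg (le_of_lt hs), add_zero]; ring

/-- `squash` as an order isomorphism. -/
noncomputable def squashIso : ℝ ≃o Ioo (0 : ℝ) 1 :=
  (squash_strictMono.orderIso).trans (OrderIso.setCongr _ _ range_squash)

/-- Transport of homeomorphisms of the line to `(0, 1)`. -/
noncomputable def unitHom : (ℝ ≃o ℝ) →* (ℝ ≃o ℝ) := extendConj squashIso

theorem unitHom_squash (c : ℝ ≃o ℝ) (t : ℝ) : unitHom c (squash t) = squash (c t) :=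
  extendConj_apply squashIso c t

theorem unitHom_fixOff (c : ℝ ≃o ℝ) : unitHom c ∈ fixOff (Ioo 0 1) := extendConj_mem_fixOff _ c

theorem exists_squash {y : ℝ} (hy : y ∈ Ioo (0 : ℝ) 1) : ∃ t, squash t = y := by
  rwa [← range_squash] at hy

theorem unitHom_plAt {c : ℝ ≃o ℝ} (hc : c ∈ plSub) {y : ℝ} (h0 : y ≠ 0) (h1 : y ≠ 1) :
    PLAt (unitHom c) y := by
  by_cases hy : y ∈ Ioo (0 : ℝ) 1
  · exact extendConj_plAt squashIso isOpen_Ioo plAt_squash hc hy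
  · have : y ∈ (Icc (0 : ℝ) 1)ᶜ := fun h => hy ⟨lt_of_le_of_ne h.1 h0.symm, lt_of_le_of_ne h.2 h1⟩
    refine (plAt_id y).congr ?_
    filter_upwards [isClosed_Icc.isOpen_compl.mem_nhds this] with z hz
    exact unitHom_fixOff c z fun h => hz (Ioo_subset_Icc_self h)

/-- Near `0` and `1`, `squash` turns the unit translation into a doubling about the end point or its
inverse. So periodicity of `c` is the type `𝔇` condition at the two end points. -/
theorem unitHom_mem {c : ℝ ≃o ℝ} (hc : c ∈ perSub) : unitHom c ∈ Dd 0 1 := by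
  refine ⟨fun y => ?_, unitHom_fixOff c⟩
  have ev : ∀ y, ∀ᶠ z in 𝓝[≠] y, PLAt (unitHom c) z := by
    intro y
    have h : ∀ p : ℝ, ∀ᶠ z in 𝓝[≠] y, z ≠ p := fun p => by
      by_cases hp : p = y
      · rw [hp]; exact self_mem_nhdsWithin
      · exact nhdsWithin_le_nhds (isOpen_compl_singleton.mem_nhds (Ne.symm hp))
    filter_upwards [h 0, h 1] with z h0 h1 using unitHom_plAt hc.1 h0 h1
  have fix : ∀ y, y ∉ Ioo (0 : ℝ) 1 → unitHom c y = y := fun y hy => unitHom_fixOff c y hy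
  by_cases h0 : y = 0
  · subst h0
    refine DAt.intro _ (ev 0) (Or.inr ⟨zero_mem _, ?_⟩)
    -- Below `T` both `t` and `c t` are nonpositive, so both lie on the branch where `squash (s -
    -- 1)` is half of `squash s`.
    set T := min (0 : ℝ) (c⁻¹ 0) with hT
    have hT0 : squash T ≤ 1 / 2 := by
      have := squash_strictMono.monotone (min_le_left (0 : ℝ) (c⁻¹ 0))
      rw [squash_of_nonpos le_rfl, pexp_zero] at this
      exact this
    have hTp : 0 < squash T := by
      have : squash T ∈ Ioo (0 : ℝ) 1 := by rw [← range_squash]; exact mem_range_self _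
      exact this.1
    filter_upwards [Iio_mem_nhds (show (0 : ℝ) < squash T / 2 by linarith)] with y hy
    rw [mem_Iio] at hy
    rw [fix 0 (by simp)]
    simp only [doubling, sub_zero, add_zero]
    rcases le_or_gt y 0 with h | h
    · rw [fix y fun h' => absurd h'.1 (not_lt.2 h), fix _ fun h' => absurd h'.1 (by linarith)]
    · obtain ⟨t, ht⟩ := exists_squash (y := 2 * y) ⟨by linarith, by linarith⟩
      have htT : t ≤ T := by rw [← squash_strictMono.le_iff_le, ht]; linarith
      have ht0 : t ≤ 0 := htT.trans (min_le_left _ _)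
      have hct : c t ≤ 0 := by
        have := c.monotone (htT.trans (min_le_right _ _))
        rwa [← RelIso.mul_apply, mul_inv_cancel] at this
      have key : ∀ s ≤ 0, squash s = 2 * squash (s - 1) := fun s hs => by
        rw [squash_of_nonpos hs, squash_of_nonpos (by linarith)]
        have := pexp_add_one (s - 1)
        rw [sub_add_cancel] at this
        rw [this]; ring
      have hy' : y = squash (t - 1) := by have := key t ht0; linarith
      have hc1 : c (t - 1) = c t - 1 := by
        have := hc.2 (t - 1); rw [sub_add_cancel] at this; linarith
      rw [← ht, unitHom_squash, hy', unitHom_squash, hc1, key _ hct]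
  by_cases h1 : y = 1
  · subst h1
    refine DAt.intro _ (ev 1) (Or.inr ⟨one_mem _, ?_⟩)
    set T := max (0 : ℝ) (c⁻¹ 0) with hT
    have hT0 : 1 / 2 ≤ squash T := by
      have := squash_strictMono.monotone (le_max_left (0 : ℝ) (c⁻¹ 0))
      rw [squash_of_nonpos le_rfl, pexp_zero] at this
      exact this
    have hTp : squash T < 1 := by
      have : squash T ∈ Ioo (0 : ℝ) 1 := by rw [← range_squash]; exact mem_range_self _
      exact this.2
    filter_upwards [Ioi_mem_nhds (show (squash T + 1) / 2 < 1 by linarith)] with y hy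
    rw [mem_Ioi] at hy
    rw [fix 1 (by simp)]
    unfold doubling
    rcases le_or_gt 1 y with h | h
    · rw [fix y fun h' => absurd h'.2 (not_lt.2 h), fix _ fun h' => absurd h'.2 (by linarith)]
    · obtain ⟨t, ht⟩ := exists_squash (y := 2 * (y - 1) + 1) ⟨by linarith, by linarith⟩
      have htT : T ≤ t := by rw [← squash_strictMono.le_iff_le, ht]; linarith
      have ht0 : 0 ≤ t := (le_max_left _ _).trans htT
      have hct : 0 ≤ c t := by
        have := c.monotone ((le_max_right _ _).trans htT)
        rwa [← RelIso.mul_apply, mul_inv_cancel] at this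
      have key : ∀ s ≥ 0, squash s = 2 * (squash (s + 1) - 1) + 1 := fun s hs => by
        rw [squash_of_nonneg hs, squash_of_nonneg (by linarith)]
        have := pexp_add_one (-(s + 1))
        rw [show -(s + 1) + 1 = -s by ring] at this
        rw [this]; ring
      have hy' : y = squash (t + 1) := by have := key t ht0; linarith
      rw [← ht, unitHom_squash, hy', unitHom_squash, hc.2, key _ hct]
  exact DAt.intro _ (ev y) (Or.inl (unitHom_plAt hc.1 h0 h1))

/-! ### Two special elements -/

/-- The translation by one, transported to the unit interval. -/
noncomputable def shiftA : ℝ ≃o ℝ := unitHom trans1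

theorem shiftA_mem : shiftA ∈ Dd 0 1 := unitHom_mem trans1_mem_perSub

theorem squeeze_aux : affIso (-2) (3 / 8) (1 / 2) = (1 : ℝ ≃o ℝ) (1 / 2) := by
  rw [affIso_apply, zpow_neg, RelIso.one_apply]; norm_num

/-- A map squeezing `(0, 1)` onto `(3/8, 1)`. -/
noncomputable def squeeze : ℝ ≃o ℝ := glue _ _ (1 / 2) squeeze_aux

theorem squeeze_of_le {t : ℝ} (ht : t ≤ 1 / 2) : squeeze t = t / 4 + 3 / 8 := by
  rw [squeeze, glue_of_le squeeze_aux ht, affIso_apply, zpow_neg]; norm_num; ring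

theorem squeeze_of_ge {t : ℝ} (ht : 1 / 2 ≤ t) : squeeze t = t := by
  rw [squeeze, glue_of_ge squeeze_aux ht]; rfl

theorem dyadic_div (i : ℤ) (n : ℕ) : (i : ℝ) / 2 ^ n ∈ dyadic := by
  rw [div_eq_mul_inv, ← inv_pow]
  exact mul_mem (intCast_mem _ _) (pow_mem half_mem n)

theorem squeeze_mem : squeeze ∈ plSub :=
  glue_mem_plSub _ (by simpa using dyadic_div 1 1)
    (affIso_mem (by have := dyadic_div 3 3; norm_num at this; exact this)) (one_mem _)

theorem conj_squeeze_mem {g : ℝ ≃o ℝ} (hg : g ∈ Dd 0 1) : squeeze * g * squeeze⁻¹ ∈ Dd 0 1 := by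
  have hd : squeeze * g * squeeze⁻¹ ∈ dSub := mul_mem (mul_mem (plSub_le_dSub squeeze_mem) hg.1)
    (inv_mem (plSub_le_dSub squeeze_mem))
  refine ⟨hd, ?_⟩
  have := conj_mem_fixOff hg.2 squeeze
  rw [image_Ioo_orderIso, squeeze_of_le (by norm_num), squeeze_of_ge (by norm_num)] at this
  exact fixOff_mono (Ioo_subset_Ioo (by norm_num) le_rfl) this

/-- The conjugate of `shiftA` supported in `(3/8, 1)`. -/
noncomputable def shiftB : ℝ ≃o ℝ := squeeze * shiftA * squeeze⁻¹

theorem shiftB_mem : shiftB ∈ Dd 0 1 := conj_squeeze_mem shiftA_mem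

theorem exists_root_trans1 (m : ℕ) : ∃ b ∈ perSub, b ^ (2 ^ m) = trans1 := by
  refine ⟨affIso 0 (2⁻¹ ^ m), ⟨affIso_mem (pow_mem half_mem m), fun t => ?_⟩, ?_⟩
  · simp; ring
  · have h : ∀ n : ℕ, ∀ t, ((affIso 0 (2⁻¹ ^ m)) ^ n) t = t + n * 2⁻¹ ^ m := by
      intro n
      induction n with
      | zero => intro t; simp
      | succ n ih =>
        intro t
        rw [pow_succ, RelIso.mul_apply, ih, affIso_apply]
        push_cast; rw [zpow_zero]; ring
    ext t
    rw [h, trans1_apply]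
    push_cast
    rw [← mul_pow]; norm_num

/-- These come from the translations by `2 ^ (-m)`. Roots of unbounded order later allow one element
to dominate words of every length. -/
theorem exists_root_shiftA (m : ℕ) : ∃ b ∈ Dd 0 1, b ^ (2 ^ m) = shiftA := by
  obtain ⟨b, hb, h⟩ := exists_root_trans1 m
  exact ⟨unitHom b, unitHom_mem hb, by rw [← map_pow, h]; rfl⟩

theorem exists_root_shiftB (m : ℕ) : ∃ b ∈ Dd 0 1, b ^ (2 ^ m) = shiftB := by
  obtain ⟨b, hb, h⟩ := exists_root_shiftA m
  exact ⟨squeeze * b * squeeze⁻¹, conj_squeeze_mem hb, by rw [conj_pow, h]; rfl⟩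

/-- A homeomorphism supported in `(1/2, 5/8)` has a periodic transport to the line. -/
theorem exists_periodic_transport {f : ℝ ≃o ℝ} (hf : f ∈ PLc (1 / 2) (5 / 8)) :
    ∃ c ∈ perSub, (∀ t ∈ Icc (0 : ℝ) 1, squash (c t) = f (squash t)) ∧
      ∀ t ∈ Icc (-1 / 2 : ℝ) 0, c t = t := by
  set S := affIso (-2) (1 / 2) with hS
  have Sa : ∀ t, S t = t / 4 + 1 / 2 := fun t => by
    rw [hS, affIso_apply, zpow_neg]; norm_num; ring
  have Sd : S ∈ plSub := affIso_mem (by simpa using half_mem)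
  set f0 : ℝ ≃o ℝ := S⁻¹ * f * S with hf0
  have f0a : ∀ t, S (f0 t) = f (S t) := fun t => S.apply_symm_apply _
  have ffix : ∀ y, y ∉ Ioo (1 / 2 : ℝ) (5 / 8) → f y = y := cptSub_le_fixOff _ _ hf.2
  have f0fix : ∀ t, t ∉ Ioo (0 : ℝ) (1 / 2) → f0 t = t := fun t ht => by
    apply S.injective
    rw [f0a, ffix]
    rw [Sa]
    exact fun h => ht ⟨by linarith [h.1], by linarith [h.2]⟩
  have f00 : f0 0 = 0 := f0fix 0 (by simp)
  have f01 : f0 1 = 1 := f0fix 1 (by norm_num)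
  have hper : f0 1 = f0 0 + 1 := by rw [f00, f01, zero_add]
  refine ⟨perExt f0 one_pos hper, ⟨perExt_mem_plSub f0 one_pos hper (one_mem _) (one_mem _)
    fun t _ => (mul_mem (mul_mem (inv_mem Sd) hf.1) Sd : f0 ∈ plSub) t,
    perExt_add f0 one_pos hper⟩, fun t ht => ?_, fun t ht => ?_⟩
  · rw [perExt_of_mem f0 one_pos hper 0 (by simpa using ht)]
    simp only [Int.cast_zero, mul_zero, sub_zero, add_zero]
    have h1 : f0 t ∈ Icc (0 : ℝ) 1 := by
      constructor
      · rw [← f00]; exact f0.monotone ht.1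
      · rw [← f01]; exact f0.monotone ht.2
    have sq : ∀ s ∈ Icc (0 : ℝ) 1, squash s = S s := fun s hs => by
      rw [squash_of_mem ⟨by linarith [hs.1], hs.2⟩, Sa]; ring
    rw [sq _ h1, f0a, sq t ht]
  · rw [perExt_of_mem f0 one_pos hper (-1) (by push_cast; constructor <;> linarith [ht.1, ht.2])]
    push_cast
    rw [f0fix _ fun h => by linarith [h.2, ht.1]]; ring

theorem squash_zero : squash 0 = 1 / 2 := by rw [squash_of_mem (by norm_num)]; norm_num

theorem squash_one : squash 1 = 3 / 4 := by rw [squash_of_mem (by norm_num)]; norm_num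

theorem exists_squash_Icc {y p q : ℝ} (hy : y ∈ Icc (squash p) (squash q)) :
    ∃ t ∈ Icc p q, squash t = y := by
  have h : ∀ t, squash t ∈ Ioo (0 : ℝ) 1 := fun t => by rw [← range_squash]; exact mem_range_self _
  obtain ⟨t, ht⟩ := exists_squash (y := y) ⟨(h p).1.trans_le hy.1, hy.2.trans_lt (h q).2⟩
  refine ⟨t, ⟨?_, ?_⟩, ht⟩
  · rw [← squash_strictMono.le_iff_le, ht]; exact hy.1
  · rw [← squash_strictMono.le_iff_le, ht]; exact hy.2

open scoped commutatorElement in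
/-- Piecewise linear maps with compact support in `(1/2, 5/8)` are commutators with `shiftB`. -/
theorem exists_commutator_shiftB {f : ℝ ≃o ℝ} (hf : f ∈ PLc (1 / 2) (5 / 8)) :
    ∃ c ∈ perSub, f = ⁅unitHom c, shiftB⁆ := by
  obtain ⟨c, hc, c1, c2⟩ := exists_periodic_transport hf
  refine ⟨c, hc, ?_⟩
  have ffix : ∀ y, y ∉ Ioo (1 / 2 : ℝ) (5 / 8) → f y = y := cptSub_le_fixOff _ _ hf.2
  have c0 : c 0 = 0 := c2 0 (by norm_num)
  have h38 : squash (-1 / 2) = 3 / 8 := by rw [squash_of_mem (by norm_num)]; norm_num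
  set F := unitHom c with hF
  have F1 : ∀ y ∈ Icc (1 / 2 : ℝ) (3 / 4), F y = f y := fun y hy => by
    obtain ⟨t, ht, rfl⟩ := exists_squash_Icc (p := 0) (q := 1) (by rwa [squash_zero, squash_one])
    rw [hF, unitHom_squash, c1 t ht]
  have F2 : ∀ y ∈ Icc (3 / 8 : ℝ) (1 / 2), F y = y := fun y hy => by
    obtain ⟨t, ht, rfl⟩ := exists_squash_Icc (p := -1 / 2) (q := 0) (by rwa [squash_zero, h38])
    rw [hF, unitHom_squash, c2 t ht]
  -- `F` repeats `f` periodically and so commutes with `shiftA`, while `shiftB` agrees with `shiftA`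
  -- above `1/2` and is trivial below `3/8`. In the commutator with `shiftB` all copies of `f`
  -- cancel except the one in `[1/2, 3/4]`.
  have FA : F * shiftA = shiftA * F := by
    rw [hF, shiftA, ← map_mul, ← map_mul]
    congr 1
    ext t
    simp only [RelIso.mul_apply, trans1_apply, hc.2]
  have B1 : ∀ y, 1 / 2 ≤ y → shiftB y = shiftA y := fun y hy => by
    have e1 : squeeze⁻¹ y = y := by
      apply squeeze.injective
      rw [squeeze_of_ge hy]; exact squeeze.apply_symm_apply y
    have e2 : 1 / 2 ≤ shiftA y := by
      have h1 : shiftA (1 / 2) = 3 / 4 := by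
        rw [← squash_zero, shiftA, unitHom_squash, trans1_apply, zero_add, squash_one]
      have := shiftA.monotone hy
      rw [h1] at this; linarith
    change squeeze (shiftA (squeeze⁻¹ y)) = _
    rw [e1, squeeze_of_ge e2]
  have A12 : shiftA (1 / 2) = 3 / 4 := by
    rw [← squash_zero, shiftA, unitHom_squash, trans1_apply, zero_add, squash_one]
  have B12 : shiftB (1 / 2) = 3 / 4 := by rw [B1 _ le_rfl, A12]
  have B38 : ∀ y ≤ 3 / 8, shiftB y = y := fun y hy => by
    have := conj_mem_fixOff shiftA_mem.2 squeeze
    rw [image_Ioo_orderIso, squeeze_of_le (by norm_num), squeeze_of_ge (by norm_num)] at this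
    exact this y fun h => by linarith [h.1]
  have F38 : F (3 / 8) = 3 / 8 := F2 _ (by norm_num)
  have F12 : F (1 / 2) = 1 / 2 := F2 _ (by norm_num)
  -- compare `f * shiftB` with `F * shiftB * F⁻¹`
  have key : ∀ z, f (shiftB (F z)) = F (shiftB z) := by
    intro z
    rcases le_or_gt z (3 / 8) with h1 | h1
    · have h2 : F z ≤ 3 / 8 := by rw [← F38]; exact F.monotone h1
      rw [B38 _ h2, B38 _ h1, ffix]
      exact fun h => by linarith [h.1]
    · rcases le_or_gt z (1 / 2) with h2 | h2
      · rw [F2 z ⟨h1.le, h2⟩]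
        have b1 : shiftB z ≤ 3 / 4 := by rw [← B12]; exact shiftB.monotone h2
        have b2 : 3 / 8 ≤ shiftB z := by
          rw [← B38 _ le_rfl]; exact shiftB.monotone h1.le
        rcases le_total (shiftB z) (1 / 2) with h3 | h3
        · rw [F2 _ ⟨b2, h3⟩, ffix]
          exact fun h => by linarith [h.1]
        · rw [F1 _ ⟨h3, b1⟩]
      · have h3 : 1 / 2 ≤ F z := by rw [← F12]; exact F.monotone h2.le
        have h4 : 3 / 4 ≤ shiftA (F z) := by rw [← A12]; exact shiftA.monotone h3
        rw [B1 _ h3, B1 _ h2.le, ffix _ fun h => by linarith [h.2]]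
        exact (DFunLike.congr_fun FA z).symm
  have : f * shiftB * F = F * shiftB := by ext z; exact key z
  rw [commutatorElement_def, ← this]; group

end SolenoidalThompson
namespace SolenoidalThompson

open Set Filter Topology
open scoped commutatorElement

/-! ### Root-closed subgroups of locally constant functions -/

/-- A subgroup closed under taking roots. -/
def RootClosed {G : Type*} [Group G] (P : Subgroup G) : Prop :=
  ∀ g : G, ∀ n : ℕ, 0 < n → g ^ n ∈ P → g ∈ P

theorem RootClosed.comap {G H : Type*} [Group G] [Group H] {P : Subgroup H} (hP : RootClosed P)
    (f : G →* H) : RootClosed (P.comap f) := fun g n hn h => hP (f g) n hn (by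
  rw [← map_pow]; exact h)

section LC

variable {X : Type*} [TopologicalSpace X] {E : Type*} [Group E]

/-- Evaluation of locally constant functions at a point. -/
def lcEval (x : X) : LocallyConstant X E →* E where
  toFun f := f x
  map_one' := rfl
  map_mul' _ _ := rfl

/-- The constant functions. -/
def lcConst (X : Type*) [TopologicalSpace X] : E →* LocallyConstant X E :=
  LocallyConstant.constMonoidHom

@[simp] theorem lcConst_apply (e : E) (x : X) : lcConst X e x = e := rfl

/-- The function equal to `e` on the clopen set `C` and to `1` elsewhere. -/
noncomputable def lcInd {C : Set X} (hC : IsClopen C) : E →* LocallyConstant X E where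
  toFun e := (LocallyConstant.const X e).mulIndicator hC
  map_one' := by
    ext x
    by_cases hx : x ∈ C
    · rw [LocallyConstant.mulIndicator_of_mem _ _ hx]; rfl
    · rw [LocallyConstant.mulIndicator_of_notMem _ _ hx]; rfl
  map_mul' a b := by
    ext x
    rw [LocallyConstant.mul_apply]
    by_cases hx : x ∈ C
    · simp only [LocallyConstant.mulIndicator_of_mem _ _ hx]; rfl
    · simp only [LocallyConstant.mulIndicator_of_notMem _ _ hx]; rw [mul_one]

theorem lcInd_of_mem {C : Set X} (hC : IsClopen C) (e : E) {x : X} (hx : x ∈ C) :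
    lcInd hC e x = e := LocallyConstant.mulIndicator_of_mem _ hC hx

theorem lcInd_of_notMem {C : Set X} (hC : IsClopen C) (e : E) {x : X} (hx : x ∉ C) :
    lcInd hC e x = 1 := LocallyConstant.mulIndicator_of_notMem _ hC hx

theorem lc_pow_apply (f : LocallyConstant X E) (n : ℕ) (x : X) : (f ^ n) x = f x ^ n :=
  map_pow (lcEval x) f n

theorem lc_commutator_apply (f g : LocallyConstant X E) (x : X) : ⁅f, g⁆ x = ⁅f x, g x⁆ :=
  map_commutatorElement (lcEval x) f g

/-- Locally constant functions with values in `V` are products of indicators. -/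
theorem mem_of_lcInd_mem [CompactSpace X] {V : Subgroup E} {P : Subgroup (LocallyConstant X E)}
    (h : ∀ (C : Set X) (hC : IsClopen C), ∀ v ∈ V, lcInd hC v ∈ P)
    (θ : LocallyConstant X E) (hθ : ∀ x, θ x ∈ V) : θ ∈ P := by
  classical
  have main : ∀ n : ℕ, ∀ θ : LocallyConstant X E, (∀ x, θ x ∈ V) →
      (θ.range_finite.toFinset.erase 1).card ≤ n → θ ∈ P := by
    intro n
    induction n with
    | zero =>
      intro θ _ hn
      have h0 : θ.range_finite.toFinset.erase 1 = ∅ := Finset.card_eq_zero.1 (by omega)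
      have : θ = 1 := by
        ext x
        by_contra hx
        have : θ x ∈ θ.range_finite.toFinset.erase 1 :=
          Finset.mem_erase.2 ⟨hx, by simp⟩
        rw [h0] at this
        simp at this
      rw [this]; exact one_mem _
    | succ n ih =>
      intro θ hθ hn
      by_cases hall : ∀ x, θ x = 1
      · have : θ = 1 := by ext x; exact hall x
        rw [this]; exact one_mem _
      push Not at hall
      obtain ⟨x₀, hx₀⟩ := hall
      have hC : IsClopen (θ ⁻¹' {θ x₀}) := θ.isLocallyConstant.isClopen_fiber _
      -- Dividing by this indicator removes one nontrivial value and creates none.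
      set θ' := (lcInd hC (θ x₀))⁻¹ * θ with hθ'
      have e1 : ∀ x, θ x = θ x₀ → θ' x = 1 := fun x hx => by
        rw [hθ', LocallyConstant.mul_apply, LocallyConstant.inv_apply, lcInd_of_mem hC _ hx, hx,
          inv_mul_cancel]
      have e2 : ∀ x, θ x ≠ θ x₀ → θ' x = θ x := fun x hx => by
        rw [hθ', LocallyConstant.mul_apply, LocallyConstant.inv_apply, lcInd_of_notMem hC _ hx,
          inv_one, one_mul]
      have hm : θ' ∈ P := by
        refine ih θ' (fun x => ?_) ?_
        · by_cases hx : θ x = θ x₀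
          · rw [e1 x hx]; exact one_mem _
          · rw [e2 x hx]; exact hθ x
        · have hlt : θ'.range_finite.toFinset.erase 1 ⊂ θ.range_finite.toFinset.erase 1 := by
            refine Finset.ssubset_iff_subset_ne.2 ⟨fun y hy => ?_, fun heq => ?_⟩
            · rw [Finset.mem_erase, Finite.mem_toFinset] at hy ⊢
              obtain ⟨hy1, x, rfl⟩ := hy
              have hx : θ x ≠ θ x₀ := fun hx => hy1 (e1 x hx)
              exact ⟨hy1, x, (e2 x hx).symm⟩
            · have : θ x₀ ∈ θ'.range_finite.toFinset.erase 1 := by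
                rw [heq]; exact Finset.mem_erase.2 ⟨hx₀, by simp⟩
              rw [Finset.mem_erase, Finite.mem_toFinset] at this
              obtain ⟨-, x, hx⟩ := this
              by_cases hx' : θ x = θ x₀
              · rw [e1 x hx'] at hx; exact hx₀ hx.symm
              · rw [e2 x hx'] at hx; exact hx' hx
          have := Finset.card_lt_card hlt
          omega
      have : θ = lcInd hC (θ x₀) * θ' := by rw [hθ']; group
      rw [this]
      exact mul_mem (h _ hC _ (hθ x₀)) hm
  exact main _ θ hθ le_rfl

end LC

/-! ### The template -/

/-- `shiftA` as an element of the group of homeomorphisms of the unit interval. -/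
noncomputable def genA : Dd 0 1 := ⟨shiftA, shiftA_mem⟩

/-- `shiftB` as an element of the group of homeomorphisms of the unit interval. -/
noncomputable def genB : Dd 0 1 := ⟨shiftB, shiftB_mem⟩

/-- The affine map onto a small interval inside `(1/2, 5/8)`. -/
noncomputable def shrink : ℝ ≃o ℝ := affIso (-6) (33 / 64)

theorem shrink_apply (t : ℝ) : shrink t = t / 64 + 33 / 64 := by
  rw [shrink, affIso_apply, zpow_neg]; norm_num; ring

theorem shrink_mem : shrink ∈ plSub :=
  affIso_mem (by have := dyadic_div 33 6; norm_num at this; exact this)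

/-- `⁅f, x⁆` is `f` times a conjugate of `f⁻¹` supported in `x '' s`, and the latter commutes with
`h`. -/
theorem commutator_eq_of_disjoint {s : Set ℝ} {f h x : ℝ ≃o ℝ} (hf : f ∈ fixOff s)
    (hh : h ∈ fixOff s) (hx : ∀ y ∈ s, x y ∉ s) : ⁅⁅f, x⁆, h⁆ = ⁅f, h⁆ := by
  have hd : Disjoint (x '' s) s := by
    rw [Set.disjoint_left]
    rintro _ ⟨y, hy, rfl⟩
    exact hx y hy
  have hc : Commute (x * f⁻¹ * x⁻¹) h := fixOff_commute hd (conj_mem_fixOff (inv_mem hf) x) hh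
  have h1 : ⁅f, x⁆ = f * (x * f⁻¹ * x⁻¹) := by rw [commutatorElement_def]; group
  have h2 := hc.eq
  rw [h1]
  generalize x * f⁻¹ * x⁻¹ = k at h2 ⊢
  rw [commutatorElement_def, commutatorElement_def, mul_inv_rev, mul_assoc f k h, h2]
  group

/-- In the coordinate `squash` both roots are half-unit translations, the second conjugated by a
periodic `c`. On `[0, 1/2]` the quotient acts as `c⁻¹`, because the half-translation lands in `[1/2,
1]`, where `c` is trivial. -/
theorem exists_displacing : ∃ a a' : Dd 0 1, a ^ 2 = genA ∧ a' ^ 2 = genA ∧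
    ∀ y ∈ Ioo (33 / 64 : ℝ) (34 / 64), (a⁻¹ * a' : ℝ ≃o ℝ) y ∉ Ioo (33 / 64 : ℝ) (34 / 64) := by
  have dy : ∀ i : ℤ, (i : ℝ) / 128 ∈ dyadic := fun i => by
    have := dyadic_div i 7; norm_num at this; exact this
  -- `u` brings `70/128` down to `66/128 = 33/64`, so its inverse throws the interval `(33/64,
  -- 34/64)` beyond `70/128`.
  obtain ⟨u, hu, hu1, hu2⟩ := exists_pl_map (a := 65 / 128) (b := 79 / 128) (x := 70 / 128)
    (x' := 66 / 128) (dy 65) (dy 79) (dy 70) (dy 66) (by norm_num) (by norm_num) (by norm_num)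
    (by norm_num)
  have huc : u ∈ PLc (1 / 2) (5 / 8) := ⟨hu, fixOff_le_cptSub (by norm_num) (by norm_num) hu1⟩
  obtain ⟨c, hc, c1, c2⟩ := exists_periodic_transport huc
  set b : ℝ ≃o ℝ := affIso 0 2⁻¹ with hb
  have ba : ∀ t, b t = t + 2⁻¹ := fun t => by rw [hb]; simp
  have hbp : b ∈ perSub := ⟨affIso_mem half_mem, fun t => by rw [ba, ba]; ring⟩
  have b2 : b ^ 2 = trans1 := by
    ext t
    rw [pow_two, RelIso.mul_apply, ba, ba, trans1_apply]; ring
  have hbc : c * b * c⁻¹ ∈ perSub := mul_mem (mul_mem hc hbp) (inv_mem hc)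
  have hcc : c * trans1 = trans1 * c := by
    ext t; simp only [RelIso.mul_apply, trans1_apply, hc.2]
  refine ⟨⟨unitHom b, unitHom_mem hbp⟩, ⟨unitHom (c * b * c⁻¹), unitHom_mem hbc⟩, ?_, ?_, ?_⟩
  · apply Subtype.ext
    change unitHom b ^ 2 = unitHom trans1
    rw [← map_pow, b2]
  · apply Subtype.ext
    change unitHom _ ^ 2 = unitHom trans1
    rw [← map_pow, conj_pow, b2, hcc, mul_inv_cancel_right]
  · intro y hy hy'
    have e : ((unitHom b)⁻¹ * unitHom (c * b * c⁻¹) : ℝ ≃o ℝ) = unitHom (b⁻¹ * (c * b * c⁻¹)) := by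
      simp only [map_mul, map_inv]
    change ((unitHom b)⁻¹ * unitHom (c * b * c⁻¹) : ℝ ≃o ℝ) y ∈ _ at hy'
    rw [e] at hy'
    have q12 : squash (1 / 2) = 5 / 8 := by rw [squash_of_mem (by norm_num)]; norm_num
    obtain ⟨t, ht, rfl⟩ := exists_squash_Icc (p := 0) (q := 1 / 2) (y := y)
      (by rw [squash_zero, q12]; constructor <;> linarith [hy.1, hy.2])
    have c0 : c 0 = 0 := c2 0 (by norm_num)
    have c12 : ∀ s ∈ Icc (1 / 2 : ℝ) 1, c s = s := fun s hs => by
      have h1 := hc.2 (s - 1)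
      rw [sub_add_cancel, c2 (s - 1) (by constructor <;> linarith [hs.1, hs.2])] at h1
      linarith
    have cinv : ∀ s, c (c⁻¹ s) = s := fun s => c.apply_symm_apply s
    have i1 : 0 ≤ c⁻¹ t := by
      rw [← c.le_iff_le, cinv, c0]; exact ht.1
    have i2 : c⁻¹ t ≤ 1 / 2 := by
      rw [← c.le_iff_le, cinv, c12 _ (by norm_num)]; exact ht.2
    have hx : (b⁻¹ * (c * b * c⁻¹)) t = c⁻¹ t := by
      apply b.injective
      have : b ((b⁻¹ * (c * b * c⁻¹)) t) = c (b (c⁻¹ t)) := b.apply_symm_apply _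
      rw [this, ba, c12 _ (by constructor <;> linarith)]
    rw [unitHom_squash, hx] at hy'
    have h3 := c1 (c⁻¹ t) ⟨i1, by linarith⟩
    rw [cinv] at h3
    have h4 := u.strictMono (show squash (c⁻¹ t) < 70 / 128 by linarith [hy'.2])
    rw [hu2, ← h3] at h4
    linarith [hy.1]

/-- `exists_commutator_shiftB` transported by `S`. The factors live only on the larger interval from
`S 0` to `S 1`, which is why nested intervals are used below. -/
theorem exists_commutator_of_mem {S g : ℝ ≃o ℝ} (hS : S ∈ plSub)
    (hg : g ∈ PLc (S (1 / 2)) (S (5 / 8))) :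
    ∃ f ∈ Dd (S 0) (S 1), ∃ h ∈ Dd (S 0) (S 1), g = ⁅f, h⁆ := by
  have key : ∀ k ∈ Dd 0 1, S * k * S⁻¹ ∈ Dd (S 0) (S 1) := fun k hk => by
    have hd : S * k * S⁻¹ ∈ dSub := mul_mem (mul_mem (plSub_le_dSub hS) hk.1)
      (inv_mem (plSub_le_dSub hS))
    refine ⟨hd, ?_⟩
    have := conj_mem_fixOff hk.2 S
    rwa [image_Ioo_orderIso] at this
  have hgc : S⁻¹ * g * S ∈ PLc (1 / 2) (5 / 8) := by
    have hd : S⁻¹ * g * S ∈ plSub := mul_mem (mul_mem (inv_mem hS) hg.1) hS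
    refine ⟨hd, ?_⟩
    obtain ⟨α, hα, β, hβ, h⟩ := hg.2
    have h1 := conj_mem_fixOff h S⁻¹
    rw [image_Ioo_orderIso, inv_inv] at h1
    refine fixOff_le_cptSub ?_ ?_ h1
    · rw [← S.lt_iff_lt]; exact hα.trans_eq (S.apply_symm_apply α).symm
    · rw [← S.lt_iff_lt]; exact (S.apply_symm_apply β).trans_lt hβ
  obtain ⟨c, hc, h⟩ := exists_commutator_shiftB hgc
  refine ⟨_, key _ (unitHom_mem hc), _, key _ shiftB_mem, ?_⟩
  have h2 : g = MulAut.conj S (S⁻¹ * g * S) := by simp [mul_assoc]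
  rw [h2, h, map_commutatorElement]
  simp

section Template

variable {X : Type*} [TopologicalSpace X]

/-- The elements of the line group obtained from `P` through a homomorphism. -/
def pullLine {G : Type*} [Group G] (P : Subgroup G) (j : Dd 0 1 →* G) : Subgroup (ℝ ≃o ℝ) :=
  (P.comap j).map (Dd 0 1).subtype

theorem mem_pullLine {G : Type*} [Group G] {P : Subgroup G} {j : Dd 0 1 →* G} {g : ℝ ≃o ℝ} :
    g ∈ pullLine P j ↔ ∃ h : g ∈ Dd 0 1, j ⟨g, h⟩ ∈ P := by
  constructor
  · rintro ⟨⟨g, hg⟩, h, rfl⟩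
    exact ⟨hg, h⟩
  · rintro ⟨h, h1⟩
    exact ⟨⟨g, h⟩, h1, rfl⟩

theorem Dc_le_pullLine {G : Type*} [Group G] {P : Subgroup G} {j : Dd 0 1 →* G}
    (hP : RootClosed P) {u v : ℝ} (hu : 0 ≤ u) (hv : v ≤ 1) (h : PLc u v ≤ pullLine P j) :
    Dc u v ≤ pullLine P j := by
  refine Dc_le_of_PLc_le (fun g hg n hn hgn => ?_) h
  rw [mem_pullLine] at hgn ⊢
  obtain ⟨h1, h2⟩ := hgn
  have hg' := Dd_mono hu hv (Dc_le_Dd _ _ hg)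
  refine ⟨hg', hP _ n hn ?_⟩
  rw [← map_pow]
  exact h2

/-- The roots of `trans1` generate `perSub`, and each of them is transported to a root of `genA`. -/
theorem perSub_map_le {G : Type*} [Group G] {P : Subgroup G} {j : Dd 0 1 →* G}
    (hP : RootClosed P) (hA : j genA ∈ P) {c : ℝ ≃o ℝ} (hc : c ∈ perSub) :
    unitHom c ∈ pullLine P j := by
  have hc' := perSub_le_closure hc
  clear hc
  induction hc' using Subgroup.closure_induction with
  | mem c hc =>
    obtain ⟨hc, n, hn, hcn⟩ := hc
    refine mem_pullLine.2 ⟨unitHom_mem hc, hP _ n hn ?_⟩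
    rw [← map_pow]
    have : (⟨unitHom c, unitHom_mem hc⟩ : Dd 0 1) ^ n = genA := by
      apply Subtype.ext
      change unitHom c ^ n = unitHom trans1
      rw [← map_pow, hcn]
    rw [this]; exact hA
  | one => rw [map_one]; exact one_mem _
  | mul a b _ _ ha hb => rw [map_mul]; exact mul_mem ha hb
  | inv a _ ha => rw [map_inv]; exact inv_mem ha

/-- A piecewise linear map here is the commutator of `genB` with an element reached from `genA` by
roots; root-closedness then passes from piecewise linear to type `𝔇`. -/
theorem Dc_half_le_pullLine {G : Type*} [Group G] {P : Subgroup G} {j : Dd 0 1 →* G}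
    (hP : RootClosed P) (hA : j genA ∈ P) (hB : j genB ∈ P) :
    Dc (1 / 2) (5 / 8) ≤ pullLine P j := by
  refine Dc_le_pullLine hP (by norm_num) (by norm_num) fun f hf => ?_
  obtain ⟨c, hc, h⟩ := exists_commutator_shiftB hf
  rw [h, commutatorElement_def]
  have h1 := perSub_map_le hP hA hc
  have h2 : shiftB ∈ pullLine P j := mem_pullLine.2 ⟨shiftB_mem, hB⟩
  exact mul_mem (mul_mem (mul_mem h1 h2) (inv_mem h1)) (inv_mem h2)

theorem subtype_commutator_eq {s : Set ℝ} {f h x : Dd 0 1} (hf : (f : ℝ ≃o ℝ) ∈ fixOff s)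
    (hh : (h : ℝ ≃o ℝ) ∈ fixOff s) (hx : ∀ y ∈ s, (x : ℝ ≃o ℝ) y ∉ s) : ⁅⁅f, x⁆, h⁆ = ⁅f, h⁆ := by
  have := commutator_eq_of_disjoint hf hh hx
  apply Subtype.ext
  exact this

theorem Dd_shrink_le : Dd (33 / 64) (34 / 64) ≤ Dc (1 / 2) (5 / 8) :=
  Dd_le_Dc (by norm_num) (by norm_num)

/-- Indicators of maps supported in a small interval lie in every root-closed subgroup containing
the constant functions `genA` and `genB`. -/
theorem Dc_shrink_le_pullLine {a a' : Dd 0 1} (ha : a ^ 2 = genA) (ha' : a' ^ 2 = genA)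
    (hx : ∀ y ∈ Ioo (33 / 64 : ℝ) (34 / 64), (a⁻¹ * a' : ℝ ≃o ℝ) y ∉ Ioo (33 / 64 : ℝ) (34 / 64))
    {P : Subgroup (LocallyConstant X (Dd 0 1))} (hP : RootClosed P)
    (hA : lcConst X genA ∈ P) (hB : lcConst X genB ∈ P) {C : Set X} (hC : IsClopen C) :
    Dc (shrink (1 / 2)) (shrink (5 / 8)) ≤ pullLine P (lcInd hC) := by
  have s0 : shrink 0 = 33 / 64 := by rw [shrink_apply]; norm_num
  have s1 : shrink 1 = 34 / 64 := by rw [shrink_apply]; norm_num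
  refine Dc_le_pullLine hP (by rw [shrink_apply]; norm_num) (by rw [shrink_apply]; norm_num)
    fun g hg => ?_
  obtain ⟨f, hf, h, hh, rfl⟩ := exists_commutator_of_mem shrink_mem hg
  rw [s0, s1] at hf hh
  obtain ⟨hf1, hfP⟩ := mem_pullLine.1 (Dc_half_le_pullLine hP hA hB (Dd_shrink_le hf))
  obtain ⟨hh1, hhP⟩ := mem_pullLine.1 (Dc_half_le_pullLine hP hA hB (Dd_shrink_le hh))
  set f' : Dd 0 1 := ⟨f, hf1⟩
  set h' : Dd 0 1 := ⟨h, hh1⟩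
  have haP : lcConst X a ∈ P := hP _ 2 two_pos (by rw [← map_pow, ha]; exact hA)
  -- `y` is `a'` on `C` and `a` elsewhere: a nonconstant square root of the constant `genA`, hence
  -- in `P`. This is how `P` sees the clopen set `C`: `a⁻¹ * y` displaces the small interval over
  -- `C` and is trivial elsewhere.
  set y : LocallyConstant X (Dd 0 1) := lcInd hC (a' * a⁻¹) * lcConst X a with hy
  have y1 : ∀ x ∈ C, y x = a' := fun x hx => by
    rw [hy, LocallyConstant.mul_apply, lcInd_of_mem hC _ hx, lcConst_apply, inv_mul_cancel_right]
  have y2 : ∀ x ∉ C, y x = a := fun x hx => by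
    rw [hy, LocallyConstant.mul_apply, lcInd_of_notMem hC _ hx, lcConst_apply, one_mul]
  have hyP : y ∈ P := by
    refine hP _ 2 two_pos ?_
    have : y ^ 2 = lcConst X genA := by
      ext x : 1
      rw [lc_pow_apply, lcConst_apply]
      by_cases hx : x ∈ C
      · rw [y1 x hx, ha']
      · rw [y2 x hx, ha]
    rw [this]; exact hA
  have hm : ⁅⁅lcConst X f', (lcConst X a)⁻¹ * y⁆, lcConst X h'⁆ ∈ P := by
    have h1 : (lcConst X a)⁻¹ * y ∈ P := mul_mem (inv_mem haP) hyP
    have h2 : ⁅lcConst X f', (lcConst X a)⁻¹ * y⁆ ∈ P :=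
      mul_mem (mul_mem (mul_mem hfP h1) (inv_mem hfP)) (inv_mem h1)
    exact mul_mem (mul_mem (mul_mem h2 hhP) (inv_mem h2)) (inv_mem hhP)
  have hfh : ⁅f, h⁆ ∈ Dd 0 1 := (⁅f', h'⁆ : Dd 0 1).2
  refine mem_pullLine.2 ⟨hfh, ?_⟩
  convert hm using 1
  ext x : 1
  rw [lc_commutator_apply, lc_commutator_apply, LocallyConstant.mul_apply,
    LocallyConstant.inv_apply, lcConst_apply, lcConst_apply, lcConst_apply]
  by_cases hx' : x ∈ C
  · rw [lcInd_of_mem hC _ hx', y1 x hx', subtype_commutator_eq (s := Ioo (33 / 64 : ℝ) (34 / 64))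
      hf.2 hh.2 hx]
    rfl
  · rw [lcInd_of_notMem hC _ hx', y2 x hx', inv_mul_cancel, commutatorElement_one_right,
      commutatorElement_one_left]

/-- The left endpoint of the core interval. -/
noncomputable def coreL : ℝ := shrink (shrink (1 / 2))

/-- The right endpoint of the core interval. -/
noncomputable def coreR : ℝ := shrink (shrink (5 / 8))

theorem core_bounds : 0 < coreL ∧ coreL < coreR ∧ coreR < 1 := by
  unfold coreL coreR
  simp only [shrink_apply]
  norm_num

variable [CompactSpace X]

/-- The factors are functions of the value of `θ`, so they stay locally constant, and they take
values in an interval whose indicators are already known to lie in `P`. Inserting the displacing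
element does not change the commutator, but it gives a form that can be bounded. -/
theorem exists_core_commutator {a a' : Dd 0 1} (ha : a ^ 2 = genA) (ha' : a' ^ 2 = genA)
    (hx : ∀ y ∈ Ioo (33 / 64 : ℝ) (34 / 64), (a⁻¹ * a' : ℝ ≃o ℝ) y ∉ Ioo (33 / 64 : ℝ) (34 / 64))
    (θ : LocallyConstant X (Dd 0 1)) (hθ : ∀ x, (θ x : ℝ ≃o ℝ) ∈ PLc coreL coreR) :
    ∃ f h : LocallyConstant X (Dd 0 1), (∀ P : Subgroup (LocallyConstant X (Dd 0 1)), RootClosed P →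
      lcConst X genA ∈ P → lcConst X genB ∈ P → f ∈ P ∧ h ∈ P) ∧
      θ = ⁅⁅f, lcConst X (a⁻¹ * a')⁆, h⁆ := by
  classical
  have hS : shrink * shrink ∈ plSub := mul_mem shrink_mem shrink_mem
  have e0 : (shrink * shrink) 0 = shrink (33 / 64) := by
    rw [RelIso.mul_apply, shrink_apply 0]; norm_num
  have e1 : (shrink * shrink) 1 = shrink (34 / 64) := by
    rw [RelIso.mul_apply, shrink_apply 1]; norm_num
  have sub1 : Dd ((shrink * shrink) 0) ((shrink * shrink) 1) ≤
      Dc (shrink (1 / 2)) (shrink (5 / 8)) := by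
    rw [e0, e1]
    exact Dd_le_Dc (shrink.strictMono (by norm_num)) (shrink.strictMono (by norm_num))
  have sub2 : Dc (shrink (1 / 2)) (shrink (5 / 8)) ≤ Dd (33 / 64) (34 / 64) :=
    (Dc_le_Dd _ _).trans (Dd_mono (by rw [shrink_apply]; norm_num) (by rw [shrink_apply]; norm_num))
  have sub3 : Dd (33 / 64) (34 / 64) ≤ Dd 0 1 := Dd_mono (by norm_num) (by norm_num)
  have ex : ∀ g : Dd 0 1, (g : ℝ ≃o ℝ) ∈ PLc coreL coreR → ∃ p : Dd 0 1 × Dd 0 1,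
      (p.1 : ℝ ≃o ℝ) ∈ Dc (shrink (1 / 2)) (shrink (5 / 8)) ∧
      (p.2 : ℝ ≃o ℝ) ∈ Dc (shrink (1 / 2)) (shrink (5 / 8)) ∧ g = ⁅p.1, p.2⁆ := by
    intro g hg
    obtain ⟨f, hf, h, hh, e⟩ := exists_commutator_of_mem hS hg
    exact ⟨(⟨f, sub3 (sub2 (sub1 hf))⟩, ⟨h, sub3 (sub2 (sub1 hh))⟩), sub1 hf, sub1 hh,
      Subtype.ext e⟩
  choose! F hF1 hF2 hF3 using ex
  have mem : ∀ k : LocallyConstant X (Dd 0 1),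
      (∀ x, (k x : ℝ ≃o ℝ) ∈ Dc (shrink (1 / 2)) (shrink (5 / 8))) →
      ∀ P : Subgroup (LocallyConstant X (Dd 0 1)), RootClosed P →
      lcConst X genA ∈ P → lcConst X genB ∈ P → k ∈ P := by
    intro k hk P hP hA hB
    refine mem_of_lcInd_mem (V := (Dc (shrink (1 / 2)) (shrink (5 / 8))).comap (Dd 0 1).subtype)
      (fun C hC v hv => ?_) k hk
    exact (mem_pullLine.1 (Dc_shrink_le_pullLine ha ha' hx hP hA hB hC hv)).2
  refine ⟨θ.map fun g => (F g).1, θ.map fun g => (F g).2, fun P hP hA hB =>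
    ⟨mem _ (fun x => hF1 _ (hθ x)) P hP hA hB, mem _ (fun x => hF2 _ (hθ x)) P hP hA hB⟩, ?_⟩
  ext x : 1
  rw [lc_commutator_apply, lc_commutator_apply, lcConst_apply, LocallyConstant.map_apply,
    LocallyConstant.map_apply]
  simp only [Function.comp_apply]
  rw [subtype_commutator_eq (s := Ioo (33 / 64 : ℝ) (34 / 64)) (sub2 (hF1 _ (hθ x))).2
    (sub2 (hF2 _ (hθ x))).2 hx]
  exact hF3 _ (hθ x)

/-- A root-closed subgroup containing the functions with piecewise linear values contains those
with values of type `𝔇`. -/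
theorem mem_of_Dc {u v : ℝ} (hu : 0 ≤ u) (hv : v ≤ 1)
    {P : Subgroup (LocallyConstant X (Dd 0 1))} (hP : RootClosed P)
    (h : ∀ θ : LocallyConstant X (Dd 0 1), (∀ x, (θ x : ℝ ≃o ℝ) ∈ PLc u v) → θ ∈ P)
    (θ : LocallyConstant X (Dd 0 1)) (hθ : ∀ x, (θ x : ℝ ≃o ℝ) ∈ Dc u v) : θ ∈ P := by
  refine mem_of_lcInd_mem (V := (Dc u v).comap (Dd 0 1).subtype) (fun C hC w hw => ?_) θ hθ
  have : Dc u v ≤ pullLine P (lcInd hC) := by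
    refine Dc_le_pullLine hP hu hv fun g hg => ?_
    refine mem_pullLine.2 ⟨Dd_mono hu hv (Dc_le_Dd _ _ (PLc_le_Dc _ _ hg)), h _ fun x => ?_⟩
    by_cases hx : x ∈ C
    · rw [lcInd_of_mem hC _ hx]; exact hg
    · rw [lcInd_of_notMem hC _ hx]; exact one_mem _
  exact (mem_pullLine.1 (this hw)).2

end Template

end SolenoidalThompson
namespace SolenoidalThompson

open Set Filter Topology
open scoped commutatorElement

/-! ### Orders and fixed points -/

theorem inv_apply_self' (f : ℝ ≃o ℝ) (x : ℝ) : f⁻¹ (f x) = x := f.symm_apply_apply x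

theorem apply_inv_self' (f : ℝ ≃o ℝ) (x : ℝ) : f (f⁻¹ x) = x := f.apply_symm_apply x

/-- A bounded orbit produces a common fixed point. -/
theorem exists_fixed_of_bdd {K : Subgroup (ℝ ≃o ℝ)} {p M : ℝ} (h : ∀ g ∈ K, g p ≤ M) :
    ∃ s, p ≤ s ∧ s ≤ M ∧ ∀ g ∈ K, g s = s := by
  set O : Set ℝ := {y | ∃ g ∈ K, g p = y} with hO
  have hb : BddAbove O := ⟨M, by rintro _ ⟨g, hg, rfl⟩; exact h g hg⟩
  have hp : p ∈ O := ⟨1, one_mem _, rfl⟩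
  have key : ∀ g ∈ K, g (sSup O) ≤ sSup O := by
    intro g hg
    have : sSup O ≤ g⁻¹ (sSup O) := by
      refine csSup_le ⟨p, hp⟩ ?_
      rintro _ ⟨k, hk, rfl⟩
      rw [← g.le_iff_le, apply_inv_self']
      exact le_csSup hb ⟨g * k, mul_mem hg hk, rfl⟩
    rw [← g.le_iff_le, apply_inv_self'] at this
    exact this
  refine ⟨sSup O, le_csSup hb hp, csSup_le ⟨p, hp⟩ ?_, fun g hg => le_antisymm (key g hg) ?_⟩
  · rintro _ ⟨g, hg, rfl⟩; exact h g hg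
  · have := key g⁻¹ (inv_mem hg)
    rwa [← g.le_iff_le, apply_inv_self'] at this

/-- Otherwise the supremum of the forward orbit of `p` would be a point of `A` that `κ` does not
move up. -/
theorem exists_le_pow_apply {κ : ℝ ≃o ℝ} {A : Set ℝ} (hA : A.OrdConnected)
    (hκ : ∀ q ∈ A, q < κ q) {p q : ℝ} (hp : p ∈ A) (hq : q ∈ A) : ∃ n : ℕ, q ≤ (κ ^ n) p := by
  by_contra! hcon
  have hb : BddAbove (range fun n : ℕ => (κ ^ n) p) :=
    ⟨q, by rintro _ ⟨n, rfl⟩; exact (hcon n).le⟩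
  set s := sSup (range fun n : ℕ => (κ ^ n) p) with hs
  have h1 : p ≤ s := le_csSup hb ⟨0, rfl⟩
  have h2 : s ≤ q := csSup_le (range_nonempty _) (by rintro _ ⟨n, rfl⟩; exact (hcon n).le)
  have h3 := hκ s (hA.out hp hq ⟨h1, h2⟩)
  have h4 : κ⁻¹ s < s := by rw [← κ.lt_iff_lt, apply_inv_self']; exact h3
  obtain ⟨_, ⟨n, rfl⟩, h5⟩ := exists_lt_of_lt_csSup (range_nonempty _) h4
  have h6 : (κ ^ (n + 1)) p ≤ s := le_csSup hb ⟨n + 1, rfl⟩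
  rw [← κ.lt_iff_lt, apply_inv_self'] at h5
  rw [pow_succ', RelIso.mul_apply] at h6
  exact absurd h5 (not_lt.2 h6)

/-- Homeomorphisms preserving `A`. -/
def stabSet (A : Set ℝ) : Subgroup (ℝ ≃o ℝ) where
  carrier := {g | ∀ q, g q ∈ A ↔ q ∈ A}
  mul_mem' {f g} hf hg q := (hf (g q)).trans (hg q)
  one_mem' q := Iff.rfl
  inv_mem' {f} hf q := by rw [← hf (f⁻¹ q), apply_inv_self']

theorem le_pow_apply_of_le {g : ℝ ≃o ℝ} {q : ℝ} (h : q ≤ g q) (n : ℕ) (hn : 0 < n) :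
    g q ≤ (g ^ n) q := by
  induction n, hn using Nat.le_induction with
  | base => simp
  | succ n _ ih =>
    rw [pow_succ', RelIso.mul_apply]
    exact g.monotone (h.trans ih)

theorem pow_apply_le_of_le {g : ℝ ≃o ℝ} {q : ℝ} (h : g q ≤ q) (n : ℕ) (hn : 0 < n) :
    (g ^ n) q ≤ g q := by
  induction n, hn using Nat.le_induction with
  | base => simp
  | succ n _ ih =>
    rw [pow_succ', RelIso.mul_apply]
    exact g.monotone (ih.trans h)

/-- For increasing `g` the point `g q` lies between `q` and `(g ^ n) q`, so convexity of `A`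
applies. -/
theorem rootClosed_stabSet {A : Set ℝ} (hA : A.OrdConnected) : RootClosed (stabSet A) := by
  have key : ∀ (g : ℝ ≃o ℝ) (n : ℕ), 0 < n → g ^ n ∈ stabSet A → ∀ q ∈ A, g q ∈ A := by
    intro g n hn h q hq
    have h1 := (h q).2 hq
    rcases le_total q (g q) with h2 | h2
    · exact hA.out hq h1 ⟨h2, le_pow_apply_of_le h2 n hn⟩
    · exact hA.out h1 hq ⟨pow_apply_le_of_le h2 n hn, h2⟩
  intro g n hn h q
  refine ⟨fun hq => ?_, key g n hn h q⟩
  have := key g⁻¹ n hn (by rw [inv_pow]; exact inv_mem h) _ hq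
  rwa [inv_apply_self'] at this

/-- Homeomorphisms fixing `t`. -/
def fixPt (t : ℝ) : Subgroup (ℝ ≃o ℝ) := MulAction.stabilizer (ℝ ≃o ℝ) t

theorem fixed_of_pow_fixed {g : ℝ ≃o ℝ} {q : ℝ} {n : ℕ} (hn : 0 < n) (h : (g ^ n) q = q) :
    g q = q := by
  rcases le_total q (g q) with h2 | h2
  · exact le_antisymm ((le_pow_apply_of_le h2 n hn).trans h.le) h2
  · exact le_antisymm h2 (h.ge.trans (pow_apply_le_of_le h2 n hn))

theorem rootClosed_fixPt (t : ℝ) : RootClosed (fixPt t) := fun _ _ hn h => fixed_of_pow_fixed hn h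

/-! ### Bounding commutators -/

section Bound

variable {κ : ℝ ≃o ℝ} {A : Set ℝ}

/-- Let `j` be least with `a q ≤ (κ ^ j) q`. If `a' q` exceeded `κ (a q)`, it would exceed `(κ ^ j)
q`. Iterating both inequalities would put `a (a q)` at or below, and `a' (a' q)` strictly above, `(κ
^ j) ((κ ^ j) q)`, though the squares agree. -/
theorem sqrt_comparison (hA : A.OrdConnected) (hκ : ∀ q ∈ A, q < κ q) {a a' : ℝ ≃o ℝ}
    (ha : Commute a κ) (ha' : Commute a' κ) (hs : a ∈ stabSet A)
    (h2 : a ^ 2 = a' ^ 2) {q : ℝ} (hq : q ∈ A) : a' q ≤ κ (a q) := by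
  have haq := (hs q).2 hq
  obtain ⟨n, hn⟩ := exists_le_pow_apply hA hκ hq haq
  obtain ⟨m, hm⟩ := exists_le_pow_apply hA hκ haq hq
  have comm : ∀ (b : ℝ ≃o ℝ), Commute b κ → ∀ (j : ℤ) (y : ℝ), b ((κ ^ j) y) = (κ ^ j) (b y) :=
    fun b hb j y => DFunLike.congr_fun (hb.zpow_right j).eq y
  have mono : ∀ i j : ℤ, i ≤ j → (κ ^ i) q ≤ (κ ^ j) q := by
    intro i j hij
    obtain ⟨k, rfl⟩ : ∃ k : ℕ, j = i + k := ⟨(j - i).toNat, by omega⟩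
    have h3 : q ≤ (κ ^ k) q := by
      rcases Nat.eq_zero_or_pos k with rfl | hk
      · simp
      · exact (hκ q hq).le.trans (le_pow_apply_of_le (hκ q hq).le k hk)
    rw [zpow_add, RelIso.mul_apply, zpow_natCast]
    exact (κ ^ i).monotone h3
  obtain ⟨j, hj1, hj2⟩ : ∃ j : ℤ, a q ≤ (κ ^ j) q ∧ ∀ z : ℤ, a q ≤ (κ ^ z) q → j ≤ z := by
    refine Int.exists_least_of_bdd (P := fun j => a q ≤ (κ ^ j) q)
      ⟨-m - 1, fun z hz => ?_⟩ ⟨n, by simpa using hn⟩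
    by_contra hlt
    push Not at hlt
    have h3 := hz.trans (mono z (-m - 1) hlt.le)
    have h4 : (κ ^ (-(m : ℤ))) q ≤ a q := by
      rw [zpow_neg, zpow_natCast, ← (κ ^ m).le_iff_le, apply_inv_self']
      exact hm
    have h5 : (κ ^ (-(m : ℤ) - 1)) q < (κ ^ (-(m : ℤ))) q := by
      have e : (-(m : ℤ)) = (-(m : ℤ) - 1) + 1 := by ring
      nth_rewrite 2 [e]
      rw [zpow_add, RelIso.mul_apply, zpow_one]
      exact (κ ^ _).strictMono (hκ q hq)
    exact absurd (h4.trans h3) (not_le.2 h5)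
  by_contra! hlt
  have h3 : (κ ^ j) q < κ (a q) := by
    by_contra! hle
    have := hj2 (j - 1) (by
      rw [← κ.le_iff_le]
      refine hle.trans (le_of_eq ?_)
      rw [← RelIso.mul_apply, ← zpow_one_add]
      congr 2; ring)
    omega
  have h4 : (κ ^ j) q < a' q := h3.trans hlt
  have h5 : (κ ^ j) ((κ ^ j) q) < a' (a' q) := by
    calc (κ ^ j) ((κ ^ j) q) < (κ ^ j) (a' q) := (κ ^ j).strictMono h4
      _ = a' ((κ ^ j) q) := (comm a' ha' j q).symm
      _ < a' (a' q) := a'.strictMono h4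
  have h6 : a (a q) ≤ (κ ^ j) ((κ ^ j) q) := by
    calc a (a q) ≤ a ((κ ^ j) q) := a.monotone hj1
      _ = (κ ^ j) (a q) := comm a ha j q
      _ ≤ _ := (κ ^ j).monotone hj1
  have h7 : a (a q) = a' (a' q) := by
    have := DFunLike.congr_fun h2 q
    rwa [pow_two, pow_two] at this
  rw [h7] at h6
  exact absurd h5 (not_lt.2 h6)

theorem bound_mul {n m : ℕ} {g h : ℝ ≃o ℝ} (hg : ∀ q ∈ A, g q ≤ (κ ^ n) q)
    (hh : ∀ q ∈ A, h q ≤ (κ ^ m) q) (hs : h ∈ stabSet A) :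
    ∀ q ∈ A, (g * h) q ≤ (κ ^ (n + m)) q := fun q hq => by
  rw [pow_add]
  exact (hg _ ((hs q).2 hq)).trans ((κ ^ n).monotone (hh q hq))

theorem bound_conj {n : ℕ} {g f : ℝ ≃o ℝ} (hg : ∀ q ∈ A, g q ≤ (κ ^ n) q)
    (hf : f ∈ stabSet A) (hc : Commute f κ) :
    ∀ q ∈ A, (f * g * f⁻¹) q ≤ (κ ^ n) q := fun q hq => by
  have h1 := f.monotone (hg _ (((inv_mem hf : f⁻¹ ∈ stabSet A) q).2 hq))
  have h2 : f ((κ ^ n) (f⁻¹ q)) = (κ ^ n) q := by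
    have := DFunLike.congr_fun (hc.pow_right n).eq (f⁻¹ q)
    simp only [RelIso.mul_apply, apply_inv_self'] at this
    exact this
  rw [h2] at h1
  exact h1

variable {X : Type*} [TopologicalSpace X] [CompactSpace X]

/-- Elements with values in the core are dominated by the fourth power of a commuting element. -/
theorem core_bound {σ : LocallyConstant X (Dd 0 1) →* (ℝ ≃o ℝ)} (hA : A.OrdConnected)
    (hκ : ∀ q ∈ A, q < κ q) (hc : ∀ θ, Commute (σ θ) κ)
    (h1 : σ (lcConst X genA) ∈ stabSet A) (h2 : σ (lcConst X genB) ∈ stabSet A)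
    {θ : LocallyConstant X (Dd 0 1)} (hθ : ∀ x, (θ x : ℝ ≃o ℝ) ∈ PLc coreL coreR) :
    σ θ ∈ stabSet A ∧ ∀ q ∈ A, σ θ q ≤ (κ ^ 4) q := by
  obtain ⟨a, a', ha, ha', hx⟩ := exists_displacing
  obtain ⟨f, h, hP, rfl⟩ := exists_core_commutator ha ha' hx θ hθ
  have hr := (rootClosed_stabSet hA).comap σ
  obtain ⟨hf, hh⟩ := hP _ hr h1 h2
  have sa : σ (lcConst X a) ∈ stabSet A := hr _ 2 two_pos (by rw [← map_pow, ha]; exact h1)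
  have sa' : σ (lcConst X a') ∈ stabSet A := hr _ 2 two_pos (by rw [← map_pow, ha']; exact h1)
  have hsq : σ (lcConst X a) ^ 2 = σ (lcConst X a') ^ 2 := by
    rw [← map_pow, ← map_pow, ← map_pow, ← map_pow, ha, ha']
  -- `x` and `x⁻¹` are bounded by `κ`, so `y = (f x f⁻¹) x⁻¹` and its inverse are bounded by `κ ^
  -- 2`, and `⁅y, h⁆ = y (h y⁻¹ h⁻¹)` by `κ ^ 4`. Conjugation by elements commuting with `κ`
  -- preserves such bounds, so `f` and `h` need none of their own.
  set x := σ (lcConst X (a⁻¹ * a')) with hxd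
  have hxe : x = (σ (lcConst X a))⁻¹ * σ (lcConst X a') := by simp [hxd]
  have sx : x ∈ stabSet A := by rw [hxe]; exact mul_mem (inv_mem sa) sa'
  have cx : Commute x κ := hc _
  have b1 : ∀ q ∈ A, x q ≤ (κ ^ 1) q := fun q hq => by
    rw [hxe, RelIso.mul_apply, ← (σ (lcConst X a)).le_iff_le, apply_inv_self', pow_one]
    have := DFunLike.congr_fun (hc (lcConst X a)).eq q
    simp only [RelIso.mul_apply] at this
    rw [this]
    exact sqrt_comparison hA hκ (hc _) (hc _) sa hsq hq
  have b1' : ∀ q ∈ A, x⁻¹ q ≤ (κ ^ 1) q := fun q hq => by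
    have e : x⁻¹ = (σ (lcConst X a'))⁻¹ * σ (lcConst X a) := by rw [hxe]; group
    rw [e, RelIso.mul_apply, ← (σ (lcConst X a')).le_iff_le, apply_inv_self', pow_one]
    have := DFunLike.congr_fun (hc (lcConst X a')).eq q
    simp only [RelIso.mul_apply] at this
    rw [this]
    exact sqrt_comparison hA hκ (hc _) (hc _) sa' hsq.symm hq
  change σ f ∈ stabSet A at hf
  change σ h ∈ stabSet A at hh
  set y := ⁅σ f, x⁆ with hy
  have sy : y ∈ stabSet A := mul_mem (mul_mem (mul_mem hf sx) (inv_mem hf)) (inv_mem sx)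
  have b2 : ∀ q ∈ A, y q ≤ (κ ^ 2) q := by
    rw [hy, commutatorElement_def]
    exact bound_mul (bound_conj b1 hf (hc f)) b1' (inv_mem sx)
  have b2' : ∀ q ∈ A, y⁻¹ q ≤ (κ ^ 2) q := by
    have e : y⁻¹ = x * (σ f * x⁻¹ * (σ f)⁻¹) := by rw [hy, commutatorElement_def]; group
    rw [e]
    exact bound_mul b1 (bound_conj b1' hf (hc f)) (mul_mem (mul_mem hf (inv_mem sx)) (inv_mem hf))
  have e : σ ⁅⁅f, lcConst X (a⁻¹ * a')⁆, h⁆ = y * (σ h * y⁻¹ * (σ h)⁻¹) := by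
    have e1 : σ ⁅⁅f, lcConst X (a⁻¹ * a')⁆, h⁆ = ⁅y, σ h⁆ := by
      rw [map_commutatorElement, map_commutatorElement]
    rw [e1, commutatorElement_def]
    group
  have sh : σ h * y⁻¹ * (σ h)⁻¹ ∈ stabSet A := mul_mem (mul_mem hh (inv_mem sy)) (inv_mem hh)
  rw [e]
  exact ⟨mul_mem sy sh, bound_mul b2 (bound_conj b2' hh (hc h)) sh⟩

/-- A point fixed by the constants `genA`, `genB` is fixed by all elements with values in the
core. -/
theorem core_fixed {σ : LocallyConstant X (Dd 0 1) →* (ℝ ≃o ℝ)} {P : Subgroup (ℝ ≃o ℝ)}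
    (hP : RootClosed P) (h1 : σ (lcConst X genA) ∈ P) (h2 : σ (lcConst X genB) ∈ P)
    {θ : LocallyConstant X (Dd 0 1)} (hθ : ∀ x, (θ x : ℝ ≃o ℝ) ∈ Dc coreL coreR) :
    σ θ ∈ P := by
  have hr := hP.comap σ
  obtain ⟨a, a', ha, ha', hx⟩ := exists_displacing
  refine mem_of_Dc core_bounds.1.le core_bounds.2.2.le hr (fun θ hθ => ?_) θ hθ
  obtain ⟨f, h, hP, rfl⟩ := exists_core_commutator ha ha' hx θ hθ
  obtain ⟨hf, hh⟩ := hP _ hr h1 h2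
  have sa : lcConst X a ∈ P.comap σ := hr _ 2 two_pos (by rw [← map_pow, ha]; exact h1)
  have sa' : lcConst X a' ∈ P.comap σ := hr _ 2 two_pos (by rw [← map_pow, ha']; exact h1)
  have sx : lcConst X (a⁻¹ * a') ∈ P.comap σ := by
    rw [map_mul, map_inv]; exact mul_mem (inv_mem sa) sa'
  have hy : ⁅f, lcConst X (a⁻¹ * a')⁆ ∈ P.comap σ :=
    mul_mem (mul_mem (mul_mem hf sx) (inv_mem hf)) (inv_mem sx)
  exact mul_mem (mul_mem (mul_mem hy hh) (inv_mem hy)) (inv_mem hh)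

/-- The stabilizer of a point is root-closed, so piecewise linear values suffice. -/
theorem fixed_of_fixed_PLc {σ : LocallyConstant X (Dd 0 1) →* (ℝ ≃o ℝ)} {t : ℝ}
    (h : ∀ θ : LocallyConstant X (Dd 0 1), (∀ x, (θ x : ℝ ≃o ℝ) ∈ PLc coreL coreR) → σ θ t = t)
    {θ : LocallyConstant X (Dd 0 1)} (hθ : ∀ x, (θ x : ℝ ≃o ℝ) ∈ Dc coreL coreR) : σ θ t = t :=
  mem_of_Dc (P := (fixPt t).comap σ) core_bounds.1.le core_bounds.2.2.le
    ((rootClosed_fixPt t).comap σ) h θ hθ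

end Bound

/-! ### Components of the set of moved points -/

/-- The points that are not separated from `t` by a fixed point of `R`. -/
def component (R : ℝ ≃o ℝ) (t : ℝ) : Set ℝ := {s | ∀ p ∈ uIcc s t, R p ≠ p}

theorem mem_component_self {R : ℝ ≃o ℝ} {t : ℝ} : t ∈ component R t ↔ R t ≠ t := by
  simp [component]

theorem uIcc_subset_component {R : ℝ ≃o ℝ} {s t : ℝ} (hs : s ∈ component R t) :
    uIcc s t ⊆ component R t := fun _ hq _ hp => hs _ (uIcc_subset_uIcc_right hq hp)

theorem ordConnected_component (R : ℝ ≃o ℝ) (t : ℝ) : (component R t).OrdConnected := by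
  refine ⟨fun x hx y hy z hz => ?_⟩
  rcases le_total z t with h | h
  · exact uIcc_subset_component hx (mem_uIcc_of_le hz.1 h)
  · exact uIcc_subset_component hy (mem_uIcc_of_ge h hz.2)

theorem lt_apply_of_mem_component {R : ℝ ≃o ℝ} {t : ℝ} (ht : t < R t) {q : ℝ}
    (hq : q ∈ component R t) : q < R q := by
  by_contra hlt
  push Not at hlt
  have hc : ContinuousOn (fun p => R p - p) (uIcc q t) := by
    have := R.continuous
    fun_prop
  have h0 : (0 : ℝ) ∈ uIcc (R q - q) (R t - t) :=
    mem_uIcc_of_le (by linarith) (by linarith)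
  obtain ⟨p, hp, h⟩ := intermediate_value_uIcc hc h0
  exact hq p hp (by simpa [sub_eq_zero] using h)

theorem image_uIcc_orderIso (g : ℝ ≃o ℝ) (a b : ℝ) : g '' uIcc a b = uIcc (g a) (g b) := by
  rcases le_total a b with h | h
  · rw [uIcc_of_le h, uIcc_of_le (g.monotone h), g.image_Icc]
  · rw [uIcc_of_ge h, uIcc_of_ge (g.monotone h), g.image_Icc]

theorem no_fixed_image {R g : ℝ ≃o ℝ} (hc : Commute g R) {a b : ℝ} (h : ∀ p ∈ uIcc a b, R p ≠ p) :
    ∀ p ∈ uIcc (g a) (g b), R p ≠ p := by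
  intro p hp
  rw [← image_uIcc_orderIso] at hp
  obtain ⟨p, hp, rfl⟩ := hp
  have := DFunLike.congr_fun hc.eq p
  simp only [RelIso.mul_apply] at this
  rw [← this]
  exact fun h' => h p hp (g.injective h')

/-- Commuting maps carry intervals without fixed points of `R` to such intervals, so the position of
`g t` decides that of the whole component. -/
theorem mem_stabSet_component {R g : ℝ ≃o ℝ} {t : ℝ} (hc : Commute g R)
    (hg : g t ∈ component R t) : g ∈ stabSet (component R t) := by
  have key : ∀ g : ℝ ≃o ℝ, Commute g R → g t ∈ component R t → ∀ q ∈ component R t,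
      g q ∈ component R t := by
    intro g hc hg q hq p hp
    rcases uIcc_subset_uIcc_union_uIcc (b := g t) hp with h | h
    · exact no_fixed_image hc hq p h
    · exact hg p h
  have hg' : g⁻¹ t ∈ component R t := by
    intro p hp
    have := no_fixed_image hc.inv_left hg p
    rw [inv_apply_self', uIcc_comm] at this
    exact this hp
  intro q
  refine ⟨fun hq => ?_, key g hc hg q⟩
  have := key g⁻¹ hc.inv_left hg' _ hq
  rwa [inv_apply_self'] at this

/-- If `R'` fixed a point `p` of the component, it would carry the fixed-point-free interval between
`p` and `t` to the one between `p` and `R' t`, and `R' t` could not leave. The inclusion is strict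
since `R' t` lies in the component of `R'`. -/
theorem component_ssubset {R R' : ℝ ≃o ℝ} {t : ℝ} (hc : Commute R' R) (ht : R t ≠ t)
    (h : R' t ∉ component R t) : R' t ≠ t ∧ component R t ⊂ component R' t := by
  have hne : R' t ≠ t := fun h' => h (by rw [h']; exact mem_component_self.2 ht)
  refine ⟨hne, Set.ssubset_iff_subset_ne.2 ⟨fun q hq p hp hfix => h ?_, fun he => h ?_⟩⟩
  · intro r hr
    have hp1 : ∀ z ∈ uIcc p t, R z ≠ z := uIcc_subset_component hq hp
    have hp2 := no_fixed_image hc hp1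
    rw [hfix] at hp2
    rcases uIcc_subset_uIcc_union_uIcc (b := p) hr with h1 | h1
    · rw [uIcc_comm] at h1
      exact hp2 r h1
    · exact hp1 r h1
  · rw [he]
    intro p hp hfix
    rcases le_total t (R' t) with h1 | h1
    · rw [uIcc_of_ge h1] at hp
      have h2 : t < p := lt_of_le_of_ne hp.1 fun h' => hne (by rw [h', hfix])
      have := R'.strictMono h2
      rw [hfix] at this
      exact absurd hp.2 (not_le.2 this)
    · rw [uIcc_of_le h1] at hp
      have h2 : p < t := lt_of_le_of_ne hp.2 fun h' => hne (by rw [← h', hfix])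
      have := R'.strictMono h2
      rw [hfix] at this
      exact absurd hp.1 (not_le.2 this)

section Family

variable {X : Type*} [TopologicalSpace X] [CompactSpace X]

/-- In a finite family of actions, some member has the property that all members commuting with it
have common fixed points for their cores near `t`. -/
theorem exists_common_fixed {ι : Type*} [Finite ι]
    (σ : ι → LocallyConstant X (Dd 0 1) →* (ℝ ≃o ℝ)) (t : ℝ) :
    (∀ k, ∀ θ : LocallyConstant X (Dd 0 1), (∀ x, (θ x : ℝ ≃o ℝ) ∈ Dc coreL coreR) →
      σ k θ t = t) ∨
    ∃ i, ∃ r : Dd 0 1, ∃ t', t ≤ t' ∧ t' ≤ σ i (lcConst X r) t ∧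
      ∀ k, (∀ f g, Commute (σ k f) (σ i g)) → ∀ θ : LocallyConstant X (Dd 0 1),
        (∀ x, (θ x : ℝ ≃o ℝ) ∈ Dc coreL coreR) → σ k θ t' = t' := by
  let gen : Bool → Dd 0 1 := fun b => if b then genA else genB
  let R : ι × Bool → ℝ ≃o ℝ := fun p => σ p.1 (lcConst X (gen p.2))
  by_cases hall : ∀ p, R p t = t
  · left
    intro k θ hθ
    exact core_fixed (P := fixPt t) (rootClosed_fixPt t) (hall (k, true)) (hall (k, false)) hθ
  right
  push Not at hall
  -- By `component_ssubset`, maximality of the component forces every generator commuting with the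
  -- chosen one to preserve it.
  obtain ⟨⟨i, b⟩, hib, hmax⟩ := Set.Finite.exists_maximalFor (fun p => component (R p) t)
    {p | R p t ≠ t} (Set.toFinite _) hall
  -- choose the sign that pushes up
  obtain ⟨r, hr, hroots, hcomp⟩ : ∃ r : Dd 0 1, t < σ i (lcConst X r) t ∧
      (∀ m : ℕ, ∃ s : Dd 0 1, s ^ (2 ^ m) = r) ∧
      component (σ i (lcConst X r)) t = component (R (i, b)) t := by
    have hg : ∀ m : ℕ, ∃ s : Dd 0 1, s ^ (2 ^ m) = gen b := by
      intro m
      cases b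
      · obtain ⟨s, hs, h⟩ := exists_root_shiftB m
        exact ⟨⟨s, hs⟩, Subtype.ext h⟩
      · obtain ⟨s, hs, h⟩ := exists_root_shiftA m
        exact ⟨⟨s, hs⟩, Subtype.ext h⟩
    rcases lt_or_gt_of_ne hib with h | h
    · refine ⟨(gen b)⁻¹, ?_, fun m => ?_, ?_⟩
      · rw [map_inv, map_inv, ← (R (i, b)).lt_iff_lt]
        change _ < R (i, b) ((R (i, b))⁻¹ t)
        rw [apply_inv_self']; exact h
      · obtain ⟨s, hs⟩ := hg m
        exact ⟨s⁻¹, by rw [inv_pow, hs]⟩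
      · ext s
        rw [map_inv, map_inv]
        refine forall₂_congr fun p _ => not_congr ?_
        change (R (i, b))⁻¹ p = p ↔ _
        rw [← (R (i, b)).injective.eq_iff, apply_inv_self', eq_comm]
    · exact ⟨gen b, h, hg, rfl⟩
  set Q := σ i (lcConst X r) with hQ
  set A := component Q t with hA
  have hAo : A.OrdConnected := ordConnected_component Q t
  have htA : t ∈ A := mem_component_self.2 hr.ne'
  let I : Set ι := {k | ∀ f g, Commute (σ k f) (σ i g)}
  -- generators of the commuting members preserve the component
  have stab : ∀ k ∈ I, ∀ b', σ k (lcConst X (gen b')) ∈ stabSet A := by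
    intro k hk b'
    refine mem_stabSet_component (hk _ _) ?_
    by_contra hn
    obtain ⟨h1, h2⟩ := component_ssubset (hk _ _) hr.ne' hn
    have h3 : component (R (i, b)) t ⊆ component (R (k, b')) t := by
      rw [← hcomp]; exact h2.1
    have h4 := hmax (j := (k, b')) h1 h3
    change component (R (k, b')) t ⊆ component (R (i, b)) t at h4
    rw [← hcomp] at h4
    exact h2.2 h4
  let S : Set (ℝ ≃o ℝ) := {g | ∃ k ∈ I, ∃ θ : LocallyConstant X (Dd 0 1),
    (∀ x, (θ x : ℝ ≃o ℝ) ∈ PLc coreL coreR) ∧ σ k θ = g}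
  -- words of bounded length are dominated by high roots of `Q`
  have words : ∀ g ∈ Subgroup.closure S, g ∈ stabSet A ∧ ∃ N : ℕ, ∀ s : Dd 0 1,
      (∀ q ∈ A, q < σ i (lcConst X s) q) →
      (∀ q ∈ A, g q ≤ (σ i (lcConst X s) ^ N) q) ∧
      (∀ q ∈ A, g⁻¹ q ≤ (σ i (lcConst X s) ^ N) q) := by
    intro g hg
    induction hg using Subgroup.closure_induction with
    | mem g hg =>
      obtain ⟨k, hk, θ, hθ, rfl⟩ := hg
      have hst : σ k θ ∈ stabSet A := (core_bound hAo
        (fun q hq => lt_apply_of_mem_component hr hq) (fun f => hk f _) (stab k hk true)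
        (stab k hk false) hθ).1
      refine ⟨hst, 4, fun s hs => ⟨?_, ?_⟩⟩
      · exact (core_bound hAo hs (fun f => hk f _) (stab k hk true) (stab k hk false) hθ).2
      · rw [← map_inv]
        exact (core_bound hAo hs (fun f => hk f _) (stab k hk true) (stab k hk false)
          (θ := θ⁻¹) fun x => inv_mem (hθ x)).2
    | one => exact ⟨one_mem _, 0, fun s _ => ⟨fun q _ => by simp, fun q _ => by simp⟩⟩
    | mul a b _ _ ha hb =>
      obtain ⟨ha, N, hN⟩ := ha
      obtain ⟨hb, M, hM⟩ := hb
      refine ⟨mul_mem ha hb, N + M, fun s hs => ⟨bound_mul (hN s hs).1 (hM s hs).1 hb, ?_⟩⟩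
      rw [mul_inv_rev, add_comm]
      exact bound_mul (hM s hs).2 (hN s hs).2 (inv_mem ha)
    | inv a _ ha =>
      obtain ⟨ha, N, hN⟩ := ha
      exact ⟨inv_mem ha, N, fun s hs => ⟨(hN s hs).2, by rw [inv_inv]; exact (hN s hs).1⟩⟩
  -- A word bounded by `κ ^ N` for every admissible `κ` is bounded by `Q`: choose `κ` with `κ ^ (2 ^
  -- N) = Q` and use `N ≤ 2 ^ N`. The bound is independent of the word, so the supremum of the orbit
  -- of `t` is a fixed point.
  have bdd : ∀ g ∈ Subgroup.closure S, g t ≤ Q t := by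
    intro g hg
    obtain ⟨-, N, hN⟩ := words g hg
    obtain ⟨s, hs⟩ := hroots N
    set κ := σ i (lcConst X s) with hκ
    have hκQ : κ ^ (2 ^ N) = Q := by rw [hκ, ← map_pow, ← map_pow, hs]
    have pos : ∀ q ∈ A, q < κ q := by
      intro q hq
      by_contra hle
      push Not at hle
      have h1 := pow_apply_le_of_le hle (2 ^ N) (by positivity)
      rw [hκQ] at h1
      exact absurd ((lt_apply_of_mem_component hr hq).trans_le h1) (not_lt.2 hle)
    refine ((hN s pos).1 t htA).trans ?_
    rw [← hκQ]
    obtain ⟨d, hd⟩ : ∃ d, 2 ^ N = N + d := ⟨2 ^ N - N, by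
      have := (Nat.lt_two_pow_self (n := N)).le; omega⟩
    rw [hd, pow_add]
    refine (κ ^ N).monotone ?_
    rcases Nat.eq_zero_or_pos d with rfl | h
    · simp
    · exact (pos t htA).le.trans (le_pow_apply_of_le (pos t htA).le d h)
  obtain ⟨t', h1, h2, h3⟩ := exists_fixed_of_bdd bdd
  refine ⟨i, r, t', h1, h2, fun k hk θ hθ => ?_⟩
  exact fixed_of_fixed_PLc (fun θ hθ => h3 _ (Subgroup.subset_closure ⟨k, hk, θ, hθ, rfl⟩)) hθ

end Family

end SolenoidalThompson
-- Unboundedness of the fixed points of families supported in compact subintervals.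
namespace SolenoidalThompson

open Set Filter Topology

/-- The pointwise maximum of two homeomorphisms. -/
def supIso (f g : ℝ ≃o ℝ) : ℝ ≃o ℝ where
  toFun t := max (f t) (g t)
  invFun t := min (f⁻¹ t) (g⁻¹ t)
  left_inv t := by
    rcases le_total (f t) (g t) with h | h
    · simp only [max_eq_right h, inv_apply_self']
      refine min_eq_right ?_
      rw [← f.le_iff_le, apply_inv_self']; exact h
    · simp only [max_eq_left h, inv_apply_self']
      refine min_eq_left ?_
      rw [← g.le_iff_le, apply_inv_self']; exact h
  right_inv t := by
    rcases le_total (f⁻¹ t) (g⁻¹ t) with h | h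
    · simp only [min_eq_left h, apply_inv_self']
      refine max_eq_left ?_
      have := g.monotone h
      rwa [apply_inv_self'] at this
    · simp only [min_eq_right h, apply_inv_self']
      refine max_eq_right ?_
      have := f.monotone h
      rwa [apply_inv_self'] at this
  map_rel_iff' {s t} := by
    simp only [Equiv.coe_fn_mk]
    constructor
    · intro h
      by_contra! hlt
      exact absurd h (not_le.2 (max_lt_max (f.strictMono hlt) (g.strictMono hlt)))
    · intro h
      exact max_le_max (f.monotone h) (g.monotone h)

theorem supIso_apply (f g : ℝ ≃o ℝ) (t : ℝ) : supIso f g t = max (f t) (g t) := rfl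

/-- Allows a single `κ`, commuting with a whole group, that moves up every point not fixed by both
generators. -/
theorem commute_supIso {c f g : ℝ ≃o ℝ} (hf : Commute c f) (hg : Commute c g) :
    Commute c (supIso f g) := by
  ext t
  have h1 := DFunLike.congr_fun hf.eq t
  have h2 := DFunLike.congr_fun hg.eq t
  simp only [RelIso.mul_apply, supIso_apply] at h1 h2 ⊢
  rw [c.monotone.map_max, h1, h2]

/-- Conjugation by `S`, from the maps on `(a, b)` to the maps on `(S a, S b)`. -/
def conjHom (S : ℝ ≃o ℝ) (hS : S ∈ plSub) (a b : ℝ) : Dd a b →* Dd (S a) (S b) where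
  toFun g := ⟨S * g * S⁻¹, by
    have hd : S * g * S⁻¹ ∈ dSub := mul_mem (mul_mem (plSub_le_dSub hS) g.2.1)
      (inv_mem (plSub_le_dSub hS))
    have := conj_mem_fixOff g.2.2 S
    rw [image_Ioo_orderIso] at this
    exact ⟨hd, this⟩⟩
  map_one' := by ext; simp
  map_mul' g h := by
    apply Subtype.ext
    change S * (g * h) * S⁻¹ = S * g * S⁻¹ * (S * h * S⁻¹)
    group

/-- Postcomposition with a homomorphism. -/
def lcMap {X : Type*} [TopologicalSpace X] {E F : Type*} [Group E] [Group F] (j : E →* F) :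
    LocallyConstant X E →* LocallyConstant X F where
  toFun f := f.map j
  map_one' := by ext x; exact map_one j
  map_mul' f g := by ext x; exact map_mul j _ _

section Unbounded

variable {X : Type*} [TopologicalSpace X]

/-- The points fixed by all functions with values supported in `(p, q)`. -/
def fixSet (σ : LocallyConstant X (Dd 0 1) →* (ℝ ≃o ℝ)) (p q : ℝ) : Set ℝ :=
  {y | ∀ θ : LocallyConstant X (Dd 0 1), (∀ x, (θ x : ℝ ≃o ℝ) ∈ Dd p q) → σ θ y = y}

variable {σ : LocallyConstant X (Dd 0 1) →* (ℝ ≃o ℝ)}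

theorem lc_commute {p q p' q' : ℝ} (h : Disjoint (Ioo p q) (Ioo p' q'))
    {θ θ' : LocallyConstant X (Dd 0 1)} (h1 : ∀ x, (θ x : ℝ ≃o ℝ) ∈ Dd p q)
    (h2 : ∀ x, (θ' x : ℝ ≃o ℝ) ∈ Dd p' q') : Commute θ θ' := by
  ext x : 1
  exact Subtype.ext (fixOff_commute h (h1 x).2 (h2 x).2)

theorem apply_mem_fixSet {p q p' q' : ℝ} (h : Disjoint (Ioo p q) (Ioo p' q'))
    {θ : LocallyConstant X (Dd 0 1)} (hθ : ∀ x, (θ x : ℝ ≃o ℝ) ∈ Dd p' q') {y : ℝ}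
    (hy : y ∈ fixSet σ p q) : σ θ y ∈ fixSet σ p q := by
  intro θ' hθ'
  have := DFunLike.congr_fun ((lc_commute h hθ' hθ).map σ).eq y
  simp only [RelIso.mul_apply] at this
  rw [this, hy θ' hθ']

/-- Families on disjoint intervals commute, so those on `(p', q')` preserve the fixed set of `(p,
q)`. Since that set is bounded, so is the orbit of `y`, and its supremum is fixed. -/
theorem exists_fixSet_ge {p q p' q' M : ℝ} (h : Disjoint (Ioo p q) (Ioo p' q'))
    (hM : ∀ y ∈ fixSet σ p q, y ≤ M) {y : ℝ} (hy : y ∈ fixSet σ p q) :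
    ∃ y' ∈ fixSet σ p' q', y ≤ y' := by
  let G : Subgroup (LocallyConstant X (Dd 0 1)) :=
    { carrier := {θ | ∀ x, (θ x : ℝ ≃o ℝ) ∈ Dd p' q'}
      mul_mem' := fun ha hb x => mul_mem (ha x) (hb x)
      one_mem' := fun x => one_mem _
      inv_mem' := fun ha x => inv_mem (ha x) }
  obtain ⟨s, h1, -, h3⟩ := exists_fixed_of_bdd (K := G.map σ) (p := y) (M := M) (by
    rintro _ ⟨θ, hθ, rfl⟩
    exact hM _ (apply_mem_fixSet h hθ hy))
  exact ⟨s, fun θ hθ => h3 _ ⟨θ, hθ, rfl⟩, h1⟩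

/-- A piecewise linear map carrying `(p', q')` onto `(p, q)` conjugates one group to the other, so
boundedness does not depend on the interval. -/
theorem bdd_fixSet {p q p' q' M : ℝ} (hp : p ∈ dyadic) (hq : q ∈ dyadic) (hp' : p' ∈ dyadic)
    (hq' : q' ∈ dyadic) (h0 : 0 < p) (h1 : p < q) (h2 : q < 1) (h0' : 0 < p') (h1' : p' < q')
    (h2' : q' < 1) (hM : ∀ y ∈ fixSet σ p q, y ≤ M) : ∃ M', ∀ y ∈ fixSet σ p' q', y ≤ M' := by
  obtain ⟨g, hg, hg1, hgp, hgq⟩ := exists_pl_map_pair (zero_mem dyadic) (one_mem dyadic) hp' hq'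
    hp hq h0' h1' h2' h0 h1 h2
  have hgE : g ∈ Dd 0 1 := ⟨plSub_le_dSub hg, hg1⟩
  set c := lcConst X (⟨g, hgE⟩ : Dd 0 1) with hc
  refine ⟨(σ c)⁻¹ M, fun y hy => ?_⟩
  rw [← (σ c).le_iff_le, apply_inv_self']
  refine hM _ fun θ hθ => ?_
  have hθ' : ∀ x, ((c⁻¹ * θ * c) x : ℝ ≃o ℝ) ∈ Dd p' q' := fun x => by
    have e : ((c⁻¹ * θ * c) x : ℝ ≃o ℝ) = g⁻¹ * θ x * g := rfl
    have hd : g⁻¹ * (θ x : ℝ ≃o ℝ) * g ∈ dSub :=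
      mul_mem (mul_mem (inv_mem (plSub_le_dSub hg)) (hθ x).1) (plSub_le_dSub hg)
    rw [e]
    refine ⟨hd, ?_⟩
    have := conj_mem_fixOff (hθ x).2 g⁻¹
    rw [image_Ioo_orderIso, inv_inv, ← hgp, ← hgq, inv_apply_self', inv_apply_self'] at this
    exact this
  have := congrArg (σ c) (hy _ hθ')
  rw [← RelIso.mul_apply, ← map_mul] at this
  rw [show c * (c⁻¹ * θ * c) = θ * c by group, map_mul] at this
  exact this

/-- The homomorphism rescaling the unit interval into itself. -/
def rescale (S : ℝ ≃o ℝ) (hS : S ∈ plSub) (h0 : 0 ≤ S 0) (h1 : S 1 ≤ 1) :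
    LocallyConstant X (Dd 0 1) →* LocallyConstant X (Dd 0 1) :=
  lcMap ((Subgroup.inclusion (Dd_mono h0 h1)).comp (conjHom S hS 0 1))

theorem rescale_apply (S : ℝ ≃o ℝ) (hS : S ∈ plSub) (h0 : 0 ≤ S 0) (h1 : S 1 ≤ 1)
    (θ : LocallyConstant X (Dd 0 1)) (x : X) :
    ((rescale S hS h0 h1 θ x : Dd 0 1) : ℝ ≃o ℝ) = S * θ x * S⁻¹ := rfl

theorem rescale_mem (S : ℝ ≃o ℝ) (hS : S ∈ plSub) (h0 : 0 ≤ S 0) (h1 : S 1 ≤ 1)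
    (θ : LocallyConstant X (Dd 0 1)) (x : X) :
    (rescale S hS h0 h1 θ x : ℝ ≃o ℝ) ∈ Dd (S 0) (S 1) := (conjHom S hS 0 1 (θ x)).2

/-- Families supported strictly inside the rescaled core are rescalings of core families, so the
results on cores apply to them. -/
theorem exists_rescale_eq (S : ℝ ≃o ℝ) (hS : S ∈ plSub) (h0 : 0 ≤ S 0) (h1 : S 1 ≤ 1) {c d : ℝ}
    (hc : coreL < c) (hd : d < coreR) {θ : LocallyConstant X (Dd 0 1)}
    (hθ : ∀ x, (θ x : ℝ ≃o ℝ) ∈ Dd (S c) (S d)) :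
    ∃ θ' : LocallyConstant X (Dd 0 1), (∀ x, (θ' x : ℝ ≃o ℝ) ∈ Dc coreL coreR) ∧
      rescale S hS h0 h1 θ' = θ := by
  classical
  have key : ∀ g ∈ Dd (S c) (S d), S⁻¹ * g * S ∈ Dc coreL coreR := fun g hg => by
    have e : ((conjHom S⁻¹ (inv_mem hS) _ _ ⟨g, hg⟩ : Dd _ _) : ℝ ≃o ℝ) = S⁻¹ * g * S := by
      change S⁻¹ * g * (S⁻¹)⁻¹ = _
      rw [inv_inv]
    have h : S⁻¹ * g * S ∈ Dd (S⁻¹ (S c)) (S⁻¹ (S d)) := by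
      rw [← e]; exact (conjHom S⁻¹ (inv_mem hS) _ _ ⟨g, hg⟩).2
    rw [inv_apply_self', inv_apply_self'] at h
    exact Dd_le_Dc hc hd h
  have le : Dc coreL coreR ≤ Dd 0 1 :=
    (Dc_le_Dd _ _).trans (Dd_mono core_bounds.1.le core_bounds.2.2.le)
  let F : Dd 0 1 → Dd 0 1 := fun g => if h : S⁻¹ * (g : ℝ ≃o ℝ) * S ∈ Dd 0 1 then ⟨_, h⟩ else 1
  have hF : ∀ x, (F (θ x) : ℝ ≃o ℝ) = S⁻¹ * θ x * S := fun x => by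
    have h := le (key _ (hθ x))
    simp only [F, dif_pos h]
  refine ⟨θ.map F, fun x => ?_, ?_⟩
  · change (F (θ x) : ℝ ≃o ℝ) ∈ _
    rw [hF]; exact key _ (hθ x)
  · ext x : 1
    apply Subtype.ext
    rw [rescale_apply]
    change S * (F (θ x) : ℝ ≃o ℝ) * S⁻¹ = _
    rw [hF]; group

variable [CompactSpace X]

/-- Fixed points of the functions supported in a compact subinterval are unbounded above. -/
theorem exists_fixSet_above (σ : LocallyConstant X (Dd 0 1) →* (ℝ ≃o ℝ)) {u v : ℝ}
    (hu : u ∈ dyadic) (hv : v ∈ dyadic) (h0 : 0 < u) (huv : u < v) (h1 : v < 1) (M : ℝ) :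
    ∃ y ∈ fixSet σ u v, M ≤ y := by
  by_contra! hcon
  have dy : ∀ i : ℤ, (i : ℝ) / 4 ∈ dyadic := fun i => by
    have := dyadic_div i 2; norm_num at this; exact this
  have e14 : (1 / 4 : ℝ) ∈ dyadic := by simpa using dy 1
  have e12 : (1 / 2 : ℝ) ∈ dyadic := by simpa using half_mem
  have e34 : (3 / 4 : ℝ) ∈ dyadic := by simpa using dy 3
  have bdd : ∀ p q : ℝ, p ∈ dyadic → q ∈ dyadic → 0 < p → p < q → q < 1 →
      ∃ M', ∀ y ∈ fixSet σ p q, y ≤ M' := fun p q hp hq a b c =>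
    bdd_fixSet hu hv hp hq h0 huv h1 a b c (M := M) fun y hy => (hcon y hy).le
  -- Two adjacent copies of the unit interval, `(1/4, 1/2)` and `(1/2, 3/4)`; their actions `ρ` and
  -- `ρ'` commute.
  set S : ℝ ≃o ℝ := affIso (-2) (1 / 4) with hS
  set S' : ℝ ≃o ℝ := affIso (-2) (1 / 2) with hS'
  have Sa : ∀ t, S t = t / 4 + 1 / 4 := fun t => by
    rw [hS, affIso_apply, zpow_neg]; norm_num; ring
  have Sa' : ∀ t, S' t = t / 4 + 1 / 2 := fun t => by
    rw [hS', affIso_apply, zpow_neg]; norm_num; ring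
  have Sm : S ∈ plSub := affIso_mem e14
  have Sm' : S' ∈ plSub := affIso_mem e12
  have S0 : S 0 = 1 / 4 := by rw [Sa]; norm_num
  have S1 : S 1 = 1 / 2 := by rw [Sa]; norm_num
  have S0' : S' 0 = 1 / 2 := by rw [Sa']; norm_num
  have S1' : S' 1 = 3 / 4 := by rw [Sa']; norm_num
  obtain ⟨c, hcd, hc1, hc2⟩ := exists_dyadic_between core_bounds.2.1
  obtain ⟨d, hdd, hd1, hd2⟩ := exists_dyadic_between hc2
  have c0 := core_bounds.1
  have d1 := core_bounds.2.2
  set ρ := σ.comp (rescale S Sm (by rw [S0]; norm_num) (by rw [S1]; norm_num)) with hρ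
  set ρ' := σ.comp (rescale S' Sm' (by rw [S0']; norm_num) (by rw [S1']; norm_num)) with hρ'
  -- Points above all fixed points of the first copy. Neither core has a fixed point here: by
  -- `exists_fixSet_ge` it would lead, through the disjoint copies, to a fixed point of the first
  -- copy at least as large.
  set A : Set ℝ := {y | ∀ p ∈ fixSet σ (1 / 4) (1 / 2), p < y} with hA
  have disj : ∀ {p q p' q' : ℝ}, q ≤ p' → Disjoint (Ioo p q) (Ioo p' q') := fun h =>
    Set.disjoint_left.2 fun x hx hx' => absurd (hx.2.trans_le h) (not_lt.2 hx'.1.le)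
  have dyS : ∀ t ∈ dyadic, S t ∈ dyadic := fun t ht => (plSub_apply_mem Sm).2 ht
  have dyS' : ∀ t ∈ dyadic, S' t ∈ dyadic := fun t ht => (plSub_apply_mem Sm').2 ht
  have nA : ∀ y ∈ A, y ∉ fixSet σ (S c) (S d) := by
    intro y hy hfix
    obtain ⟨B, hB⟩ := bdd (S c) (S d) (dyS c hcd) (dyS d hdd) (by rw [Sa]; linarith)
      (S.strictMono hd1) (by rw [Sa]; linarith)
    obtain ⟨y', hy', h2⟩ := exists_fixSet_ge (p' := 1 / 2) (q' := 3 / 4)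
      (disj (by rw [Sa]; linarith)) hB hfix
    obtain ⟨B', hB'⟩ := bdd (1 / 2) (3 / 4) e12 e34 (by norm_num) (by norm_num) (by norm_num)
    obtain ⟨y'', hy'', h3⟩ := exists_fixSet_ge (p' := 1 / 4) (q' := 1 / 2)
      (disj le_rfl).symm hB' hy'
    exact absurd (hy y'' hy'') (not_lt.2 (h2.trans h3))
  have nA' : ∀ y ∈ A, y ∉ fixSet σ (S' c) (S' d) := by
    intro y hy hfix
    obtain ⟨B, hB⟩ := bdd (S' c) (S' d) (dyS' c hcd) (dyS' d hdd) (by rw [Sa']; linarith)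
      (S'.strictMono hd1) (by rw [Sa']; linarith)
    obtain ⟨y', hy', h2⟩ := exists_fixSet_ge (p' := 1 / 4) (q' := 1 / 2)
      (disj (by rw [Sa']; linarith)).symm hB hfix
    exact absurd (hy y' hy') (not_lt.2 h2)
  have hAo : A.OrdConnected := ⟨fun x hx y _ z hz p hp => (hx p hp).trans_le hz.1⟩
  set a := ρ (lcConst X genA) with ha
  set b := ρ (lcConst X genB) with hb
  -- If `κ q ≤ q`, both generators of the first copy fix `q`, and so does its core. Hence `κ` moves
  -- all of `A` up. The second copy commutes with `κ`, so its core is bounded by `κ ^ 4` and has a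
  -- fixed point in `A`, which is absurd.
  set κ := supIso (supIso a a⁻¹) (supIso b b⁻¹) with hκ
  have κa : ∀ t, κ t = max (max (a t) (a⁻¹ t)) (max (b t) (b⁻¹ t)) := fun t => rfl
  have up : ∀ g : ℝ ≃o ℝ, ∀ t, max (g t) (g⁻¹ t) ≤ t → g t = t := fun g t h => by
    refine le_antisymm ((le_max_left _ _).trans h) ?_
    have := g.monotone ((le_max_right _ _).trans h)
    rwa [apply_inv_self'] at this
  have hpos : ∀ q ∈ A, q < κ q := by
    intro q hq
    by_contra hle
    rw [κa, not_lt, max_le_iff] at hle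
    refine nA q hq fun θ hθ => ?_
    obtain ⟨θ', h2, rfl⟩ := exists_rescale_eq S Sm (by rw [S0]; norm_num) (by rw [S1]; norm_num)
      hc1 hd2 hθ
    exact core_fixed (σ := ρ) (P := fixPt q) (rootClosed_fixPt q) (up a q hle.1) (up b q hle.2) h2
  have mV : ∀ (θ : LocallyConstant X (Dd 0 1)) (x : X), (rescale S Sm (by rw [S0]; norm_num) (by rw [S1]; norm_num) θ x : ℝ ≃o ℝ) ∈
      Dd (1 / 4) (1 / 2) := fun θ x => by
    exact Dd_mono S0.ge S1.le
      (rescale_mem S Sm (by rw [S0]; norm_num) (by rw [S1]; norm_num) θ x)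
  have mV' : ∀ (θ : LocallyConstant X (Dd 0 1)) (x : X), (rescale S' Sm' (by rw [S0']; norm_num) (by rw [S1']; norm_num) θ x :
      ℝ ≃o ℝ) ∈ Dd (1 / 2) (3 / 4) := fun θ x => by
    exact Dd_mono S0'.ge S1'.le
      (rescale_mem S' Sm' (by rw [S0']; norm_num) (by rw [S1']; norm_num) θ x)
  have cc : ∀ θ θ', Commute (ρ' θ) (ρ θ') := fun θ θ' =>
    (lc_commute (disj le_rfl).symm (mV' θ) (mV θ')).map σ
  have hcomm : ∀ θ, Commute (ρ' θ) κ := fun θ => commute_supIso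
    (commute_supIso (cc _ _) (cc _ _).inv_right) (commute_supIso (cc _ _) (cc _ _).inv_right)
  have pres : ∀ θ, ρ' θ ∈ stabSet A := by
    have one : ∀ θ, ∀ q ∈ A, ρ' θ q ∈ A := fun θ q hq p hp => by
      have h2 : ρ' θ⁻¹ p ∈ fixSet σ (1 / 4) (1 / 2) :=
        apply_mem_fixSet (disj le_rfl) (mV' θ⁻¹) hp
      have := (ρ' θ).strictMono (hq _ h2)
      rwa [map_inv, apply_inv_self'] at this
    intro θ q
    refine ⟨fun h => ?_, one θ q⟩
    have := one θ⁻¹ _ h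
    rwa [map_inv, inv_apply_self'] at this
  obtain ⟨q, hq⟩ : ∃ q, q ∈ A := by
    obtain ⟨B, hB⟩ := bdd (1 / 4) (1 / 2) e14 e12 (by norm_num) (by norm_num) (by norm_num)
    exact ⟨B + 1, fun p hp => by linarith [hB p hp]⟩
  let G : Subgroup (LocallyConstant X (Dd 0 1)) :=
    { carrier := {θ | ∀ x, (θ x : ℝ ≃o ℝ) ∈ PLc coreL coreR}
      mul_mem' := fun ha hb x => mul_mem (ha x) (hb x)
      one_mem' := fun x => one_mem _
      inv_mem' := fun ha x => inv_mem (ha x) }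
  obtain ⟨s, hs1, -, hs3⟩ := exists_fixed_of_bdd (K := G.map ρ') (p := q) (M := (κ ^ 4) q) (by
    rintro _ ⟨θ, hθ, rfl⟩
    exact (core_bound hAo hpos hcomm (pres _) (pres _) hθ).2 q hq)
  refine nA' s (fun p hp => (hq p hp).trans_le hs1) fun θ hθ => ?_
  obtain ⟨θ', h2, rfl⟩ := exists_rescale_eq S' Sm' (by rw [S0']; norm_num) (by rw [S1']; norm_num)
      hc1 hd2 hθ
  exact fixed_of_fixed_PLc (σ := ρ') (fun θ hθ => hs3 _ ⟨θ, hθ, rfl⟩) h2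

end Unbounded

end SolenoidalThompson
-- Lifts of group elements to the leaves.
namespace SolenoidalThompson

open Set Filter Topology

namespace ReversibleSystem

section Lifts

variable {X : Type*} [TopologicalSpace X] {S : ReversibleSystem X}

theorem isOpenMap_projZ : IsOpenMap S.projZ := by
  intro U hU
  have : S.projZ ⁻¹' (S.projZ '' U) = ⋃ p : ℤˣ × ℤ,
      (fun a : X × ℝ => (S.actX p.1 p.2 a.1, isometryHomeo p.1 p.2 a.2)) ⁻¹' U := by
    ext a
    simp only [mem_preimage, mem_image, mem_iUnion]
    constructor
    · rintro ⟨b, hb, h⟩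
      obtain ⟨ε, n, h1, h2⟩ := S.exists_act h.symm
      refine ⟨(ε, n), ?_⟩
      rw [h1, h2]
      exact hb
    · rintro ⟨p, h⟩
      exact ⟨_, h, S.projZ_act _ _ _ _⟩
  change IsOpen (S.projZ ⁻¹' (S.projZ '' U))
  rw [this]
  exact isOpen_iUnion fun p => hU.preimage
    (((S.actX p.1 p.2).continuous.comp continuous_fst).prodMk
      ((isometryHomeo p.1 p.2).continuous.comp continuous_snd))

theorem isOpenQuotientMap_projZ : IsOpenQuotientMap S.projZ :=
  ⟨S.projZ_surjective, S.continuous_projZ, isOpenMap_projZ⟩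

/-- The preimage is the union of the dihedral translates of `C × [a, b]`, which is locally finite
because the real coordinate leaves only finitely many `n`. -/
theorem isClosed_image_projZ {C : Set X} (hC : IsClosed C) (a b : ℝ) :
    IsClosed (S.projZ '' (C ×ˢ Icc a b)) := by
  have : S.projZ ⁻¹' (S.projZ '' (C ×ˢ Icc a b)) = ⋃ p : ℤˣ × ℤ,
      (fun a : X × ℝ => (S.actX p.1 p.2 a.1, isometryHomeo p.1 p.2 a.2)) ⁻¹' (C ×ˢ Icc a b) := by
    ext a
    simp only [mem_preimage, mem_image, mem_iUnion]
    constructor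
    · rintro ⟨b, hb, h⟩
      obtain ⟨ε, n, h1, h2⟩ := S.exists_act h.symm
      refine ⟨(ε, n), ?_⟩
      rw [h1, h2]
      exact hb
    · rintro ⟨p, h⟩
      exact ⟨_, h, S.projZ_act _ _ _ _⟩
  rw [← isOpenQuotientMap_projZ.isQuotientMap.isClosed_preimage, this]
  refine LocallyFinite.isClosed_iUnion ?_ fun p => (hC.prod isClosed_Icc).preimage
    (((S.actX p.1 p.2).continuous.comp continuous_fst).prodMk
      ((isometryHomeo p.1 p.2).continuous.comp continuous_snd))
  rintro ⟨x, t⟩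
  refine ⟨univ ×ˢ Ioo (t - 1) (t + 1),
    prod_mem_nhds univ_mem (Ioo_mem_nhds (by linarith) (by linarith)), ?_⟩
  refine (finite_univ.prod (finite_Icc (⌊-|t| - 1 - b⌋) (⌈|t| + 1 - a⌉))).subset ?_
  rintro ⟨ε, n⟩ ⟨⟨y, s⟩, ⟨-, h1⟩, -, h2⟩
  have h1 : a ≤ (ε : ℤ) * s - n ∧ (ε : ℤ) * s - n ≤ b := h1
  simp only [mem_Ioo] at h2
  have h3 : |((ε : ℤ) : ℝ) * s| ≤ |t| + 1 := by
    have : |s| ≤ |t| + 1 := by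
      rw [abs_le]
      constructor <;> linarith [neg_abs_le t, le_abs_self t]
    rcases Int.units_eq_one_or ε with rfl | rfl <;> simpa using this
  rw [abs_le] at h3
  refine ⟨mem_univ _, ?_, ?_⟩
  · have : (⌊-|t| - 1 - b⌋ : ℝ) ≤ n := (Int.floor_le _).trans (by linarith)
    exact_mod_cast this
  · have : (n : ℝ) ≤ ⌈|t| + 1 - a⌉ := le_trans (by linarith) (Int.le_ceil _)
    exact_mod_cast this

/-- Lifts of points in a leaf are determined up to the period of the leaf. -/
theorem projZ_eq_iff_same {x : X} {s t : ℝ} : S.projZ (x, s) = S.projZ (x, t) ↔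
    ∃ n : ℤ, (S.φ ^ n) x = x ∧ t = s - n := by
  rw [projZ_eq_iff]
  constructor
  · rintro ⟨n, h | h⟩
    · rw [Prod.mk.injEq] at h
      exact ⟨n, h.1.symm, h.2⟩
    · exfalso
      apply S.σ_not_mem_orbit x (-n)
      have e1 : x = (S.φ ^ n) (S.σ x) := congrArg Prod.fst h
      conv_lhs => rw [e1]
      rw [S.zpow_zpow]; simp
  · rintro ⟨n, h1, h2⟩
    exact ⟨n, Or.inl (by simp only [h1, h2])⟩

variable [CompactSpace X] [TopologicalSpace.MetrizableSpace X] [TotallyDisconnectedSpace X]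

theorem compactSpace_dihedral : CompactSpace S.DihedralSuspension := by
  have := compactSpace_suspension (S := S)
  have hc : Continuous S.toDihedral := by
    rw [S.isOpenQuotientMap_projY.continuous_comp_iff.symm]
    exact S.continuous_projZ
  have hs : range S.toDihedral = univ := by
    refine eq_univ_of_forall fun z => ?_
    obtain ⟨a, rfl⟩ := S.projZ_surjective z
    exact ⟨S.projY a, rfl⟩
  rw [← isCompact_univ_iff, ← hs]
  exact isCompact_range hc

/-- The lift of `g` to the leaf of `x`: the homeomorphism `t ↦ t + τ_g (π_Y (x, t))`. -/
noncomputable def leafMap (g : S.thompsonGroup) (x : X) : ℝ ≃o ℝ :=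
  orbitAction (S.projY (x, 0)) g

theorem leafMap_apply (g : S.thompsonGroup) (x : X) (t : ℝ) :
    leafMap g x t = t + translationCocycle g (S.projY (x, t)) := by
  rw [leafMap, orbitAction_apply, flow_projY, zero_add]

theorem leafMap_one (x : X) : leafMap (1 : S.thompsonGroup) x = 1 := map_one _

theorem leafMap_mul (g h : S.thompsonGroup) (x : X) :
    leafMap (g * h) x = leafMap g x * leafMap h x := map_mul _ _ _

theorem leafMap_inv (g : S.thompsonGroup) (x : X) : leafMap g⁻¹ x = (leafMap g x)⁻¹ :=
  map_inv _ _

theorem projZ_leafMap (g : S.thompsonGroup) (x : X) (t : ℝ) :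
    S.projZ (x, leafMap g x t) = g.1 (S.projZ (x, t)) := by
  rw [← toDihedral_projY, ← toDihedral_projY, ← (translationCocycle_spec g).toDihedral_flow,
    flow_projY, leafMap_apply]

theorem continuous_leafMap (g : S.thompsonGroup) :
    Continuous fun p : X × ℝ => leafMap g p.1 p.2 := by
  simp only [leafMap_apply]
  exact continuous_snd.add ((translationCocycle_spec g).continuous.comp S.continuous_projY)

theorem leafMap_zpow (g : S.thompsonGroup) (n : ℤ) (x : X) (t : ℝ) :
    leafMap g ((S.φ ^ n) x) (t - n) = leafMap g x t - n := by
  rw [leafMap_apply, leafMap_apply, (S.projY_eq_iff (a := (x, t))).2 ⟨n, rfl⟩]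
  ring

/-- Two lifts differ by a period of the leaf, which vanishes over nonperiodic points; these are
dense. The local form is what is needed in charts. -/
theorem leafMap_unique {g : S.thompsonGroup} {U : Set (X × ℝ)} (hU : IsOpen U) {θ : X × ℝ → ℝ}
    (hθ : ContinuousOn θ U) (h : ∀ p ∈ U, S.projZ (p.1, θ p) = g.1 (S.projZ p)) :
    ∀ p ∈ U, leafMap g p.1 p.2 = θ p := by
  by_contra! hne
  have hW : IsOpen (U ∩ (fun p => leafMap g p.1 p.2 - θ p) ⁻¹' {0}ᶜ) :=
    ((continuous_leafMap g).continuousOn.sub hθ).isOpen_inter_preimage hU isOpen_compl_singleton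
  obtain ⟨p, hp, hne⟩ := hne
  obtain ⟨⟨x, t⟩, ⟨h1, h2⟩, hx⟩ := (S.topologicallyFree.preimage
    (isOpenMap_fst (X := X) (Y := ℝ))).inter_open_nonempty _ hW ⟨p, hp, fun h => hne (sub_eq_zero.1 h)⟩
  have e := (projZ_leafMap g x t).trans (h _ h1).symm
  obtain ⟨n, e1, e2⟩ := projZ_eq_iff_same.1 e
  have hn : n = 0 := by
    by_contra hn
    exact hx n hn e1
  apply h2
  rw [hn] at e2
  simp only [mem_singleton_iff]
  push_cast at e2
  linarith

/-- The leaves of `x` and `σ x` have the same image in `Z`, with opposite orientations. Conjugating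
the lift by this reversal gives another lift of `g`, hence the same one. -/
theorem leafMap_σ (g : S.thompsonGroup) (x : X) (t : ℝ) :
    leafMap g (S.σ x) (-t) = -leafMap g x t := by
  have hq : ∀ p : X × ℝ, S.projZ (S.σ p.1, -p.2) = S.projZ p := fun p =>
    (S.projZ_eq_iff.2 ⟨0, Or.inr (by simp)⟩).symm
  have := leafMap_unique (g := g) isOpen_univ (θ := fun p => -leafMap g (S.σ p.1) (-p.2))
    ((((continuous_leafMap g).comp ((S.σ.continuous.comp continuous_fst).prodMk
      continuous_snd.neg)).neg).continuousOn) (fun p _ => by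
      have h1 := hq (p.1, -leafMap g (S.σ p.1) (-p.2))
      simp only [neg_neg] at h1
      rw [← h1, projZ_leafMap, hq]) (x, t) (mem_univ _)
  simp only at this
  rw [this, neg_neg]

/-- By uniqueness of lifts, all leaf maps over a chart coincide with the type `𝔇` map of that chart.
-/
theorem exists_local_leafMap (g : S.thompsonGroup) (x : X) (t : ℝ) :
    ∃ (C : Set X) (e : OpenPartialHomeomorph ℝ ℝ), IsClopen C ∧ x ∈ C ∧ t ∈ e.source ∧ IsTypeD e ∧
      ∀ y ∈ C, ∀ s ∈ e.source, leafMap g y s = e s := by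
  obtain ⟨D, e, k, hD, -⟩ := g.2 (S.projZ (x, t))
  obtain ⟨C, f, k, hx, ht⟩ := k.move hD
  refine ⟨C, f, k.1.1, hx, ht, k.2.2.1, fun y hy s hs => ?_⟩
  exact leafMap_unique (U := C ×ˢ f.source) (k.1.1.isOpen.prod f.open_source) (θ := fun p => f p.2)
    (f.continuousOn.comp continuousOn_snd fun p hp => hp.2)
    (fun p hp => (k.2.2.2.2 p.1 hp.1 p.2 hp.2).symm) (y, s) ⟨hy, hs⟩

theorem leafMap_mem_dSub (g : S.thompsonGroup) (x : X) : leafMap g x ∈ dSub := fun t => by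
  obtain ⟨C, e, hC, hx, ht, he, h⟩ := exists_local_leafMap g x t
  exact ⟨e, ht, he, h x hx⟩

/-- Transverse local constancy, made uniform in `t` by compactness; it turns families of leaf maps
into locally constant functions. -/
theorem eventually_leafMap_eq (g : S.thompsonGroup) (x : X) (a b : ℝ) :
    ∀ᶠ y in 𝓝 x, ∀ t ∈ Icc a b, leafMap g y t = leafMap g x t := by
  refine isCompact_Icc.eventually_forall_of_forall_eventually fun t _ => ?_
  obtain ⟨C, e, hC, hx, ht, he, h⟩ := exists_local_leafMap g x t
  filter_upwards [(hC.isOpen.prod e.open_source).mem_nhds ⟨hx, ht⟩] with p hp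
  rw [h _ hp.1 _ hp.2, h _ hx _ hp.2]

theorem leafMap_eq_self {g : S.thompsonGroup} {V : Set S.DihedralSuspension} (hV : IsOpen V)
    (h : ∀ z ∈ V, g.1 z = z) {x : X} {t : ℝ} (ht : S.projZ (x, t) ∈ V) : leafMap g x t = t :=
  leafMap_unique (hV.preimage S.continuous_projZ) (θ := fun p => p.2) continuousOn_snd
    (fun _ hp => (h _ hp).symm) (x, t) ht

end Lifts

end ReversibleSystem

end SolenoidalThompson
-- Elements supported in boxes.
namespace SolenoidalThompson

open Set Filter Topology

/-- A map fixing the end points of a dyadic interval can be cut off outside it. -/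
theorem exists_cut {f : ℝ ≃o ℝ} (hf : f ∈ dSub) {a b : ℝ} (hab : a ≤ b) (ha : a ∈ dyadic)
    (hb : b ∈ dyadic) (hfa : f a = a) (hfb : f b = b) : ∃ e ∈ Dd a b, ∀ t ∈ Icc a b, e t = f t := by
  have h1 : (1 : ℝ ≃o ℝ) a = f a := hfa.symm
  have h2 : glue 1 f a h1 b = (1 : ℝ ≃o ℝ) b := by rw [glue_of_ge h1 hab, hfb]; rfl
  have hd : glue (glue 1 f a h1) 1 b h2 ∈ dSub :=
    glue_mem_dSub h2 hb (glue_mem_dSub h1 ha (one_mem _) hf) (one_mem _)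
  refine ⟨_, ⟨hd, fun t ht => ?_⟩, fun t ht => ?_⟩
  · rcases le_total b t with h | h
    · rw [glue_of_ge h2 h]; rfl
    · rw [glue_of_le h2 h]
      rcases le_total t a with h3 | h3
      · rw [glue_of_le h1 h3]; rfl
      · rw [glue_of_ge h1 h3]
        rcases h.eq_or_lt with rfl | h4
        · exact hfb
        · rcases h3.eq_or_lt with rfl | h5
          · exact hfa
          · exact absurd ⟨h5, h4⟩ ht
  · rw [glue_of_le h2 ht.2, glue_of_ge h1 ht.1]

namespace ReversibleSystem

section Boxes

variable {X : Type*} [TopologicalSpace X] {S : ReversibleSystem X}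

variable (S) in
/-- `π_Z` is injective on a neighbourhood of `C × [a, b]`. -/
def IsBox (C : Set X) (a b : ℝ) : Prop :=
  IsClopen C ∧ ∃ ε > 0, InjOn S.projZ (C ×ˢ Ioo (a - ε) (b + ε))

variable (S) in
def boxSet (C : Set X) (a b : ℝ) : Set S.DihedralSuspension := S.projZ '' (C ×ˢ Icc a b)

theorem isClosed_boxSet {C : Set X} (hC : IsClopen C) (a b : ℝ) : IsClosed (S.boxSet C a b) :=
  isClosed_image_projZ hC.isClosed a b

theorem boxSet_mono {C C' : Set X} {a b a' b' : ℝ} (hC : C ⊆ C') (ha : a' ≤ a) (hb : b ≤ b') :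
    S.boxSet C a b ⊆ S.boxSet C' a' b' := image_mono (prod_mono hC (Icc_subset_Icc ha hb))

theorem IsBox.mono {C C' : Set X} {a b a' b' : ℝ} (h : S.IsBox C' a' b') (hC' : IsClopen C)
    (hC : C ⊆ C') (ha : a' ≤ a) (hb : b ≤ b') : S.IsBox C a b := by
  obtain ⟨-, ε, hε, h⟩ := h
  exact ⟨hC', ε, hε, h.mono (prod_mono hC (Ioo_subset_Ioo (by linarith) (by linarith)))⟩

/-- The use of the margin `ε`: in the coordinates around the box, only the box itself projects into
`boxSet`. This makes extension by the identity continuous. -/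
theorem IsBox.mem_Icc {C : Set X} {a b ε : ℝ}
    (h : InjOn S.projZ (C ×ˢ Ioo (a - ε) (b + ε))) (hε : 0 < ε) {x : X} {t : ℝ} (hx : x ∈ C)
    (ht : t ∈ Ioo (a - ε) (b + ε)) (hz : S.projZ (x, t) ∈ S.boxSet C a b) : t ∈ Icc a b := by
  obtain ⟨⟨y, s⟩, hy, e⟩ := hz
  have := h (x₁ := (y, s)) (x₂ := (x, t)) ⟨hy.1, by linarith [hy.2.1], by linarith [hy.2.2]⟩
    ⟨hx, ht⟩ e
  rw [Prod.mk.injEq] at this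
  rw [← this.2]; exact hy.2

open Classical in
/-- The map acting by `π_Z (x, t) ↦ π_Z (x, θ x t)` on the box and trivially elsewhere. -/
noncomputable def boxFun {C : Set X} {a b : ℝ} (θ : X → ℝ ≃o ℝ) (z : S.DihedralSuspension) :
    S.DihedralSuspension :=
  if h : z ∈ S.boxSet C a b then S.projZ (h.choose.1, θ h.choose.1 h.choose.2) else z

theorem boxFun_of_notMem {C : Set X} {a b : ℝ} (θ : X → ℝ ≃o ℝ) {z : S.DihedralSuspension}
    (h : z ∉ S.boxSet C a b) : boxFun (C := C) (a := a) (b := b) θ z = z := dif_neg h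

theorem boxFun_apply {C : Set X} {a b : ℝ} (h : S.IsBox C a b) (θ : X → ℝ ≃o ℝ) {x : X} {t : ℝ}
    (hx : x ∈ C) (ht : t ∈ Icc a b) :
    boxFun (C := C) (a := a) (b := b) θ (S.projZ (x, t)) = S.projZ (x, θ x t) := by
  have hz : S.projZ (x, t) ∈ S.boxSet C a b := ⟨(x, t), ⟨hx, ht⟩, rfl⟩
  obtain ⟨-, ε, hε, hi⟩ := h
  have key : ∀ p ∈ C ×ˢ Icc a b, p ∈ C ×ˢ Ioo (a - ε) (b + ε) := fun p hp =>
    ⟨hp.1, ⟨by linarith [hp.2.1], by linarith [hp.2.2]⟩⟩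
  have : hz.choose = (x, t) := hi (key _ hz.choose_spec.1) (key _ ⟨hx, ht⟩) hz.choose_spec.2
  unfold boxFun
  rw [dif_pos hz, this]

theorem mem_Icc_of_fixOff {a b t : ℝ} {f : ℝ ≃o ℝ} (hf : f ∈ fixOff (Ioo a b))
    (ht : t ∈ Icc a b) : f t ∈ Icc a b := by
  by_cases h : t ∈ Ioo a b
  · exact Ioo_subset_Icc_self (fixOff_apply_mem hf h)
  · rwa [hf t h]

theorem boxFun_comp {C : Set X} {a b : ℝ} (h : S.IsBox C a b) (θ θ' : X → ℝ ≃o ℝ)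
    (hθ : ∀ x, θ' x ∈ fixOff (Ioo a b)) (z : S.DihedralSuspension) :
    boxFun (C := C) (a := a) (b := b) θ (boxFun (C := C) (a := a) (b := b) θ' z) =
      boxFun (C := C) (a := a) (b := b) (fun x => θ x * θ' x) z := by
  by_cases hz : z ∈ S.boxSet C a b
  · obtain ⟨⟨x, t⟩, hx, rfl⟩ := hz
    rw [boxFun_apply h _ hx.1 hx.2, boxFun_apply h _ hx.1 (mem_Icc_of_fixOff (hθ x) hx.2),
      boxFun_apply h _ hx.1 hx.2]
    rfl
  · simp only [boxFun_of_notMem _ hz]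

theorem boxFun_one {C : Set X} {a b : ℝ} (h : S.IsBox C a b) (z : S.DihedralSuspension) :
    boxFun (C := C) (a := a) (b := b) (fun _ => 1) z = z := by
  by_cases hz : z ∈ S.boxSet C a b
  · obtain ⟨⟨x, t⟩, hx, rfl⟩ := hz
    rw [boxFun_apply h _ hx.1 hx.2]
    rfl
  · exact boxFun_of_notMem _ hz

/-- Around a point of the box the margin provides coordinates in which the map is one fixed `θ x`,
which is the identity past the ends. Off the closed box the map is the identity. -/
theorem boxFun_local {C : Set X} {a b : ℝ} (h : S.IsBox C a b)
    (θ : LocallyConstant X (Dd a b)) (z : S.DihedralSuspension) :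
    ∃ (p : X × ℝ) (f : ℝ ≃o ℝ), f ∈ dSub ∧ S.projZ p = z ∧ ∀ᶠ q in 𝓝 p,
      boxFun (C := C) (a := a) (b := b) (fun x => (θ x : ℝ ≃o ℝ)) (S.projZ q) =
        S.projZ (q.1, f q.2) := by
  by_cases hz : z ∈ S.boxSet C a b
  · obtain ⟨⟨x, t⟩, hx, rfl⟩ := hz
    refine ⟨(x, t), θ x, (θ x).2.1, rfl, ?_⟩
    obtain ⟨ε, hε, hi⟩ := h.2
    have h1 : ∀ᶠ q : X × ℝ in 𝓝 (x, t), θ q.1 = θ x :=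
      (continuous_fst.tendsto (x, t)).eventually (θ.isLocallyConstant.eventually_eq x)
    have h2 : ∀ᶠ q : X × ℝ in 𝓝 (x, t), q ∈ C ×ˢ Ioo (a - ε) (b + ε) :=
      (h.1.isOpen.prod isOpen_Ioo).mem_nhds
        ⟨hx.1, ⟨by linarith [hx.2.1], by linarith [hx.2.2]⟩⟩
    filter_upwards [h1, h2] with q e hq
    rw [← e]
    by_cases hqt : q.2 ∈ Icc a b
    · exact boxFun_apply h _ hq.1 hqt
    · rw [boxFun_of_notMem _ fun hm => hqt (IsBox.mem_Icc hi hε hq.1 hq.2 hm),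
        (θ q.1).2.2 _ fun hm => hqt (Ioo_subset_Icc_self hm)]
  · obtain ⟨p, rfl⟩ := S.projZ_surjective z
    refine ⟨p, 1, one_mem _, rfl, ?_⟩
    filter_upwards [S.continuous_projZ.continuousAt.eventually
      ((isClosed_boxSet h.1 a b).isOpen_compl.mem_nhds hz)] with q hq
    exact boxFun_of_notMem _ hq

theorem continuous_boxFun {C : Set X} {a b : ℝ} (h : S.IsBox C a b)
    (θ : LocallyConstant X (Dd a b)) :
    Continuous (boxFun (S := S) (C := C) (a := a) (b := b) fun x => (θ x : ℝ ≃o ℝ)) := by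
  rw [continuous_iff_continuousAt]
  intro z
  obtain ⟨p, f, -, rfl, hp⟩ := boxFun_local h θ z
  rw [← isOpenQuotientMap_projZ.continuousAt_comp_iff]
  refine ContinuousAt.congr (f := fun q : X × ℝ => S.projZ (q.1, f q.2)) ?_ (hp.mono fun _ h => h.symm)
  exact (S.continuous_projZ.comp
    (continuous_fst.prodMk (f.continuous.comp continuous_snd))).continuousAt

variable [CompactSpace X] [TopologicalSpace.MetrizableSpace X] [TotallyDisconnectedSpace X]

/-- One representative of each point suffices; charts at the source and the target are obtained by
shrinking around it and its image. -/
theorem isLocallyTypeD_of_local {g : S.DihedralSuspension ≃ₜ S.DihedralSuspension}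
    (h : ∀ z, ∃ (p : X × ℝ) (f : ℝ ≃o ℝ), f ∈ dSub ∧ S.projZ p = z ∧
      ∀ᶠ q in 𝓝 p, g (S.projZ q) = S.projZ (q.1, f q.2)) : S.IsLocallyTypeD g := by
  intro z
  obtain ⟨⟨x, t⟩, f, hf, rfl, h⟩ := h z
  obtain ⟨C₁, I₁, k₁, hx₁, ht₁⟩ := S.exists_chart (x, t)
  obtain ⟨C₂, I₂, k₂, hx₂, ht₂⟩ := S.exists_chart (x, f t)
  obtain ⟨e, hte, he, hfe⟩ := hf t
  rw [nhds_prod_eq, eventually_prod_iff] at h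
  obtain ⟨pa, hpa, pb, hpb, h⟩ := h
  obtain ⟨C₃, ⟨hx₃, hC₃⟩, hCa⟩ := (nhds_basis_clopen x).mem_iff.1 hpa
  obtain ⟨ε, hε, hI⟩ := exists_Ioo_of_eventually ((((show ∀ᶠ s in 𝓝 t, s ∈ I₁ from k₁.2.1.mem_nhds ht₁).and
    (f.continuous.continuousAt.eventually (k₂.2.1.mem_nhds ht₂))).and
      (show ∀ᶠ s in 𝓝 t, s ∈ e.source from e.open_source.mem_nhds hte)).and hpb)
  have hI' : ∀ s ∈ Ioo (t - ε) (t + ε), ((s ∈ I₁ ∧ f s ∈ I₂) ∧ s ∈ e.source) ∧ pb s := fun s hs =>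
    hI s (by rw [abs_lt]; constructor <;> linarith [hs.1, hs.2])
  set f' := e.restrOpen (Ioo (t - ε) (t + ε)) isOpen_Ioo with hf'
  have hs : f'.source = Ioo (t - ε) (t + ε) := inter_eq_right.2 fun s hs => (hI' s hs).1.2
  have happ : ∀ s ∈ Ioo (t - ε) (t + ε), f' s = f s := fun s hs => (hfe s (hI' s hs).1.2).symm
  have htgt : f'.target = f '' Ioo (t - ε) (t + ε) := by
    rw [← f'.image_source_eq_target, hs]
    exact image_congr happ
  have hC : IsClopen (C₁ ∩ C₂ ∩ C₃) := (k₁.1.inter k₂.1).inter hC₃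
  have key : ∀ y ∈ C₁ ∩ C₂ ∩ C₃, ∀ s ∈ f'.source, g (S.projZ (y, s)) = S.projZ (y, f' s) := by
    intro y hy s hs'
    rw [hs] at hs'
    rw [happ s hs']
    exact h (hCa hy.2) (hI' s hs').2
  have htm : t ∈ Ioo (t - ε) (t + ε) := ⟨by linarith, by linarith⟩
  refine ⟨C₁ ∩ C₂ ∩ C₃, f', ⟨k₁.mono hC f'.open_source (hs ▸ ordConnected_Ioo)
    (fun y hy => hy.1.1) (hs ▸ fun s hs => (hI' s hs).1.1.1), k₂.mono hC f'.open_target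
    (by rw [htgt, image_Ioo_orderIso]; exact ordConnected_Ioo) (fun y hy => hy.1.2)
    (by rw [htgt]; rintro _ ⟨s, hs, rfl⟩; exact (hI' s hs).1.1.2), he.restr _, image_of_forall key, key⟩,
    ⟨(x, t), ⟨⟨⟨hx₁, hx₂⟩, hx₃⟩, hs ▸ htm⟩, rfl⟩, ⟨(x, f t), ⟨⟨⟨hx₁, hx₂⟩, hx₃⟩, ?_⟩, ?_⟩⟩
  · rw [htgt]; exact ⟨t, htm, rfl⟩
  · rw [key x ⟨⟨hx₁, hx₂⟩, hx₃⟩ t (hs ▸ htm), happ t htm]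

/-- The homomorphism from locally constant families of maps of `[a, b]` to `𝒯(φ, σ)`. -/
noncomputable def boxHom {C : Set X} {a b : ℝ} (h : S.IsBox C a b) :
    LocallyConstant X (Dd a b) →* S.thompsonGroup where
  toFun θ :=
    have hinv : ∀ θ : LocallyConstant X (Dd a b), ∀ z : S.DihedralSuspension,
        boxFun (C := C) (a := a) (b := b) (fun x => (θ⁻¹ x : ℝ ≃o ℝ))
          (boxFun (C := C) (a := a) (b := b) (fun x => (θ x : ℝ ≃o ℝ)) z) = z := fun θ z => by
      rw [boxFun_comp h _ _ fun x => (θ x).2.2]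
      refine Eq.trans ?_ (boxFun_one h z)
      congr 1
      ext x t
      change ((θ x : ℝ ≃o ℝ)⁻¹ * θ x) t = _
      rw [inv_mul_cancel]
    ⟨{  toFun := boxFun (C := C) (a := a) (b := b) fun x => (θ x : ℝ ≃o ℝ)
        invFun := boxFun (C := C) (a := a) (b := b) fun x => (θ⁻¹ x : ℝ ≃o ℝ)
        left_inv := hinv θ
        right_inv := fun z => by simpa using hinv θ⁻¹ z
        continuous_toFun := continuous_boxFun h θ
        continuous_invFun := continuous_boxFun h θ⁻¹ }, isLocallyTypeD_of_local (boxFun_local h θ)⟩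
  map_one' := Subtype.ext (Homeomorph.ext fun z => boxFun_one h z)
  map_mul' θ θ' := Subtype.ext (Homeomorph.ext fun z =>
    (boxFun_comp h (fun x => (θ x : ℝ ≃o ℝ)) (fun x => (θ' x : ℝ ≃o ℝ)) (fun x => (θ' x).2.2) z).symm)

theorem boxHom_apply {C : Set X} {a b : ℝ} (h : S.IsBox C a b) (θ : LocallyConstant X (Dd a b))
    {x : X} {t : ℝ} (hx : x ∈ C) (ht : t ∈ Icc a b) :
    (boxHom h θ).1 (S.projZ (x, t)) = S.projZ (x, (θ x : ℝ ≃o ℝ) t) :=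
  boxFun_apply h (fun x => (θ x : ℝ ≃o ℝ)) hx ht

/-- The elements of `𝒯(φ, σ)` supported in `A`. -/
def suppSub (A : Set S.DihedralSuspension) : Subgroup S.thompsonGroup where
  carrier := {g | ∀ z ∉ A, g.1 z = z}
  mul_mem' {f g} hf hg z hz := by
    change f.1 (g.1 z) = z
    rw [hg z hz, hf z hz]
  one_mem' z _ := rfl
  inv_mem' {f} hf z hz := by
    change f.1.symm z = z
    rw [Homeomorph.symm_apply_eq, hf z hz]

theorem suppSub_mono {A B : Set S.DihedralSuspension} (h : A ⊆ B) : suppSub A ≤ suppSub B :=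
  fun _ hf z hz => hf z fun h' => hz (h h')

theorem boxHom_mem_suppSub {C : Set X} {a b : ℝ} (h : S.IsBox C a b)
    (θ : LocallyConstant X (Dd a b)) : boxHom h θ ∈ suppSub (S.boxSet C a b) :=
  fun _ hz => boxFun_of_notMem (fun x => (θ x : ℝ ≃o ℝ)) hz

theorem suppSub_commute {A B : Set S.DihedralSuspension} (h : Disjoint A B)
    {f g : S.thompsonGroup} (hf : f ∈ suppSub A) (hg : g ∈ suppSub B) : Commute f g := by
  have key : ∀ {A : Set S.DihedralSuspension} {f : S.thompsonGroup}, f ∈ suppSub A →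
      ∀ z ∈ A, f.1 z ∈ A := fun {A f} hf z hz => by
    by_contra h
    have := hf _ h
    rw [f.1.injective this] at h
    exact h hz
  apply Subtype.ext
  ext z
  change f.1 (g.1 z) = g.1 (f.1 z)
  by_cases hz : z ∈ A
  · rw [hg z fun h' => h.le_bot ⟨hz, h'⟩, hg _ fun h' => h.le_bot ⟨key hf z hz, h'⟩]
  · rw [hf z hz]
    by_cases hz' : z ∈ B
    · rw [hf _ fun h' => h.le_bot ⟨h', key hg z hz'⟩]
    · rw [hg z hz', hf z hz]

/-- The leaf maps of `g` are trivial just outside `[a, b]`, hence fix the end points by continuity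
and can be cut off there. Off `C` the value is set to `1`. So elements supported in a box are the
same as locally constant families. -/
theorem exists_boxHom_eq {C : Set X} {a b : ℝ} (h : S.IsBox C a b) (hab : a ≤ b)
    (ha : a ∈ dyadic) (hb : b ∈ dyadic) {g : S.thompsonGroup}
    (hg : g ∈ suppSub (S.boxSet C a b)) : ∃ θ, boxHom h θ = g := by
  classical
  obtain ⟨ε, hε, hi⟩ := h.2
  have hout : ∀ x ∈ C, ∀ t ∈ Ioo (a - ε) (b + ε), t ∉ Icc a b → leafMap g x t = t :=
    fun x hx t ht hn => leafMap_eq_self (isClosed_boxSet h.1 a b).isOpen_compl hg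
      fun hm => hn (IsBox.mem_Icc hi hε hx ht hm)
  have hfa : ∀ x ∈ C, leafMap g x a = a := by
    intro x hx
    refine tendsto_nhds_unique (((leafMap g x).continuous.tendsto a).mono_left
      (nhdsWithin_le_nhds (s := Iio a))) ((tendsto_nhdsWithin_of_tendsto_nhds tendsto_id).congr' ?_)
    filter_upwards [Ioo_mem_nhdsLT (show a - ε < a by linarith)] with t ht
    exact (hout x hx t ⟨ht.1, by linarith [ht.2]⟩ fun h => not_le.2 ht.2 h.1).symm
  have hfb : ∀ x ∈ C, leafMap g x b = b := by
    intro x hx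
    refine tendsto_nhds_unique (((leafMap g x).continuous.tendsto b).mono_left
      (nhdsWithin_le_nhds (s := Ioi b))) ((tendsto_nhdsWithin_of_tendsto_nhds tendsto_id).congr' ?_)
    filter_upwards [Ioo_mem_nhdsGT (show b < b + ε by linarith)] with t ht
    exact (hout x hx t ⟨by linarith [ht.1], ht.2⟩ fun h => not_le.2 ht.1 h.2).symm
  have hex : ∀ x, ∃ e : Dd a b, (x ∈ C → ∀ t ∈ Icc a b, (e : ℝ ≃o ℝ) t = leafMap g x t) ∧
      (x ∉ C → e = 1) := by
    intro x
    by_cases hx : x ∈ C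
    · obtain ⟨e, he, h1⟩ := exists_cut (leafMap_mem_dSub g x) hab ha hb (hfa x hx) (hfb x hx)
      exact ⟨⟨e, he⟩, fun _ => h1, fun h => absurd hx h⟩
    · exact ⟨1, fun h => absurd h hx, fun _ => rfl⟩
  choose θ hθ1 hθ2 using hex
  have hloc : IsLocallyConstant θ := by
    rw [IsLocallyConstant.iff_eventually_eq]
    intro x
    by_cases hx : x ∈ C
    · filter_upwards [eventually_leafMap_eq g x a b, h.1.isOpen.mem_nhds hx] with y hy hyC
      ext t
      by_cases ht : t ∈ Icc a b
      · rw [hθ1 y hyC t ht, hθ1 x hx t ht, hy t ht]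
      · rw [(θ y).2.2 t fun h => ht (Ioo_subset_Icc_self h),
          (θ x).2.2 t fun h => ht (Ioo_subset_Icc_self h)]
    · filter_upwards [h.1.compl.isOpen.mem_nhds hx] with y hy
      rw [hθ2 y hy, hθ2 x hx]
  refine ⟨⟨θ, hloc⟩, Subtype.ext (Homeomorph.ext fun z => ?_)⟩
  by_cases hz : z ∈ S.boxSet C a b
  · obtain ⟨⟨x, t⟩, hx, rfl⟩ := hz
    rw [boxHom_apply h _ hx.1 hx.2, ← projZ_leafMap]
    congr 2
    exact hθ1 x hx.1 t hx.2
  · rw [boxHom_mem_suppSub h _ z hz, hg z hz]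

theorem leafMap_boxHom {C : Set X} {a b : ℝ} (h : S.IsBox C a b) (θ : LocallyConstant X (Dd a b))
    {x : X} {t : ℝ} (hx : x ∈ C) (ht : t ∈ Ioo a b) :
    leafMap (boxHom h θ) x t = (θ x : ℝ ≃o ℝ) t := by
  have hc : ContinuousOn (fun p : X × ℝ => (θ p.1 : ℝ ≃o ℝ) p.2) (C ×ˢ Ioo a b) := fun p _ => by
    refine ContinuousAt.continuousWithinAt (ContinuousAt.congr (f := fun q : X × ℝ =>
      (θ p.1 : ℝ ≃o ℝ) q.2) ((θ p.1 : ℝ ≃o ℝ).continuous.comp continuous_snd).continuousAt ?_)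
    filter_upwards [continuousAt_fst.eventually (θ.isLocallyConstant.eventually_eq p.1)] with q hq
    exact congrArg (fun e : Dd a b => (e : ℝ ≃o ℝ) q.2) hq.symm
  exact leafMap_unique (h.1.isOpen.prod isOpen_Ioo) hc (fun p hp =>
    (boxHom_apply h θ hp.1 (Ioo_subset_Icc_self hp.2)).symm) (x, t) ⟨hx, ht⟩

/-- Every neighbourhood contains a dyadic box around any of its points. -/
theorem exists_box {x : X} {t : ℝ} {N : Set S.DihedralSuspension} (hN : N ∈ 𝓝 (S.projZ (x, t))) :
    ∃ C, x ∈ C ∧ ∃ ε > 0, S.IsBox C (t - ε) (t + ε) ∧ S.boxSet C (t - ε) (t + ε) ⊆ N := by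
  obtain ⟨C₁, I₁, k₁, hx₁, ht₁⟩ := S.exists_chart (x, t)
  have h := S.continuous_projZ.continuousAt.eventually hN
  rw [nhds_prod_eq, eventually_prod_iff] at h
  obtain ⟨pa, hpa, pb, hpb, h⟩ := h
  obtain ⟨C₃, ⟨hx₃, hC₃⟩, hCa⟩ := (nhds_basis_clopen x).mem_iff.1 hpa
  obtain ⟨ε, hε, hI⟩ := exists_Ioo_of_eventually
    ((show ∀ᶠ s in 𝓝 t, s ∈ I₁ from k₁.2.1.mem_nhds ht₁).and hpb)
  refine ⟨C₁ ∩ C₃, ⟨hx₁, hx₃⟩, ε / 2, by linarith, ⟨k₁.1.inter hC₃, ε / 2, by linarith, ?_⟩, ?_⟩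
  · refine k₁.2.2.2.mono ?_
    rintro ⟨y, s⟩ hp
    refine ⟨hp.1.1, (hI s ?_).1⟩
    rw [abs_lt]; constructor <;> linarith [hp.2.1, hp.2.2]
  · rintro _ ⟨⟨y, s⟩, hp, rfl⟩
    refine h (hCa hp.1.2) (hI s ?_).2
    rw [abs_lt]; constructor <;> linarith [hp.2.1, hp.2.2]

end Boxes

end ReversibleSystem

end SolenoidalThompson
-- Fragmentation into small boxes.
namespace SolenoidalThompson

open Set Filter Topology

/-- Two overlapping intervals generate. -/
theorem exists_factor {a p q s : ℝ} (ha : a ∈ dyadic) (hp : p ∈ dyadic) (hq : q ∈ dyadic)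
    (hs : s ∈ dyadic) (hap : a < p) (hpq : p < q) (hqs : q < s) (e : Dd a s) :
    ∃ l₁ r₁ l₂ r₂ : Dd a s, e = l₁ * r₁ * l₂ * r₂ ∧ (l₁ : ℝ ≃o ℝ) ∈ Dd a q ∧
      (r₁ : ℝ ≃o ℝ) ∈ Dd p s ∧ (l₂ : ℝ ≃o ℝ) ∈ Dd a q ∧ (r₂ : ℝ ≃o ℝ) ∈ Dd p s := by
  obtain ⟨e, he⟩ := e
  have hl : Dd a q ≤ Dd a s := Dd_mono le_rfl hqs.le
  have hr : Dd p s ≤ Dd a s := Dd_mono hap.le le_rfl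
  -- Once `e m` is returned to `m` by a map supported in one of the two intervals, what remains
  -- fixes `m` and splits into a part on `[a, m]` and a part on `[m, s]`.
  obtain ⟨m, hm, hpm, hmq⟩ := exists_dyadic_between hpq
  have hem := (dSub_apply_mem he.1).2 hm
  have hem' : e m ∈ Ioo a s := fixOff_apply_mem he.2 ⟨by linarith, by linarith⟩
  have key : ∀ f ∈ Dd a s, f (e m) = m →
      ∃ l ∈ Dd a q, ∃ r ∈ Dd p s, f * e = l * r := by
    intro f hf hfm
    have hfe : f * e ∈ Dd a s := mul_mem hf he
    have h1 : (f * e) m = m := hfm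
    obtain ⟨l, hl, hl'⟩ := exists_cut hfe.1 (by linarith) ha hm (hfe.2 a (by simp)) h1
    obtain ⟨r, hr, hr'⟩ := exists_cut hfe.1 (by linarith) hm hs h1 (hfe.2 s (by simp))
    refine ⟨l, Dd_mono le_rfl hmq.le hl, r, Dd_mono hpm.le le_rfl hr, ?_⟩
    ext t
    rw [RelIso.mul_apply l]
    rcases le_total t m with htm | htm
    · rw [hr.2 t fun h => not_le.2 h.1 htm]
      by_cases hat : a ≤ t
      · exact (hl' t ⟨hat, htm⟩).symm
      · rw [hl.2 t fun h => hat h.1.le, hfe.2 t fun h => hat h.1.le]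
    · rw [hl.2 (r t) fun h => ?_]
      · by_cases hts : t ≤ s
        · exact (hr' t ⟨htm, hts⟩).symm
        · rw [hr.2 t fun h => hts h.2.le, hfe.2 t fun h => hts h.2.le]
      · have : r m ≤ r t := r.monotone htm
        rw [hr.2 m (by simp)] at this
        exact not_lt.2 this h.2
  rcases lt_or_ge (e m) q with hc | hc
  · obtain ⟨f, hf, hf1, hf2⟩ := exists_pl_map ha hq hem hm hem'.1 hc (by linarith) hmq
    have hf' : f ∈ Dd a q := ⟨plSub_le_dSub hf, hf1⟩
    obtain ⟨l, h1, r, h2, h3⟩ := key f (hl hf') hf2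
    refine ⟨⟨f⁻¹, inv_mem (hl hf')⟩, 1, ⟨l, hl h1⟩, ⟨r, hr h2⟩, Subtype.ext ?_, inv_mem hf',
      one_mem _, h1, h2⟩
    change e = f⁻¹ * 1 * l * r
    rw [mul_one, mul_assoc, ← h3, inv_mul_cancel_left]
  · obtain ⟨f, hf, hf1, hf2⟩ := exists_pl_map hp hs hem hm (hpq.trans_le hc) hem'.2 hpm (by linarith)
    have hf' : f ∈ Dd p s := ⟨plSub_le_dSub hf, hf1⟩
    obtain ⟨l, h1, r, h2, h3⟩ := key f (hr hf') hf2
    refine ⟨1, ⟨f⁻¹, inv_mem (hr hf')⟩, ⟨l, hl h1⟩, ⟨r, hr h2⟩, Subtype.ext ?_, one_mem _,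
      inv_mem hf', h1, h2⟩
    change e = 1 * f⁻¹ * l * r
    rw [one_mul, mul_assoc, ← h3, inv_mul_cancel_left]

namespace ReversibleSystem

section Fragmentation

variable {X : Type*} [TopologicalSpace X] {S : ReversibleSystem X}

variable (S) in
/-- A box `C × [a, b]` with dyadic end points. -/
structure IsDyadicBox (C : Set X) (a b : ℝ) : Prop where
  isBox : S.IsBox C a b
  lt : a < b
  left : a ∈ dyadic
  right : b ∈ dyadic

theorem boxSet_empty (a b : ℝ) : S.boxSet ∅ a b = ∅ := by simp [boxSet]

theorem isClosed_singleton_projZ (z : S.DihedralSuspension) [T1Space X] : IsClosed {z} := by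
  obtain ⟨⟨x, t⟩, rfl⟩ := S.projZ_surjective z
  have := isClosed_image_projZ (S := S) (isClosed_singleton (x := x)) t t
  rwa [Icc_self, singleton_prod_singleton, image_singleton] at this

variable [CompactSpace X] [TopologicalSpace.MetrizableSpace X] [TotallyDisconnectedSpace X]

theorem exists_dyadicBox {z : S.DihedralSuspension} {N : Set S.DihedralSuspension} (hN : N ∈ 𝓝 z) :
    ∃ C a b, S.IsDyadicBox C a b ∧ S.boxSet C a b ∈ 𝓝 z ∧ S.boxSet C a b ⊆ N := by
  obtain ⟨⟨x, t⟩, rfl⟩ := S.projZ_surjective z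
  obtain ⟨C, hx, ε, hε, h1, h2⟩ := exists_box hN
  obtain ⟨a, ha, ha1, ha2⟩ := exists_dyadic_between (show t - ε < t by linarith)
  obtain ⟨b, hb, hb1, hb2⟩ := exists_dyadic_between (show t < t + ε by linarith)
  refine ⟨C, a, b, ⟨h1.mono h1.1 subset_rfl ha1.le hb2.le, ha2.trans hb1, ha, hb⟩, ?_,
    (boxSet_mono subset_rfl ha1.le hb2.le).trans h2⟩
  exact isOpenMap_projZ.image_mem_nhds (prod_mem_nhds (h1.1.isOpen.mem_nhds hx)
    (Icc_mem_nhds ha2 hb1))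

theorem boxHom_mem_suppSub_of {C D : Set X} {a b u v : ℝ} (h : S.IsBox C a b)
    {θ : LocallyConstant X (Dd a b)}
    (hθ : ∀ x ∈ C, ∀ t, ¬(x ∈ D ∧ t ∈ Icc u v) → (θ x : ℝ ≃o ℝ) t = t) :
    boxHom h θ ∈ suppSub (S.boxSet D u v) := by
  intro z hz
  by_cases hz' : z ∈ S.boxSet C a b
  · obtain ⟨⟨x, t⟩, hx, rfl⟩ := hz'
    rw [boxHom_apply h _ hx.1 hx.2, hθ x hx.1 t fun hm => hz ⟨(x, t), hm, rfl⟩]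
  · exact boxHom_mem_suppSub h _ z hz'

theorem suppSub_empty_le (H : Subgroup S.thompsonGroup) : suppSub (∅ : Set S.DihedralSuspension) ≤ H := by
  intro g hg
  have : g = 1 := Subtype.ext (Homeomorph.ext fun z => hg z (notMem_empty z))
  rw [this]
  exact one_mem H

theorem suppSub_union_le {C D : Set X} {a b : ℝ} (h : S.IsDyadicBox C a b) (hD : IsClopen D)
    {H : Subgroup S.thompsonGroup}
    (h1 : suppSub (S.boxSet (C ∩ D) a b) ≤ H) (h2 : suppSub (S.boxSet (C \ D) a b) ≤ H) :
    suppSub (S.boxSet C a b) ≤ H := by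
  classical
  intro g hg
  obtain ⟨θ, rfl⟩ := exists_boxHom_eq h.isBox h.lt.le h.left h.right hg
  have e : θ = θ.mulIndicator hD * θ.mulIndicator hD.compl := by
    ext x : 1
    rw [LocallyConstant.mul_apply]
    by_cases hx : x ∈ D
    · rw [θ.mulIndicator_of_mem hD hx, θ.mulIndicator_of_notMem hD.compl (not_not.2 hx), mul_one]
    · rw [θ.mulIndicator_of_notMem hD hx, θ.mulIndicator_of_mem hD.compl hx, one_mul]
  rw [e, map_mul]
  refine mul_mem (h1 (boxHom_mem_suppSub_of _ fun x hx t ht => ?_))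
    (h2 (boxHom_mem_suppSub_of _ fun x hx t ht => ?_))
  · by_cases hxD : x ∈ D
    · rw [(θ.mulIndicator hD x).2.2 t fun h' => ht ⟨⟨hx, hxD⟩, Ioo_subset_Icc_self h'⟩]
    · rw [θ.mulIndicator_of_notMem hD hxD]; rfl
  · by_cases hxD : x ∈ D
    · rw [θ.mulIndicator_of_notMem hD.compl (not_not.2 hxD)]; rfl
    · rw [(θ.mulIndicator hD.compl x).2.2 t fun h' => ht ⟨⟨hx, hxD⟩, Ioo_subset_Icc_self h'⟩]

/-- `exists_factor` applied to each value of the family; factors chosen as functions of the value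
are locally constant. -/
theorem suppSub_overlap_le {C : Set X} {a p q s : ℝ} (h : S.IsDyadicBox C a s) (hp : p ∈ dyadic)
    (hq : q ∈ dyadic) (hap : a < p) (hpq : p < q) (hqs : q < s) {H : Subgroup S.thompsonGroup}
    (h1 : suppSub (S.boxSet C a q) ≤ H) (h2 : suppSub (S.boxSet C p s) ≤ H) :
    suppSub (S.boxSet C a s) ≤ H := by
  intro g hg
  obtain ⟨θ, rfl⟩ := exists_boxHom_eq h.isBox h.lt.le h.left h.right hg
  choose l₁ r₁ l₂ r₂ he k1 k2 k3 k4 using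
    exists_factor (a := a) (s := s) h.left hp hq h.right hap hpq hqs
  have e : θ = θ.map l₁ * θ.map r₁ * θ.map l₂ * θ.map r₂ := by
    ext x : 1
    exact he (θ x)
  have hl : ∀ l : Dd a s → Dd a s, (∀ e, (l e : ℝ ≃o ℝ) ∈ Dd a q) → boxHom h.isBox (θ.map l) ∈ H :=
    fun l hl => h1 (boxHom_mem_suppSub_of _ fun x hx t ht => (hl (θ x)).2 t fun h' =>
      ht ⟨hx, Ioo_subset_Icc_self h'⟩)
  have hr : ∀ l : Dd a s → Dd a s, (∀ e, (l e : ℝ ≃o ℝ) ∈ Dd p s) → boxHom h.isBox (θ.map l) ∈ H :=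
    fun l hl => h2 (boxHom_mem_suppSub_of _ fun x hx t ht => (hl (θ x)).2 t fun h' =>
      ht ⟨hx, Ioo_subset_Icc_self h'⟩)
  rw [e, map_mul, map_mul, map_mul]
  exact mul_mem (mul_mem (mul_mem (hl _ k1) (hr _ k2)) (hl _ k3)) (hr _ k4)

/-- Fragmentation: the maps supported in a box are generated by those supported in small boxes. -/
theorem suppSub_le_of_local {C : Set X} {a b : ℝ} (h : S.IsDyadicBox C a b)
    {H : Subgroup S.thompsonGroup} (hH : ∀ z ∈ S.boxSet C a b, ∃ N ∈ 𝓝 z, ∀ C' a' b',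
      S.IsDyadicBox C' a' b' → S.boxSet C' a' b' ⊆ N → suppSub (S.boxSet C' a' b') ≤ H) :
    suppSub (S.boxSet C a b) ≤ H := by
  have hC := h.isBox.1
  -- Compactness of `[a, b]` gives one length `δ` valid at every height, over all small enough `D`
  -- around `x`.
  have subdivide : ∀ x ∈ C, ∃ δ > 0, ∀ᶠ D in (𝓝 x).smallSets, ∀ a' ∈ Icc a b, ∀ b' ∈ Icc a b,
      a' ∈ dyadic → b' ∈ dyadic → a' < b' → b' < a' + δ → IsClopen D → D ⊆ C →
        suppSub (S.boxSet D a' b') ≤ H := by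
    intro x hx
    refine isCompact_Icc.induction_on (p := fun V => ∃ δ > 0, ∀ᶠ D in (𝓝 x).smallSets,
      ∀ a' ∈ V, ∀ b' ∈ Icc a b, a' ∈ dyadic → b' ∈ dyadic → a' < b' → b' < a' + δ →
        IsClopen D → D ⊆ C → suppSub (S.boxSet D a' b') ≤ H) ?_ ?_ ?_ ?_
    · exact ⟨1, one_pos, Eventually.of_forall fun D a' ha' => absurd ha' (notMem_empty a')⟩
    · rintro V W hVW ⟨δ, hδ, hd⟩
      exact ⟨δ, hδ, hd.mono fun D hD a' ha' => hD a' (hVW ha')⟩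
    · rintro V W ⟨δ, hδ, hd⟩ ⟨δ', hδ', hd'⟩
      refine ⟨min δ δ', lt_min hδ hδ', ?_⟩
      filter_upwards [hd, hd'] with D h1 h2 a' ha' b' hb' k1 k2 k3 k4
      rcases ha' with ha' | ha'
      · exact h1 a' ha' b' hb' k1 k2 k3 (k4.trans_le (by gcongr; exact min_le_left _ _))
      · exact h2 a' ha' b' hb' k1 k2 k3 (k4.trans_le (by gcongr; exact min_le_right _ _))
    · intro t ht
      obtain ⟨N, hN, hN'⟩ := hH (S.projZ (x, t)) ⟨(x, t), ⟨hx, ht⟩, rfl⟩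
      have h1 := S.continuous_projZ.continuousAt.eventually hN
      rw [nhds_prod_eq, eventually_prod_iff] at h1
      obtain ⟨pa, hpa, pb, hpb, h1⟩ := h1
      obtain ⟨ε, hε, hI⟩ := exists_Ioo_of_eventually hpb
      refine ⟨Icc a b ∩ Ioo (t - ε / 2) (t + ε / 2), inter_mem_nhdsWithin _
        (Ioo_mem_nhds (by linarith) (by linarith)), ε / 2, by linarith, ?_⟩
      filter_upwards [eventually_smallSets_forall.2 hpa] with D hD a' ha' b' hb' k1 k2 k3 k4 k5 k6
      refine hN' D a' b' ⟨h.isBox.mono k5 k6 ha'.1.1 hb'.2, k3, k1, k2⟩ ?_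
      rintro _ ⟨⟨y, s⟩, hy, rfl⟩
      refine h1 (hD y hy.1) (hI s ?_)
      rw [abs_lt]
      constructor <;> linarith [ha'.2.1, ha'.2.2, hy.2.1, hy.2.2]
  -- Over such `D` all of `[a, b]` is reached by overlapping intervals, in steps of length `δ / 2`.
  have smallBase : ∀ x ∈ C, ∃ D₀ ∈ 𝓝 x, ∀ D ⊆ D₀, IsClopen D → D ⊆ C → suppSub (S.boxSet D a b) ≤ H := by
    intro x hx
    obtain ⟨δ, hδ, hd⟩ := subdivide x hx
    obtain ⟨D₀, hD₀, hd⟩ := eventually_smallSets.1 hd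
    refine ⟨D₀, hD₀, fun D hD k1 k2 => ?_⟩
    have key : ∀ n : ℕ, ∀ s ∈ Ioc a b, s ∈ dyadic → s < a + (n + 1) * (δ / 2) →
        suppSub (S.boxSet D a s) ≤ H := by
      intro n
      induction n with
      | zero =>
        intro s hs hsd hlt
        push_cast at hlt
        exact hd D hD a ⟨le_rfl, h.lt.le⟩ s ⟨hs.1.le, hs.2⟩ h.left hsd hs.1 (by linarith) k1 k2
      | succ n ih =>
        intro s hs hsd hlt
        push_cast at hlt
        have hn : 0 < ((n : ℝ) + 1) * (δ / 2) := by positivity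
        have hlt' : max a (s - δ) < min s (a + (n + 1) * (δ / 2)) := by
          rw [max_lt_iff, lt_min_iff, lt_min_iff]
          refine ⟨⟨hs.1, ?_⟩, ?_, ?_⟩ <;> linarith
        obtain ⟨p, hp, hp1, hp2⟩ := exists_dyadic_between hlt'
        obtain ⟨q, hq, hq1, hq2⟩ := exists_dyadic_between hp2
        rw [max_lt_iff] at hp1
        rw [lt_min_iff] at hq2
        refine suppSub_overlap_le ⟨h.isBox.mono k1 k2 le_rfl hs.2, hs.1, h.left, hsd⟩ hp hq hp1.1
          hq1 hq2.1 (ih q ⟨by linarith, by linarith [hs.2]⟩ hq hq2.2) ?_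
        exact hd D hD p ⟨hp1.1.le, by linarith [hs.2]⟩ s ⟨hs.1.le, hs.2⟩ hp hsd (by linarith)
          (by linarith) k1 k2
    obtain ⟨n, hn⟩ := exists_nat_gt ((b - a) / (δ / 2))
    refine key n b ⟨h.lt, le_rfl⟩ h.right ?_
    rw [div_lt_iff₀ (by linarith)] at hn
    linarith
  -- Compactness of `C` in the transverse direction; unions are handled by splitting families along
  -- clopen sets.
  have glueBase : ∃ V, IsClopen V ∧ C ⊆ V ∧ ∀ D ⊆ V, IsClopen D → D ⊆ C → suppSub (S.boxSet D a b) ≤ H := by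
    refine hC.isClosed.isCompact.induction_on (p := fun W => ∃ V, IsClopen V ∧ W ⊆ V ∧
      ∀ D ⊆ V, IsClopen D → D ⊆ C → suppSub (S.boxSet D a b) ≤ H) ?_ ?_ ?_ ?_
    · refine ⟨∅, isClopen_empty, subset_rfl, fun D hD _ _ => ?_⟩
      rw [subset_empty_iff.1 hD, boxSet_empty]
      exact suppSub_empty_le H
    · rintro W W' hW ⟨V, h1, h2, h3⟩
      exact ⟨V, h1, hW.trans h2, h3⟩
    · rintro W W' ⟨V, h1, h2, h3⟩ ⟨V', h1', h2', h3'⟩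
      refine ⟨V ∪ V', h1.union h1', union_subset_union h2 h2', fun D hD k1 k2 => ?_⟩
      exact suppSub_union_le ⟨h.isBox.mono k1 k2 le_rfl le_rfl, h.lt, h.left, h.right⟩ h1
        (h3 _ inter_subset_right (k1.inter h1) (inter_subset_left.trans k2))
        (h3' _ (fun y hy => (hD hy.1).resolve_left hy.2) (k1.diff h1) (sdiff_subset.trans k2))
    · intro x hx
      obtain ⟨D₀, hD₀, hd⟩ := smallBase x hx
      obtain ⟨V, ⟨hxV, hV⟩, hVD⟩ := (nhds_basis_clopen x).mem_iff.1 hD₀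
      exact ⟨V, mem_nhdsWithin_of_mem_nhds (hV.isOpen.mem_nhds hxV), V, hV, subset_rfl,
        fun D hD => hd D (hD.trans hVD)⟩
  obtain ⟨V, -, h1, h2⟩ := glueBase
  exact h2 C h1 hC subset_rfl

/-- The subgroup generated by the elements supported in a box inside `V`. -/
def locSub (V : Set S.DihedralSuspension) : Subgroup S.thompsonGroup :=
  Subgroup.closure {g | ∃ C a b, S.IsDyadicBox C a b ∧ S.boxSet C a b ⊆ V ∧
    g ∈ suppSub (S.boxSet C a b)}

theorem suppSub_le_locSub {C : Set X} {a b : ℝ} (h : S.IsDyadicBox C a b)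
    {V : Set S.DihedralSuspension} (hV : S.boxSet C a b ⊆ V) :
    suppSub (S.boxSet C a b) ≤ locSub V :=
  fun _ hg => Subgroup.subset_closure ⟨C, a, b, h, hV, hg⟩

theorem locSub_le {V : Set S.DihedralSuspension} {H : Subgroup S.thompsonGroup}
    (h : ∀ C a b, S.IsDyadicBox C a b → S.boxSet C a b ⊆ V → suppSub (S.boxSet C a b) ≤ H) :
    locSub V ≤ H := by
  rw [locSub, Subgroup.closure_le]
  rintro g ⟨C, a, b, h1, h2, h3⟩
  exact h C a b h1 h2 h3

/-- Since both sets are open, fragmentation cuts a box in the union into boxes each inside one of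
them. -/
theorem locSub_union_le {V W : Set S.DihedralSuspension} (hV : IsOpen V) (hW : IsOpen W) :
    locSub (V ∪ W) ≤ locSub V ⊔ locSub W := by
  refine locSub_le fun C a b h hVW => suppSub_le_of_local h fun z hz => ?_
  rcases hVW hz with hz | hz
  · exact ⟨V, hV.mem_nhds hz, fun C' a' b' h' hs => (suppSub_le_locSub h' hs).trans le_sup_left⟩
  · exact ⟨W, hW.mem_nhds hz, fun C' a' b' h' hs => (suppSub_le_locSub h' hs).trans le_sup_right⟩

/-- The image of a box under `g` need not be a box, so the box is first fragmented until the images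
of the pieces lie in boxes inside `W`. -/
theorem conj_mem_locSub {V W : Set S.DihedralSuspension} (hW : IsOpen W) (g : S.thompsonGroup)
    (hVW : ∀ z ∈ V, g.1 z ∈ W) {k : S.thompsonGroup} (hk : k ∈ locSub V) :
    g * k * g⁻¹ ∈ locSub W := by
  suffices h : locSub V ≤ (locSub W).comap (MulAut.conj g).toMonoidHom from h hk
  refine locSub_le fun C a b h hV => suppSub_le_of_local h fun z hz => ?_
  obtain ⟨C₁, a₁, b₁, h1, h2, h3⟩ := exists_dyadicBox (hW.mem_nhds (hVW z (hV hz)))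
  refine ⟨g.1 ⁻¹' S.boxSet C₁ a₁ b₁, g.1.continuous.continuousAt.preimage_mem_nhds h2,
    fun C' a' b' h' hs l hl => suppSub_le_locSub h1 h3 fun w hw => ?_⟩
  change g.1 (l.1 (g.1.symm w)) = w
  rw [hl _ fun h => hw ?_, g.1.apply_symm_apply]
  have := hs h
  rwa [mem_preimage, g.1.apply_symm_apply] at this

end Fragmentation

end ReversibleSystem

end SolenoidalThompson
-- Generation of the group by elements supported in boxes.
namespace SolenoidalThompson

open Set Filter Topology

/-- A fixed-point free involution of a totally disconnected compact space has a clopen fundamental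
domain. -/
theorem exists_fundamental_domain {X : Type*} [TopologicalSpace X] [CompactSpace X] [T2Space X]
    [TotallyDisconnectedSpace X] (τ : X ≃ₜ X) (h1 : ∀ x, τ (τ x) = x) (h2 : ∀ x, τ x ≠ x) :
    ∃ A : Set X, IsClopen A ∧ ∀ x, x ∈ A ↔ τ x ∉ A := by
  obtain ⟨A, hA, h3, h4⟩ : ∃ A : Set X, IsClopen A ∧ (∀ x ∈ A, τ x ∉ A) ∧ univ ⊆ A ∪ τ ⁻¹' A := by
    refine isCompact_univ.induction_on (p := fun V => ∃ A : Set X, IsClopen A ∧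
      (∀ x ∈ A, τ x ∉ A) ∧ V ⊆ A ∪ τ ⁻¹' A) ?_ ?_ ?_ ?_
    · exact ⟨∅, isClopen_empty, by simp, empty_subset _⟩
    · rintro V W hVW ⟨A, hA, h3, h4⟩
      exact ⟨A, hA, h3, hVW.trans h4⟩
    · rintro V W ⟨A, hA, h3, h4⟩ ⟨B, hB, h3', h4'⟩
      -- Only the part of `B` not yet covered by `A` and its image is added, which keeps the set
      -- disjoint from its image.
      refine ⟨A ∪ (B \ (A ∪ τ ⁻¹' A)), hA.union (hB.diff (hA.union (hA.preimage τ.continuous))),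
        ?_, ?_⟩
      · intro x hx hx'
        have := h1 x
        have := h3 x
        have := h3' x
        simp only [mem_union, Set.mem_sdiff, mem_preimage, h1] at hx hx'
        tauto
      · rintro x (hx | hx)
        · have := h4 hx
          simp only [mem_union, Set.mem_sdiff, mem_preimage, h1] at this ⊢
          tauto
        · have := h4' hx
          simp only [mem_union, Set.mem_sdiff, mem_preimage, h1] at this ⊢
          tauto
    · intro x _
      obtain ⟨U, V, hU, hV, hxU, hxV, hUV⟩ := t2_separation (h2 x)
      obtain ⟨W, ⟨hxW, hW⟩, hWU⟩ := (nhds_basis_clopen x).mem_iff.1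
        (inter_mem (hV.mem_nhds hxV) (τ.continuous.continuousAt.preimage_mem_nhds (hU.mem_nhds hxU)))
      refine ⟨W, mem_nhdsWithin_of_mem_nhds (hW.isOpen.mem_nhds hxW), W, hW, fun y hy hy' => ?_,
        subset_union_left⟩
      exact hUV.le_bot ⟨(hWU hy).2, (hWU hy').1⟩
  refine ⟨A, hA, fun x => ⟨h3 x, fun hx => ?_⟩⟩
  exact (h4 (mem_univ x)).resolve_right hx

/-- Numbering the finitely many values permits induction over the fibres. -/
theorem exists_factor_nat {X E : Type*} [TopologicalSpace X] [CompactSpace X] [Nonempty E]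
    (f : LocallyConstant X E) : ∃ (κ : LocallyConstant X ℕ) (F : ℕ → E), ∀ x, F (κ x) = f x := by
  have := f.range_finite.to_subtype
  obtain ⟨n, ⟨e⟩⟩ := Finite.exists_equiv_fin (range f)
  have hk : IsLocallyConstant fun x => (e ⟨f x, x, rfl⟩ : ℕ) := by
    rw [IsLocallyConstant.iff_eventually_eq]
    intro x
    filter_upwards [f.isLocallyConstant.eventually_eq x] with y hy
    have hy : f y = f x := hy
    simp only [hy]
  refine ⟨⟨_, hk⟩, fun i => if h : i < n then e.symm ⟨i, h⟩ else Classical.arbitrary E, fun x => ?_⟩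
  simp [Fin.is_lt]

theorem eq_zero_of_gap {f : ℤ → ℝ} {δ : ℝ} (h : ∀ n, f n + δ ≤ f (n + 1)) (hδ : 0 < δ) {n : ℤ}
    (hn : |f n - f 0| < δ) : n = 0 := by
  have hm : Monotone f := monotone_int_of_le_succ fun n => by linarith [h n]
  rw [abs_lt] at hn
  rcases lt_trichotomy n 0 with h0 | h0 | h0
  · have h1 := hm (show n ≤ -1 by omega)
    have h2 := h (-1)
    rw [neg_add_cancel] at h2
    linarith
  · exact h0
  · have h1 := hm (show 0 + 1 ≤ n by omega)
    have h2 := h 0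
    linarith

namespace ReversibleSystem

section Generation

variable {X : Type*} [TopologicalSpace X] {S : ReversibleSystem X}

theorem σ_ne (x : X) : S.σ x ≠ x := fun h => S.σ_not_mem_orbit x 0 (by simpa using h.symm)

/-- The injectivity of `π_Z` near a section. -/
theorem injOn_section {A : Set X} (hA : ∀ x ∈ A, S.σ x ∉ A) {u : X → ℝ} {r : ℝ} (hr : 0 < r)
    (hu : ∀ x, u (S.σ x) = -u x) (hgap : ∀ x, u x + 4 * r ≤ u (S.φ x) + 1) :
    InjOn S.projZ {p | p.1 ∈ A ∧ |p.2 - u p.1| < 2 * r} := by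
  -- By the gap condition the heights `u (φⁿ x) + n` increase by at least `4 r` with `n`. So points
  -- within `2 r` of the section are identified only with `n = 0`, and the flip with `n = 0` takes
  -- `A` off itself.
  have key : ∀ (x : X) (n : ℤ), |u ((S.φ ^ n) x) + n - u x| < 4 * r → n = 0 := by
    intro x n hn
    refine eq_zero_of_gap (f := fun n : ℤ => u ((S.φ ^ n) x) + n) (fun m => ?_)
      (show 0 < 4 * r by linarith) (by simpa using hn)
    have := hgap ((S.φ ^ m) x)
    have e : S.φ ((S.φ ^ m) x) = (S.φ ^ (m + 1)) x := by
      rw [add_comm, ← S.zpow_zpow, zpow_one]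
    rw [e] at this
    push_cast
    linarith
  rintro ⟨x, t⟩ ⟨hx, ht⟩ ⟨y, s⟩ ⟨hy, hs⟩ h
  obtain ⟨n, e | e⟩ := S.projZ_eq_iff.1 h <;> rw [Prod.mk.injEq] at e <;> obtain ⟨rfl, rfl⟩ := e <;>
    simp only at hx ht hy hs <;> rw [abs_lt] at ht hs
  · obtain rfl := key x n (by rw [abs_lt]; constructor <;> linarith [ht.1, ht.2, hs.1, hs.2])
    simp
  · have := hu x
    obtain rfl := key (S.σ x) n
      (by rw [abs_lt]; constructor <;> linarith [ht.1, ht.2, hs.1, hs.2])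
    exact absurd hy (by simpa using hA x hx)

variable [CompactSpace X] [TopologicalSpace.MetrizableSpace X] [TotallyDisconnectedSpace X]

/-- The section is moved over one fibre of `κ` at a time. By injectivity the box of half-height `r`
over fibre `n` contains no point within `r` of the section over another fibre, so earlier moves are
not disturbed. -/
theorem exists_move {A : Set X} (hA : IsClopen A) {κ : LocallyConstant X ℕ} {u v : ℕ → ℝ} {r : ℝ}
    (hu : ∀ i, u i ∈ dyadic) (hv : ∀ i, v i ∈ dyadic) (hr : 0 < r) (hrd : r ∈ dyadic)
    (huv : ∀ i, |v i - u i| < r)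
    (hinj : InjOn S.projZ {p | p.1 ∈ A ∧ |p.2 - u (κ p.1)| < 2 * r}) (n : ℕ) :
    ∃ k ∈ locSub (univ : Set S.DihedralSuspension), ∀ x ∈ A,
      leafMap k x (u (κ x)) = if κ x < n then v (κ x) else u (κ x) := by
  induction n with
  | zero => exact ⟨1, one_mem _, fun x _ => by simp [leafMap_one]⟩
  | succ n ih =>
    obtain ⟨k, hk, h⟩ := ih
    have huvn := abs_lt.1 (huv n)
    obtain ⟨e, he, he1, he2⟩ := exists_pl_map (sub_mem (hu n) hrd) (add_mem (hu n) hrd) (hu n) (hv n)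
      (show u n - r < u n by linarith) (by linarith) (by linarith) (by linarith)
    have hC : IsClopen (A ∩ κ ⁻¹' {n}) := hA.inter (κ.isLocallyConstant.isClopen_fiber n)
    have hb : S.IsBox (A ∩ κ ⁻¹' {n}) (u n - r) (u n + r) := by
      refine ⟨hC, r, hr, hinj.mono ?_⟩
      rintro ⟨x, t⟩ ⟨⟨hx, hx'⟩, ht⟩
      have hx' : κ x = n := hx'
      refine ⟨hx, ?_⟩
      simp only [hx']
      rw [abs_lt]
      constructor <;> linarith [ht.1, ht.2]
    have hd : S.IsDyadicBox (A ∩ κ ⁻¹' {n}) (u n - r) (u n + r) :=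
      ⟨hb, by linarith, sub_mem (hu n) hrd, add_mem (hu n) hrd⟩
    set b := boxHom hb (lcConst X ⟨e, plSub_le_dSub he, he1⟩) with hbdef
    have hoff : ∀ x ∈ A, κ x ≠ n → ∀ w, |w - u (κ x)| < r → leafMap b x w = w := by
      intro x hx hn w hw
      refine leafMap_eq_self (isClosed_boxSet hC _ _).isOpen_compl (boxHom_mem_suppSub hb _)
        fun hm => ?_
      obtain ⟨⟨y, s⟩, ⟨⟨hy, hy'⟩, hs⟩, hys⟩ := hm
      have hy' : κ y = n := hy'
      have := hinj (x₁ := (y, s)) (x₂ := (x, w)) ⟨hy, ?_⟩ ⟨hx, hw.trans (by linarith)⟩ hys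
      · rw [Prod.mk.injEq] at this
        exact hn (this.1 ▸ hy')
      · simp only [hy']
        rw [abs_lt]
        constructor <;> linarith [hs.1, hs.2]
    refine ⟨b * k, mul_mem (suppSub_le_locSub hd (subset_univ _) (boxHom_mem_suppSub hb _)) hk,
      fun x hx => ?_⟩
    rw [leafMap_mul, RelIso.mul_apply, h x hx]
    rcases lt_trichotomy (κ x) n with hlt | heq | hgt
    · rw [if_pos hlt, if_pos (hlt.trans n.lt_succ_self)]
      exact hoff x hx hlt.ne _ (huv _)
    · rw [if_neg (by omega), if_pos (by omega), heq, leafMap_boxHom hb _ ⟨hx, heq⟩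
        ⟨by linarith, by linarith⟩]
      exact he2
    · rw [if_neg (by omega), if_neg (by omega)]
      exact hoff x hx hgt.ne' _ (by simpa using hr)

/-- The zero section is moved to its image by an arbitrary element by a product of elements
supported in boxes. -/
theorem exists_move_section (g : S.thompsonGroup) :
    ∃ k ∈ locSub (univ : Set S.DihedralSuspension), ∀ x, leafMap k x 0 = leafMap g x 0 := by
  classical
  obtain ⟨A, hA, hA'⟩ := exists_fundamental_domain S.σ S.σ_σ σ_ne
  have hloc : IsLocallyConstant fun x => leafMap g x 0 := by
    rw [IsLocallyConstant.iff_eventually_eq]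
    intro x
    filter_upwards [eventually_leafMap_eq g x 0 0] with y hy using hy 0 (by simp)
  obtain ⟨κ, c, hc⟩ := exists_factor_nat (⟨_, hloc⟩ : LocallyConstant X ℝ)
  have hc : ∀ x, c (κ x) = leafMap g x 0 := hc
  rcases isEmpty_or_nonempty X with hX | hX
  · exact ⟨1, one_mem _, fun x => isEmptyElim x⟩
  have hσ : ∀ x, leafMap g (S.σ x) 0 = -leafMap g x 0 := fun x => by simpa using leafMap_σ g x 0
  have hcont : Continuous fun x => leafMap g x 0 := hloc.continuous
  have hgap : ∀ x ∈ (univ : Set X), 0 < leafMap g (S.φ x) 0 + 1 - leafMap g x 0 := by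
    intro x _
    have := leafMap_zpow g 1 x 1
    simp only [zpow_one, Int.cast_one, sub_self] at this
    rw [this]
    linarith [(leafMap g x).strictMono (show (0 : ℝ) < 1 by norm_num)]
  obtain ⟨δ, hδ, hgap⟩ := isCompact_univ.exists_forall_le'
    ((hcont.comp S.φ.continuous).add_const 1 |>.sub hcont).continuousOn hgap
  obtain ⟨B, hB⟩ := isCompact_univ.exists_bound_of_continuousOn hcont.continuousOn
  obtain ⟨r, hrd, hr, hr'⟩ := exists_dyadic_between (show 0 < min δ 1 / 4 by positivity)
  have hrδ : 4 * r ≤ δ := by linarith [min_le_left δ 1]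
  have hr1 : 4 * r ≤ 1 := by linarith [min_le_right δ 1]
  have hB0 : 0 ≤ B := (norm_nonneg _).trans (hB hX.some (mem_univ _))
  obtain ⟨M, hM⟩ := exists_pow_lt_of_lt_one (show 0 < r / (B + 1) by positivity)
    (show (2 : ℝ)⁻¹ < 1 by norm_num)
  rw [lt_div_iff₀ (by positivity)] at hM
  -- Indices that are not attained get the value `0`, so that the bound and dyadicity hold for all
  -- of them.
  set c' : ℕ → ℝ := fun i => if ∃ x, κ x = i then c i else 0 with hc'
  have hc'x : ∀ x, c' (κ x) = leafMap g x 0 := fun x => by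
    rw [← hc]
    exact if_pos ⟨x, rfl⟩
  have hcB : ∀ i, |c' i| ≤ B := by
    intro i
    by_cases hi : ∃ x, κ x = i
    · obtain ⟨x, rfl⟩ := hi
      rw [hc'x]
      exact hB x (mem_univ _)
    · simpa [hc', hi] using hB0
  have hcd : ∀ i, c' i ∈ dyadic := by
    intro i
    by_cases hi : ∃ x, κ x = i
    · obtain ⟨x, rfl⟩ := hi
      rw [hc'x]
      exact (dSub_apply_mem (leafMap_mem_dSub g x)).2 (zero_mem _)
    · simp only [hc', if_neg hi]
      exact zero_mem _
  obtain ⟨N, hN⟩ := κ.range_finite.bddAbove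
  -- The zero section is moved along the linear interpolation to its image. A convex combination of
  -- two sections with gap at least `4 r` has the same property, and `M` is large enough for each
  -- step to be shorter than `r`.
  have main : ∀ j : ℕ, j ≤ 2 ^ M → ∃ k ∈ locSub (univ : Set S.DihedralSuspension), ∀ x,
      leafMap k x 0 = (j * (2 : ℝ)⁻¹ ^ M) * leafMap g x 0 := by
    intro j
    induction j with
    | zero => exact fun _ => ⟨1, one_mem _, fun x => by simp [leafMap_one]⟩
    | succ j ih =>
      intro hj
      obtain ⟨k, hk, h⟩ := ih (by omega)
      set q := (2 : ℝ)⁻¹ ^ M with hq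
      have hq0 : 0 < q := by positivity
      have hjd : ∀ j : ℕ, (j : ℝ) * q ∈ dyadic := fun j =>
        mul_mem (natCast_mem _ j) (pow_mem half_mem M)
      have hjq : (j : ℝ) * q ≤ 1 := by
        have h1 : (j : ℝ) ≤ 2 ^ M := by exact_mod_cast (show j ≤ 2 ^ M by omega)
        calc (j : ℝ) * q ≤ 2 ^ M * q := by gcongr
          _ = 1 := by rw [hq, inv_pow]; field_simp
      have hj0 : 0 ≤ (j : ℝ) * q := by positivity
      obtain ⟨k', hk', h'⟩ := exists_move (S := S) hA (κ := κ) (u := fun i => j * q * c' i)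
        (v := fun i => (j + 1 : ℕ) * q * c' i) (r := r) (fun i => mul_mem (hjd j) (hcd i))
        (fun i => mul_mem (hjd (j + 1)) (hcd i)) hr hrd (fun i => by
          have e : ((j + 1 : ℕ) : ℝ) * q * c' i - j * q * c' i = q * c' i := by push_cast; ring
          rw [e, abs_mul, abs_of_pos hq0]
          nlinarith [hcB i]) (by
          refine injOn_section (fun x hx => (hA' x).1 hx) (u := fun x => j * q * c' (κ x)) hr
            (fun x => ?_) fun x => ?_
          · rw [hc'x, hc'x, hσ]; ring
          · rw [hc'x, hc'x]
            have h1 := hgap x (mem_univ _)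
            simp only [Function.comp_apply, Pi.sub_apply] at h1
            nlinarith [mul_nonneg hj0 (show 0 ≤ leafMap g (S.φ x) 0 + 1 - leafMap g x 0 - δ by
              linarith), mul_le_mul_of_nonneg_left hrδ hj0, mul_le_mul_of_nonneg_left hr1
                (show 0 ≤ 1 - j * q by linarith)]) (N + 1)
      have h'A : ∀ x ∈ A, leafMap k' x (j * q * leafMap g x 0) = (j + 1 : ℕ) * q * leafMap g x 0 := by
        intro x hx
        have := h' x hx
        have hxN : κ x ≤ N := hN ⟨x, rfl⟩
        rwa [if_pos (by omega), hc'x] at this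
      refine ⟨k' * k, mul_mem hk' hk, fun x => ?_⟩
      rw [leafMap_mul, RelIso.mul_apply, h]
      by_cases hx : x ∈ A
      · exact h'A x hx
      · have hx' : S.σ x ∈ A := by
          by_contra h
          exact hx ((hA' x).2 h)
        have h1 := h'A _ hx'
        rw [hσ, mul_neg, leafMap_σ, mul_neg, neg_inj] at h1
        exact h1
  obtain ⟨k, hk, h⟩ := main (2 ^ M) le_rfl
  refine ⟨k, hk, fun x => ?_⟩
  rw [h x]
  push_cast
  rw [inv_pow]
  field_simp

/-- A map fixing the zero section agrees near it with a map supported in a box. -/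
theorem exists_germ {g : S.thompsonGroup} (hg : ∀ x, leafMap g x 0 = 0) :
    ∃ k ∈ locSub (univ : Set S.DihedralSuspension), ∃ s > 0, ∀ x, ∀ t ∈ Icc (-s) s,
      leafMap k x t = leafMap g x t := by
  classical
  obtain ⟨A, hA, hA'⟩ := exists_fundamental_domain S.σ S.σ_σ σ_ne
  have hd4 : (4 : ℝ)⁻¹ ∈ dyadic := by
    have := mul_mem half_mem half_mem
    norm_num at this ⊢
    exact this
  have hb : S.IsBox A (-4⁻¹) 4⁻¹ := by
    refine ⟨hA, 4⁻¹, by norm_num, (injOn_section (fun x hx => (hA' x).1 hx) (u := fun _ => 0)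
      (r := 4⁻¹) (by norm_num) (by simp) (by norm_num)).mono ?_⟩
    rintro ⟨x, t⟩ hx
    refine ⟨hx.1, ?_⟩
    rw [abs_lt]
    constructor <;> linarith [hx.2.1, hx.2.2]
  have hbd : S.IsDyadicBox A (-4⁻¹) 4⁻¹ := ⟨hb, by norm_num, neg_mem hd4, hd4⟩
  have h1 : ∀ᶠ t in 𝓝 (0 : ℝ), ∀ x ∈ (univ : Set X), |leafMap g x t| < 4⁻¹ := by
    refine isCompact_univ.eventually_forall_of_forall_eventually fun x _ => ?_
    have hc : Continuous fun p : ℝ × X => |leafMap g p.2 p.1| :=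
      ((continuous_leafMap g).comp (continuous_snd.prodMk continuous_fst)).abs
    refine hc.continuousAt.eventually_lt continuousAt_const ?_
    simp [hg]
  obtain ⟨ε, hε, h1⟩ := exists_Ioo_of_eventually h1
  obtain ⟨s, hsd, hs0, hs⟩ := exists_dyadic_between (show 0 < min ε 4⁻¹ by positivity)
  rw [lt_min_iff] at hs
  have hloc : IsLocallyConstant fun x => fun t : Icc (-s) s => leafMap g x t := by
    rw [IsLocallyConstant.iff_eventually_eq]
    intro x
    filter_upwards [eventually_leafMap_eq g x (-s) s] with y hy
    ext t
    exact hy t t.2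
  -- The extension is a function of the restricted leaf map alone, so it is locally constant in `x`;
  -- the value `1` is a dummy.
  let E : (Icc (-s) s → ℝ) → Dd (-4⁻¹) 4⁻¹ := fun w =>
    if h : ∃ e : Dd (-4⁻¹) 4⁻¹, ∀ t : Icc (-s) s, (e : ℝ ≃o ℝ) t = w t then h.choose else 1
  have hE : ∀ x, ∀ t ∈ Icc (-s) s, (E (fun t => leafMap g x t) : ℝ ≃o ℝ) t = leafMap g x t := by
    intro x t ht
    have ha := abs_lt.1 (h1 s (by rw [sub_zero, abs_of_pos hs0]; exact hs.1) x (mem_univ _))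
    have ha' := abs_lt.1 (h1 (-s) (by rw [sub_zero, abs_neg, abs_of_pos hs0]; exact hs.1) x
      (mem_univ _))
    obtain ⟨e, he, he1, -⟩ := exists_extend (leafMap_mem_dSub g x) (neg_mem hd4) hd4 (neg_mem hsd)
      hsd (by linarith [hs.2]) (by linarith) hs.2 ha'.1 ha.2
    have hex : ∃ e : Dd (-4⁻¹) 4⁻¹, ∀ t : Icc (-s) s, (e : ℝ ≃o ℝ) t = leafMap g x t :=
      ⟨⟨e, he⟩, fun t => he1 t t.2⟩
    simp only [E, dif_pos hex]
    exact hex.choose_spec ⟨t, ht⟩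
  have hkA : ∀ x ∈ A, ∀ t ∈ Icc (-s) s,
      leafMap (boxHom hb (LocallyConstant.map E ⟨_, hloc⟩)) x t = leafMap g x t := fun x hx t ht => by
    rw [leafMap_boxHom hb _ hx ⟨by linarith [ht.1, hs.2], by linarith [ht.2, hs.2]⟩]
    exact hE x t ht
  refine ⟨boxHom hb (LocallyConstant.map E ⟨_, hloc⟩),
    suppSub_le_locSub hbd (subset_univ _) (boxHom_mem_suppSub hb _), s, hs0, fun x t ht => ?_⟩
  by_cases hx : x ∈ A
  · exact hkA x hx t ht
  · have hx' : S.σ x ∈ A := by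
      by_contra h
      exact hx ((hA' x).2 h)
    have h2 := hkA _ hx' (-t) ⟨by linarith [ht.2], by linarith [ht.1]⟩
    rwa [leafMap_σ, leafMap_σ, neg_inj] at h2

/-- Once `g` is corrected on the zero section and then near it, the remainder is the identity near
that section. It is therefore supported in a single box: heights `[s, 1 - s]` over a clopen
fundamental domain of `φ⁻¹ σ`, which belongs to the reflection `t ↦ 1 - t`. -/
theorem locSub_univ : locSub (univ : Set S.DihedralSuspension) = ⊤ := by
  rw [eq_top_iff]
  intro g _
  obtain ⟨k, hk, h1⟩ := exists_move_section g
  obtain ⟨k', hk', s₀, hs₀, h2⟩ := exists_germ (g := k⁻¹ * g) fun x => by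
    rw [leafMap_mul, RelIso.mul_apply, ← h1, leafMap_inv]
    exact (leafMap k x).symm_apply_apply 0
  set g' := k'⁻¹ * (k⁻¹ * g) with hg'
  obtain ⟨s, hsd, hs0, hs⟩ := exists_dyadic_between (show 0 < min s₀ 2⁻¹ by positivity)
  rw [lt_min_iff] at hs
  have h3 : ∀ x, ∀ t ∈ Icc (-s) s, leafMap g' x t = t := by
    intro x t ht
    rw [hg', leafMap_mul, RelIso.mul_apply, ← h2 x t ⟨by linarith [ht.1], by linarith [ht.2]⟩,
      leafMap_inv]
    exact (leafMap k' x).symm_apply_apply t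
  have hτσ : ∀ x, (S.φ ^ (-1 : ℤ) * S.σ) x = (S.φ ^ (-1 : ℤ)) (S.σ x) := fun _ => rfl
  obtain ⟨A, hA, hA'⟩ := exists_fundamental_domain (S.φ ^ (-1 : ℤ) * S.σ) (fun x => by
      rw [hτσ, hτσ, S.σ_zpow, S.zpow_zpow, S.σ_σ]; simp) (fun x h => by
      apply S.σ_not_mem_orbit x 1
      rw [hτσ] at h
      conv_lhs => rw [← h]
      rw [S.zpow_zpow]; simp)
  have hb : S.IsDyadicBox A s (1 - s) := by
    refine ⟨⟨hA, s, hs0, ?_⟩, by linarith [hs.2], hsd, sub_mem (one_mem _) hsd⟩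
    rintro ⟨x, t⟩ ⟨hx, ht⟩ ⟨y, w⟩ ⟨hy, hw⟩ h
    simp only [sub_self, sub_add_cancel, mem_Ioo] at hx hy ht hw
    obtain ⟨n, e | e⟩ := S.projZ_eq_iff.1 h <;> rw [Prod.mk.injEq] at e <;>
      obtain ⟨rfl, rfl⟩ := e
    · have h1 : (-1 : ℝ) < n := by linarith
      have h2 : (n : ℝ) < 1 := by linarith
      have : n = 0 := by
        have h1 : -1 < n := by exact_mod_cast h1
        have h2 : n < 1 := by exact_mod_cast h2
        omega
      subst this
      simp
    · have h1 : (-2 : ℝ) < n := by linarith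
      have h2 : (n : ℝ) < 0 := by linarith
      have : n = -1 := by
        have h1 : -2 < n := by exact_mod_cast h1
        have h2 : n < 0 := by exact_mod_cast h2
        omega
      subst this
      exact absurd hy ((hA' x).1 hx)
  have hsupp : g' ∈ suppSub (S.boxSet A s (1 - s)) := by
    have key : ∀ x ∈ A, ∀ t ∈ Icc (0 : ℝ) 1, S.projZ (x, t) ∉ S.boxSet A s (1 - s) →
        g'.1 (S.projZ (x, t)) = S.projZ (x, t) := by
      intro x hx t ht hz
      rw [← projZ_leafMap]
      have hts : t < s ∨ 1 - s < t := by
        by_contra! h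
        exact hz ⟨(x, t), ⟨hx, h⟩, rfl⟩
      rcases hts with hts | hts
      · rw [h3 x t ⟨by linarith [ht.1], hts.le⟩]
      · have h4 := leafMap_zpow g' 1 x t
        rw [h3 _ _ ⟨by push_cast; linarith, by push_cast; linarith [ht.2]⟩] at h4
        rw [show leafMap g' x t = t by linarith]
    intro z hz
    obtain ⟨⟨x, t⟩, rfl⟩ := S.projZ_surjective z
    rw [(S.projZ_eq_iff (a := (x, t))).2 ⟨⌊t⌋, Or.inl rfl⟩] at hz ⊢
    set y := (S.φ ^ ⌊t⌋) x
    have ht : t - ⌊t⌋ ∈ Icc (0 : ℝ) 1 := ⟨by linarith [Int.floor_le t],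
      by linarith [Int.lt_floor_add_one t]⟩
    by_cases hy : y ∈ A
    · exact key y hy _ ht hz
    · have hy' : (S.φ ^ (-1 : ℤ)) (S.σ y) ∈ A := by
        by_contra h
        exact hy ((hA' y).2 h)
      simp only at hz ⊢
      rw [(S.projZ_eq_iff (a := (y, t - ⌊t⌋))).2 ⟨-1, Or.inr rfl⟩] at hz ⊢
      simp only at hz ⊢
      refine key _ hy' _ ⟨?_, ?_⟩ hz <;> push_cast <;> linarith [ht.1, ht.2]
  have e : g = k * (k' * g') := by rw [hg']; group
  rw [e]
  exact mul_mem hk (mul_mem hk' (suppSub_le_locSub hb (subset_univ _) hsupp))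

end Generation

end ReversibleSystem

end SolenoidalThompson
-- Existence of a fixed pair.
namespace SolenoidalThompson

open Set Filter Topology

namespace ReversibleSystem

section FixedPairs

variable {X : Type*} [TopologicalSpace X] {S : ReversibleSystem X}

variable (S) in
/-- A box parametrized by the unit interval. -/
structure FineBox where
  C : Set X
  T : ℝ ≃o ℝ
  mem : T ∈ plSub
  isBox : S.IsBox C (T 0) (T 1)

/-- The subset of the dihedral suspension covered by a parametrized box. -/
def FineBox.carrier (f : S.FineBox) : Set S.DihedralSuspension := S.boxSet f.C (f.T 0) (f.T 1)

variable [CompactSpace X] [TopologicalSpace.MetrizableSpace X] [TotallyDisconnectedSpace X]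

/-- The action of the functions with values in the maps of the unit interval. -/
noncomputable def FineBox.act (f : S.FineBox) : LocallyConstant X (Dd 0 1) →* S.thompsonGroup :=
  (boxHom f.isBox).comp (lcMap (conjHom f.T f.mem 0 1))

theorem FineBox.act_mem (f : S.FineBox) (θ : LocallyConstant X (Dd 0 1)) :
    f.act θ ∈ suppSub f.carrier := boxHom_mem_suppSub f.isBox _

/-- `exists_boxHom_eq` on the sub-box, with the values conjugated back by `T`. -/
theorem FineBox.exists_act_eq (f : S.FineBox) {u v : ℝ} (hu : u ∈ dyadic) (hv : v ∈ dyadic)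
    (h0 : 0 ≤ u) (huv : u < v) (h1 : v ≤ 1) {g : S.thompsonGroup}
    (hg : g ∈ suppSub (S.boxSet f.C (f.T u) (f.T v))) :
    ∃ θ : LocallyConstant X (Dd 0 1), (∀ x, (θ x : ℝ ≃o ℝ) ∈ Dd u v) ∧ f.act θ = g := by
  have hb : S.IsBox f.C (f.T u) (f.T v) :=
    f.isBox.mono f.isBox.1 subset_rfl (f.T.monotone h0) (f.T.monotone h1)
  obtain ⟨θ, rfl⟩ := exists_boxHom_eq hb (f.T.monotone huv.le) ((plSub_apply_mem f.mem).2 hu)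
    ((plSub_apply_mem f.mem).2 hv) hg
  have hE : ∀ e : Dd (f.T u) (f.T v), f.T⁻¹ * e * f.T ∈ Dd u v := by
    intro e
    have h : f.T⁻¹ * (e : ℝ ≃o ℝ) * f.T⁻¹⁻¹ ∈ Dd (f.T⁻¹ (f.T u)) (f.T⁻¹ (f.T v)) :=
      (conjHom f.T⁻¹ (inv_mem f.mem) (f.T u) (f.T v) e).2
    rwa [inv_apply_self', inv_apply_self', inv_inv] at h
  refine ⟨θ.map fun e : Dd (f.T u) (f.T v) => (⟨f.T⁻¹ * e * f.T, Dd_mono h0 h1 (hE e)⟩ : Dd 0 1), fun x => hE (θ x), ?_⟩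
  set θ' := lcMap (conjHom f.T f.mem 0 1)
    (θ.map fun e : Dd (f.T u) (f.T v) => (⟨f.T⁻¹ * e * f.T, Dd_mono h0 h1 (hE e)⟩ : Dd 0 1)) with hθ'
  have e : ∀ x, (θ' x : ℝ ≃o ℝ) = θ x := by
    intro x
    change f.T * (f.T⁻¹ * (θ x : ℝ ≃o ℝ) * f.T) * f.T⁻¹ = θ x
    group
  change boxHom f.isBox θ' = _
  refine Subtype.ext (Homeomorph.ext fun z => ?_)
  by_cases hz : z ∈ S.boxSet f.C (f.T u) (f.T v)
  · obtain ⟨⟨x, t⟩, hx, rfl⟩ := hz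
    rw [boxHom_apply hb _ hx.1 hx.2, boxHom_apply f.isBox _ hx.1
      ⟨(f.T.monotone h0).trans hx.2.1, hx.2.2.trans (f.T.monotone h1)⟩, e]
  · rw [boxHom_mem_suppSub hb θ z hz]
    exact boxHom_mem_suppSub_of f.isBox (fun x hx t ht => by
      rw [e]
      exact (θ x).2.2 t fun h => ht ⟨hx, Ioo_subset_Icc_self h⟩) z hz

/-- The point `z` lies over the core of the box, so the results on cores apply to all elements
supported close to `z`. -/
theorem exists_fineBox {z : S.DihedralSuspension} {N : Set S.DihedralSuspension} (hN : N ∈ 𝓝 z) :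
    ∃ (f : S.FineBox) (u v : ℝ), u ∈ dyadic ∧ v ∈ dyadic ∧ coreL < u ∧ u < v ∧ v < coreR ∧
      f.carrier ⊆ N ∧ ∃ N' ∈ 𝓝 z, ∀ g ∈ suppSub N', ∃ θ : LocallyConstant X (Dd 0 1),
        (∀ x, (θ x : ℝ ≃o ℝ) ∈ Dd u v) ∧ f.act θ = g := by
  obtain ⟨⟨x, t⟩, rfl⟩ := S.projZ_surjective z
  obtain ⟨C, hx, ε, hε, h1, h2⟩ := exists_box hN
  obtain ⟨hc0, hc, hc1⟩ := core_bounds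
  obtain ⟨k, hk⟩ := exists_pow_lt_of_lt_one hε (show (2 : ℝ)⁻¹ < 1 by norm_num)
  have hqk : (2 : ℝ) ^ (-(k : ℤ)) = (2 : ℝ)⁻¹ ^ k := by simp
  set q := (2 : ℝ) ^ (-(k : ℤ)) with hq
  have hq0 : 0 < q := by positivity
  -- The range of `w` says that `t` lies over the open core. As the core is inside `(0, 1)` and `q <
  -- ε`, the whole box stays within `ε` of `t`.
  obtain ⟨w, hw, hw1, hw2⟩ := exists_dyadic_between
    (show t - q * coreR < t - q * coreL by nlinarith)
  have hT : ∀ s, affIso (-(k : ℤ)) w s = q * s + w := fun s => rfl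
  have hwL : coreL < (t - w) / q := by rw [lt_div_iff₀ hq0]; linarith
  have hwR : (t - w) / q < coreR := by rw [div_lt_iff₀ hq0]; linarith
  obtain ⟨u, hu, hu1, hu2⟩ := exists_dyadic_between hwL
  obtain ⟨v, hv, hv1, hv2⟩ := exists_dyadic_between hwR
  rw [lt_div_iff₀ hq0] at hu2
  rw [div_lt_iff₀ hq0] at hv1
  have e0 : t - ε ≤ affIso (-(k : ℤ)) w 0 := by rw [hT]; nlinarith
  have e1 : affIso (-(k : ℤ)) w 1 ≤ t + ε := by rw [hT]; nlinarith
  have huv : u < v := by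
    have : u * q < v * q := by linarith
    exact lt_of_mul_lt_mul_right this hq0.le
  refine ⟨⟨C, affIso (-(k : ℤ)) w, affIso_mem hw, h1.mono h1.1 subset_rfl e0 e1⟩, u, v, hu, hv, hu1,
    huv, hv2, (boxSet_mono subset_rfl e0 e1).trans h2,
    S.boxSet C (affIso (-(k : ℤ)) w u) (affIso (-(k : ℤ)) w v), ?_, fun g hg =>
    FineBox.exists_act_eq _ hu hv (hc0.trans hu1).le huv (hv2.trans hc1).le hg⟩
  refine isOpenMap_projZ.image_mem_nhds (prod_mem_nhds (h1.1.isOpen.mem_nhds hx) (Icc_mem_nhds ?_ ?_))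
  · rw [hT]; linarith
  · rw [hT]; linarith

/-- By `exists_fixSet_above` the elements supported near `z` have a common fixed point `M ≥ 0`,
which they cannot push `0` past. Compactness of `Z` makes `M` uniform. -/
theorem exists_orbit_bound (ρ : S.thompsonGroup →* (ℝ ≃o ℝ)) : ∃ M, ∀ z : S.DihedralSuspension, ∃ N ∈ 𝓝 z, ∀ g ∈ suppSub N,
    ρ g 0 ≤ M := by
  have := compactSpace_dihedral (S := S)
  suffices h : ∃ M, ∀ z ∈ (univ : Set S.DihedralSuspension), ∃ N ∈ 𝓝 z, ∀ g ∈ suppSub N,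
      ρ g 0 ≤ M by
    simpa using h
  refine isCompact_univ.induction_on (p := fun V => ∃ M, ∀ z ∈ V, ∃ N ∈ 𝓝 z, ∀ g ∈ suppSub N,
    ρ g 0 ≤ M) ?_ ?_ ?_ ?_
  · exact ⟨0, fun z hz => absurd hz (notMem_empty z)⟩
  · rintro V W hVW ⟨M, h⟩
    exact ⟨M, fun z hz => h z (hVW hz)⟩
  · rintro V W ⟨M, h⟩ ⟨M', h'⟩
    refine ⟨max M M', ?_⟩
    rintro z (hz | hz)
    · obtain ⟨N, hN, h⟩ := h z hz
      exact ⟨N, hN, fun g hg => (h g hg).trans (le_max_left _ _)⟩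
    · obtain ⟨N, hN, h⟩ := h' z hz
      exact ⟨N, hN, fun g hg => (h g hg).trans (le_max_right _ _)⟩
  · intro z _
    obtain ⟨f, u, v, hu, hv, hu1, huv, hv1, -, N, hN, h⟩ := exists_fineBox (univ_mem (f := 𝓝 z))
    obtain ⟨M, hM, hM0⟩ := exists_fixSet_above (ρ.comp f.act) hu hv (core_bounds.1.trans hu1) huv
      (hv1.trans core_bounds.2.2) 0
    refine ⟨interior N, mem_nhdsWithin_of_mem_nhds (interior_mem_nhds.2 hN), M, fun w hw =>
      ⟨N, mem_interior_iff_mem_nhds.1 hw, fun g hg => ?_⟩⟩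
    obtain ⟨θ, hθ, rfl⟩ := h g hg
    rw [← hM θ hθ]
    exact (ρ (f.act θ)).monotone hM0

/-- The elements of the core of a parametrized box. -/
def FineBox.core (f : S.FineBox) : Set S.thompsonGroup :=
  {g | ∃ θ : LocallyConstant X (Dd 0 1), (∀ x, (θ x : ℝ ≃o ℝ) ∈ Dc coreL coreR) ∧ f.act θ = g}

/-- A word involves only finitely many indices. -/
theorem exists_finite_of_mem_closure {G ι : Type*} [Group G] {s : ι → Set G} {P : ι → Prop} {g : G}
    (hg : g ∈ Subgroup.closure {g | ∃ i, P i ∧ g ∈ s i}) :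
    ∃ F : Set ι, F.Finite ∧ (∀ i ∈ F, P i) ∧ g ∈ Subgroup.closure {g | ∃ i ∈ F, g ∈ s i} := by
  induction hg using Subgroup.closure_induction with
  | mem g hg =>
    obtain ⟨i, hi, hg⟩ := hg
    exact ⟨{i}, finite_singleton i, by simpa using hi, Subgroup.subset_closure ⟨i, rfl, hg⟩⟩
  | one => exact ⟨∅, finite_empty, by simp, one_mem _⟩
  | mul a b _ _ iha ihb =>
    obtain ⟨F, h1, h2, h3⟩ := iha
    obtain ⟨F', h1', h2', h3'⟩ := ihb
    refine ⟨F ∪ F', h1.union h1', fun i hi => hi.elim (h2 i) (h2' i), mul_mem ?_ ?_⟩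
    · refine Subgroup.closure_mono ?_ h3
      rintro _ ⟨i, hi, h⟩
      exact ⟨i, Or.inl hi, h⟩
    · refine Subgroup.closure_mono ?_ h3'
      rintro _ ⟨i, hi, h⟩
      exact ⟨i, Or.inr hi, h⟩
  | inv a _ iha =>
    obtain ⟨F, h1, h2, h3⟩ := iha
    exact ⟨F, h1, h2, inv_mem h3⟩

/-- Without such a pair, compactness of `[0, M]` gives each `z` a neighbourhood `K z` and finitely
many elements, generated off `K z`, with no common fixed point in `[0, M]`. Finitely many `K z`
cover `Z`, and the cores of finitely many small boxes generate all these elements. The box from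
`exists_common_fixed` lies in some `K z`; the boxes off `K z` commute with it, so their cores share
a fixed point in `[0, M]`, a contradiction. -/
theorem exists_fixed_pair (ρ : S.thompsonGroup →* (ℝ ≃o ℝ)) [Nonempty X] : ∃ (z : S.DihedralSuspension) (t : ℝ),
    ∀ g ∈ locSub ({z}ᶜ : Set S.DihedralSuspension), ρ g t = t := by
  by_contra! hcon
  have := compactSpace_dihedral (S := S)
  obtain ⟨M, hM⟩ := exists_orbit_bound ρ
  have exists_finset : ∀ z : S.DihedralSuspension, ∃ K ∈ 𝓝 z, ∃ L : Set S.thompsonGroup, L.Finite ∧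
      (∀ g ∈ L, g ∈ locSub Kᶜ) ∧ ∀ t ∈ Icc 0 M, ∃ g ∈ L, ρ g t ≠ t := by
    intro z
    refine isCompact_Icc.induction_on (p := fun T => ∃ K ∈ 𝓝 z, ∃ L : Set S.thompsonGroup, L.Finite ∧
      (∀ g ∈ L, g ∈ locSub Kᶜ) ∧ ∀ t ∈ T, ∃ g ∈ L, ρ g t ≠ t) ?_ ?_ ?_ ?_
    · exact ⟨univ, univ_mem, ∅, finite_empty, by simp, by simp⟩
    · rintro T T' hT ⟨K, hK, L, h1, h2, h3⟩
      exact ⟨K, hK, L, h1, h2, fun t ht => h3 t (hT ht)⟩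
    · rintro T T' ⟨K, hK, L, h1, h2, h3⟩ ⟨K', hK', L', h1', h2', h3'⟩
      have hmono : ∀ V W : Set S.DihedralSuspension, V ⊆ W → locSub V ≤ locSub W := fun V W h =>
        locSub_le fun C a b hb hs => suppSub_le_locSub hb (hs.trans h)
      refine ⟨K ∩ K', inter_mem hK hK', L ∪ L', h1.union h1', ?_, ?_⟩
      · rintro g (hg | hg)
        · exact hmono _ _ (compl_subset_compl.2 inter_subset_left) (h2 g hg)
        · exact hmono _ _ (compl_subset_compl.2 inter_subset_right) (h2' g hg)
      · rintro t (ht | ht)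
        · obtain ⟨g, hg, h⟩ := h3 t ht
          exact ⟨g, Or.inl hg, h⟩
        · obtain ⟨g, hg, h⟩ := h3' t ht
          exact ⟨g, Or.inr hg, h⟩
    · intro t _
      obtain ⟨C, a, b, hb, hz, g, hg, hgt⟩ : ∃ C a b, S.IsDyadicBox C a b ∧ z ∉ S.boxSet C a b ∧
          ∃ g ∈ suppSub (S.boxSet C a b), ρ g t ≠ t := by
        by_contra! h
        obtain ⟨g, hg, hgt⟩ := hcon z t
        refine hgt ?_
        have hle : locSub ({z}ᶜ : Set S.DihedralSuspension) ≤ (fixPt t).comap ρ :=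
          locSub_le fun C a b hb hs g hg => h C a b hb (fun h' => hs h' rfl) g hg
        exact hle hg
      refine ⟨{s | ρ g s ≠ s}, mem_nhdsWithin_of_mem_nhds
        ((isOpen_ne_fun (ρ g).continuous continuous_id).mem_nhds hgt), (S.boxSet C a b)ᶜ,
        (isClosed_boxSet hb.isBox.1 a b).isOpen_compl.mem_nhds hz, {g}, finite_singleton g, ?_, ?_⟩
      · rintro _ rfl
        rw [compl_compl]
        exact suppSub_le_locSub hb subset_rfl hg
      · exact fun s hs => ⟨g, rfl, hs⟩
  have exists_closed : ∀ z : S.DihedralSuspension, ∃ K ∈ 𝓝 z, IsClosed K ∧ ∃ L : Set S.thompsonGroup,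
      L.Finite ∧ (∀ g ∈ L, g ∈ locSub Kᶜ) ∧ ∀ t ∈ Icc 0 M, ∃ g ∈ L, ρ g t ≠ t := by
    intro z
    obtain ⟨K, hK, L, h1, h2, h3⟩ := exists_finset z
    obtain ⟨C, a, b, hb, hbz, hbK⟩ := exists_dyadicBox hK
    exact ⟨S.boxSet C a b, hbz, isClosed_boxSet hb.isBox.1 a b, L, h1, fun g hg =>
      locSub_le (fun C' a' b' hb' hs => suppSub_le_locSub hb' (hs.trans (compl_subset_compl.2 hbK)))
        (h2 g hg), h3⟩
  choose K hK hKc L hL hLK hLt using exists_closed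
  obtain ⟨s, hs⟩ := CompactSpace.elim_nhds_subcover (fun z => interior (K z))
    fun z => interior_mem_nhds.2 (hK z)
  have hcov : ∀ w : S.DihedralSuspension, ∃ z ∈ s, w ∈ interior (K z) := by
    intro w
    have : w ∈ ⋃ z ∈ s, interior (K z) := hs ▸ mem_univ w
    simpa using this
  -- What is needed of the distinguished box: it lies inside one `K z`, and its elements do not push
  -- `0` beyond `M`.
  let good : S.FineBox → Prop := fun f => (∃ z ∈ s, f.carrier ⊆ K z) ∧
    ∀ g ∈ suppSub f.carrier, ρ g 0 ≤ M
  have locSub_le_cores : ∀ z, locSub (K z)ᶜ ≤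
      Subgroup.closure {g | ∃ f : S.FineBox, (good f ∧ f.carrier ⊆ (K z)ᶜ) ∧ g ∈ f.core} := by
    intro z
    refine locSub_le fun C a b hb hsub => suppSub_le_of_local hb fun w hw => ?_
    obtain ⟨z', hz', hwz'⟩ := hcov w
    obtain ⟨N, hN, hNM⟩ := hM w
    obtain ⟨f, u, v, hu, hv, hu1, huv, hv1, hfN, N', hN', h⟩ := exists_fineBox
      (inter_mem (inter_mem (isOpen_interior.mem_nhds hwz') hN)
        ((hKc z).isOpen_compl.mem_nhds (hsub hw)))
    refine ⟨N', hN', fun C' a' b' _ hs' g hg => Subgroup.subset_closure ⟨f, ⟨⟨⟨z', hz', fun y hy =>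
      interior_subset (hfN hy).1.1⟩, fun g hg => hNM g (suppSub_mono (fun y hy => (hfN hy).1.2) hg)⟩,
      fun y hy => (hfN hy).2⟩, ?_⟩⟩
    obtain ⟨θ, hθ, rfl⟩ := h g (suppSub_mono hs' hg)
    exact ⟨θ, fun x => Dd_le_Dc hu1 hv1 (hθ x), rfl⟩
  have exists_finite_boxes : ∀ z, ∀ g ∈ L z, ∃ F : Set S.FineBox, F.Finite ∧ (∀ f ∈ F, good f ∧ f.carrier ⊆ (K z)ᶜ) ∧
      g ∈ Subgroup.closure {g | ∃ f ∈ F, g ∈ f.core} := fun z g hg =>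
    exists_finite_of_mem_closure (locSub_le_cores z (hLK z g hg))
  choose! F hF hFg hFc using exists_finite_boxes
  let 𝓕 : Set S.FineBox := ⋃ z ∈ s, ⋃ g ∈ L z, F z g
  have h𝓕 : 𝓕.Finite := s.finite_toSet.biUnion fun z _ => (hL z).biUnion fun g hg => hF z g hg
  have h𝓕mem : ∀ z ∈ s, ∀ g ∈ L z, ∀ f ∈ F z g, f ∈ 𝓕 := fun z hz g hg f hf =>
    mem_biUnion (x := z) hz (mem_biUnion (x := g) hg hf)
  have := h𝓕.to_subtype
  have hM0 : 0 ≤ M := by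
    obtain ⟨N, -, h⟩ := hM (S.projZ (Classical.arbitrary X, 0))
    simpa using h 1 (one_mem _)
  have fin : ∀ z ∈ s, ∀ t ∈ Icc 0 M, ¬ ∀ f ∈ 𝓕, f.carrier ⊆ (K z)ᶜ → ∀ g ∈ f.core, ρ g t = t := by
    intro z hz t ht h
    obtain ⟨g, hg, hgt⟩ := hLt z t ht
    refine hgt ?_
    have hle : Subgroup.closure {k | ∃ f ∈ F z g, k ∈ f.core} ≤ (fixPt t).comap ρ := by
      rw [Subgroup.closure_le]
      rintro k ⟨f, hf, hk⟩
      exact h f (h𝓕mem z hz g hg f hf) (hFg z g hg f hf).2 k hk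
    exact hle (hFc z g hg)
  rcases exists_common_fixed (fun f : 𝓕 => ρ.comp f.1.act) 0 with h | ⟨⟨i, hi⟩, r, t', h1, h2, h3⟩
  · obtain ⟨z, hz, -⟩ := hcov (S.projZ (Classical.arbitrary X, 0))
    refine fin z hz 0 ⟨le_rfl, hM0⟩ fun f hf _ g hg => ?_
    obtain ⟨θ, hθ, rfl⟩ := hg
    exact h ⟨f, hf⟩ θ hθ
  · obtain ⟨⟨z, hz, hiz⟩, hgi⟩ : good i := by
      simp only [𝓕, mem_iUnion] at hi
      obtain ⟨z, hz, g, hg, hi⟩ := hi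
      exact (hFg z g hg i hi).1
    refine fin z hz t' ⟨h1, h2.trans (hgi _ (i.act_mem _))⟩ fun f hf hfK g hg => ?_
    obtain ⟨θ, hθ, rfl⟩ := hg
    refine h3 ⟨f, hf⟩ (fun a b => ?_) θ hθ
    refine (suppSub_commute ?_ (f.act_mem a) (i.act_mem b)).map ρ
    exact (disjoint_compl_left.mono_right hiz).mono_left hfK

end FixedPairs

end ReversibleSystem

end SolenoidalThompson
-- The covering of the dihedral suspension and lifting of paths.
namespace SolenoidalThompson

open Set Filter Topology

namespace ReversibleSystem

section Covering

variable {X : Type*} [TopologicalSpace X] {S : ReversibleSystem X}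

variable (S) in
/-- The action of the infinite dihedral group on `X × ℝ`. -/
def deckGroup : Subgroup (X × ℝ ≃ₜ X × ℝ) where
  carrier := {g | ∃ n : ℤ, (∀ p, g p = ((S.φ ^ n) p.1, p.2 - n)) ∨
    ∀ p, g p = ((S.φ ^ n) (S.σ p.1), -p.2 - n)}
  one_mem' := ⟨0, Or.inl fun p => by simp⟩
  mul_mem' := by
    rintro g g' ⟨m, h⟩ ⟨n, h'⟩
    rcases h with h | h <;> rcases h' with h' | h'
    · exact ⟨m + n, Or.inl fun p => by
        rw [Homeomorph.mul_apply, h, h']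
        simp only [S.zpow_zpow, Prod.mk.injEq, true_and]; push_cast; ring⟩
    · exact ⟨m + n, Or.inr fun p => by
        rw [Homeomorph.mul_apply, h, h']
        simp only [S.zpow_zpow, Prod.mk.injEq, true_and]; push_cast; ring⟩
    · exact ⟨m - n, Or.inr fun p => by
        rw [Homeomorph.mul_apply, h, h']
        simp only [S.zpow_zpow, S.σ_zpow, Prod.mk.injEq, ← sub_eq_add_neg, true_and]
        push_cast; ring⟩
    · exact ⟨m - n, Or.inl fun p => by
        rw [Homeomorph.mul_apply, h, h']
        simp only [S.zpow_zpow, S.σ_zpow, S.σ_σ, Prod.mk.injEq, ← sub_eq_add_neg, true_and]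
        push_cast; ring⟩
  inv_mem' := by
    rintro g ⟨n, h | h⟩
    · refine ⟨-n, Or.inl fun p => g.injective ?_⟩
      rw [h ((S.φ ^ (-n)) p.1, p.2 - (-n : ℤ)), ← Homeomorph.mul_apply, mul_inv_cancel]
      simp
    · refine ⟨n, Or.inr fun p => g.injective ?_⟩
      rw [h ((S.φ ^ n) (S.σ p.1), -p.2 - n), ← Homeomorph.mul_apply, mul_inv_cancel]
      simp [S.σ_zpow, S.σ_σ]

instance : MulAction S.deckGroup (X × ℝ) where
  smul g p := g.1 p
  one_smul _ := rfl
  mul_smul _ _ _ := rfl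

theorem projZ_eq_iff_orbit {a b : X × ℝ} :
    S.projZ a = S.projZ b ↔ a ∈ MulAction.orbit S.deckGroup b := by
  rw [eq_comm, projZ_eq_iff]
  constructor
  · rintro ⟨n, h | h⟩
    · refine ⟨⟨(S.φ ^ n).prodCongr (Homeomorph.subRight (n : ℝ)), n, Or.inl fun p => rfl⟩, h.symm⟩
    · refine ⟨⟨(S.σ.trans (S.φ ^ n)).prodCongr
        ((Homeomorph.neg ℝ).trans (Homeomorph.subRight (n : ℝ))), n, Or.inr fun p => rfl⟩, h.symm⟩
  · rintro ⟨⟨g, n, h⟩, rfl⟩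
    exact ⟨n, h.imp (fun h => h b) fun h => h b⟩

/-- A translation with `n ≠ 0` moves the real coordinate, and a flip with a fixed point would give a
`φ`-orbit preserved by `σ`. -/
theorem deckGroup_free (g : S.deckGroup) {p : X × ℝ} (h : g • p = p) : g = 1 := by
  obtain ⟨g, n, hg | hg⟩ := g
  · have h1 : ((S.φ ^ n) p.1, p.2 - n) = p := (hg p).symm.trans h
    have h2 : (n : ℝ) = 0 := by have := congrArg Prod.snd h1; simp at this; simpa using this
    have h3 : n = 0 := by exact_mod_cast h2
    subst h3
    exact Subtype.ext (Homeomorph.ext fun p => by rw [hg]; simp)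
  · have h1 : ((S.φ ^ n) (S.σ p.1), -p.2 - n) = p := (hg p).symm.trans h
    have h2 : (S.φ ^ n) (S.σ p.1) = p.1 := congrArg Prod.fst h1
    exact absurd (by rw [S.σ_σ, h2]) (S.σ_not_mem_orbit (S.σ p.1) n)

variable [CompactSpace X] [TopologicalSpace.MetrizableSpace X] [TotallyDisconnectedSpace X]

/-- By freeness, a neighbourhood on which `π_Z` is injective meets none of its nontrivial
translates. -/
theorem isQuotientCoveringMap_projZ : IsQuotientCoveringMap S.projZ S.deckGroup where
  toIsQuotientMap := isOpenQuotientMap_projZ.isQuotientMap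
  continuous_const_smul g := g.1.continuous
  apply_eq_iff_mem_orbit := projZ_eq_iff_orbit
  disjoint p := by
    obtain ⟨C, hx, ε, hε, hb, -⟩ := exists_box (S := S) (x := p.1) (t := p.2) univ_mem
    obtain ⟨hC, δ, hδ, hi⟩ := hb
    refine ⟨C ×ˢ Ioo (p.2 - ε) (p.2 + ε), (hC.isOpen.prod isOpen_Ioo).mem_nhds
      ⟨hx, by constructor <;> simp [hε]⟩, fun g => ?_⟩
    rintro ⟨_, ⟨u, hu, rfl⟩, hgu⟩
    have key : ∀ v ∈ C ×ˢ Ioo (p.2 - ε) (p.2 + ε),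
        v ∈ C ×ˢ Ioo (p.2 - ε - δ) (p.2 + ε + δ) := fun v hv =>
      ⟨hv.1, by linarith [hv.2.1], by linarith [hv.2.2]⟩
    exact deckGroup_free g (hi (key _ hgu) (key _ hu) (projZ_eq_iff_orbit.2 ⟨g, rfl⟩))

/-- A path in the dihedral suspension stays in one leaf. -/
theorem exists_leaf_lift {q : ℝ → S.DihedralSuspension} (hq : Continuous q) :
    ∃ (x : X) (h : ℝ → ℝ), Continuous h ∧ ∀ t, q t = S.projZ (x, h t) := by
  obtain ⟨e, he⟩ := S.projZ_surjective (q 0)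
  have he : S.projZ e = (⟨q, hq⟩ : C(ℝ, S.DihedralSuspension)) 0 := he
  obtain ⟨F, ⟨-, hF⟩, -⟩ := isQuotientCoveringMap_projZ.isCoveringMap.existsUnique_continuousMap_lifts
    ⟨q, hq⟩ 0 e he
  refine ⟨(F 0).1, fun t => (F t).2, F.continuous.snd, fun t => ?_⟩
  -- A connected image in the totally disconnected space `X` is a point.
  have h : (F 0).1 = (F t).1 := (isPreconnected_univ.image _ F.continuous.fst.continuousOn).subsingleton
    ⟨0, mem_univ _, rfl⟩ ⟨t, mem_univ _, rfl⟩
  rw [h]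
  exact (congrFun hF t).symm

end Covering

end ReversibleSystem

end SolenoidalThompson
-- Moving points along leaves.
namespace SolenoidalThompson

open Set Filter Topology

namespace ReversibleSystem

section Moving

variable {X : Type*} [TopologicalSpace X] [CompactSpace X] [TopologicalSpace.MetrizableSpace X]
  [TotallyDisconnectedSpace X] {S : ReversibleSystem X}

/-- Elements supported near a point of a leaf can move it. -/
theorem exists_lt_leafMap {x : X} {t : ℝ} {N : Set S.DihedralSuspension}
    (hN : N ∈ 𝓝 (S.projZ (x, t))) : ∃ g ∈ locSub N, t < leafMap g x t ∧
    leafMap g x t < t + 1 := by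
  obtain ⟨C, hx, ε, hε, hb, hs⟩ := exists_box hN
  obtain ⟨a, ha, ha1, ha2⟩ := exists_dyadic_between (show t - ε < t by linarith)
  obtain ⟨b, hbd, hb1, hb2⟩ := exists_dyadic_between (show t < t + ε by linarith)
  obtain ⟨u, hu, hu1, hu2⟩ := exists_dyadic_between ha2
  obtain ⟨v, hv, hv1, hv2⟩ := exists_dyadic_between hb1
  -- `d < b - v` leaves room for the extension, and `d < 1` keeps the displacement below every
  -- period of the leaf.
  obtain ⟨d, hd, hd1, hd2⟩ := exists_dyadic_between
    (show 0 < min (b - v) 1 by rw [lt_min_iff]; constructor <;> linarith)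
  rw [lt_min_iff] at hd2
  have hT : ∀ s, affIso 0 d s = s + d := fun s => by simp
  obtain ⟨e, he, h, -⟩ := exists_extend (f := affIso 0 d) (plSub_le_dSub (affIso_mem hd)) ha hbd hu hv
    hu1 (by linarith) hv2 (by rw [hT]; linarith) (by rw [hT]; linarith [hd2.1])
  have hbox : S.IsBox C a b := hb.mono hb.1 subset_rfl ha1.le hb2.le
  refine ⟨boxHom hbox (LocallyConstant.const X ⟨e, he⟩), suppSub_le_locSub
    ⟨hbox, by linarith, ha, hbd⟩ ((boxSet_mono subset_rfl ha1.le hb2.le).trans hs)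
    (boxHom_mem_suppSub _ _), ?_⟩
  rw [leafMap_boxHom hbox _ hx ⟨ha2, hb1⟩]
  change t < e t ∧ e t < t + 1
  rw [h t ⟨hu2.le, hv1.le⟩, hT]
  constructor <;> linarith [hd2.2]

theorem exists_ne_apply (z : S.DihedralSuspension) : ∃ g : S.thompsonGroup, g.1 z ≠ z := by
  obtain ⟨⟨x, t⟩, rfl⟩ := S.projZ_surjective z
  obtain ⟨g, -, h1, h2⟩ := exists_lt_leafMap (S := S) (x := x) (t := t) univ_mem
  refine ⟨g, fun h => ?_⟩
  rw [← projZ_leafMap, projZ_eq_iff_same] at h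
  obtain ⟨n, -, hn⟩ := h
  have h3 : 0 < n := by have : (0 : ℝ) < n := by linarith
                        exact_mod_cast this
  have h4 : n < 1 := by have : (n : ℝ) < 1 := by linarith
                        exact_mod_cast this
  omega

end Moving

/-! ### The equivariant map to the dihedral suspension and its lift to a leaf. -/

section Semiconjugacy

variable {X : Type*} [TopologicalSpace X] [CompactSpace X] [TopologicalSpace.MetrizableSpace X]
  [TotallyDisconnectedSpace X] {S : ReversibleSystem X}

/-- The complements of two distinct points cover `Z`, so fragmentation and `locSub_univ` apply. -/
theorem locSub_compl_sup {z z' : S.DihedralSuspension} (h : z ≠ z') :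
    locSub ({z}ᶜ) ⊔ locSub ({z'}ᶜ) = ⊤ := by
  rw [eq_top_iff, ← locSub_univ]
  have : (univ : Set S.DihedralSuspension) = {z}ᶜ ∪ {z'}ᶜ := by
    rw [← compl_inter, singleton_inter_eq_empty.2 (by simpa using h), compl_empty]
  rw [this]
  exact locSub_union_le (isClosed_singleton_projZ z).isOpen_compl
    (isClosed_singleton_projZ z').isOpen_compl

variable {ρ : S.thompsonGroup →* (ℝ ≃o ℝ)}

/-- A point with two partners would be fixed by the whole group. -/
theorem fixed_unique (hirr : IsIrreducible ρ) {z z' : S.DihedralSuspension} {t : ℝ}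
    (h : ∀ g ∈ locSub ({z}ᶜ), ρ g t = t) (h' : ∀ g ∈ locSub ({z'}ᶜ), ρ g t = t) : z = z' := by
  by_contra hne
  obtain ⟨g, hg⟩ := hirr t
  have : (⊤ : Subgroup S.thompsonGroup) ≤ (fixPt t).comap ρ := by
    rw [← locSub_compl_sup hne]
    exact sup_le h h'
  exact hg (this (Subgroup.mem_top g))

/-- The condition fails at `(z, t)` exactly when some element supported in a closed box missing `z`
moves `t`, which is an open condition. -/
theorem isClosed_fixed_pairs (ρ : S.thompsonGroup →* (ℝ ≃o ℝ)) : IsClosed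
    {p : S.DihedralSuspension × ℝ | ∀ g ∈ locSub ({p.1}ᶜ), ρ g p.2 = p.2} := by
  have : {p : S.DihedralSuspension × ℝ | ∀ g ∈ locSub ({p.1}ᶜ), ρ g p.2 = p.2} =
      ⋂ (C : Set X) (a : ℝ) (b : ℝ) (_ : S.IsDyadicBox C a b) (g ∈ suppSub (S.boxSet C a b)),
        Prod.fst ⁻¹' S.boxSet C a b ∪ {p | ρ g p.2 = p.2} := by
    ext ⟨z, t⟩
    simp only [mem_ofPred_eq, mem_iInter, mem_union, mem_preimage]
    constructor
    · intro h C a b hb g hg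
      by_cases hz : z ∈ S.boxSet C a b
      · exact Or.inl hz
      · exact Or.inr (h g (suppSub_le_locSub hb (subset_compl_singleton_iff.2 hz) hg))
    · intro h
      refine locSub_le (H := (fixPt t).comap ρ) fun C a b hb hz g hg => ?_
      exact (h C a b hb g hg).resolve_left (subset_compl_singleton_iff.1 hz)
  rw [this]
  refine isClosed_iInter fun C => isClosed_iInter fun a => isClosed_iInter fun b =>
    isClosed_iInter fun hb => isClosed_iInter fun g => isClosed_iInter fun _ =>
    ((isClosed_boxSet hb.isBox.1 a b).preimage continuous_fst).union
      (isClosed_eq ((ρ g).continuous.comp continuous_snd) continuous_snd)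

/-- Conjugation by `k⁻¹` takes the subgroup of `k z` into that of `z`. -/
theorem fixed_pair_smul {z : S.DihedralSuspension} {t : ℝ} (h : ∀ g ∈ locSub ({z}ᶜ), ρ g t = t)
    (k : S.thompsonGroup) : ∀ g ∈ locSub ({k.1 z}ᶜ), ρ g (ρ k t) = ρ k t := by
  intro g hg
  have h1 := conj_mem_locSub (isClosed_singleton_projZ z).isOpen_compl k⁻¹ (V := {k.1 z}ᶜ)
    (fun w hw hz => hw ?_) hg
  · have h2 := h _ h1
    rw [inv_inv, map_mul, map_mul, map_inv] at h2
    have h3 : (ρ k) ((ρ k)⁻¹ ((ρ g) ((ρ k) t))) = ρ k t := congrArg (ρ k) h2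
    rwa [apply_inv_self'] at h3
  · change k.1.symm w = z at hz
    change w = k.1 z
    rw [← hz, k.1.apply_symm_apply]

/-- A minimal irreducible action is semiconjugate to the action on the dihedral suspension. -/
theorem exists_equivariant_map [Nonempty X] (hirr : IsIrreducible ρ) (hmin : IsMinimal ρ) :
    ∃ q : ℝ → S.DihedralSuspension, Continuous q ∧ (∀ g t, q (ρ g t) = g.1 (q t)) ∧
      ∀ t, ∀ g ∈ locSub ({q t}ᶜ), ρ g t = t := by
  have := compactSpace_dihedral (S := S)
  set P := {p : S.DihedralSuspension × ℝ | ∀ g ∈ locSub ({p.1}ᶜ), ρ g p.2 = p.2} with hP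
  have hPc : IsClosed P := isClosed_fixed_pairs ρ
  -- This projection is closed since `Z` is compact, and it contains a whole orbit, so minimality
  -- makes it everything.
  have hT : Prod.snd '' P = univ := by
    obtain ⟨z, t, h⟩ := exists_fixed_pair ρ
    refine eq_univ_of_univ_subset ?_
    rw [← (hmin t).closure_eq]
    refine closure_minimal ?_ (isClosedMap_snd_of_compactSpace _ hPc)
    rintro _ ⟨g, rfl⟩
    exact ⟨(g.1 z, ρ g t), fixed_pair_smul h g, rfl⟩
  have hq : ∀ t, ∃ z, (z, t) ∈ P := fun t => by
    obtain ⟨⟨z, s⟩, h, rfl⟩ : t ∈ Prod.snd '' P := hT ▸ mem_univ t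
    exact ⟨z, h⟩
  choose q hq using hq
  -- Closed graph with compact target: preimages of closed sets are projections of closed sets.
  refine ⟨q, continuous_iff_isClosed.2 fun F hF => ?_, fun g t =>
    fixed_unique hirr (hq (ρ g t)) (fixed_pair_smul (hq t) g), hq⟩
  have : q ⁻¹' F = Prod.snd '' (P ∩ Prod.fst ⁻¹' F) := by
    ext t
    constructor
    · exact fun h => ⟨(q t, t), ⟨hq t, h⟩, rfl⟩
    · rintro ⟨⟨z, s⟩, ⟨h1, h2⟩, rfl⟩
      change q s ∈ F
      have he : q s = z := fixed_unique hirr (hq s) h1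
      rw [he]
      exact h2
  rw [this]
  exact isClosedMap_snd_of_compactSpace _ (hPc.inter (hF.preimage continuous_fst))

variable (ρ) in
/-- A semiconjugacy from an action on the line to the action on a leaf, compatible with the
stabilizers of germs. -/
structure LeafSemiconj (x : X) (h : ℝ → ℝ) : Prop where
  continuous : Continuous h
  equivariant : ∀ g t, h (ρ g t) = leafMap g x (h t)
  fixed : ∀ t, ∀ g ∈ locSub ({S.projZ (x, h t)}ᶜ), ρ g t = t
  nonconstant : ∃ s t, h s ≠ h t

/-- Lifting the semiconjugacy to a leaf. -/
theorem exists_leafSemiconj [Nonempty X] (hirr : IsIrreducible ρ) (hmin : IsMinimal ρ) :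
    ∃ (x : X) (h : ℝ → ℝ), LeafSemiconj ρ x h := by
  obtain ⟨q, hqc, hqe, hqf⟩ := exists_equivariant_map hirr hmin
  obtain ⟨x, h, hc, hl⟩ := exists_leaf_lift hqc
  obtain ⟨t, ht⟩ : ∃ t, q t ≠ q 0 := by
    by_contra! hcon
    obtain ⟨g, hg⟩ := exists_ne_apply (q 0)
    exact hg ((hqe g 0).symm.trans (hcon _))
  -- `leafMap g x ∘ h` and `h ∘ ρ g` lift the same path, so they differ by an integer, constant by
  -- continuity.
  have hint : ∀ g, ∃ n : ℤ, ∀ s, leafMap g x (h s) - h (ρ g s) = n := by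
    intro g
    have h1 : ∀ s, ∃ n : ℤ, leafMap g x (h s) - h (ρ g s) = n := fun s => by
      have h2 : S.projZ (x, leafMap g x (h s)) = S.projZ (x, h (ρ g s)) := by
        rw [projZ_leafMap, ← hl, ← hl, hqe]
      obtain ⟨n, -, hn⟩ := projZ_eq_iff_same.1 h2
      exact ⟨n, by linarith⟩
    choose n hn using h1
    have hcont : Continuous fun s => leafMap g x (h s) - h (ρ g s) :=
      ((leafMap g x).continuous.comp hc).sub (hc.comp (ρ g).continuous)
    have hcn : Continuous n := by
      rw [Int.isClosedEmbedding_coe_real.isInducing.continuous_iff]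
      exact hcont.congr hn
    exact ⟨n 0, fun s => by
      rw [hn, (isPreconnected_univ.image n hcn.continuousOn).subsingleton
        ⟨s, mem_univ _, rfl⟩ ⟨0, mem_univ _, rfl⟩]⟩
  -- The elements with discrepancy zero. One supported in a box missing `q s` fixes both `s` and `h
  -- s`, so its discrepancy vanishes at `s`, hence everywhere. Two distinct values of `q` then yield
  -- the whole group.
  let H : Subgroup S.thompsonGroup :=
    { carrier := {g | ∀ s, h (ρ g s) = leafMap g x (h s)}
      one_mem' := fun s => by rw [map_one, leafMap_one]; rfl
      mul_mem' := fun {a b} ha hb s => by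
        rw [map_mul, leafMap_mul]
        exact (ha _).trans (congrArg _ (hb s))
      inv_mem' := fun {a} ha s => by
        rw [map_inv, leafMap_inv]
        have := ha ((ρ a)⁻¹ s)
        rw [apply_inv_self'] at this
        rw [this, inv_apply_self'] }
  have hH : ∀ s, locSub ({q s}ᶜ) ≤ H := by
    intro s
    refine locSub_le fun C a b hb hsub g hg => ?_
    have hz : q s ∉ S.boxSet C a b := subset_compl_singleton_iff.1 hsub
    obtain ⟨n, hn⟩ := hint g
    have h1 : leafMap g x (h s) = h s := leafMap_eq_self (isClosed_boxSet hb.isBox.1 a b).isOpen_compl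
      (fun z hz => hg z hz) (by rwa [← hl])
    have h2 := hn s
    rw [h1, hqf s g (suppSub_le_locSub hb hsub hg), sub_self] at h2
    exact fun r => by have := hn r; linarith
  have htop : ∀ g, g ∈ H := fun g => by
    have : (⊤ : Subgroup S.thompsonGroup) ≤ H := by
      rw [← locSub_compl_sup ht]
      exact sup_le (hH t) (hH 0)
    exact this (Subgroup.mem_top g)
  refine ⟨x, h, hc, fun g t => htop g t, fun t => by rw [← hl]; exact hqf t, t, 0, fun he => ht ?_⟩
  rw [hl, hl, he]

end Semiconjugacy

end ReversibleSystem

end SolenoidalThompson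
-- The lifted semiconjugacy is a homeomorphism.
namespace SolenoidalThompson

open Set Filter Topology

namespace ReversibleSystem

theorem projZ_σ {X : Type*} [TopologicalSpace X] {S : ReversibleSystem X} (x : X) (t : ℝ) :
    S.projZ (S.σ x, -t) =
    S.projZ (x, t) :=
  (S.projZ_eq_iff.2 ⟨0, Or.inr (by simp)⟩).symm

section Conjugacy

variable {X : Type*} [TopologicalSpace X] [CompactSpace X] [TopologicalSpace.MetrizableSpace X]
  [TotallyDisconnectedSpace X] {S : ReversibleSystem X} {ρ : S.thompsonGroup →* (ℝ ≃o ℝ)} {x : X}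
  {h : ℝ → ℝ}

namespace LeafSemiconj

/-- The same leaf read backwards; it turns statements about maxima into statements about minima. -/
theorem neg (H : LeafSemiconj ρ x h) : LeafSemiconj ρ (S.σ x) fun t => -h t where
  continuous := H.continuous.neg
  equivariant g t := by rw [leafMap_σ, H.equivariant]
  fixed t := by rw [projZ_σ]; exact H.fixed t
  nonconstant := by simpa using H.nonconstant

/-- There is no interior local maximum at which the semiconjugacy is not locally constant. -/
theorem le_of_maximum (H : LeafSemiconj ρ x h) {a b t : ℝ} (ht : t ∈ Icc a b)
    (hM : ∀ s ∈ Icc a b, h s ≤ h t) : h t ≤ max (h a) (h b) := by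
  by_contra! hlt
  rw [max_lt_iff] at hlt
  -- A level above both end values and less than one below the maximum, so that no period of the
  -- leaf identifies the two.
  obtain ⟨v, hv1, hv2⟩ := exists_between (show max (max (h a) (h b)) (h t - 1) < h t by
    simp [hlt.1, hlt.2])
  simp only [max_lt_iff] at hv1
  obtain ⟨a', ha', hva⟩ := intermediate_value_Icc ht.1 H.continuous.continuousOn
    (show v ∈ Icc (h a) (h t) from ⟨hv1.1.1.le, hv2.le⟩)
  obtain ⟨b', hb', hvb⟩ := intermediate_value_Icc' ht.2 H.continuous.continuousOn
    (show v ∈ Icc (h b) (h t) from ⟨hv1.1.2.le, hv2.le⟩)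
  have hz : S.projZ (x, h t) ≠ S.projZ (x, v) := fun e => by
    obtain ⟨n, -, hn⟩ := projZ_eq_iff_same.1 e
    have h3 : 0 < n := by
      have : (0 : ℝ) < n := by linarith
      exact_mod_cast this
    have h4 : n < 1 := by
      have : (n : ℝ) < 1 := by linarith
      exact_mod_cast this
    omega
  -- `g` raises the maximal value but fixes `a'` and `b'`, whose level is `v`. So `ρ g t` remains in
  -- `[a, b]` and exceeds the maximum.
  obtain ⟨g, hg, hgt, -⟩ := exists_lt_leafMap
    ((isClosed_singleton_projZ (S.projZ (x, v))).isOpen_compl.mem_nhds hz)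
  have ha := H.fixed a' g (by rwa [hva])
  have hb := H.fixed b' g (by rwa [hvb])
  have h1 := (ρ g).monotone ha'.2
  have h2 := (ρ g).monotone hb'.1
  rw [ha] at h1
  rw [hb] at h2
  have h3 := hM (ρ g t) ⟨ha'.1.trans h1, h2.trans hb'.2⟩
  rw [H.equivariant] at h3
  linarith

theorem le_max (H : LeafSemiconj ρ x h) {a b s : ℝ} (hs : s ∈ Icc a b) : h s ≤ max (h a) (h b) := by
  obtain ⟨t, ht, hM⟩ := isCompact_Icc.exists_isMaxOn ⟨s, hs⟩ (H.continuous.continuousOn (s := Icc a b))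
  exact (hM hs).trans (H.le_of_maximum ht fun r hr => hM hr)

/-- If `h a = h b`, the bounds on maxima and minima make `h` constant on `[a, b]`. Every orbit
enters `(a, b)`, so by equivariance `h` is locally constant, hence constant. -/
theorem injective (H : LeafSemiconj ρ x h) (hmin : IsMinimal ρ) : Function.Injective h := by
  suffices key : ∀ a b, a < b → h a ≠ h b by
    intro a b hab
    by_contra hne
    rcases lt_or_gt_of_ne hne with h1 | h1
    · exact key a b h1 hab
    · exact key b a h1 hab.symm
  intro a b hab he
  have hconst : ∀ s ∈ Icc a b, h s = h a := fun s hs => by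
    refine le_antisymm ?_ ?_
    · simpa [← he] using H.le_max hs
    · simpa [← he] using H.neg.le_max hs
  have hloc : IsLocallyConstant h := by
    rw [IsLocallyConstant.iff_eventually_eq]
    intro t
    obtain ⟨_, ⟨g, rfl⟩, ht⟩ := (hmin t).exists_mem_open isOpen_Ioo (nonempty_Ioo.2 hab)
    have ht : ρ g t ∈ Ioo a b := ht
    filter_upwards [(ρ g).continuous.continuousAt.preimage_mem_nhds (isOpen_Ioo.mem_nhds ht)] with s hs
    refine (leafMap g x).injective ?_
    rw [← H.equivariant, ← H.equivariant, hconst _ (Ioo_subset_Icc_self hs),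
      hconst _ (Ioo_subset_Icc_self ht)]
  obtain ⟨s, t, hst⟩ := H.nonconstant
  exact hst (hloc.apply_eq_of_preconnectedSpace s t)

/-- The range of `h` is invariant, so its supremum, if finite, would be fixed by every leaf map. -/
theorem exists_ge (H : LeafSemiconj ρ x h) (c : ℝ) : ∃ t, c ≤ h t := by
  by_contra! hlt
  have hb : BddAbove (range h) := ⟨c, by rintro _ ⟨t, rfl⟩; exact (hlt t).le⟩
  set s := sSup (range h) with hs
  have key : ∀ g : S.thompsonGroup, s ≤ leafMap g x s := fun g => by
    refine csSup_le (range_nonempty h) ?_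
    rintro _ ⟨t, rfl⟩
    have h1 : ρ g ((ρ g)⁻¹ t) = t := apply_inv_self' _ _
    rw [← h1, H.equivariant]
    exact (leafMap g x).monotone (le_csSup hb ⟨_, rfl⟩)
  obtain ⟨g, -, hg, -⟩ := exists_lt_leafMap (S := S) (x := x) (t := s) univ_mem
  have h2 := key g⁻¹
  rw [leafMap_inv] at h2
  have h3 := (leafMap g x).monotone h2
  rw [apply_inv_self'] at h3
  linarith

theorem surjective (H : LeafSemiconj ρ x h) : Function.Surjective h := fun c => by
  obtain ⟨b, hb⟩ := H.exists_ge c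
  obtain ⟨a, ha⟩ := H.neg.exists_ge (-c)
  exact mem_range_of_exists_le_of_exists_ge H.continuous ⟨a, neg_le_neg_iff.1 ha⟩ ⟨b, hb⟩

/-- Subtracting `h 0` moves the base point of the leaf from `(x, 0)` to `(x, h 0)` and makes the
conjugacy fix `0`. -/
theorem pointedConjugate (H : LeafSemiconj ρ x h) (hmono : StrictMono h) :
    PointedConjugate ρ (orbitAction (S.projY (x, h 0))) := by
  refine ⟨(hmono.orderIsoOfSurjective h H.surjective).trans (OrderIso.addRight (-h 0)),
    add_neg_cancel (h 0), fun g t => ?_⟩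
  change h (ρ g t) + -h 0 = orbitAction _ g (h t + -h 0)
  rw [orbitAction_apply, flow_projY, H.equivariant, leafMap_apply,
    show h 0 + (h t + -h 0) = h t by ring]
  ring

end LeafSemiconj

theorem exists_pointedConjugate (hirr : IsIrreducible ρ) (hmin : IsMinimal ρ) :
    ∃ y : S.Suspension, PointedConjugate ρ (orbitAction y) := by
  -- For empty `X` the group is trivial and cannot act irreducibly.
  have hX : Nonempty X := by
    by_contra hX
    rw [not_nonempty_iff] at hX
    obtain ⟨g, hg⟩ := hirr 0
    have : g = 1 := Subtype.ext (Homeomorph.ext fun z => by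
      obtain ⟨p, -⟩ := S.projZ_surjective z
      exact isEmptyElim p.1)
    exact hg (by rw [this, map_one]; rfl)
  obtain ⟨x, h, H⟩ := exists_leafSemiconj hirr hmin
  rcases H.continuous.strictMono_of_inj (H.injective hmin) with hm | hm
  · exact ⟨_, H.pointedConjugate hm⟩
  -- A decreasing `h` is replaced by `-h`, which belongs to the leaf of `σ x`.
  · exact ⟨_, H.neg.pointedConjugate hm.neg⟩

end Conjugacy

end ReversibleSystem

end SolenoidalThompson

theorem theorem4p1 {X : Type*} [TopologicalSpace X] [CompactSpace X]
    [TopologicalSpace.MetrizableSpace X] [TotallyDisconnectedSpace X]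
    (S : SolenoidalThompson.ReversibleSystem X)
    (ρ : S.thompsonGroup →* (ℝ ≃o ℝ))
    (hirr : SolenoidalThompson.IsIrreducible ρ) (hmin : SolenoidalThompson.IsMinimal ρ) :
    ∃ y : S.Suspension, SolenoidalThompson.PointedConjugate ρ
      (SolenoidalThompson.ReversibleSystem.orbitAction y) :=
  SolenoidalThompson.ReversibleSystem.exists_pointedConjugate hirr hmin
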